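/- Fix a prime $p$ and an integer $n\ge 0$. Let $BP_*=\mathbb{Z}_{(p)}[v_1,v_2,\dots]$ with $|v_i|=2(p^i-1)$, where the $v_i$ are the Hazewinkel generators; put $v_0=p$ and $I_k=(p,v_1,\dots,v_{k-1})$ for $0\le k\le\infty$. Let $BP_*BP=BP_*[t_1,t_2,\dots]$ with its standard Hopf algebroid structure over $BP_*$, and consider the category of $\mathbb{Z}$-graded $BP_*BP$-comodules and comodule maps of degree $0$. A comodule is $v_n$-torsion if each of its elements is killed by a power of $v_n$. A localization with respect to the $v_n$-torsion comodules is a functor $L_n$ on comodules with a natural map $M\to L_nM$ such that, for every comodule $M$, the kernel and the cokernel of $M\to L_nM$ are $v_n$-torsion and $L_nM$ is local, i.e. $\operatorname{Hom}(f,L_nM)$ is a bijection for every comodule map $f$ with $v_n$-torsion kernel and cokernel. For a finitely generated ideal $I=(\alpha_0,\dots,\alpha_n)$ of a commutative ring $R$, let $\check{C}^\bullet(I)$ be the Čech complex with $\check{C}^k(I)=\bigoplus_{|S|=k+1}R[1/\alpha_S]$, where $S$ runs through the subsets of $\{0,\dots,n\}$ and $\alpha_S=\prod_{i\in S}\alpha_i$,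 and let $\check{C}H^i_I(M)=H^i(\check{C}^\bullet(I)\otimes_RM)$ for an $R$-module $M$. Theorem. The category of $BP_*BP$-comodules has enough injectives, and a localization $L_n$ as above exists. Let $L_n$ be any such localization, and let $L_n^i$ ($i\ge 0$) be its right derived functors. Then, for every comodule $M$: (1) There is an isomorphism of graded $BP_*$-modules $L_n^iM\cong\check{C}H^i_{I_{n+1}}(M)$ for all $i\ge0$, natural in $M$, where $\check{C}H_{I_{n+1}}$ is formed with the generators $v_0,v_1,\dots,v_n$ of $I_{n+1}$. (2) $L_n^iM=0$ for $i>n$. (3) $L_n^iM$ is $I_{n+1}$-torsion for $i>0$: each of its elements is killed by a power of $I_{n+1}$. (4) If $v_j$ acts isomorphically on $M$ for some $0\le j\le n$, then $M\to L_nM$ is an isomorphism and $L_n^iM=0$ for $i>0$. (5) If $k<n$, then $L_n^i(BP_*/I_k)=0$ unless $i=0$ or $i=n-k$; the map $BP_*/I_k\to L_n(BP_*/I_k)$ is an isomorphism; and, as comodules, $L_n^{n-k}(BP_*/I_k)\cong BP_*/(p,v_1,\dots,v_{k-1},v_k^\infty,\dots,v_n^\infty)$. Here the comodules $BP_*/(p,\dots,v_{k-1},v_k^\infty,\dots,v_{j-1}^\infty)$,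 $j\ge k$, are defined inductively: for $j=k$ it is $BP_*/I_k$, and the one for $j+1$ is the cokernel of the injection of the one for $j$ into its localization obtained by inverting $v_j$. (6) $L_n^i(BP_*/I_n)=0$ for $i>0$. If $n=0$, then $BP_*\to L_0(BP_*)$ is isomorphic to $BP_*\to BP_*\otimes\mathbb{Q}$. If $n>0$, then $BP_*/I_n\to L_n(BP_*/I_n)$ is the localization $BP_*/I_n\to v_n^{-1}BP_*/I_n$. (7) If $n<k\le\infty$, then $L_n^i(BP_*/I_k)=0$ for all $i\ge0$. (8) Each $L_n^i$ commutes with filtered colimits and arbitrary direct sums, and $L_n$ commutes with finite limits. -/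

import Mathlib

open CategoryTheory CategoryTheory.Limits TensorProduct

set_option linter.unusedSectionVars false

noncomputable section

namespace BPcomod

section Sequences

variable (p : ℕ) {B : Type*} [CommRing B] [Algebra ℚ B]

/-- The coefficients `ℓ_n` of the logarithm of the formal group law with Hazewinkel generators
`v_1, v_2, …`: `ℓ_0 = 1` and `p ℓ_n = ∑_{i < n} ℓ_i v_{n-i} ^ (p ^ i)`. -/
def logSeq (v : ℕ → B) : ℕ → B
  | 0 => 1
  | n + 1 => (p : ℚ)⁻¹ • ∑ i : Fin (n + 1), logSeq v i * v (n + 1 - i) ^ p ^ (i : ℕ)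

/-- The inverse of `logSeq`: the generators `v_n` with
`p c_n = ∑_{i < n} c_i v_{n-i} ^ (p ^ i)`, for `c_0 = 1`. -/
def unlogSeq (c : ℕ → B) : ℕ → B
  | 0 => p * c 0
  | n + 1 => p * c (n + 1) - ∑ i : Fin n, c (i + 1) * unlogSeq c (n - i) ^ p ^ (i + 1 : ℕ)

/-- The solution `s` of `c_n = ∑_{i ≤ n} l_i s_{n-i} ^ (p ^ i)`, for `l_0 = 1`. -/
def expSeq (l c : ℕ → B) : ℕ → B
  | 0 => c 0
  | n + 1 => c (n + 1) - ∑ i : Fin (n + 1), l (i + 1) * expSeq l c (n - i) ^ p ^ (i + 1 : ℕ)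

/-- The sequence `n ↦ ∑_{i ≤ n} l_i s_{n-i} ^ (p ^ i)`. -/
def formalSum (l s : ℕ → B) (n : ℕ) : B :=
  ∑ i ∈ Finset.range (n + 1), l i * s (n - i) ^ p ^ i

variable {p}

theorem unlogSeq_succ (c : ℕ → B) (n : ℕ) : unlogSeq p c (n + 1) =
    p * c (n + 1) - ∑ i ∈ Finset.range n, c (i + 1) * unlogSeq p c (n - i) ^ p ^ (i + 1) := by
  rw [unlogSeq, Finset.sum_range]

theorem unlogSeq_spec (c : ℕ → B) (h0 : c 0 = 1) (n : ℕ) :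
    ∑ i ∈ Finset.range (n + 1), c i * unlogSeq p c (n + 1 - i) ^ p ^ i = p * c (n + 1) := by
  rw [Finset.sum_range_succ', Nat.sub_zero, unlogSeq_succ]
  simp [h0]

theorem expSeq_spec (l c : ℕ → B) (h0 : l 0 = 1) (n : ℕ) :
    formalSum p l (expSeq p l c) n = c n := by
  cases n with
  | zero => simp [formalSum, expSeq, h0]
  | succ n =>
    rw [formalSum, Finset.sum_range_succ']
    simp only [h0, Nat.sub_zero, pow_zero, pow_one, one_mul]
    rw [expSeq, Finset.sum_range]
    simp

theorem logSeq_spec (hp : p ≠ 0) (v : ℕ → B) (n : ℕ) :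
    ∑ i ∈ Finset.range (n + 1), logSeq p v i * v (n + 1 - i) ^ p ^ i = p * logSeq p v (n + 1) := by
  have h : (p : B) = algebraMap ℚ B p := by simp
  rw [logSeq, h, ← Algebra.smul_def, smul_smul, mul_inv_cancel₀ (by exact_mod_cast hp), one_smul,
    Finset.sum_range]

theorem logSeq_zero (v : ℕ → B) : logSeq p v 0 = 1 := by rw [logSeq]

theorem p_cancel (hp : p ≠ 0) {a b : B} (h : (p : B) * a = p * b) : a = b := by
  have h1 : (p : B) = algebraMap ℚ B p := by simp
  have h2 : algebraMap ℚ B ((p : ℚ)⁻¹) * (p : B) = 1 := by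
    rw [h1, ← map_mul, inv_mul_cancel₀ (by exact_mod_cast hp), map_one]
  calc a = algebraMap ℚ B ((p : ℚ)⁻¹) * (p : B) * a := by rw [h2, one_mul]
    _ = algebraMap ℚ B ((p : ℚ)⁻¹) * (p : B) * b := by rw [mul_assoc, h, mul_assoc]
    _ = b := by rw [h2, one_mul]

section Frobenius

variable {R : Type*} [CommRing R]

theorem phi_iterate (ι : R →+* B) (φR : R →+* R) (φ : B →+* B) (hφ : ∀ r, φ (ι r) = ι (φR r))
    (j : ℕ) (r : R) : (φ ^ j) (ι r) = ι ((φR ^ j) r) := by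
  induction j with
  | zero => simp
  | succ j ih => rw [pow_succ', pow_succ', RingHom.mul_def, RingHom.mul_def, RingHom.comp_apply,
      RingHom.comp_apply, ih, hφ]

theorem phi_iterate_v (φR : R →+* R) (v : ℕ → R) (hv : ∀ i, φR (v (i + 1)) = v (i + 1) ^ p)
    (j i : ℕ) : (φR ^ j) (v (i + 1)) = v (i + 1) ^ p ^ j := by
  induction j with
  | zero => simp
  | succ j ih => rw [pow_succ', RingHom.mul_def, RingHom.comp_apply, ih, map_pow, hv, ← pow_mul,
      pow_succ']

theorem logSeq_frob (ι : R →+* B) (φR : R →+* R) (φ : B →+* B) (hφ : ∀ r, φ (ι r) = ι (φR r))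
    (hp : p ≠ 0) (v : ℕ → R) (hv : ∀ i, φR (v (i + 1)) = v (i + 1) ^ p)
    (n : ℕ) : (p : B) * logSeq p (ι ∘ v) (n + 1) =
    ∑ j ∈ Finset.range (n + 1), ι (v (j + 1)) * (φ ^ (j + 1)) (logSeq p (ι ∘ v) (n - j)) := by
  induction n using Nat.strong_induction_on with
  | _ n ih =>
  apply p_cancel hp
  rw [← logSeq_spec hp, Finset.sum_range_succ', Finset.sum_range_succ _ n, mul_add, mul_add]
  congr 1
  · rw [Finset.mul_sum, Finset.mul_sum]
    trans ∑ i ∈ Finset.range n, ∑ j ∈ Finset.range (i + 1),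
      ι (v (j + 1)) * (φ ^ (j + 1)) (logSeq p (ι ∘ v) (i - j) * ι (v (n - i)) ^ p ^ (i - j))
    · refine Finset.sum_congr rfl fun i hi => ?_
      rw [← mul_assoc, ih i (by simpa using hi), Finset.sum_mul]
      refine Finset.sum_congr rfl fun j hj => ?_
      rw [Finset.mem_range] at hi hj
      obtain ⟨m, hm⟩ : ∃ m, n - i = m + 1 := ⟨n - i - 1, by omega⟩
      have h1 : n + 1 - (i + 1) = m + 1 := by omega
      rw [h1, hm, map_mul, map_pow, phi_iterate ι φR φ hφ, phi_iterate_v φR v hv, mul_assoc,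
        Function.comp_apply, map_pow, ← pow_mul, ← pow_add]
      congr 4
      omega
    · have key := Finset.sum_range_diag_flip n (fun j k : ℕ =>
        ι (v (j + 1)) * (φ ^ (j + 1)) (logSeq p (ι ∘ v) k * ι (v (n - j - k)) ^ p ^ k))
      refine Eq.trans (Finset.sum_congr rfl fun i hi => Finset.sum_congr rfl fun j hj => ?_)
        (key.trans (Finset.sum_congr rfl fun j hj => ?_))
      · rw [Finset.mem_range] at hi hj
        have : n - j - (i - j) = n - i := by omega
        simp only [this]
      · rw [Finset.mem_range] at hj
        obtain ⟨m, hm⟩ : ∃ m, n - j = m + 1 := ⟨n - j - 1, by omega⟩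
        rw [← Finset.mul_sum, ← map_sum, hm]
        have h2 := logSeq_spec hp (ι ∘ v) m
        simp only [Function.comp_apply] at h2
        rw [h2, map_mul, map_natCast]
        ring
  · simp [logSeq_zero]

theorem logSeq_int (ι : R →+* B) (hp : p ≠ 0) (v : ℕ → R)
    (n : ℕ) : ∃ r, (p : B) ^ n * logSeq p (ι ∘ v) n = ι r := by
  induction n using Nat.strong_induction_on with
  | _ n ih =>
  cases n with
  | zero => exact ⟨1, by simp [logSeq_zero]⟩
  | succ n =>
    have : ∀ i : ℕ, ∃ r, i < n + 1 → (p : B) ^ i * logSeq p (ι ∘ v) i = ι r := fun i => by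
      by_cases h : i < n + 1
      · obtain ⟨r, hr⟩ := ih i h
        exact ⟨r, fun _ => hr⟩
      · exact ⟨0, fun h' => absurd h' h⟩
    choose r hr using this
    refine ⟨∑ i ∈ Finset.range (n + 1), p ^ (n - i) * r i * v (n + 1 - i) ^ p ^ i, ?_⟩
    rw [pow_succ, mul_assoc, ← logSeq_spec hp, Finset.mul_sum, map_sum]
    refine Finset.sum_congr rfl fun i hi => ?_
    rw [Finset.mem_range] at hi
    rw [map_mul, map_mul, ← hr i hi, map_pow, map_pow, map_natCast, Function.comp_apply,
      ← mul_assoc, ← mul_assoc, ← pow_add]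
    congr 4
    omega

theorem frob_iterate_dvd (φR : R →+* R) (hF : ∀ r, (p : R) ∣ φR r - r ^ p)
    (j : ℕ) (r : R) : (p : R) ∣ (φR ^ j) r - r ^ p ^ j := by
  induction j with
  | zero => simp
  | succ j ih =>
    obtain ⟨a, ha⟩ := ih
    obtain ⟨b, hb⟩ := hF (r ^ p ^ j)
    refine ⟨φR a + b, ?_⟩
    have h1 : (φR ^ j) r = r ^ p ^ j + p * a := by rw [← ha]; ring
    rw [pow_succ', RingHom.mul_def, RingHom.comp_apply, h1, map_add, map_mul, map_natCast,
      pow_succ, pow_mul, mul_add, ← hb]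
    ring

theorem bracket_int (ι : R →+* B) (φR : R →+* R) (φ : B →+* B) (hφ : ∀ r, φ (ι r) = ι (φR r))
    (hF : ∀ r, (p : R) ∣ φR r - r ^ p)
    (j k : ℕ) (a : B) (ha : ∃ y, (p : B) ^ k * a = ι y) (r : R) :
    ∃ z, (φ ^ j) a * (ι r ^ p ^ (j + k) - (φ ^ j) (ι r) ^ p ^ k) = p * ι z := by
  obtain ⟨y, hy⟩ := ha
  have h1 : (p : R) ∣ r ^ p ^ j - (φR ^ j) r := by
    have := frob_iterate_dvd φR hF j r
    rwa [← dvd_neg, neg_sub] at this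
  obtain ⟨x, hx⟩ := dvd_sub_pow_of_dvd_sub h1 k
  refine ⟨(φR ^ j) y * x, ?_⟩
  rw [phi_iterate ι φR φ hφ, ← map_pow, ← map_pow, ← map_sub, pow_add, pow_mul, hx, map_mul,
    map_pow, map_natCast, map_mul, ← phi_iterate ι φR φ hφ, ← hy, map_mul, map_pow, map_natCast]
  ring

theorem dwork (ι : R →+* B) (φR : R →+* R) (φ : B →+* B) (hφ : ∀ r, φ (ι r) = ι (φR r))
    (hp : p ≠ 0) (v : ℕ → R) (hv : ∀ i, φR (v (i + 1)) = v (i + 1) ^ p)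
    (hF : ∀ r, (p : R) ∣ φR r - r ^ p)
    (s : ℕ → B) (n : ℕ) (hs : ∀ m < n, ∃ r, s m = ι r) :
    ∃ z, (p : B) * formalSum p (logSeq p (ι ∘ v)) s n = p * s n + p * ι z +
      ∑ j ∈ Finset.range n, ι (v (j + 1)) *
        (φ ^ (j + 1)) (formalSum p (logSeq p (ι ∘ v)) s (n - 1 - j)) := by
  have : ∀ i : ℕ, ∃ r, i < n → s i = ι r := fun i => by
    by_cases h : i < n
    · obtain ⟨r, hr⟩ := hs i h
      exact ⟨r, fun _ => hr⟩
    · exact ⟨0, fun h' => absurd h' h⟩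
  choose r hr using this
  have hb : ∀ j k : ℕ, ∃ z, (φ ^ (j + 1)) (logSeq p (ι ∘ v) k) *
      (ι (r (n - 1 - j - k)) ^ p ^ (j + 1 + k) -
        (φ ^ (j + 1)) (ι (r (n - 1 - j - k))) ^ p ^ k) = p * ι z := fun j k =>
    bracket_int ι φR φ hφ hF (j + 1) k _ (logSeq_int ι hp v k) _
  choose z hz using hb
  refine ⟨∑ j ∈ Finset.range n, ∑ k ∈ Finset.range (n - j), v (j + 1) * z j k, ?_⟩
  have key := Finset.sum_range_diag_flip n (fun j k : ℕ =>
        ι (v (j + 1)) * ((φ ^ (j + 1)) (logSeq p (ι ∘ v) k) *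
          ι (r (n - 1 - j - k)) ^ p ^ (j + 1 + k)))
  have e1 : (p : B) * formalSum p (logSeq p (ι ∘ v)) s n = p * s n +
      ∑ j ∈ Finset.range n, ∑ k ∈ Finset.range (n - j), ι (v (j + 1)) *
        ((φ ^ (j + 1)) (logSeq p (ι ∘ v) k) * ι (r (n - 1 - j - k)) ^ p ^ (j + 1 + k)) := by
    rw [← key, formalSum, Finset.sum_range_succ', mul_add, add_comm]
    congr 1
    · simp [logSeq_zero]
    · rw [Finset.mul_sum]
      refine Finset.sum_congr rfl fun i hi => ?_
      rw [Finset.mem_range] at hi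
      rw [← mul_assoc, logSeq_frob ι φR φ hφ hp v hv, Finset.sum_mul]
      refine Finset.sum_congr rfl fun j hj => ?_
      rw [Finset.mem_range] at hj
      have h1 : n - 1 - j - (i - j) = n - (i + 1) := by omega
      have h2 : j + 1 + (i - j) = i + 1 := by omega
      rw [h1, h2, hr _ (by omega)]
      ring
  rw [e1, add_assoc]
  congr 1
  rw [map_sum, Finset.mul_sum, ← Finset.sum_add_distrib]
  refine Finset.sum_congr rfl fun j hj => ?_
  rw [Finset.mem_range] at hj
  have h3 : n - 1 - j + 1 = n - j := by omega
  rw [formalSum, h3, map_sum, map_sum, Finset.mul_sum, Finset.mul_sum, ← Finset.sum_add_distrib]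
  refine Finset.sum_congr rfl fun k hk => ?_
  rw [Finset.mem_range] at hk
  rw [map_mul, map_mul, map_pow, hr _ (by omega : n - 1 - j - k < n)]
  linear_combination ι (v (j + 1)) * hz j k

/-- A sequence with the same functional equation defect as the logarithm has integral
exponential coordinates. -/
theorem expSeq_int (ι : R →+* B) (φR : R →+* R) (φ : B →+* B) (hφ : ∀ r, φ (ι r) = ι (φR r))
    (hp : p ≠ 0) (v : ℕ → R) (hv : ∀ i, φR (v (i + 1)) = v (i + 1) ^ p)
    (hF : ∀ r, (p : R) ∣ φR r - r ^ p)
    (c : ℕ → B)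
    (hc : ∀ n, ∃ z, (p : B) * c n = p * ι z +
      ∑ j ∈ Finset.range n, ι (v (j + 1)) * (φ ^ (j + 1)) (c (n - 1 - j))) (n : ℕ) :
    ∃ r, expSeq p (logSeq p (ι ∘ v)) c n = ι r := by
  induction n using Nat.strong_induction_on with
  | _ n ih =>
  obtain ⟨z, hz⟩ := dwork ι φR φ hφ hp v hv hF _ n ih
  obtain ⟨y, hy⟩ := hc n
  refine ⟨y - z, p_cancel hp ?_⟩
  simp only [expSeq_spec _ c (logSeq_zero _)] at hz
  rw [map_sub]
  linear_combination hy - hz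

theorem unlogSeq_int (ι : R →+* B) (φR : R →+* R) (φ : B →+* B) (hφ : ∀ r, φ (ι r) = ι (φR r))
    (hp : p ≠ 0) (v : ℕ → R) (hF : ∀ r, (p : R) ∣ φR r - r ^ p)
    (c : ℕ → B) (h0 : c 0 = 1)
    (hi : ∀ n, ∃ r, (p : B) ^ n * c n = ι r)
    (hc : ∀ n, ∃ z, (p : B) * c n = p * ι z +
      ∑ j ∈ Finset.range n, ι (v (j + 1)) * (φ ^ (j + 1)) (c (n - 1 - j))) (n : ℕ) :
    ∃ z ∈ Ideal.span {x : R | x = p ∨ ∃ j, 0 < j ∧ j < n + 1 ∧ x = v j},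
      unlogSeq p c (n + 1) = ι (v (n + 1) + z) := by
  choose e he using hc
  induction n using Nat.strong_induction_on with
  | _ n ih =>
  have : ∀ i : ℕ, ∃ r, i < n → r ∈ Ideal.span {x : R | x = p ∨ ∃ j, 0 < j ∧ j < n + 1 ∧ x = v j} ∧
      unlogSeq p c (i + 1) = ι r := fun i => by
    by_cases h : i < n
    · obtain ⟨r, hr, hr'⟩ := ih i h
      refine ⟨v (i + 1) + r, fun _ => ⟨Ideal.add_mem _ (Ideal.subset_span
        (Or.inr ⟨i + 1, by omega, by omega, rfl⟩)) (Ideal.span_mono ?_ hr), hr'⟩⟩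
      rintro x (rfl | ⟨j, h1, h2, rfl⟩)
      · exact Or.inl rfl
      · exact Or.inr ⟨j, h1, by omega, rfl⟩
    · exact ⟨0, fun h' => absurd h' h⟩
  choose W hW using this
  have hb : ∀ j k : ℕ, ∃ z, (φ ^ (j + 1)) (c k) * (ι (W (n - 1 - j - k)) ^ p ^ (j + 1 + k) -
        (φ ^ (j + 1)) (ι (W (n - 1 - j - k))) ^ p ^ k) = p * ι z := fun j k =>
    bracket_int ι φR φ hφ hF (j + 1) k _ (hi k) _
  choose z hz using hb
  refine ⟨p * e (n + 1) - ∑ i ∈ Finset.range n, e (i + 1) * W (n - 1 - i) ^ p ^ (i + 1) -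
    ∑ j ∈ Finset.range n, ∑ k ∈ Finset.range (n - j), v (j + 1) * z j k, ?_, ?_⟩
  · refine Ideal.sub_mem _ (Ideal.sub_mem _ ?_ ?_) ?_
    · exact Ideal.mul_mem_right _ _ (Ideal.subset_span (Or.inl rfl))
    · refine Ideal.sum_mem _ fun i hi => Ideal.mul_mem_left _ _ (Ideal.pow_mem_of_mem _
        (hW _ ?_).1 _ (by positivity))
      rw [Finset.mem_range] at hi
      omega
    · refine Ideal.sum_mem _ fun j hj => Ideal.sum_mem _ fun k _ => Ideal.mul_mem_right _ _
        (Ideal.subset_span (Or.inr ⟨j + 1, by omega, ?_, rfl⟩))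
      rw [Finset.mem_range] at hj
      omega
  · apply p_cancel hp
    have key := Finset.sum_range_diag_flip n (fun j k : ℕ =>
        ι (v (j + 1)) * ((φ ^ (j + 1)) (c k) *
          ι (W (n - 1 - j - k)) ^ p ^ (j + 1 + k)))
    have e1 : ∑ i ∈ Finset.range n, (p : B) * (c (i + 1) * unlogSeq p c (n - i) ^ p ^ (i + 1)) =
        ∑ i ∈ Finset.range n, (p : B) * (ι (e (i + 1)) * ι (W (n - 1 - i)) ^ p ^ (i + 1)) +
        ∑ j ∈ Finset.range n, ∑ k ∈ Finset.range (n - j), ι (v (j + 1)) * ((φ ^ (j + 1)) (c k) *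
          ι (W (n - 1 - j - k)) ^ p ^ (j + 1 + k)) := by
      rw [← key, ← Finset.sum_add_distrib]
      refine Finset.sum_congr rfl fun i hi => ?_
      rw [Finset.mem_range] at hi
      obtain ⟨m, hm⟩ : ∃ m, n - i = m + 1 := ⟨n - i - 1, by omega⟩
      have h1 : n - 1 - i = m := by omega
      rw [← mul_assoc, he, hm, (hW m (by omega)).2, h1, add_mul, Finset.sum_mul]
      congr 1
      · ring
      · refine Finset.sum_congr rfl fun j hj => ?_
        rw [Finset.mem_range] at hj
        have h2 : n - 1 - j - (i - j) = m := by omega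
        have h3 : j + 1 + (i - j) = i + 1 := by omega
        have h4 : i + 1 - 1 - j = i - j := by omega
        rw [h2, h3, h4]
        ring
    have e2 : ∑ j ∈ Finset.range n, (p : B) * (ι (v (j + 1)) * (φ ^ (j + 1)) (c (n - j))) =
        ∑ j ∈ Finset.range n, ∑ k ∈ Finset.range (n - j), ι (v (j + 1)) * ((φ ^ (j + 1)) (c k) *
          (φ ^ (j + 1)) (ι (W (n - 1 - j - k))) ^ p ^ k) := by
      refine Finset.sum_congr rfl fun j hj => ?_
      rw [Finset.mem_range] at hj
      obtain ⟨m, hm⟩ : ∃ m, n - j = m + 1 := ⟨n - j - 1, by omega⟩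
      have h5 : (p : B) * (φ ^ (j + 1)) (c (m + 1)) = (φ ^ (j + 1)) ((p : B) * c (m + 1)) := by
        rw [map_mul, map_natCast]
      rw [hm, mul_left_comm, h5, ← unlogSeq_spec c h0, map_sum, Finset.mul_sum]
      refine Finset.sum_congr rfl fun k hk => ?_
      rw [Finset.mem_range] at hk
      have h6 : m + 1 - k = (n - 1 - j - k) + 1 := by omega
      rw [h6, (hW _ (by omega)).2, map_mul, map_pow]
    have e3 : ∑ j ∈ Finset.range n, ∑ k ∈ Finset.range (n - j), ι (v (j + 1)) *
          ((φ ^ (j + 1)) (c k) * (φ ^ (j + 1)) (ι (W (n - 1 - j - k))) ^ p ^ k) =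
        ∑ j ∈ Finset.range n, ∑ k ∈ Finset.range (n - j), ι (v (j + 1)) * ((φ ^ (j + 1)) (c k) *
          ι (W (n - 1 - j - k)) ^ p ^ (j + 1 + k)) -
        p * ∑ j ∈ Finset.range n, ∑ k ∈ Finset.range (n - j), ι (v (j + 1)) * ι (z j k) := by
      rw [Finset.mul_sum, ← Finset.sum_sub_distrib]
      refine Finset.sum_congr rfl fun j _ => ?_
      rw [Finset.mul_sum, ← Finset.sum_sub_distrib]
      refine Finset.sum_congr rfl fun k _ => ?_
      linear_combination (-ι (v (j + 1))) * hz j k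
    rw [unlogSeq_succ, mul_sub, he (n + 1), Finset.sum_range_succ, mul_add, mul_add,
      Finset.mul_sum, Finset.mul_sum, e1]
    simp only [Nat.add_sub_cancel] at e2 ⊢
    rw [e2, e3]
    simp only [Nat.sub_self, h0, map_one, map_add, map_sub, map_sum, map_mul, map_pow,
      map_natCast, ← Finset.mul_sum]
    ring

end Frobenius

section Naturality

variable {C : Type*} [CommRing C] [Algebra ℚ C] (f : B →+* C)

theorem map_logSeq (v : ℕ → B) (n : ℕ) : f (logSeq p v n) = logSeq p (f ∘ v) n := by
  induction n using Nat.strong_induction_on with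
  | _ n ih =>
  cases n with
  | zero => simp [logSeq]
  | succ n =>
    rw [logSeq, logSeq, map_rat_smul, map_sum]
    congr 1
    refine Finset.sum_congr rfl fun i _ => ?_
    rw [map_mul, map_pow, ih i i.2, Function.comp_apply]

theorem map_formalSum (l s : ℕ → B) (n : ℕ) :
    f (formalSum p l s n) = formalSum p (f ∘ l) (f ∘ s) n := by
  simp [formalSum]

theorem map_unlogSeq (c : ℕ → B) (n : ℕ) : f (unlogSeq p c n) = unlogSeq p (f ∘ c) n := by
  induction n using Nat.strong_induction_on with
  | _ n ih =>
  cases n with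
  | zero => simp [unlogSeq]
  | succ n =>
    rw [unlogSeq, unlogSeq, map_sub, map_sum]
    congr 1
    · simp
    refine Finset.sum_congr rfl fun i _ => ?_
    rw [map_mul, map_pow, ih _ (by omega), Function.comp_apply]

theorem map_expSeq (l c : ℕ → B) (n : ℕ) :
    f (expSeq p l c n) = expSeq p (f ∘ l) (f ∘ c) n := by
  induction n using Nat.strong_induction_on with
  | _ n ih =>
  cases n with
  | zero => simp [expSeq]
  | succ n =>
    rw [expSeq, expSeq, map_sub, map_sum]
    congr 1
    refine Finset.sum_congr rfl fun i _ => ?_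
    rw [map_mul, map_pow, ih _ (by omega), Function.comp_apply]

end Naturality

theorem logSeq_unlogSeq (hp : p ≠ 0) (c : ℕ → B) (h0 : c 0 = 1) (n : ℕ) :
    logSeq p (unlogSeq p c) n = c n := by
  induction n using Nat.strong_induction_on with
  | _ n ih =>
  cases n with
  | zero => rw [logSeq_zero, h0]
  | succ n =>
    apply p_cancel hp
    rw [← logSeq_spec hp, ← unlogSeq_spec c h0]
    refine Finset.sum_congr rfl fun i hi => ?_
    rw [ih i (Finset.mem_range.1 hi)]

theorem unlogSeq_logSeq (hp : p ≠ 0) (v : ℕ → B) (n : ℕ) :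
    unlogSeq p (logSeq p v) (n + 1) = v (n + 1) := by
  induction n using Nat.strong_induction_on with
  | _ n ih =>
  rw [unlogSeq_succ, ← logSeq_spec hp, Finset.sum_range_succ']
  simp only [logSeq_zero, Nat.sub_zero, pow_zero, pow_one, one_mul]
  rw [Finset.sum_congr rfl fun i hi => ?_, add_sub_cancel_left]
  rw [Finset.mem_range] at hi
  obtain ⟨m, hm⟩ : ∃ m, n - i = m + 1 := ⟨n - i - 1, by omega⟩
  have h1 : n + 1 - (i + 1) = m + 1 := by omega
  rw [h1, hm, ih m (by omega)]

theorem formalSum_assoc (hp : p ≠ 0) (l t s : ℕ → B) (n : ℕ) : formalSum p (formalSum p l t) s n =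
    ∑ k ∈ Finset.range (n + 1), formalSum p l
      (fun m => if m < k then 0 else t (m - k) * s k ^ p ^ (m - k)) n := by
  rw [formalSum, ← Finset.sum_range_reflect]
  refine Finset.sum_congr rfl fun k hk => ?_
  rw [Finset.mem_range] at hk
  have h1 : n + 1 - 1 - k = n - k := by omega
  have h2 : n - (n - k) = k := by omega
  rw [h1, h2, formalSum, formalSum, Finset.sum_mul]
  refine Finset.sum_subset_zero_on_sdiff (by simp) (fun i hi => ?_) (fun i hi => ?_)
  · simp only [Finset.mem_sdiff, Finset.mem_range] at hi
    rw [if_pos (by omega), zero_pow (pow_ne_zero _ hp), mul_zero]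
  · rw [Finset.mem_range] at hi
    have h3 : n - i - k = n - k - i := by omega
    rw [if_neg (by omega), mul_pow, ← pow_mul, ← pow_add, h3, mul_assoc]
    congr 4
    omega

end Sequences

section Families

variable (p : ℕ) {B : Type*} [CommRing B]

/-- The sequence `p, v_1, v_2, …`; here and below `v i` stands for `v_{i+1}`. -/
def vHat (v : ℕ → B) : ℕ → B
  | 0 => p
  | n + 1 => v n

/-- The sequence `1, t_1, t_2, …`. -/
def tHat (t : ℕ → B) : ℕ → B
  | 0 => 1
  | n + 1 => t n

theorem logSeq_congr [Algebra ℚ B] {v w : ℕ → B} (h : ∀ n, v (n + 1) = w (n + 1)) :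
    logSeq p v = logSeq p w := by
  funext n
  induction n using Nat.strong_induction_on with
  | _ n ih =>
  cases n with
  | zero => simp [logSeq]
  | succ n =>
    rw [logSeq, logSeq]
    congr 1
    refine Finset.sum_congr rfl fun i _ => ?_
    have h1 : n + 1 - (i : ℕ) = (n - i) + 1 := by omega
    rw [ih i i.2, h1, h]

end Families

section Universal

variable (p : ℕ)

/-- The coefficients of the logarithm, as polynomials in the `v_i` over `ℚ`. -/
def univLog {σ : Type} (v : ℕ → σ) : ℕ → MvPolynomial σ ℚ :=
  logSeq p (vHat p fun i => MvPolynomial.X (v i))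

/-- The polynomial for `η_R(v_{n+1})` in the `v_i` and `t_i` over `ℚ`, determined by
`η_R(ℓ_m) = ∑_{i ≤ m} ℓ_i t_{m-i} ^ (p ^ i)`. -/
def etaRat (n : ℕ) : MvPolynomial (ℕ ⊕ ℕ) ℚ :=
  unlogSeq p (formalSum p (univLog p Sum.inl)
    (tHat fun i => MvPolynomial.X (Sum.inr i))) (n + 1)

/-- The polynomial for `Δ(t_{n+1})` in the `v_i`, `t_i ⊗ 1` and `1 ⊗ t_i` over `ℚ`, determined by
`∑_{i ≤ m} ℓ_i Δ(t_{m-i}) ^ (p ^ i) = ∑_{i + j + k = m} ℓ_i t_j ^ (p ^ i) ⊗ t_k ^ (p ^ (i + j))`. -/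
def deltaRat (n : ℕ) : MvPolynomial (ℕ ⊕ ℕ ⊕ ℕ) ℚ :=
  expSeq p (univLog p Sum.inl)
    (formalSum p (formalSum p (univLog p Sum.inl)
      (tHat fun i => MvPolynomial.X (Sum.inr (Sum.inl i))))
      (tHat fun i => MvPolynomial.X (Sum.inr (Sum.inr i)))) (n + 1)

variable [hp : Fact p.Prime]

theorem univ_frob {σ : Type} (r : MvPolynomial σ ℤ) :
    (p : MvPolynomial σ ℤ) ∣ (MvPolynomial.expand p : _ →ₐ[ℤ] _).toRingHom r - r ^ p := by
  have := (MvPolynomial.C_dvd_iff_zmod p (MvPolynomial.expand p r - r ^ p)).2 (by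
    rw [map_sub, map_pow, MvPolynomial.map_expand, MvPolynomial.expand_zmod, sub_self])
  simpa using this

theorem univ_comm {σ : Type} (r : MvPolynomial σ ℤ) :
    (MvPolynomial.expand p : MvPolynomial σ ℚ →ₐ[ℚ] _).toRingHom
      (MvPolynomial.map (Int.castRingHom ℚ) r) =
    MvPolynomial.map (Int.castRingHom ℚ) ((MvPolynomial.expand p : _ →ₐ[ℤ] _).toRingHom r) := by
  simp [MvPolynomial.map_expand]

theorem univ_v {σ : Type} (v : ℕ → σ) :
    (vHat p fun i => (MvPolynomial.X (v i) : MvPolynomial σ ℚ)) =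
      MvPolynomial.map (Int.castRingHom ℚ) ∘ (vHat p fun i => MvPolynomial.X (v i)) := by
  funext i
  cases i <;> simp [vHat]

theorem univ_t {σ : Type} (v : ℕ → σ) :
    (tHat fun i => (MvPolynomial.X (v i) : MvPolynomial σ ℚ)) =
      MvPolynomial.map (Int.castRingHom ℚ) ∘ (tHat fun i => MvPolynomial.X (v i)) := by
  funext i
  cases i <;> simp [tHat]

theorem univ_vfrob {σ : Type} (v : ℕ → σ) (i : ℕ) :
    (MvPolynomial.expand p : MvPolynomial σ ℤ →ₐ[ℤ] _).toRingHom
      (vHat p (fun i => MvPolynomial.X (v i)) (i + 1)) =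
      (vHat p (fun i => MvPolynomial.X (v i)) (i + 1)) ^ p := by
  simp [vHat]

theorem exists_etaInt (n : ℕ) : ∃ r : MvPolynomial (ℕ ⊕ ℕ) ℤ,
    MvPolynomial.map (Int.castRingHom ℚ) r = etaRat p n ∧
    r - MvPolynomial.X (Sum.inl n) ∈ Ideal.span {x : MvPolynomial (ℕ ⊕ ℕ) ℤ |
      x = p ∨ ∃ j, j < n ∧ x = MvPolynomial.X (Sum.inl j)} := by
  have hp0 := hp.out.ne_zero
  have hi : ∀ n, ∃ r, (p : MvPolynomial (ℕ ⊕ ℕ) ℚ) ^ n * formalSum p (univLog p Sum.inl)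
      (tHat fun i => MvPolynomial.X (Sum.inr i)) n =
        MvPolynomial.map (Int.castRingHom ℚ) r := fun n => by
    choose r hr using logSeq_int (MvPolynomial.map (Int.castRingHom ℚ)) hp0
      (vHat p fun i => MvPolynomial.X (Sum.inl i : ℕ ⊕ ℕ))
    refine ⟨∑ i ∈ Finset.range (n + 1), (p : MvPolynomial (ℕ ⊕ ℕ) ℤ) ^ (n - i) * r i *
      tHat (fun i => MvPolynomial.X (Sum.inr i)) (n - i) ^ p ^ i, ?_⟩
    rw [formalSum, Finset.mul_sum, map_sum]
    refine Finset.sum_congr rfl fun i hi => ?_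
    rw [univLog, univ_v, univ_t, map_mul, map_mul, ← hr, map_pow, map_pow, map_natCast,
      ← mul_assoc, ← mul_assoc, ← pow_add]
    rw [Finset.mem_range] at hi
    congr 4
    omega
  obtain ⟨z, hz, hz'⟩ := unlogSeq_int (MvPolynomial.map (Int.castRingHom ℚ))
    (MvPolynomial.expand p : MvPolynomial (ℕ ⊕ ℕ) ℤ →ₐ[ℤ] _).toRingHom
    (MvPolynomial.expand p : MvPolynomial (ℕ ⊕ ℕ) ℚ →ₐ[ℚ] _).toRingHom (univ_comm p) hp0
    (vHat p fun i => MvPolynomial.X (Sum.inl i)) (univ_frob p)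
    (formalSum p (univLog p Sum.inl) (tHat fun i => MvPolynomial.X (Sum.inr i)))
    (by simp [formalSum, univLog, logSeq_zero, tHat]) hi (fun n => by
      obtain ⟨z, hz⟩ := dwork (MvPolynomial.map (Int.castRingHom ℚ))
        (MvPolynomial.expand p : MvPolynomial (ℕ ⊕ ℕ) ℤ →ₐ[ℤ] _).toRingHom
        (MvPolynomial.expand p : MvPolynomial (ℕ ⊕ ℕ) ℚ →ₐ[ℚ] _).toRingHom (univ_comm p) hp0
        (vHat p fun i => MvPolynomial.X (Sum.inl i)) (univ_vfrob p _) (univ_frob p)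
        (tHat fun i => MvPolynomial.X (Sum.inr i)) n (fun m _ => ⟨_, congrFun (univ_t _) m⟩)
      refine ⟨tHat (fun i => MvPolynomial.X (Sum.inr i)) n + z, ?_⟩
      rw [univLog, univ_v, hz, congrFun (univ_t _) n, map_add, mul_add]
      rfl) n
  refine ⟨_, hz'.symm, ?_⟩
  simp only [vHat, add_sub_cancel_left]
  refine Ideal.span_mono ?_ hz
  rintro x (rfl | ⟨j, h1, h2, rfl⟩)
  · exact Or.inl rfl
  · obtain ⟨m, rfl⟩ : ∃ m, j = m + 1 := ⟨j - 1, by omega⟩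
    exact Or.inr ⟨m, by omega, rfl⟩

theorem exists_deltaInt (n : ℕ) : ∃ r : MvPolynomial (ℕ ⊕ ℕ ⊕ ℕ) ℤ,
    MvPolynomial.map (Int.castRingHom ℚ) r = deltaRat p n := by
  have hp0 := hp.out.ne_zero
  have : ∀ n, ∃ z, (p : MvPolynomial (ℕ ⊕ ℕ ⊕ ℕ) ℚ) * formalSum p (formalSum p (univLog p Sum.inl)
      (tHat fun i => MvPolynomial.X (Sum.inr (Sum.inl i))))
      (tHat fun i => MvPolynomial.X (Sum.inr (Sum.inr i))) n =
      (p : MvPolynomial (ℕ ⊕ ℕ ⊕ ℕ) ℚ) * MvPolynomial.map (Int.castRingHom ℚ) z + ∑ j ∈ Finset.range n,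
        MvPolynomial.map (Int.castRingHom ℚ) (vHat p (fun i => MvPolynomial.X (Sum.inl i)) (j + 1)) *
        ((MvPolynomial.expand p : MvPolynomial (ℕ ⊕ ℕ ⊕ ℕ) ℚ →ₐ[ℚ] _).toRingHom ^ (j + 1))
          (formalSum p (formalSum p (univLog p Sum.inl)
      (tHat fun i => MvPolynomial.X (Sum.inr (Sum.inl i))))
      (tHat fun i => MvPolynomial.X (Sum.inr (Sum.inr i))) (n - 1 - j)) := fun n => by
    set t : ℕ → MvPolynomial (ℕ ⊕ ℕ ⊕ ℕ) ℤ := tHat fun i => MvPolynomial.X (Sum.inr (Sum.inl i))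
    set s : ℕ → MvPolynomial (ℕ ⊕ ℕ ⊕ ℕ) ℤ := tHat fun i => MvPolynomial.X (Sum.inr (Sum.inr i))
    set u : ℕ → ℕ → MvPolynomial (ℕ ⊕ ℕ ⊕ ℕ) ℚ := fun k m => if m < k then 0 else
      (tHat fun i => MvPolynomial.X (Sum.inr (Sum.inl i))) (m - k) *
        (tHat fun i => MvPolynomial.X (Sum.inr (Sum.inr i))) k ^ p ^ (m - k) with hu
    have hu' : ∀ k m, u k m = MvPolynomial.map (Int.castRingHom ℚ)
        (if m < k then 0 else t (m - k) * s k ^ p ^ (m - k)) := fun k m => by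
      rw [hu]
      simp only [univ_t]
      split_ifs <;> simp [t, s]
    have hext : ∀ N m, m ≤ N → formalSum p (formalSum p (univLog p Sum.inl)
        (tHat fun i => MvPolynomial.X (Sum.inr (Sum.inl i))))
        (tHat fun i => MvPolynomial.X (Sum.inr (Sum.inr i))) m =
        ∑ k ∈ Finset.range (N + 1), formalSum p (univLog p Sum.inl) (u k) m := fun N m hm => by
      rw [formalSum_assoc hp0]
      refine Finset.sum_subset (by simpa using hm) fun k _ hk => ?_
      rw [Finset.mem_range] at hk
      refine Finset.sum_eq_zero fun i _ => ?_
      have : m - i < k := by omega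
      simp only [if_pos this]
      rw [zero_pow (pow_ne_zero _ hp0), mul_zero]
    have hd := fun k => dwork (MvPolynomial.map (Int.castRingHom ℚ))
        (MvPolynomial.expand p : MvPolynomial (ℕ ⊕ ℕ ⊕ ℕ) ℤ →ₐ[ℤ] _).toRingHom
        (MvPolynomial.expand p : MvPolynomial (ℕ ⊕ ℕ ⊕ ℕ) ℚ →ₐ[ℚ] _).toRingHom (univ_comm p) hp0
        (vHat p fun i => MvPolynomial.X (Sum.inl i)) (univ_vfrob p _) (univ_frob p)
        (u k) n (fun m _ => ⟨_, hu' k m⟩)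
    choose z hz using hd
    refine ⟨∑ k ∈ Finset.range (n + 1), ((if n < k then 0 else t (n - k) * s k ^ p ^ (n - k)) + z k),
      ?_⟩
    rw [hext n n le_rfl, univLog, univ_v, Finset.mul_sum, Finset.sum_congr rfl fun k _ => hz k,
      Finset.sum_add_distrib]
    congr 1
    · rw [map_sum, Finset.mul_sum]
      refine Finset.sum_congr rfl fun k _ => ?_
      rw [hu', map_add, mul_add]
    · rw [Finset.sum_comm]
      refine Finset.sum_congr rfl fun j hj => ?_
      rw [Finset.mem_range] at hj
      have hext' := hext n (n - 1 - j) (by omega)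
      rw [univLog, univ_v] at hext'
      rw [hext', map_sum, Finset.mul_sum]
  obtain ⟨r, hr⟩ := expSeq_int (MvPolynomial.map (Int.castRingHom ℚ))
    (MvPolynomial.expand p : MvPolynomial (ℕ ⊕ ℕ ⊕ ℕ) ℤ →ₐ[ℤ] _).toRingHom
    (MvPolynomial.expand p : MvPolynomial (ℕ ⊕ ℕ ⊕ ℕ) ℚ →ₐ[ℚ] _).toRingHom (univ_comm p) hp0
    (vHat p fun i => MvPolynomial.X (Sum.inl i)) (univ_vfrob p _) (univ_frob p)
    (formalSum p (formalSum p (univLog p Sum.inl)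
      (tHat fun i => MvPolynomial.X (Sum.inr (Sum.inl i))))
      (tHat fun i => MvPolynomial.X (Sum.inr (Sum.inr i)))) this (n + 1)
  refine ⟨r, hr.symm.trans ?_⟩
  rw [deltaRat, univLog, univ_v]

end Universal

section Evaluation

variable (p : ℕ) [hp : Fact p.Prime]

/-- The polynomial for `η_R(v_{n+1})`, which is integral. -/
def etaPoly (n : ℕ) : MvPolynomial (ℕ ⊕ ℕ) ℤ := (exists_etaInt p n).choose

/-- The polynomial for `Δ(t_{n+1})`, which is integral. -/
def deltaPoly (n : ℕ) : MvPolynomial (ℕ ⊕ ℕ ⊕ ℕ) ℤ := (exists_deltaInt p n).choose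

variable {B : Type*} [CommRing B]

/-- The value of the polynomial for `η_R(v_{n+1})` in a ring. -/
def etaEval (v t : ℕ → B) (n : ℕ) : B := MvPolynomial.aeval (Sum.elim v t) (etaPoly p n)

/-- The value of the polynomial for `Δ(t_{n+1})` in a ring. -/
def deltaEval (v t s : ℕ → B) (n : ℕ) : B :=
  MvPolynomial.aeval (Sum.elim v (Sum.elim t s)) (deltaPoly p n)

theorem map_etaEval {C : Type*} [CommRing C] (f : B →+* C) (v t : ℕ → B) (n : ℕ) :
    f (etaEval p v t n) = etaEval p (f ∘ v) (f ∘ t) n := by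
  rw [etaEval, etaEval, ← Sum.comp_elim]
  exact MvPolynomial.comp_aeval_apply (φ := f.toIntAlgHom) _ _

theorem map_deltaEval {C : Type*} [CommRing C] (f : B →+* C) (v t s : ℕ → B) (n : ℕ) :
    f (deltaEval p v t s n) = deltaEval p (f ∘ v) (f ∘ t) (f ∘ s) n := by
  rw [deltaEval, deltaEval, ← Sum.comp_elim, ← Sum.comp_elim]
  exact MvPolynomial.comp_aeval_apply (φ := f.toIntAlgHom) _ _

theorem comp_vHat {C : Type*} [CommRing C] (f : B →+* C) (v : ℕ → B) :
    f ∘ vHat p v = vHat p (f ∘ v) := by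
  funext i
  cases i <;> simp [vHat]

theorem comp_tHat {C : Type*} [CommRing C] (f : B →+* C) (v : ℕ → B) :
    f ∘ tHat v = tHat (f ∘ v) := by
  funext i
  cases i <;> simp [tHat]

theorem logSeq_etaEval [Algebra ℚ B] (v t : ℕ → B) :
    logSeq p (vHat p (etaEval p v t)) = formalSum p (logSeq p (vHat p v)) (tHat t) := by
  have h : ∀ n, etaEval p v t n =
      unlogSeq p (formalSum p (logSeq p (vHat p v)) (tHat t)) (n + 1) := fun n => by
    rw [etaEval, ← MvPolynomial.aeval_map_algebraMap ℚ]
    have h1 := (exists_etaInt p n).choose_spec.1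
    change MvPolynomial.aeval (Sum.elim v t) (MvPolynomial.map (Int.castRingHom ℚ) _) = _
    rw [etaPoly, h1, etaRat]
    set f : MvPolynomial (ℕ ⊕ ℕ) ℚ →+* B := (MvPolynomial.aeval (Sum.elim v t) :
      MvPolynomial (ℕ ⊕ ℕ) ℚ →ₐ[ℚ] B).toRingHom with hf
    have h2 : ∀ x, MvPolynomial.aeval (Sum.elim v t) x = f x := fun x => rfl
    rw [h2, map_unlogSeq]
    congr 1
    funext m
    rw [Function.comp_apply, map_formalSum, comp_tHat, univLog]
    congr 1
    · funext m
      rw [Function.comp_apply, map_logSeq, comp_vHat]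
      congr 2
      funext i
      simp [hf]
    · congr 1
      funext i
      simp [hf]
  have h0 : formalSum p (logSeq p (vHat p v)) (tHat t) 0 = 1 := by
    simp [formalSum, logSeq_zero, tHat]
  funext n
  rw [← logSeq_unlogSeq hp.out.ne_zero _ h0 n]
  rw [logSeq_congr p (v := vHat p (etaEval p v t))
    (w := unlogSeq p (formalSum p (logSeq p (vHat p v)) (tHat t))) h]

theorem formalSum_deltaEval [Algebra ℚ B] (v t s : ℕ → B) :
    formalSum p (logSeq p (vHat p v)) (tHat (deltaEval p v t s)) =
      formalSum p (formalSum p (logSeq p (vHat p v)) (tHat t)) (tHat s) := by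
  have h : ∀ n, deltaEval p v t s n = expSeq p (logSeq p (vHat p v)) (formalSum p (formalSum p
      (logSeq p (vHat p v)) (tHat t)) (tHat s)) (n + 1) := fun n => by
    rw [deltaEval, ← MvPolynomial.aeval_map_algebraMap ℚ]
    have h1 := (exists_deltaInt p n).choose_spec
    change MvPolynomial.aeval (Sum.elim v (Sum.elim t s))
      (MvPolynomial.map (Int.castRingHom ℚ) _) = _
    rw [deltaPoly, h1, deltaRat]
    set f : MvPolynomial (ℕ ⊕ ℕ ⊕ ℕ) ℚ →+* B := (MvPolynomial.aeval (Sum.elim v (Sum.elim t s)) :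
      MvPolynomial (ℕ ⊕ ℕ ⊕ ℕ) ℚ →ₐ[ℚ] B).toRingHom with hf
    have h2 : ∀ x, MvPolynomial.aeval (Sum.elim v (Sum.elim t s)) x = f x := fun x => rfl
    have hl : f ∘ univLog p Sum.inl = logSeq p (vHat p v) := by
      funext m
      rw [Function.comp_apply, univLog, map_logSeq, comp_vHat]
      congr 2
      funext i
      simp [hf]
    have ht : f ∘ (tHat fun i => MvPolynomial.X (Sum.inr (Sum.inl i))) = tHat t := by
      rw [comp_tHat]
      congr 1
      funext i
      simp [hf]
    have hs : f ∘ (tHat fun i => MvPolynomial.X (Sum.inr (Sum.inr i))) = tHat s := by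
      rw [comp_tHat]
      congr 1
      funext i
      simp [hf]
    rw [h2, map_expSeq, hl]
    congr 1
    funext m
    rw [Function.comp_apply, map_formalSum, hs]
    congr 1
    funext m
    rw [Function.comp_apply, map_formalSum, ht, hl]
  funext n
  rw [← expSeq_spec (p := p) (logSeq p (vHat p v)) (formalSum p (formalSum p
      (logSeq p (vHat p v)) (tHat t)) (tHat s)) (logSeq_zero _) n]
  congr 1
  funext m
  cases m with
  | zero => simp [tHat, expSeq, formalSum, logSeq_zero]
  | succ m => rw [tHat, h]

theorem logSeq_injective [Algebra ℚ B] {v w : ℕ → B}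
    (h : logSeq p (vHat p v) = logSeq p (vHat p w)) : v = w := by
  funext n
  have h1 := unlogSeq_logSeq (p := p) hp.out.ne_zero (vHat p v) n
  have h2 := unlogSeq_logSeq (p := p) hp.out.ne_zero (vHat p w) n
  rw [h, h2] at h1
  exact h1.symm

theorem map_etaEval_deltaEval {D C : Type*} [CommRing D] [CommRing C] (f : D →+* C)
    (v t s : ℕ → D) (n : ℕ) :
    f (etaEval p v (deltaEval p v t s) n) =
      etaEval p (f ∘ v) (deltaEval p (f ∘ v) (f ∘ t) (f ∘ s)) n ∧
    f (etaEval p (etaEval p v t) s n) = etaEval p (etaEval p (f ∘ v) (f ∘ t)) (f ∘ s) n := by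
  constructor
  · rw [map_etaEval]
    congr 1
    funext m
    rw [Function.comp_apply, map_deltaEval]
  · rw [map_etaEval]
    congr 1
    funext m
    rw [Function.comp_apply, map_etaEval]

theorem etaEval_deltaEval (v t s : ℕ → B) :
    etaEval p v (deltaEval p v t s) = etaEval p (etaEval p v t) s := by
  have hQ : etaEval p (B := MvPolynomial (ℕ ⊕ ℕ ⊕ ℕ) ℚ) (fun i => MvPolynomial.X (Sum.inl i))
      (deltaEval p (fun i => MvPolynomial.X (Sum.inl i))
      (fun i => MvPolynomial.X (Sum.inr (Sum.inl i)))
      (fun i => MvPolynomial.X (Sum.inr (Sum.inr i)))) =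
      etaEval p (etaEval p (fun i => MvPolynomial.X (Sum.inl i))
      (fun i => MvPolynomial.X (Sum.inr (Sum.inl i))))
      (fun i => MvPolynomial.X (Sum.inr (Sum.inr i))) := by
    apply logSeq_injective p
    rw [logSeq_etaEval, formalSum_deltaEval, logSeq_etaEval, logSeq_etaEval]
  funext n
  have hZ : etaEval p (B := MvPolynomial (ℕ ⊕ ℕ ⊕ ℕ) ℤ) (fun i => MvPolynomial.X (Sum.inl i))
      (deltaEval p (fun i => MvPolynomial.X (Sum.inl i))
      (fun i => MvPolynomial.X (Sum.inr (Sum.inl i)))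
      (fun i => MvPolynomial.X (Sum.inr (Sum.inr i)))) n =
      etaEval p (etaEval p (fun i => MvPolynomial.X (Sum.inl i))
      (fun i => MvPolynomial.X (Sum.inr (Sum.inl i))))
      (fun i => MvPolynomial.X (Sum.inr (Sum.inr i))) n := by
    apply MvPolynomial.map_injective (Int.castRingHom ℚ) Int.cast_injective
    rw [(map_etaEval_deltaEval p _ _ _ _ n).1, (map_etaEval_deltaEval p _ _ _ _ n).2]
    simpa [Function.comp_def] using congrFun hQ n
  have := congrArg (MvPolynomial.aeval (Sum.elim v (Sum.elim t s)) :
    MvPolynomial (ℕ ⊕ ℕ ⊕ ℕ) ℤ →ₐ[ℤ] B).toRingHom hZ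
  have h2 := map_etaEval_deltaEval p (MvPolynomial.aeval (Sum.elim v (Sum.elim t s)) :
    MvPolynomial (ℕ ⊕ ℕ ⊕ ℕ) ℤ →ₐ[ℤ] B).toRingHom (fun i => MvPolynomial.X (Sum.inl i))
      (fun i => MvPolynomial.X (Sum.inr (Sum.inl i)))
      (fun i => MvPolynomial.X (Sum.inr (Sum.inr i))) n
  rw [h2.1, h2.2] at this
  simpa [Function.comp_def] using this

theorem etaEval_zero (v : ℕ → B) : etaEval p v 0 = v := by
  have hQ : etaEval p (B := MvPolynomial ℕ ℚ) MvPolynomial.X 0 = MvPolynomial.X := by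
    apply logSeq_injective p
    rw [logSeq_etaEval]
    funext n
    rw [formalSum, Finset.sum_range_succ, Finset.sum_eq_zero]
    · simp [tHat]
    · intro i hi
      rw [Finset.mem_range] at hi
      obtain ⟨m, hm⟩ : ∃ m, n - i = m + 1 := ⟨n - i - 1, by omega⟩
      rw [hm, tHat, Pi.zero_apply, zero_pow (pow_ne_zero _ hp.out.ne_zero), mul_zero]
  funext n
  have hZ : etaEval p (B := MvPolynomial ℕ ℤ) MvPolynomial.X 0 n = MvPolynomial.X n := by
    apply MvPolynomial.map_injective (Int.castRingHom ℚ) Int.cast_injective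
    rw [map_etaEval]
    have h1 : (MvPolynomial.map (Int.castRingHom ℚ)) ∘ (MvPolynomial.X : ℕ → MvPolynomial ℕ ℤ) =
      MvPolynomial.X := by funext i; simp
    have h2 : (MvPolynomial.map (Int.castRingHom ℚ)) ∘ (0 : ℕ → MvPolynomial ℕ ℤ) = 0 := by
      funext i; simp
    rw [h1, h2, hQ, MvPolynomial.map_X]
  have := congrArg (MvPolynomial.aeval v : MvPolynomial ℕ ℤ →ₐ[ℤ] B).toRingHom hZ
  rw [map_etaEval] at this
  have h1 : (MvPolynomial.aeval v : MvPolynomial ℕ ℤ →ₐ[ℤ] B).toRingHom ∘ MvPolynomial.X = v := by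
    funext i; simp
  have h2 : (MvPolynomial.aeval v : MvPolynomial ℕ ℤ →ₐ[ℤ] B).toRingHom ∘ (0 : ℕ → MvPolynomial ℕ ℤ) = 0 := by
    funext i; simp
  rw [h1, h2] at this
  simpa using this

theorem etaEval_sub_mem (v t : ℕ → B) (n : ℕ) :
    etaEval p v t n - v n ∈ Ideal.span {x : B | x = p ∨ ∃ j, j < n ∧ x = v j} := by
  have h := Ideal.mem_map_of_mem (MvPolynomial.aeval (Sum.elim v t) :
    MvPolynomial (ℕ ⊕ ℕ) ℤ →ₐ[ℤ] B).toRingHom (exists_etaInt p n).choose_spec.2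
  rw [Ideal.map_span] at h
  have h2 : (MvPolynomial.aeval (Sum.elim v t) : MvPolynomial (ℕ ⊕ ℕ) ℤ →ₐ[ℤ] B).toRingHom
      ((exists_etaInt p n).choose - MvPolynomial.X (Sum.inl n)) = etaEval p v t n - v n := by
    rw [map_sub]
    congr 1
    simp
  rw [h2] at h
  refine Ideal.span_mono ?_ h
  rintro _ ⟨x, rfl | ⟨j, h1, rfl⟩, rfl⟩
  · exact Or.inl (by simp)
  · exact Or.inr ⟨j, h1, by simp⟩

/-- The degree `2 (p ^ (n + 1) - 1)` of `v_{n+1}` and of `t_{n+1}`. -/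
def genDeg (n : ℕ) : ℤ := 2 * ((p : ℤ) ^ (n + 1) - 1)

theorem isWH_formalSum {σ : Type} {w : σ → ℤ} {l s : ℕ → MvPolynomial σ ℚ}
    (hl : ∀ n, (l n).IsWeightedHomogeneous w (2 * ((p : ℤ) ^ n - 1)))
    (hs : ∀ n, (s n).IsWeightedHomogeneous w (2 * ((p : ℤ) ^ n - 1))) (n : ℕ) :
    (formalSum p l s n).IsWeightedHomogeneous w (2 * ((p : ℤ) ^ n - 1)) := by
  refine MvPolynomial.IsWeightedHomogeneous.sum _ _ _ fun i hi => ?_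
  rw [Finset.mem_range] at hi
  convert (hl i).mul ((hs (n - i)).pow (p ^ i)) using 1
  have : (p : ℤ) ^ n = p ^ i * p ^ (n - i) := by rw [← pow_add]; congr 1; omega
  rw [this, nsmul_eq_mul]
  push_cast
  ring

theorem isWH_logSeq {σ : Type} {w : σ → ℤ} {v : ℕ → MvPolynomial σ ℚ}
    (hv : ∀ n, (v n).IsWeightedHomogeneous w (2 * ((p : ℤ) ^ n - 1))) (n : ℕ) :
    (logSeq p v n).IsWeightedHomogeneous w (2 * ((p : ℤ) ^ n - 1)) := by
  induction n using Nat.strong_induction_on with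
  | _ n ih =>
  cases n with
  | zero => simpa [logSeq] using MvPolynomial.isWeightedHomogeneous_one ℚ w
  | succ n =>
    rw [logSeq]
    refine (MvPolynomial.weightedHomogeneousSubmodule ℚ w _).smul_mem _
      (MvPolynomial.IsWeightedHomogeneous.sum _ _ _ fun i _ => ?_)
    convert (ih i i.2).mul ((hv (n + 1 - i)).pow (p ^ (i : ℕ))) using 1
    have : (p : ℤ) ^ (n + 1) = p ^ (i : ℕ) * p ^ (n + 1 - i) := by
      rw [← pow_add]; congr 1; omega
    rw [this, nsmul_eq_mul]
    push_cast
    ring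

theorem isWH_unlogSeq {σ : Type} {w : σ → ℤ} {c : ℕ → MvPolynomial σ ℚ}
    (hc : ∀ n, (c n).IsWeightedHomogeneous w (2 * ((p : ℤ) ^ n - 1))) (n : ℕ) :
    (unlogSeq p c n).IsWeightedHomogeneous w (2 * ((p : ℤ) ^ n - 1)) := by
  have hpc : ∀ n, ((p : MvPolynomial σ ℚ) * c n).IsWeightedHomogeneous w
      (2 * ((p : ℤ) ^ n - 1)) := fun n => by
    rw [← nsmul_eq_mul]
    exact (MvPolynomial.weightedHomogeneousSubmodule ℚ w _).nsmul_mem (hc n) _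
  induction n using Nat.strong_induction_on with
  | _ n ih =>
  cases n with
  | zero => rw [unlogSeq]; exact hpc 0
  | succ n =>
    rw [unlogSeq]
    refine (hpc _).sub (MvPolynomial.IsWeightedHomogeneous.sum _ _ _ fun i _ => ?_)
    have h : 2 * ((p : ℤ) ^ (n + 1) - 1) = 2 * ((p : ℤ) ^ ((i : ℕ) + 1) - 1) +
        p ^ ((i : ℕ) + 1) • (2 * ((p : ℤ) ^ (n - i) - 1)) := by
      have : (p : ℤ) ^ (n + 1) = p ^ (i + 1 : ℕ) * p ^ (n - i) := by
        rw [← pow_add]; congr 1; omega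
      rw [this, nsmul_eq_mul]
      push_cast
      ring
    rw [h]
    exact (hc (i + 1)).mul ((ih (n - i) (by omega)).pow (p ^ (i + 1 : ℕ)))

theorem etaPoly_isWH (n : ℕ) : (etaPoly p n).IsWeightedHomogeneous
    (Sum.elim (genDeg p) (genDeg p)) (genDeg p n) := by
  have hX : ∀ (f : ℕ → ℕ ⊕ ℕ), (∀ i, Sum.elim (genDeg p) (genDeg p) (f i) = genDeg p i) →
      ∀ i, (MvPolynomial.X (f i) : MvPolynomial (ℕ ⊕ ℕ) ℚ).IsWeightedHomogeneous
      (Sum.elim (genDeg p) (genDeg p)) (2 * ((p : ℤ) ^ (i + 1) - 1)) := fun f hf i => by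
    have := MvPolynomial.isWeightedHomogeneous_X ℚ (Sum.elim (genDeg p) (genDeg p)) (f i)
    rwa [hf] at this
  have h : (etaRat p n).IsWeightedHomogeneous
      (Sum.elim (genDeg p) (genDeg p)) (genDeg p n) := by
    refine isWH_unlogSeq p (isWH_formalSum p (isWH_logSeq p fun i => ?_) fun i => ?_) (n + 1)
    · cases i with
      | zero => simpa [vHat] using MvPolynomial.isWeightedHomogeneous_C _ (p : ℚ)
      | succ i => exact hX _ (fun _ => rfl) i
    · cases i with
      | zero => simpa [tHat] using MvPolynomial.isWeightedHomogeneous_one ℚ _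
      | succ i => exact hX _ (fun _ => rfl) i
  rw [← (exists_etaInt p n).choose_spec.1] at h
  intro d hd
  refine h (d := d) ?_
  rw [MvPolynomial.coeff_map]
  simpa [etaPoly] using hd

theorem etaEval_mem {𝒜 : ℤ → AddSubgroup B} (h1 : 1 ∈ 𝒜 0)
    (hmul : ∀ i j a b, a ∈ 𝒜 i → b ∈ 𝒜 j → a * b ∈ 𝒜 (i + j)) (v t : ℕ → B)
    (hv : ∀ n, v n ∈ 𝒜 (genDeg p n)) (ht : ∀ n, t n ∈ 𝒜 (genDeg p n)) (n : ℕ) :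
    etaEval p v t n ∈ 𝒜 (genDeg p n) := by
  have hpow : ∀ i a (k : ℕ), a ∈ 𝒜 i → a ^ k ∈ 𝒜 (k • i) := fun i a k ha => by
    induction k with
    | zero => simpa using h1
    | succ k ih => rw [pow_succ, succ_nsmul]; exact hmul _ _ _ _ ih ha
  rw [etaEval, MvPolynomial.aeval_def, MvPolynomial.eval₂_eq]
  refine sum_mem fun d hd => ?_
  have hw := etaPoly_isWH p n (MvPolynomial.mem_support_iff.1 hd)
  rw [eq_intCast, ← zsmul_eq_mul, ← hw]
  refine zsmul_mem ?_ _
  rw [Finsupp.weight_apply, Finsupp.sum]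
  have : ∀ (s : Finset (ℕ ⊕ ℕ)), ∏ i ∈ s, Sum.elim v t i ^ d i ∈
      𝒜 (∑ i ∈ s, d i • Sum.elim (genDeg p) (genDeg p) i) := fun s => by
    classical
    induction s using Finset.induction_on with
    | empty => simpa using h1
    | insert a s ha ih =>
      rw [Finset.prod_insert ha, Finset.sum_insert ha]
      refine hmul _ _ _ _ (hpow _ _ _ ?_) ih
      cases a
      · exact hv _
      · exact ht _
  exact this _

end Evaluation

section HopfAlgebroid

variable (p : ℕ) [hp : Fact p.Prime]

instance span_isPrime : (Ideal.span {(p : ℤ)}).IsPrime :=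
  (Ideal.span_singleton_prime (by exact_mod_cast hp.out.ne_zero)).2
    (Nat.prime_iff_prime_int.1 hp.out)

/-- The ring `ℤ_(p)`. -/
def ZLoc : Type := Localization.AtPrime (Ideal.span {(p : ℤ)})

instance : CommRing (ZLoc p) := inferInstanceAs (CommRing (Localization.AtPrime _))

/-- `BP_* = ℤ_(p)[v_1, v_2, …]`; the variable `X i` is `v_{i+1}`. -/
def BP : Type := MvPolynomial ℕ (ZLoc p)

instance : CommRing (BP p) := inferInstanceAs (CommRing (MvPolynomial ℕ (ZLoc p)))

instance : Algebra (ZLoc p) (BP p) :=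
  inferInstanceAs (Algebra (ZLoc p) (MvPolynomial ℕ (ZLoc p)))

/-- The polynomial generator `v_{i+1}` of `BP_*`. -/
def vVar (i : ℕ) : BP p := (MvPolynomial.X i : MvPolynomial ℕ (ZLoc p))

theorem BP_hom_ext {S : Type*} [CommRing S] {f g : BP p →+* S}
    (hC : ∀ r : ZLoc p, f (algebraMap _ _ r) = g (algebraMap _ _ r))
    (hX : ∀ i, f (vVar p i) = g (vVar p i)) : f = g :=
  MvPolynomial.ringHom_ext (R := ZLoc p) (σ := ℕ) (f := f) (g := g) hC hX

/-- `BP_*BP = BP_*[t_1, t_2, …]`; the variable `X i` is `t_{i+1}`, and the structure of an algebra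
over `BP_*` is the left unit. -/
abbrev BPBP : Type := MvPolynomial ℕ (BP p)

/-- `BP_*BP ⊗ BP_*BP` (over `BP_*`, by the right unit on the first and the left unit on the second
factor), which is a polynomial ring in the `1 ⊗ t_i` over the first factor. -/
abbrev BPBP2 : Type := MvPolynomial ℕ (BPBP p)

/-- `v_{i+1}` in `BP_*BP`, embedded by the left unit. -/
def vOne (i : ℕ) : BPBP p := MvPolynomial.C (vVar p i)

/-- `t_{i+1}` in `BP_*BP`. -/
def tOne (i : ℕ) : BPBP p := MvPolynomial.X i

/-- `v_{i+1} ⊗ 1` in `BP_*BP ⊗ BP_*BP`. -/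
def vTwo (i : ℕ) : BPBP2 p := MvPolynomial.C (vOne p i)

/-- `t_{i+1} ⊗ 1` in `BP_*BP ⊗ BP_*BP`. -/
def tLeft (i : ℕ) : BPBP2 p := MvPolynomial.C (tOne p i)

/-- `1 ⊗ t_{i+1}` in `BP_*BP ⊗ BP_*BP`. -/
def tRight (i : ℕ) : BPBP2 p := MvPolynomial.X i

/-- The right unit `η_R`. -/
def etaR : BP p →+* BPBP p :=
  MvPolynomial.eval₂Hom (R := ZLoc p) (σ := ℕ) (MvPolynomial.C.comp (algebraMap (ZLoc p) (BP p)))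
    (etaEval p (vOne p) (tOne p))

/-- The counit `ε`, with `ε(t_i) = 0`. -/
def counit : BPBP p →ₐ[BP p] BP p := MvPolynomial.aeval fun _ => 0

/-- The map `g ↦ g ⊗ 1`. -/
def inl : BPBP p →ₐ[BP p] BPBP2 p := IsScalarTower.toAlgHom _ _ _

/-- The map `g ↦ 1 ⊗ g`; it sends `η_L(a)` to `η_R(a) ⊗ 1`. -/
def inr : BPBP p →+* BPBP2 p :=
  MvPolynomial.eval₂Hom (MvPolynomial.C.comp (etaR p)) (tRight p)

/-- The comultiplication `Δ`. -/
def comul : BPBP p →ₐ[BP p] BPBP2 p :=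
  MvPolynomial.aeval (deltaEval p (vTwo p) (tLeft p) (tRight p))

theorem inr_C (a : BP p) : inr p (MvPolynomial.C a) = inl p (etaR p a) := by
  simp [inr, inl]

theorem etaR_X (i : ℕ) : etaR p (vVar p i) = etaEval p (vOne p) (tOne p) i :=
  MvPolynomial.eval₂Hom_X' _ _ _

theorem etaR_C (r : ZLoc p) : etaR p (algebraMap _ _ r) =
    MvPolynomial.C (algebraMap _ _ r) :=
  MvPolynomial.eval₂Hom_C _ _ _

theorem counit_etaR (a : BP p) : counit p (etaR p a) = a := by
  have : (counit p).toRingHom.comp (etaR p) = RingHom.id _ := by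
    refine BP_hom_ext p (fun r => ?_) fun i => ?_
    · rw [RingHom.comp_apply, etaR_C]
      exact (counit p).commutes _
    · rw [RingHom.comp_apply, etaR_X]
      refine (map_etaEval p (B := BPBP p) (C := BP p) (counit p).toRingHom _ _ _).trans ?_
      have h1 : (counit p).toRingHom ∘ vOne p = vVar p := by
        funext i; simp [counit, vOne]
      have h2 : (counit p).toRingHom ∘ tOne p = 0 := by
        funext i; simp [counit, tOne]
      rw [h1, h2, etaEval_zero]
      rfl
  exact RingHom.congr_fun this a

theorem comul_etaR (a : BP p) : comul p (etaR p a) = inr p (etaR p a) := by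
  have : (comul p).toRingHom.comp (etaR p) = (inr p).comp (etaR p) := by
    refine BP_hom_ext p (fun r => ?_) fun i => ?_
    · rw [RingHom.comp_apply, RingHom.comp_apply, etaR_C, inr_C, etaR_C]
      exact (comul p).commutes _
    · rw [RingHom.comp_apply, RingHom.comp_apply, etaR_X]
      refine (map_etaEval p (B := BPBP p) (C := BPBP2 p) (comul p).toRingHom _ _ _).trans
        (Eq.trans ?_ (map_etaEval p (B := BPBP p) (C := BPBP2 p) (inr p) _ _ _).symm)
      have h1 : (comul p).toRingHom ∘ vOne p = vTwo p := by
        funext i; exact (comul p).commutes _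
      have h2 : (comul p).toRingHom ∘ tOne p = deltaEval p (vTwo p) (tLeft p) (tRight p) := by
        funext i; simp [comul, tOne]
      have h3 : inr p ∘ vOne p = etaEval p (vTwo p) (tLeft p) := by
        funext i
        rw [Function.comp_apply, vOne, inr_C, etaR_X]
        exact map_etaEval p (B := BPBP p) (C := BPBP2 p) (inl p).toRingHom _ _ _
      have h4 : inr p ∘ tOne p = tRight p := by
        funext i; simp [inr, tOne]
      rw [h1, h2, h3, h4, etaEval_deltaEval]
  exact RingHom.congr_fun this a

/-- Elements of degree `d` in `BP_*`, where `v_i` has degree `2 (p ^ i - 1)`. -/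
def BPdeg (d : ℤ) : AddSubgroup (BP p) :=
  (MvPolynomial.weightedHomogeneousSubmodule (ZLoc p) (genDeg p) d).toAddSubgroup

/-- Elements of degree `d` in `BP_*BP`, where `t_i` has degree `2 (p ^ i - 1)`. -/
def BPBPdeg (d : ℤ) : AddSubgroup (BPBP p) where
  carrier := {g | ∀ e, MvPolynomial.coeff e g ∈ BPdeg p (d - Finsupp.weight (genDeg p) e)}
  zero_mem' e := by simpa using zero_mem _
  add_mem' ha hb e := by rw [MvPolynomial.coeff_add]; exact add_mem (ha e) (hb e)
  neg_mem' ha e := by rw [MvPolynomial.coeff_neg]; exact neg_mem (ha e)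

theorem BPdeg_mul {i j : ℤ} {a b : BP p} (ha : a ∈ BPdeg p i) (hb : b ∈ BPdeg p j) :
    a * b ∈ BPdeg p (i + j) :=
  MvPolynomial.IsWeightedHomogeneous.mul (R := ZLoc p) (w := genDeg p) ha hb

theorem vVar_mem (n : ℕ) : vVar p n ∈ BPdeg p (genDeg p n) :=
  MvPolynomial.isWeightedHomogeneous_X (ZLoc p) (genDeg p) n

theorem algebraMap_mem (r : ZLoc p) : algebraMap _ _ r ∈ BPdeg p 0 :=
  MvPolynomial.isWeightedHomogeneous_C (genDeg p) r

theorem BPdeg_one : (1 : BP p) ∈ BPdeg p 0 :=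
  MvPolynomial.isWeightedHomogeneous_one (ZLoc p) (genDeg p)

theorem BPBPdeg_mul {i j : ℤ} {a b : BPBP p} (ha : a ∈ BPBPdeg p i) (hb : b ∈ BPBPdeg p j) :
    a * b ∈ BPBPdeg p (i + j) := fun e => by
  classical
  rw [MvPolynomial.coeff_mul]
  refine sum_mem fun x hx => ?_
  convert BPdeg_mul p (ha x.1) (hb x.2) using 1
  have h := Finset.HasAntidiagonal.mem_antidiagonal.1 hx
  rw [← h, map_add]
  congr 1
  ring

theorem C_mem_BPBPdeg {i : ℤ} {a : BP p} (ha : a ∈ BPdeg p i) :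
    MvPolynomial.C a ∈ BPBPdeg p i := fun e => by
  classical
  rw [MvPolynomial.coeff_C]
  split_ifs with h
  · subst h; simpa using ha
  · exact zero_mem _

theorem etaR_mem {d : ℤ} {a : BP p} (ha : a ∈ BPdeg p d) : etaR p a ∈ BPBPdeg p d := by
  have h1 : (1 : BPBP p) ∈ BPBPdeg p 0 := by
    exact C_mem_BPBPdeg p (BPdeg_one p)
  have hv : ∀ n, etaR p (vVar p n) ∈ BPBPdeg p (genDeg p n) := fun n => by
    rw [etaR_X]
    refine etaEval_mem p h1 (fun _ _ _ _ => BPBPdeg_mul p) _ _ (fun n => ?_) (fun n => ?_) n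
    · exact C_mem_BPBPdeg p (vVar_mem p n)
    · intro e
      classical
      rw [tOne, MvPolynomial.coeff_X]
      split_ifs with h
      · subst h; simpa [Finsupp.weight_single] using BPdeg_one p
      · exact zero_mem _
  have hpow : ∀ n (k : ℕ), etaR p (vVar p n) ^ k ∈ BPBPdeg p (k • genDeg p n) :=
    fun n k => by
    induction k with
    | zero => simpa using h1
    | succ k ih => rw [pow_succ, succ_nsmul]; exact BPBPdeg_mul p ih (hv n)
  have hprod : ∀ (e : ℕ →₀ ℕ) (s : Finset ℕ), ∏ i ∈ s, etaR p (vVar p i) ^ e i ∈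
      BPBPdeg p (∑ i ∈ s, e i • genDeg p i) := fun e s => by
    classical
    induction s using Finset.induction_on with
    | empty => simpa using h1
    | insert a s ha ih =>
      rw [Finset.prod_insert ha, Finset.sum_insert ha]
      exact BPBPdeg_mul p (hpow _ _) ih
  have has : a = ∑ e ∈ MvPolynomial.support (R := ZLoc p) (σ := ℕ) a,
      algebraMap (ZLoc p) (BP p) (MvPolynomial.coeff (R := ZLoc p) e a) *
        ∏ i ∈ e.support, vVar p i ^ e i :=
    (MvPolynomial.as_sum (R := ZLoc p) a).trans
      (Finset.sum_congr rfl fun e _ => MvPolynomial.monomial_eq)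
  rw [has, map_sum]
  refine sum_mem fun e he => ?_
  have hw := ha (MvPolynomial.mem_support_iff.1 he)
  rw [map_mul, map_prod]
  simp only [map_pow]
  rw [← hw, Finsupp.weight_apply, Finsupp.sum, ← zero_add (∑ _ ∈ _, _)]
  refine BPBPdeg_mul p ?_ (hprod e _)
  rw [etaR_C]
  exact C_mem_BPBPdeg p (algebraMap_mem p _)

/-- `v_0 = p`, and `v_n` is the Hazewinkel generator for `n > 0`. -/
def vGen (n : ℕ) : BP p := vHat p (vVar p) n

/-- `I_k = (p, v_1, …, v_{k-1})`, for `k ≤ ∞`. -/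
def idealI (k : ℕ∞) : Ideal (BP p) := Ideal.span {x | ∃ j : ℕ, (j : ℕ∞) < k ∧ x = vGen p j}

theorem vGen_mem (n : ℕ) : ∃ d, vGen p n ∈ BPdeg p d := by
  cases n with
  | zero => exact ⟨0, by
      have := algebraMap_mem p (p : ZLoc p)
      rwa [map_natCast] at this⟩
  | succ n => exact ⟨_, vVar_mem p n⟩

theorem etaR_vGen (n : ℕ) : etaR p (vGen p n) - MvPolynomial.C (vGen p n) ∈
    (idealI p n).map (MvPolynomial.C : BP p →+* BPBP p) := by
  cases n with
  | zero => simp [vGen, vHat]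
  | succ n =>
    have := etaEval_sub_mem p (vOne p) (tOne p) n
    rw [vGen, vHat, etaR_X]
    refine Ideal.span_le.2 ?_ this
    rintro x (rfl | ⟨j, hj, rfl⟩)
    · have : (p : BPBP p) = MvPolynomial.C (vGen p 0) := by simp [vGen, vHat]
      rw [this]
      exact Ideal.mem_map_of_mem _ (Ideal.subset_span ⟨0, by simp, rfl⟩)
    · exact Ideal.mem_map_of_mem _ (Ideal.subset_span ⟨j + 1, by exact_mod_cast by omega, rfl⟩)

end HopfAlgebroid

section Grading

variable {M : Type*} [AddCommGroup M] {deg : ℤ → AddSubgroup M}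

/-- The projection to the component of degree `d` of a graded abelian group. -/
def gproj (h : DirectSum.IsInternal deg) (d : ℤ) : M →+ M :=
  ((deg d).subtype.comp (DFinsupp.evalAddMonoidHom d)).comp
    (AddEquiv.ofBijective (DirectSum.coeAddMonoidHom deg) h).symm.toAddMonoidHom

theorem gproj_mem (h : DirectSum.IsInternal deg) (d : ℤ) (x : M) : gproj h d x ∈ deg d :=
  Subtype.property _

theorem gproj_coe (h : DirectSum.IsInternal deg) (d : ℤ) (z : DirectSum ℤ fun i => deg i) :
    gproj h d (DirectSum.coeAddMonoidHom deg z) = z d := by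
  have : (AddEquiv.ofBijective (DirectSum.coeAddMonoidHom deg) h).symm
    (DirectSum.coeAddMonoidHom deg z) = z :=
    (AddEquiv.ofBijective (DirectSum.coeAddMonoidHom deg) h).symm_apply_apply z
  simp only [gproj, AddMonoidHom.comp_apply, AddEquiv.toAddMonoidHom_eq_coe, AddMonoidHom.coe_coe,
    this]
  rfl

theorem gproj_of_mem (h : DirectSum.IsInternal deg) {d : ℤ} {x : M} (hx : x ∈ deg d) (e : ℤ) :
    gproj h e x = if d = e then x else 0 := by
  have := gproj_coe h e (DirectSum.of (fun i => deg i) d ⟨x, hx⟩)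
  rw [DirectSum.coeAddMonoidHom_of] at this
  rw [this, DirectSum.coe_of_apply]
  split_ifs <;> rfl

/-- Induction on the decomposition into homogeneous elements. -/
theorem graded_induction (h : DirectSum.IsInternal deg) {P : M → Prop} (x : M) (h0 : P 0)
    (ha : ∀ x y, P x → P y → P (x + y)) (hd : ∀ d, ∀ x ∈ deg d, P x) : P x := by
  obtain ⟨z, rfl⟩ := h.2 x
  induction z using DirectSum.induction_on with
  | zero => simpa using h0
  | of i x => rw [DirectSum.coeAddMonoidHom_of]; exact hd i _ x.2
  | add x y hx hy => rw [map_add]; exact ha _ _ hx hy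

theorem eq_zero_of_gproj (h : DirectSum.IsInternal deg) {x : M} (hx : ∀ d, gproj h d x = 0) :
    x = 0 := by
  obtain ⟨z, rfl⟩ := h.2 x
  have : z = 0 := by
    ext d
    rw [← gproj_coe h, hx]
    simp
  rw [this, map_zero]

theorem isInternal_of_proj (π : ℤ → M →+ M)
    (h1 : ∀ d, ∀ x ∈ deg d, ∀ e, π e x = if d = e then x else 0)
    (h2 : ∀ x : M, x ∈ (DirectSum.coeAddMonoidHom deg).range) : DirectSum.IsInternal deg := by
  have key : ∀ (z : DirectSum ℤ fun i => deg i) d,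
      π d (DirectSum.coeAddMonoidHom deg z) = z d := fun z d => by
    induction z using DirectSum.induction_on with
    | zero => simp
    | of i x =>
      rw [DirectSum.coeAddMonoidHom_of, h1 i x x.2, DirectSum.coe_of_apply]
      split_ifs <;> rfl
    | add x y hx hy => rw [map_add, map_add, hx, hy]; simp
  refine ⟨(injective_iff_map_eq_zero _).2 fun z hz => ?_, fun x => h2 x⟩
  ext d
  rw [← key, hz]
  simp

end Grading

section Comodules

variable (p : ℕ) [hp : Fact p.Prime]

section Coaction

variable {p} {M : Type*} [AddCommGroup M] [Module (BP p) M]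

theorem rTensor_smul {S : Type*} [CommRing S] [Algebra (BP p) S] (f : BPBP p →ₐ[BP p] S)
    (g : BPBP p) (z : BPBP p ⊗[BP p] M) :
    f.toLinearMap.rTensor M (g • z) = f g • f.toLinearMap.rTensor M z := by
  induction z using TensorProduct.induction_on with
  | zero => simp
  | tmul a m => simp [TensorProduct.smul_tmul']
  | add x y hx hy => rw [smul_add, map_add, hx, hy, map_add, smul_add]

theorem coactTensor_aux (ψ : M →ₛₗ[etaR p] BPBP p ⊗[BP p] M) (a : BP p) (g : BPBP p) (m : M) :
    inr p (a • g) • (inl p).toLinearMap.rTensor M (ψ m) =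
      inr p g • (inl p).toLinearMap.rTensor M (ψ (a • m)) := by
  rw [LinearMap.map_smulₛₗ, rTensor_smul (inl p), smul_smul, MvPolynomial.smul_eq_C_mul, map_mul,
    inr_C, mul_comm]

/-- For `ψ : M → M ⊗ Γ`, the map `ψ ⊗ 1 : M ⊗ Γ → M ⊗ Γ ⊗ Γ`. -/
def coactTensor (ψ : M →ₛₗ[etaR p] BPBP p ⊗[BP p] M) :
    BPBP p ⊗[BP p] M →+ BPBP2 p ⊗[BP p] M :=
  TensorProduct.liftAddHom
    (AddMonoidHom.mk' (fun g => AddMonoidHom.mk'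
      (fun m => inr p g • (inl p).toLinearMap.rTensor M (ψ m))
      (fun m m' => by rw [map_add, map_add, smul_add]))
      (fun g g' => AddMonoidHom.ext fun m => by
        simp only [AddMonoidHom.mk'_apply, AddMonoidHom.add_apply]
        rw [map_add, add_smul]))
    (fun a g m => coactTensor_aux ψ a g m)

theorem coactTensor_tmul (ψ : M →ₛₗ[etaR p] BPBP p ⊗[BP p] M) (g : BPBP p) (m : M) :
    coactTensor ψ (g ⊗ₜ m) = inr p g • (inl p).toLinearMap.rTensor M (ψ m) := rfl

/-- The elements of degree `d` in `M ⊗ Γ`. -/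
def tensorDeg (deg : ℤ → AddSubgroup M) (d : ℤ) : AddSubgroup (BPBP p ⊗[BP p] M) :=
  AddSubgroup.closure {z | ∃ i j : ℤ, i + j = d ∧ ∃ g ∈ BPBPdeg p i, ∃ m ∈ deg j, z = g ⊗ₜ m}

end Coaction

/-- Graded comodules `M` over `(BP_*, BP_*BP)`, with coaction `ψ : M → M ⊗ BP_*BP`. The tensor
product over the left unit of `BP_*BP` is written in the opposite order; it is a module over
`BP_*` by the right unit, for which `ψ` is linear. -/
structure Comod where
  carrier : Type
  [addCommGroup : AddCommGroup carrier]
  [module : Module (BP p) carrier]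
  deg : ℤ → AddSubgroup carrier
  isInternal : DirectSum.IsInternal deg
  smul_mem : ∀ {i j : ℤ} {a : BP p} {m : carrier}, a ∈ BPdeg p i → m ∈ deg j → a • m ∈ deg (i + j)
  coact : carrier →ₛₗ[etaR p] BPBP p ⊗[BP p] carrier
  coact_mem : ∀ {d : ℤ} {m : carrier}, m ∈ deg d → coact m ∈ tensorDeg deg d
  counit_coact : ∀ m, TensorProduct.lid (BP p) carrier
    ((counit p).toLinearMap.rTensor carrier (coact m)) = m
  coassoc : ∀ m, (comul p).toLinearMap.rTensor carrier (coact m) = coactTensor coact (coact m)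

attribute [instance] Comod.addCommGroup Comod.module

namespace Comod

variable {p}

/-- Homomorphisms of comodules: maps of `BP_*`-modules that preserve the degree and commute with
the coaction. -/
@[ext]
structure Hom (M N : Comod p) where
  toLin : M.carrier →ₗ[BP p] N.carrier
  map_deg : ∀ {d : ℤ} {m : M.carrier}, m ∈ M.deg d → toLin m ∈ N.deg d
  map_coact : ∀ m, N.coact (toLin m) = toLin.lTensor (BPBP p) (M.coact m)

instance : Category (Comod p) where
  Hom := Hom
  id M := ⟨LinearMap.id, id, fun m => by simp⟩
  comp f g := ⟨g.toLin ∘ₗ f.toLin, fun h => g.map_deg (f.map_deg h), fun m => by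
    rw [LinearMap.comp_apply, g.map_coact, f.map_coact, LinearMap.lTensor_comp_apply]⟩

variable {M N P : Comod p}

@[ext]
theorem hom_ext {f g : M ⟶ N} (h : ∀ m, f.toLin m = g.toLin m) : f = g :=
  Hom.ext (LinearMap.ext h)

@[simp] theorem comp_toLin (f : M ⟶ N) (g : N ⟶ P) : (f ≫ g).toLin = g.toLin ∘ₗ f.toLin := rfl

@[simp] theorem id_toLin : Hom.toLin (𝟙 M) = LinearMap.id := rfl

section

instance : Zero (Hom M N) := ⟨⟨0, fun _ => zero_mem _, fun m => by simp⟩⟩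

instance : Add (Hom M N) := ⟨fun f g => ⟨f.toLin + g.toLin,
  fun h => add_mem (f.map_deg h) (g.map_deg h), fun m => by
    simp [f.map_coact, g.map_coact, LinearMap.lTensor_add]⟩⟩

instance : Neg (Hom M N) := ⟨fun f => ⟨-f.toLin, fun h => neg_mem (f.map_deg h), fun m => by
    rw [LinearMap.lTensor_neg, LinearMap.neg_apply, LinearMap.neg_apply, map_neg, f.map_coact]⟩⟩

instance : Sub (Hom M N) := ⟨fun f g => ⟨f.toLin - g.toLin,
  fun h => sub_mem (f.map_deg h) (g.map_deg h), fun m => by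
    rw [LinearMap.lTensor_sub, LinearMap.sub_apply, LinearMap.sub_apply, map_sub, f.map_coact,
      g.map_coact]⟩⟩

instance : SMul ℕ (Hom M N) := ⟨fun n f => ⟨n • f.toLin, fun h => nsmul_mem (f.map_deg h) n,
  fun m => by
    have : (n • f.toLin).lTensor (BPBP p) = n • f.toLin.lTensor (BPBP p) :=
      map_nsmul (LinearMap.lTensorHom (R := BP p) (BPBP p)) n f.toLin
    rw [this, LinearMap.smul_apply, LinearMap.smul_apply, map_nsmul, f.map_coact]⟩⟩

instance : SMul ℤ (Hom M N) := ⟨fun n f => ⟨n • f.toLin, fun h => zsmul_mem (f.map_deg h) n,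
  fun m => by
    have : (n • f.toLin).lTensor (BPBP p) = n • f.toLin.lTensor (BPBP p) :=
      map_zsmul (LinearMap.lTensorHom (R := BP p) (BPBP p)) n f.toLin
    rw [this, LinearMap.smul_apply, LinearMap.smul_apply, map_zsmul, f.map_coact]⟩⟩

theorem toLin_injective : Function.Injective (Hom.toLin : Hom M N → _) := fun _ _ h => Hom.ext h

instance : AddCommGroup (Hom M N) := toLin_injective.addCommGroup _ rfl (fun _ _ => rfl)
  (fun _ => rfl) (fun _ _ => rfl) (fun _ _ => rfl) fun _ _ => rfl

end

instance : Preadditive (Comod p) where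
  homGroup M N := inferInstanceAs (AddCommGroup (Hom M N))
  add_comp _ _ _ _ _ h := hom_ext fun _ => map_add h.toLin _ _
  comp_add _ _ _ _ _ _ := rfl

@[simp] theorem zero_toLin : Hom.toLin (0 : M ⟶ N) = 0 := rfl

@[simp] theorem sub_toLin (f g : M ⟶ N) : Hom.toLin (f - g) = f.toLin - g.toLin := rfl

end Comod

end Comodules

section Tensor

variable {p : ℕ} [hp : Fact p.Prime]
variable {M N : Type*} [AddCommGroup M] [Module (BP p) M] [AddCommGroup N] [Module (BP p) N]

/-- The coefficient of `t ^ e` in an element of `M ⊗ Γ`. -/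
def tcoeff (e : ℕ →₀ ℕ) : BPBP p ⊗[BP p] M →ₗ[BP p] M :=
  (TensorProduct.lid (BP p) M).toLinearMap ∘ₗ (MvPolynomial.lcoeff (BP p) e).rTensor M

theorem tcoeff_tmul (e : ℕ →₀ ℕ) (g : BPBP p) (m : M) :
    tcoeff e (g ⊗ₜ[BP p] m) = MvPolynomial.coeff e g • m := by
  simp [tcoeff]

theorem tcoeff_lTensor (f : M →ₗ[BP p] N) (e : ℕ →₀ ℕ) (z : BPBP p ⊗[BP p] M) :
    tcoeff e (f.lTensor (BPBP p) z) = f (tcoeff e z) := by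
  induction z using TensorProduct.induction_on with
  | zero => simp
  | tmul g m => simp [tcoeff_tmul]
  | add x y hx hy => rw [map_add, map_add, hx, hy, map_add, map_add]

theorem eq_sum_tcoeff (z : BPBP p ⊗[BP p] M) : ∃ s : Finset (ℕ →₀ ℕ),
    z = ∑ e ∈ s, (MvPolynomial.monomial e (1 : BP p)) ⊗ₜ[BP p] tcoeff e z := by
  classical
  suffices h : ∃ s : Finset (ℕ →₀ ℕ), ∀ s', s ⊆ s' →
      z = ∑ e ∈ s', (MvPolynomial.monomial e (1 : BP p)) ⊗ₜ[BP p] tcoeff e z by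
    obtain ⟨s, hs⟩ := h
    exact ⟨s, hs s subset_rfl⟩
  induction z using TensorProduct.induction_on with
  | zero => exact ⟨∅, fun s' _ => by simp⟩
  | tmul g m =>
    refine ⟨g.support, fun s' hs' => ?_⟩
    conv_lhs => rw [MvPolynomial.as_sum g, TensorProduct.sum_tmul]
    refine Finset.sum_subset_zero_on_sdiff hs' (fun e he => ?_) (fun e _ => ?_)
    · rw [Finset.mem_sdiff, MvPolynomial.notMem_support_iff] at he
      rw [tcoeff_tmul, he.2, zero_smul, TensorProduct.tmul_zero]
    · rw [tcoeff_tmul, TensorProduct.tmul_smul, TensorProduct.smul_tmul', MvPolynomial.smul_monomial,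
        smul_eq_mul, mul_one]
  | add x y hx hy =>
    obtain ⟨s, hs⟩ := hx
    obtain ⟨t, ht⟩ := hy
    refine ⟨s ∪ t, fun s' hs' => ?_⟩
    conv_lhs => rw [hs s' (Finset.union_subset_left hs'), ht s' (Finset.union_subset_right hs')]
    rw [← Finset.sum_add_distrib]
    refine Finset.sum_congr rfl fun e _ => ?_
    rw [map_add, TensorProduct.tmul_add]

theorem mem_tensorDeg_iff {deg : ℤ → AddSubgroup M}
    (hsmul : ∀ {i j : ℤ} {a : BP p} {m : M}, a ∈ BPdeg p i → m ∈ deg j → a • m ∈ deg (i + j))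
    {d : ℤ} {z : BPBP p ⊗[BP p] M} :
    z ∈ tensorDeg deg d ↔ ∀ e, tcoeff e z ∈ deg (d - Finsupp.weight (genDeg p) e) := by
  classical
  constructor
  · intro hz e
    induction hz using AddSubgroup.closure_induction with
    | mem z hz =>
      obtain ⟨i, j, rfl, g, hg, m, hm, rfl⟩ := hz
      rw [tcoeff_tmul]
      convert hsmul (hg e) hm using 2
      ring
    | zero => rw [map_zero]; exact zero_mem _
    | add x y _ _ hx hy => rw [map_add]; exact add_mem hx hy
    | neg x _ hx => rw [map_neg]; exact neg_mem hx
  · intro h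
    obtain ⟨s, hs⟩ := eq_sum_tcoeff z
    rw [hs]
    refine sum_mem fun e _ => AddSubgroup.subset_closure
      ⟨Finsupp.weight (genDeg p) e, _, by ring, _, fun e' => ?_, _, h e, rfl⟩
    rw [MvPolynomial.coeff_monomial]
    split_ifs with he
    · subst he
      rw [sub_self]
      exact BPdeg_one p
    · exact zero_mem _

theorem lTensor_inj {f : M →ₗ[BP p] N} (hf : Function.Injective f) :
    Function.Injective (f.lTensor (BPBP p)) :=
  Module.Flat.lTensor_preserves_injective_linearMap f hf

theorem lTensor_inj2 {f : M →ₗ[BP p] N} (hf : Function.Injective f) :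
    Function.Injective (f.lTensor (BPBP2 p)) :=
  Module.Flat.lTensor_preserves_injective_linearMap f hf

theorem lTensor_smul (f : M →ₗ[BP p] N) (g : BPBP p) (z : BPBP p ⊗[BP p] M) :
    f.lTensor (BPBP p) (g • z) = g • f.lTensor (BPBP p) z := by
  induction z using TensorProduct.induction_on with
  | zero => simp
  | tmul a m => simp [TensorProduct.smul_tmul']
  | add x y hx hy => rw [smul_add, map_add, hx, hy, map_add, smul_add]

theorem lTensor_smul2 (f : M →ₗ[BP p] N) (g : BPBP2 p) (z : BPBP2 p ⊗[BP p] M) :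
    f.lTensor (BPBP2 p) (g • z) = g • f.lTensor (BPBP2 p) z := by
  induction z using TensorProduct.induction_on with
  | zero => simp
  | tmul a m => simp [TensorProduct.smul_tmul']
  | add x y hx hy => rw [smul_add, map_add, hx, hy, map_add, smul_add]

theorem counit_nat (f : M →ₗ[BP p] N) (z : BPBP p ⊗[BP p] M) :
    TensorProduct.lid (BP p) N ((counit p).toLinearMap.rTensor N (f.lTensor (BPBP p) z)) =
      f (TensorProduct.lid (BP p) M ((counit p).toLinearMap.rTensor M z)) := by
  induction z using TensorProduct.induction_on with
  | zero => simp
  | tmul a m => simp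
  | add x y hx hy => simp only [map_add, hx, hy]

theorem rTensor_nat (h : BPBP p →ₗ[BP p] BPBP2 p) (f : M →ₗ[BP p] N) (z : BPBP p ⊗[BP p] M) :
    h.rTensor N (f.lTensor (BPBP p) z) = f.lTensor (BPBP2 p) (h.rTensor M z) := by
  rw [← LinearMap.comp_apply, ← LinearMap.comp_apply, LinearMap.rTensor_comp_lTensor,
    LinearMap.lTensor_comp_rTensor]

theorem coactTensor_nat {ψ : M →ₛₗ[etaR p] BPBP p ⊗[BP p] M}
    {ψ' : N →ₛₗ[etaR p] BPBP p ⊗[BP p] N} (f : M →ₗ[BP p] N)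
    (hf : ∀ m, ψ' (f m) = f.lTensor (BPBP p) (ψ m)) (z : BPBP p ⊗[BP p] M) :
    coactTensor ψ' (f.lTensor (BPBP p) z) = f.lTensor (BPBP2 p) (coactTensor ψ z) := by
  induction z using TensorProduct.induction_on with
  | zero => simp
  | tmul g m =>
    rw [LinearMap.lTensor_tmul, coactTensor_tmul, coactTensor_tmul, hf, rTensor_nat, lTensor_smul2]
  | add x y hx hy => simp only [map_add, hx, hy]

theorem tensorDeg_nat {deg : ℤ → AddSubgroup M} {deg' : ℤ → AddSubgroup N} (f : M →ₗ[BP p] N)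
    (hf : ∀ {d : ℤ} {m : M}, m ∈ deg d → f m ∈ deg' d) {d : ℤ} {z : BPBP p ⊗[BP p] M}
    (hz : z ∈ tensorDeg deg d) : f.lTensor (BPBP p) z ∈ tensorDeg deg' d := by
  induction hz using AddSubgroup.closure_induction with
  | mem z hz =>
    obtain ⟨i, j, rfl, g, hg, m, hm, rfl⟩ := hz
    exact AddSubgroup.subset_closure ⟨i, j, rfl, g, hg, f m, hf hm, rfl⟩
  | zero => rw [map_zero]; exact zero_mem _
  | add x y _ _ hx hy => rw [map_add]; exact add_mem hx hy
  | neg x _ hx => rw [map_neg]; exact neg_mem hx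

end Tensor

namespace Comod

variable {p : ℕ} [hp : Fact p.Prime] {M N P : Comod p}

theorem hom_gproj (f : M ⟶ N) (d : ℤ) (x : M.carrier) :
    f.toLin (gproj M.isInternal d x) = gproj N.isInternal d (f.toLin x) := by
  refine graded_induction (P := fun x => f.toLin (gproj M.isInternal d x) =
    gproj N.isInternal d (f.toLin x)) M.isInternal x ?_ (fun x y hx hy => ?_) fun e x hx => ?_
  · simp only [map_zero]
  · simp only [map_add, hx, hy]
  · rw [gproj_of_mem _ hx, gproj_of_mem _ (f.map_deg hx)]
    split_ifs <;> simp

theorem mem_deg_of_injective (f : M ⟶ N) (hf : Function.Injective f.toLin) {d : ℤ}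
    {x : M.carrier} (hx : f.toLin x ∈ N.deg d) : x ∈ M.deg d := by
  have : gproj M.isInternal d x = x := by
    apply hf
    rw [hom_gproj, gproj_of_mem _ hx, if_pos rfl]
  rw [← this]
  exact gproj_mem _ _ _

/-- A homomorphism with image in the image of an injective homomorphism lifts. -/
def liftOfInjective (f : M ⟶ N) (hf : Function.Injective f.toLin) (g : P ⟶ N)
    (h : ∀ x, g.toLin x ∈ LinearMap.range f.toLin) : P ⟶ M where
  toLin := (LinearEquiv.ofInjective f.toLin hf).symm.toLinearMap ∘ₗ g.toLin.codRestrict _ h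
  map_deg {d x} hx := by
    apply mem_deg_of_injective f hf
    have : f.toLin ((LinearEquiv.ofInjective f.toLin hf).symm (g.toLin.codRestrict _ h x)) =
        g.toLin x := LinearEquiv.ofInjective_symm_apply (f := f.toLin) (h := hf) _
    simp only [LinearMap.comp_apply, LinearEquiv.coe_coe, this]
    exact g.map_deg hx
  map_coact x := by
    have h1 : f.toLin ∘ₗ ((LinearEquiv.ofInjective f.toLin hf).symm.toLinearMap ∘ₗ
        g.toLin.codRestrict _ h) = g.toLin :=
      LinearMap.ext fun x => LinearEquiv.ofInjective_symm_apply (f := f.toLin) (h := hf) _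
    apply lTensor_inj hf
    rw [← f.map_coact, ← LinearMap.lTensor_comp_apply, h1, ← g.map_coact]
    exact congrArg N.coact (LinearMap.congr_fun h1 x)

theorem liftOfInjective_comp (f : M ⟶ N) (hf : Function.Injective f.toLin) (g : P ⟶ N)
    (h : ∀ x, g.toLin x ∈ LinearMap.range f.toLin) : liftOfInjective f hf g h ≫ f = g :=
  hom_ext fun x => LinearEquiv.ofInjective_symm_apply (f := f.toLin) (h := hf) ⟨g.toLin x, h x⟩

/-- A homomorphism killing the kernel of a surjective homomorphism descends. -/
def descOfSurjective (f : M ⟶ N) (hf : Function.Surjective f.toLin) (g : M ⟶ P)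
    (h : LinearMap.ker f.toLin ≤ LinearMap.ker g.toLin) : N ⟶ P :=
  have key : ∀ m, (((LinearMap.ker f.toLin).liftQ g.toLin h) ∘ₗ
      (f.toLin.quotKerEquivOfSurjective hf).symm.toLinearMap) (f.toLin m) = g.toLin m := fun m => by
    have : (f.toLin.quotKerEquivOfSurjective hf).symm (f.toLin m) =
        Submodule.Quotient.mk m := by
      rw [LinearEquiv.symm_apply_eq]; rfl
    simp only [LinearMap.comp_apply, LinearEquiv.coe_coe, this]
    rfl
  { toLin := ((LinearMap.ker f.toLin).liftQ g.toLin h) ∘ₗ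
      (f.toLin.quotKerEquivOfSurjective hf).symm.toLinearMap
    map_deg := fun {d x} hx => by
      obtain ⟨m, rfl⟩ := hf x
      have : f.toLin m = f.toLin (gproj M.isInternal d m) := by
        rw [hom_gproj, gproj_of_mem _ hx, if_pos rfl]
      rw [this, key]
      exact g.map_deg (gproj_mem _ _ _)
    map_coact := fun x => by
      obtain ⟨m, rfl⟩ := hf x
      rw [key, f.map_coact, g.map_coact, ← LinearMap.lTensor_comp_apply]
      congr 2
      exact (LinearMap.ext key).symm }

theorem comp_descOfSurjective (f : M ⟶ N) (hf : Function.Surjective f.toLin) (g : M ⟶ P)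
    (h : LinearMap.ker f.toLin ≤ LinearMap.ker g.toLin) : f ≫ descOfSurjective f hf g h = g := by
  refine hom_ext fun m => ?_
  have : (f.toLin.quotKerEquivOfSurjective hf).symm (f.toLin m) =
      Submodule.Quotient.mk m := by
    rw [LinearEquiv.symm_apply_eq]; rfl
  change (LinearMap.ker f.toLin).liftQ g.toLin h
    ((f.toLin.quotKerEquivOfSurjective hf).symm (f.toLin m)) = _
  rw [this]
  rfl

/-- The quotient of a comodule by a graded submodule stable under the coaction. -/
def quot (M : Comod p) (K : Submodule (BP p) M.carrier)
    (hgr : ∀ x ∈ K, ∀ d, gproj M.isInternal d x ∈ K)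
    (hco : ∀ x ∈ K, K.mkQ.lTensor (BPBP p) (M.coact x) = 0) : Comod p where
  carrier := M.carrier ⧸ K
  deg d := (M.deg d).map K.mkQ.toAddMonoidHom
  isInternal := by
    refine isInternal_of_proj (fun d => QuotientAddGroup.map K.toAddSubgroup K.toAddSubgroup
      (gproj M.isInternal d) fun x hx => hgr x hx d) ?_ fun x => ?_
    · rintro d _ ⟨x, hx, rfl⟩ e
      change K.mkQ (gproj M.isInternal e x) = if d = e then K.mkQ x else 0
      rw [gproj_of_mem _ hx]
      split_ifs
      · rfl
      · exact map_zero _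
    · obtain ⟨x, rfl⟩ := K.mkQ_surjective x
      refine graded_induction (P := fun x => K.mkQ x ∈ AddMonoidHom.range _) M.isInternal x ?_ (fun x y hx hy => ?_) fun d x hx => ?_
      · rw [map_zero]; exact zero_mem _
      · rw [map_add]; exact add_mem hx hy
      · exact ⟨DirectSum.of (fun d => (M.deg d).map K.mkQ.toAddMonoidHom) d ⟨_, x, hx, rfl⟩,
          DirectSum.coeAddMonoidHom_of _ _ _⟩
  smul_mem := by
    rintro i j a _ ha ⟨m, hm, rfl⟩
    exact ⟨a • m, M.smul_mem ha hm, map_smul K.mkQ a m⟩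
  coact := K.liftQ
    { toFun := fun m => K.mkQ.lTensor (BPBP p) (M.coact m)
      map_add' := fun x y => by rw [map_add, map_add]
      map_smul' := fun a x => by rw [LinearMap.map_smulₛₗ, lTensor_smul] } hco
  coact_mem := by
    rintro d _ ⟨m, hm, rfl⟩
    exact tensorDeg_nat (deg' := fun d => (M.deg d).map K.mkQ.toAddMonoidHom) K.mkQ
      (fun {d m} hm => ⟨m, hm, rfl⟩) (M.coact_mem hm)
  counit_coact x := by
    obtain ⟨m, rfl⟩ := K.mkQ_surjective x
    refine (counit_nat K.mkQ (M.coact m)).trans ?_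
    rw [M.counit_coact]
  coassoc x := by
    obtain ⟨m, rfl⟩ := K.mkQ_surjective x
    refine (rTensor_nat _ K.mkQ (M.coact m)).trans ?_
    rw [M.coassoc]
    exact (coactTensor_nat K.mkQ (fun m => rfl) _).symm

/-- The projection to a quotient comodule. -/
def quotπ (M : Comod p) (K : Submodule (BP p) M.carrier)
    (hgr : ∀ x ∈ K, ∀ d, gproj M.isInternal d x ∈ K)
    (hco : ∀ x ∈ K, K.mkQ.lTensor (BPBP p) (M.coact x) = 0) : M ⟶ M.quot K hgr hco where
  toLin := K.mkQ
  map_deg hm := ⟨_, hm, rfl⟩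
  map_coact _ := rfl

/-- The subcomodule given by a graded submodule stable under the coaction. -/
def sub (M : Comod p) (K : Submodule (BP p) M.carrier)
    (hgr : ∀ x ∈ K, ∀ d, gproj M.isInternal d x ∈ K)
    (hco : ∀ x ∈ K, M.coact x ∈ LinearMap.range (K.subtype.lTensor (BPBP p))) : Comod p :=
  have hinj := lTensor_inj (p := p) K.injective_subtype
  have hinj2 := lTensor_inj2 (p := p) K.injective_subtype
  let ψ : K →ₛₗ[etaR p] BPBP p ⊗[BP p] K :=
    { toFun := fun x => (hco x x.2).choose
      map_add' := fun x y => hinj (by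
        rw [map_add, (hco _ (x + y).2).choose_spec, (hco _ x.2).choose_spec,
          (hco _ y.2).choose_spec, ← map_add]; rfl)
      map_smul' := fun a x => hinj (by
        rw [lTensor_smul, (hco _ (a • x).2).choose_spec, (hco _ x.2).choose_spec,
          ← LinearMap.map_smulₛₗ]; rfl) }
  have hψ : ∀ x : K, M.coact x = K.subtype.lTensor (BPBP p) (ψ x) := fun x =>
    (hco x x.2).choose_spec.symm
  { carrier := K
    deg := fun d => (M.deg d).comap K.subtype.toAddMonoidHom
    isInternal := by
      refine isInternal_of_proj (fun d => ((gproj M.isInternal d).comp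
        K.subtype.toAddMonoidHom).codRestrict K fun x => hgr x x.2 d) ?_ fun x => ?_
      · intro d x hx e
        apply Subtype.ext
        change gproj M.isInternal e x = _
        rw [gproj_of_mem _ (show (x : M.carrier) ∈ M.deg d from hx)]
        split_ifs <;> rfl
      · classical
        obtain ⟨z, hz⟩ := M.isInternal.2 x
        have hzK : ∀ d, (z d : M.carrier) ∈ K := fun d => by
          rw [← gproj_coe M.isInternal, hz]
          exact hgr x x.2 d
        have hx : x = ∑ d ∈ DFinsupp.support z, (⟨z d, hzK d⟩ : K) := by
          apply K.injective_subtype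
          rw [map_sum, Submodule.subtype_apply, ← hz, DirectSum.coeAddMonoidHom_eq_dfinsuppSum]
          rfl
        rw [hx]
        refine sum_mem fun d _ => ⟨DirectSum.of _ d ⟨⟨z d, hzK d⟩, (z d).2⟩, ?_⟩
        exact DirectSum.coeAddMonoidHom_of _ _ _
    smul_mem := fun ha hm => M.smul_mem ha hm
    coact := ψ
    coact_mem := fun {d m} hm => by
      refine (mem_tensorDeg_iff (deg := fun d => (M.deg d).comap K.subtype.toAddMonoidHom)
        fun ha hm => M.smul_mem ha hm).2 fun e => ?_
      have := (mem_tensorDeg_iff M.smul_mem).1 (M.coact_mem hm) e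
      change K.subtype _ ∈ M.deg _
      rw [← tcoeff_lTensor K.subtype e, ← hψ]
      exact this
    counit_coact := fun x => by
      apply K.injective_subtype
      rw [← counit_nat, ← hψ]
      exact M.counit_coact x
    coassoc := fun x => by
      apply hinj2
      rw [← rTensor_nat, ← coactTensor_nat K.subtype hψ, ← hψ]
      exact M.coassoc x }

end Comod

namespace Comod

variable {p : ℕ} [hp : Fact p.Prime] {M N P : Comod p}

/-- The inclusion of a subcomodule. -/
def subι (M : Comod p) (K : Submodule (BP p) M.carrier)
    (hgr : ∀ x ∈ K, ∀ d, gproj M.isInternal d x ∈ K)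
    (hco : ∀ x ∈ K, M.coact x ∈ LinearMap.range (K.subtype.lTensor (BPBP p))) :
    M.sub K hgr hco ⟶ M where
  toLin := K.subtype
  map_deg hm := hm
  map_coact := fun (x : K) => (hco x x.2).choose_spec.symm

theorem ker_gproj (f : M ⟶ N) (x : M.carrier) (hx : x ∈ LinearMap.ker f.toLin) (d : ℤ) :
    gproj M.isInternal d x ∈ LinearMap.ker f.toLin := by
  rw [LinearMap.mem_ker] at hx ⊢
  rw [hom_gproj, hx, map_zero]

theorem ker_coact (f : M ⟶ N) (x : M.carrier) (hx : x ∈ LinearMap.ker f.toLin) :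
    M.coact x ∈ LinearMap.range ((LinearMap.ker f.toLin).subtype.lTensor (BPBP p)) := by
  have hex := Module.Flat.lTensor_exact (BPBP p) (LinearMap.exact_subtype_ker_map f.toLin)
  refine (hex _).1 ?_
  rw [LinearMap.mem_ker] at hx
  rw [← f.map_coact, hx, map_zero]

/-- The kernel of a homomorphism. -/
def ker (f : M ⟶ N) : Comod p := M.sub (LinearMap.ker f.toLin) (ker_gproj f) (ker_coact f)

/-- The inclusion of the kernel. -/
def kerι (f : M ⟶ N) : ker f ⟶ M := subι _ _ _ _

theorem kerι_injective (f : M ⟶ N) : Function.Injective (kerι f).toLin :=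
  Subtype.val_injective

theorem kerι_comp (f : M ⟶ N) : kerι f ≫ f = 0 := hom_ext fun x => x.2

theorem mem_range_kerι (f : M ⟶ N) {x : M.carrier} (hx : f.toLin x = 0) :
    x ∈ LinearMap.range (kerι f).toLin := ⟨⟨x, hx⟩, rfl⟩

theorem range_gproj (f : M ⟶ N) (x : N.carrier) (hx : x ∈ LinearMap.range f.toLin) (d : ℤ) :
    gproj N.isInternal d x ∈ LinearMap.range f.toLin := by
  obtain ⟨y, rfl⟩ := hx
  exact ⟨_, hom_gproj f d y⟩

theorem range_coact (f : M ⟶ N) (x : N.carrier) (hx : x ∈ LinearMap.range f.toLin) :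
    (LinearMap.range f.toLin).mkQ.lTensor (BPBP p) (N.coact x) = 0 := by
  obtain ⟨y, rfl⟩ := hx
  have : (LinearMap.range f.toLin).mkQ ∘ₗ f.toLin = 0 := LinearMap.range_mkQ_comp f.toLin
  rw [f.map_coact, ← LinearMap.lTensor_comp_apply, this, LinearMap.lTensor_zero,
    LinearMap.zero_apply]

/-- The cokernel of a homomorphism. -/
def coker (f : M ⟶ N) : Comod p := N.quot (LinearMap.range f.toLin) (range_gproj f) (range_coact f)

/-- The projection to the cokernel. -/
def cokerπ (f : M ⟶ N) : N ⟶ coker f := quotπ _ _ _ _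

theorem cokerπ_surjective (f : M ⟶ N) : Function.Surjective (cokerπ f).toLin :=
  Submodule.mkQ_surjective _

theorem ker_cokerπ (f : M ⟶ N) : LinearMap.ker (cokerπ f).toLin = LinearMap.range f.toLin :=
  Submodule.ker_mkQ _

theorem comp_cokerπ (f : M ⟶ N) : f ≫ cokerπ f = 0 := hom_ext fun x => by
  have : f.toLin x ∈ LinearMap.ker (cokerπ f).toLin := by
    rw [ker_cokerπ]; exact ⟨x, rfl⟩
  exact this

theorem mono_of_injective (f : M ⟶ N) (hf : Function.Injective f.toLin) : Mono f :=
  ⟨fun _ _ e => hom_ext fun x => hf (LinearMap.congr_fun (congrArg Hom.toLin e) x)⟩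

theorem epi_of_surjective (f : M ⟶ N) (hf : Function.Surjective f.toLin) : Epi f :=
  ⟨fun _ _ e => hom_ext fun x => by
    obtain ⟨y, rfl⟩ := hf x
    exact LinearMap.congr_fun (congrArg Hom.toLin e) y⟩

theorem injective_of_mono (f : M ⟶ N) [Mono f] : Function.Injective f.toLin := by
  have h : kerι f = 0 := by
    rw [← cancel_mono f, kerι_comp, zero_comp]
  refine (injective_iff_map_eq_zero _).2 fun x hx => ?_
  exact LinearMap.congr_fun (congrArg Hom.toLin h) (⟨x, hx⟩ : LinearMap.ker f.toLin)

theorem surjective_of_epi (f : M ⟶ N) [Epi f] : Function.Surjective f.toLin := by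
  have h : cokerπ f = 0 := by
    rw [← cancel_epi f, comp_cokerπ, comp_zero]
  intro x
  have hx : x ∈ LinearMap.ker (cokerπ f).toLin := by
    rw [h]; rfl
  rwa [ker_cokerπ] at hx

/-- An injective homomorphism is a kernel of any homomorphism with which it is exact. -/
def isLimitOfExact (f : M ⟶ N) (g : N ⟶ P) (w : f ≫ g = 0) (hf : Function.Injective f.toLin)
    (h : LinearMap.ker g.toLin ≤ LinearMap.range f.toLin) : IsLimit (KernelFork.ofι f w) :=
  haveI := mono_of_injective f hf
  KernelFork.IsLimit.ofι' f w fun k hk =>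
    ⟨liftOfInjective f hf k fun x => h (LinearMap.congr_fun (congrArg Hom.toLin hk) x),
      liftOfInjective_comp _ _ _ _⟩

/-- A surjective homomorphism is a cokernel of any homomorphism with which it is exact. -/
def isColimitOfExact (f : M ⟶ N) (g : N ⟶ P) (w : f ≫ g = 0) (hg : Function.Surjective g.toLin)
    (h : LinearMap.ker g.toLin ≤ LinearMap.range f.toLin) : IsColimit (CokernelCofork.ofπ g w) :=
  haveI := epi_of_surjective g hg
  CokernelCofork.IsColimit.ofπ' g w fun k hk =>
    ⟨descOfSurjective g hg k (h.trans (by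
      rintro _ ⟨x, rfl⟩
      exact LinearMap.congr_fun (congrArg Hom.toLin hk) x)), comp_descOfSurjective _ _ _ _⟩

instance : HasKernels (Comod p) where
  has_limit f := ⟨⟨⟨_, isLimitOfExact (kerι f) f (kerι_comp f) (kerι_injective f)
    fun _ hx => mem_range_kerι f hx⟩⟩⟩

instance : HasCokernels (Comod p) where
  has_colimit f := ⟨⟨⟨_, isColimitOfExact f (cokerπ f) (comp_cokerπ f) (cokerπ_surjective f)
    (ker_cokerπ f).le⟩⟩⟩

instance : IsNormalMonoCategory (Comod p) where
  normalMonoOfMono f _ := ⟨⟨_, cokerπ f, comp_cokerπ f,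
    isLimitOfExact f (cokerπ f) (comp_cokerπ f) (injective_of_mono f) (ker_cokerπ f).le⟩⟩

instance : IsNormalEpiCategory (Comod p) where
  normalEpiOfEpi f _ := ⟨⟨_, kerι f, kerι_comp f,
    isColimitOfExact (kerι f) f (kerι_comp f) (surjective_of_epi f)
      fun _ hx => mem_range_kerι f hx⟩⟩

variable (p) in
/-- The zero comodule. -/
def zero : Comod p where
  carrier := PUnit
  deg _ := ⊤
  isInternal := isInternal_of_proj (fun _ => 0) (fun _ _ _ _ => rfl) fun _ => zero_mem _
  smul_mem _ _ := trivial
  coact := 0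
  coact_mem _ := zero_mem _
  counit_coact _ := rfl
  coassoc _ := by simp

instance : HasZeroObject (Comod p) := ⟨zero p, by
  rw [IsZero.iff_id_eq_zero]
  rfl⟩

section Prod

variable (M N)

/-- The direct sum of two comodules. -/
def prod : Comod p where
  carrier := M.carrier × N.carrier
  deg d := (M.deg d).prod (N.deg d)
  isInternal := by
    refine isInternal_of_proj
      (fun d => (gproj M.isInternal d).prodMap (gproj N.isInternal d)) ?_ ?_
    · rintro d ⟨x, y⟩ ⟨hx, hy⟩ e
      refine Prod.ext ((gproj_of_mem M.isInternal hx e).trans ?_)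
        ((gproj_of_mem N.isInternal hy e).trans ?_) <;> split_ifs <;> rfl
    · rintro ⟨x, y⟩
      have hx : ((x, 0) : M.carrier × N.carrier) ∈
          (DirectSum.coeAddMonoidHom fun d => (M.deg d).prod (N.deg d)).range := by
        refine graded_induction (P := fun x => ((x, 0) : M.carrier × N.carrier) ∈
          AddMonoidHom.range _) M.isInternal x (zero_mem _) (fun x y hx hy => ?_)
          fun d x hx => ?_
        · simpa using add_mem hx hy
        · exact ⟨DirectSum.of (fun d => (M.deg d).prod (N.deg d)) d ⟨(x, 0), hx, zero_mem _⟩,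
            DirectSum.coeAddMonoidHom_of _ _ _⟩
      have hy : ((0, y) : M.carrier × N.carrier) ∈
          (DirectSum.coeAddMonoidHom fun d => (M.deg d).prod (N.deg d)).range := by
        refine graded_induction (P := fun y => ((0, y) : M.carrier × N.carrier) ∈
          AddMonoidHom.range _) N.isInternal y (zero_mem _) (fun x y hx hy => ?_)
          fun d x hx => ?_
        · simpa using add_mem hx hy
        · exact ⟨DirectSum.of (fun d => (M.deg d).prod (N.deg d)) d ⟨(0, x), zero_mem _, hx⟩,
            DirectSum.coeAddMonoidHom_of _ _ _⟩
      simpa using add_mem hx hy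
  smul_mem ha hm := ⟨M.smul_mem ha hm.1, N.smul_mem ha hm.2⟩
  coact :=
    { toFun := fun x => (LinearMap.inl (BP p) M.carrier N.carrier).lTensor (BPBP p) (M.coact x.1) +
        (LinearMap.inr (BP p) M.carrier N.carrier).lTensor (BPBP p) (N.coact x.2)
      map_add' := fun x y => by
        rw [Prod.fst_add, Prod.snd_add, map_add, map_add, map_add, map_add]
        abel
      map_smul' := fun a x => by
        rw [Prod.smul_fst, Prod.smul_snd, LinearMap.map_smulₛₗ, LinearMap.map_smulₛₗ,
          lTensor_smul, lTensor_smul, smul_add] }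
  coact_mem {d m} hm := by
    refine add_mem (tensorDeg_nat (deg' := fun d => (M.deg d).prod (N.deg d)) _
      (fun {d m} hm => ?_) (M.coact_mem hm.1))
      (tensorDeg_nat (deg' := fun d => (M.deg d).prod (N.deg d)) _
      (fun {d m} hm => ?_) (N.coact_mem hm.2))
    · exact ⟨hm, zero_mem _⟩
    · exact ⟨zero_mem _, hm⟩
  counit_coact x := by
    change TensorProduct.lid _ _ (LinearMap.rTensor _ _ (_ + _)) = x
    rw [map_add, map_add, counit_nat, counit_nat, M.counit_coact, N.counit_coact]
    simp
  coassoc x := by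
    change LinearMap.rTensor _ _ (_ + _) = coactTensor _ (_ + _)
    rw [map_add, map_add, rTensor_nat, rTensor_nat, M.coassoc, N.coassoc]
    refine congrArg₂ _ (coactTensor_nat _ (fun m => ?_) _).symm
      (coactTensor_nat _ (fun m => ?_) _).symm
    · change LinearMap.lTensor _ _ _ + LinearMap.lTensor _ _ (N.coact 0) = _
      rw [map_zero, map_zero, add_zero]
      rfl
    · change LinearMap.lTensor _ _ (M.coact 0) + LinearMap.lTensor _ _ _ = _
      rw [map_zero, map_zero, zero_add]
      rfl

theorem lTensor_fst {A B : Type*} [AddCommGroup A] [AddCommGroup B] [Module (BP p) A]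
    [Module (BP p) B] (x : BPBP p ⊗[BP p] A) (y : BPBP p ⊗[BP p] B) :
    (LinearMap.fst (BP p) A B).lTensor (BPBP p) ((LinearMap.inl (BP p) A B).lTensor (BPBP p) x +
      (LinearMap.inr (BP p) A B).lTensor (BPBP p) y) = x := by
  rw [map_add, ← LinearMap.lTensor_comp_apply, ← LinearMap.lTensor_comp_apply,
    LinearMap.fst_comp_inl, LinearMap.fst_comp_inr]
  simp

theorem lTensor_snd {A B : Type*} [AddCommGroup A] [AddCommGroup B] [Module (BP p) A]
    [Module (BP p) B] (x : BPBP p ⊗[BP p] A) (y : BPBP p ⊗[BP p] B) :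
    (LinearMap.snd (BP p) A B).lTensor (BPBP p) ((LinearMap.inl (BP p) A B).lTensor (BPBP p) x +
      (LinearMap.inr (BP p) A B).lTensor (BPBP p) y) = y := by
  rw [map_add, ← LinearMap.lTensor_comp_apply, ← LinearMap.lTensor_comp_apply,
    LinearMap.snd_comp_inl, LinearMap.snd_comp_inr]
  simp

/-- The direct sum as a bicone. -/
def prodBicone : BinaryBicone M N where
  pt := prod M N
  fst :=
    { toLin := LinearMap.fst _ _ _
      map_deg := fun h => h.1
      map_coact := fun _ => (lTensor_fst _ _).symm }
  snd :=
    { toLin := LinearMap.snd _ _ _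
      map_deg := fun h => h.2
      map_coact := fun _ => (lTensor_snd _ _).symm }
  inl :=
    { toLin := LinearMap.inl _ _ _
      map_deg := fun h => ⟨h, zero_mem _⟩
      map_coact := fun x => by
        change LinearMap.lTensor _ _ _ + LinearMap.lTensor _ _ (N.coact 0) = _
        rw [map_zero, map_zero, add_zero]
        rfl }
  inr :=
    { toLin := LinearMap.inr _ _ _
      map_deg := fun h => ⟨zero_mem _, h⟩
      map_coact := fun x => by
        change LinearMap.lTensor _ _ (M.coact 0) + LinearMap.lTensor _ _ _ = _
        rw [map_zero, map_zero, zero_add]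
        rfl }
  inl_fst := rfl
  inl_snd := rfl
  inr_fst := rfl
  inr_snd := rfl

instance : HasBinaryBiproducts (Comod p) := ⟨fun M N => ⟨⟨prodBicone M N,
  isBinaryBilimitOfTotal _ (hom_ext fun _ => Prod.ext (add_zero _) (zero_add _))⟩⟩⟩

end Prod

instance : HasFiniteProducts (Comod p) := hasFiniteProducts_of_has_binary_and_terminal

instance : Abelian (Comod p) where

end Comod

section UnitComodule

variable (p : ℕ) [hp : Fact p.Prime]

theorem BPdeg_isInternal : DirectSum.IsInternal (BPdeg p) := by
  classical
  let _ := MvPolynomial.weightedGradedAlgebra (ZLoc p) (genDeg p)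
  exact DirectSum.Decomposition.isInternal
    (MvPolynomial.weightedHomogeneousSubmodule (ZLoc p) (genDeg p))

/-- The comodule `BP_*`, with coaction given by the right unit. -/
def unitComod : Comod p where
  carrier := BP p
  deg := BPdeg p
  isInternal := BPdeg_isInternal p
  smul_mem := BPdeg_mul p
  coact :=
    { toFun := fun a => etaR p a ⊗ₜ[BP p] (1 : BP p)
      map_add' := fun a b => by rw [map_add, TensorProduct.add_tmul]
      map_smul' := fun a b => by
        rw [smul_eq_mul, map_mul, TensorProduct.smul_tmul', smul_eq_mul] }
  coact_mem {d a} ha := AddSubgroup.subset_closure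
    ⟨d, 0, add_zero d, etaR p a, etaR_mem p ha, 1, BPdeg_one p, rfl⟩
  counit_coact a := by
    change counit p (etaR p a) • (1 : BP p) = a
    rw [counit_etaR, smul_eq_mul, mul_one]
  coassoc a := by
    change comul p (etaR p a) ⊗ₜ[BP p] (1 : BP p) =
      inr p (etaR p a) • (inl p (etaR p 1) ⊗ₜ[BP p] (1 : BP p))
    rw [comul_etaR, map_one, map_one, TensorProduct.smul_tmul', smul_eq_mul, mul_one]

theorem gproj_mul {e : ℤ} {a : BP p} (ha : a ∈ BPdeg p e) (d : ℤ) (x : BP p) :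
    gproj (BPdeg_isInternal p) d (a * x) = a * gproj (BPdeg_isInternal p) (d - e) x := by
  refine graded_induction (P := fun x => gproj (BPdeg_isInternal p) d (a * x) =
    a * gproj (BPdeg_isInternal p) (d - e) x) (BPdeg_isInternal p) x ?_
    (fun x y hx hy => ?_) fun i x hx => ?_
  · rw [mul_zero, map_zero, map_zero, mul_zero]
  · rw [mul_add, map_add, hx, hy, map_add, mul_add]
  · rw [gproj_of_mem _ (BPdeg_mul p ha hx), gproj_of_mem _ hx, mul_ite, mul_zero]
    congr 1
    exact propext ⟨fun h => by omega, fun h => by omega⟩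

theorem idealI_gproj (k : ℕ∞) (x : BP p) (hx : x ∈ idealI p k) : ∀ d : ℤ,
    gproj (BPdeg_isInternal p) d x ∈ idealI p k := by
  induction hx using Submodule.span_induction with
  | mem x hx =>
    obtain ⟨j, hj, rfl⟩ := hx
    obtain ⟨e, he⟩ := vGen_mem p j
    intro d
    rw [gproj_of_mem _ he]
    split_ifs
    · exact Ideal.subset_span ⟨j, hj, rfl⟩
    · exact zero_mem _
  | zero => intro d; rw [map_zero]; exact zero_mem _
  | add x y _ _ hx hy => intro d; rw [map_add]; exact add_mem (hx d) (hy d)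
  | smul a x _ hx =>
    intro d
    refine graded_induction (P := fun a => gproj (BPdeg_isInternal p) d (a * x) ∈ idealI p k)
      (BPdeg_isInternal p) a ?_ (fun a b ha hb => ?_) fun e a ha => ?_
    · rw [zero_mul, map_zero]; exact zero_mem _
    · rw [add_mul, map_add]; exact add_mem ha hb
    · rw [gproj_mul p ha]; exact Ideal.mul_mem_left _ _ (hx _)

theorem tmul_mk_eq_zero (I : Ideal (BP p)) {g : BPBP p}
    (hg : g ∈ I.map (MvPolynomial.C : BP p →+* BPBP p)) :
    g ⊗ₜ[BP p] (Submodule.mkQ I (1 : BP p)) = 0 := by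
  induction hg using Submodule.span_induction with
  | mem x hx =>
    obtain ⟨a, ha, rfl⟩ := hx
    have h1 : (MvPolynomial.C a : BPBP p) = a • 1 := by
      rw [MvPolynomial.smul_eq_C_mul, mul_one]
    have h2 : a • Submodule.mkQ I (1 : BP p) = 0 := by
      rw [← map_smul, smul_eq_mul, mul_one]
      exact (Submodule.Quotient.mk_eq_zero I).2 ha
    rw [h1, TensorProduct.smul_tmul, h2, TensorProduct.tmul_zero]
  | zero => rw [TensorProduct.zero_tmul]
  | add x y _ _ hx hy => rw [TensorProduct.add_tmul, hx, hy, add_zero]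
  | smul a x _ hx => rw [← TensorProduct.smul_tmul', hx, smul_zero]

theorem etaR_mem_map (k : ℕ∞) (x : BP p) (hx : x ∈ idealI p k) :
    etaR p x ∈ (idealI p k).map (MvPolynomial.C : BP p →+* BPBP p) := by
  induction hx using Submodule.span_induction with
  | mem x hx =>
    obtain ⟨j, hj, rfl⟩ := hx
    have h1 : idealI p j ≤ idealI p k := Ideal.span_mono fun x ⟨i, hi, hx⟩ => ⟨i, hi.trans hj, hx⟩
    have h2 := Ideal.map_mono (f := (MvPolynomial.C : BP p →+* BPBP p)) h1 (etaR_vGen p j)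
    have h3 : MvPolynomial.C (vGen p j) ∈ (idealI p k).map (MvPolynomial.C : BP p →+* BPBP p) :=
      Ideal.mem_map_of_mem _ (Ideal.subset_span ⟨j, hj, rfl⟩)
    simpa using add_mem h2 h3
  | zero => rw [map_zero]; exact zero_mem _
  | add x y _ _ hx hy => rw [map_add]; exact add_mem hx hy
  | smul a x _ hx => rw [smul_eq_mul, map_mul]; exact Ideal.mul_mem_left _ _ hx

/-- The comodule `BP_* / I_k`, for `k ≤ ∞`. -/
def BPmod (k : ℕ∞) : Comod p :=
  (unitComod p).quot (idealI p k) (idealI_gproj p k) fun x hx =>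
    tmul_mk_eq_zero p (idealI p k) (etaR_mem_map p k x hx)

/-- The projection from `BP_*` to `BP_* / I_k`. -/
def BPmodπ (k : ℕ∞) : unitComod p ⟶ BPmod p k := Comod.quotπ _ _ _ _

end UnitComodule

section Localization

variable (p : ℕ) [hp : Fact p.Prime]

/-- The functor sending a comodule to its underlying `BP_*`-module. -/
def forgetMod : Comod p ⥤ ModuleCat.{0} (BP p) where
  obj M := ModuleCat.of (BP p) M.carrier
  map f := ModuleCat.ofHom f.toLin

/-- A comodule is `v_n`-torsion if each of its elements is killed by a power of `v_n`. -/
def IsVTorsion (n : ℕ) (M : Comod p) : Prop :=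
  ∀ x : M.carrier, ∃ N : ℕ, vGen p n ^ N • x = 0

/-- The class of homomorphisms whose kernel and cokernel are `v_n`-torsion. -/
def torsionEquiv (n : ℕ) : MorphismProperty (Comod p) := fun _ _ f =>
  IsVTorsion p n (Comod.ker f) ∧ IsVTorsion p n (Comod.coker f)

/-- A localization functor `L_n` on comodules with respect to the torsion theory of `v_n`-torsion
comodules: for each `M`, a homomorphism `M ⟶ L_n M` with `v_n`-torsion kernel and cokernel to
an object that is local with respect to all such homomorphisms. -/
structure TorsionLocalization (n : ℕ) where
  functor : Comod p ⥤ Comod p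
  unit : 𝟭 (Comod p) ⟶ functor
  unit_mem : ∀ M, torsionEquiv p n (unit.app M)
  isLocal : ∀ M, (torsionEquiv p n).isLocal (functor.obj M)

instance {n : ℕ} (L : TorsionLocalization p n) : L.functor.Additive where
  map_add {M N f g} := by
    apply (L.isLocal N (L.unit.app M) (L.unit_mem M)).1
    change L.unit.app M ≫ L.functor.map (f + g) =
      L.unit.app M ≫ (L.functor.map f + L.functor.map g)
    rw [Preadditive.comp_add, ← L.unit.naturality, ← L.unit.naturality, ← L.unit.naturality]
    simp

variable {p} in
/-- The `i`-th right derived functor `L_n^i` of `L_n`. -/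
abbrev TorsionLocalization.derived [EnoughInjectives (Comod p)] {n : ℕ}
    (L : TorsionLocalization p n) (i : ℕ) : Comod p ⥤ Comod p := L.functor.rightDerived i

end Localization

section Cech

variable {A : Type} [CommRing A]

/-- The canonical map from `A[1/a]` to `A[1/b]`, if `a` divides `b`. -/
def awayMap {a b : A} (h : a ∣ b) : Localization.Away a →ₐ[A] Localization.Away b :=
  IsLocalization.Away.liftAlgHom (A := A) (f := Algebra.ofId A (Localization.Away b)) a
    (isUnit_of_dvd_unit (map_dvd (algebraMap A (Localization.Away b)) h)
      (IsLocalization.Away.algebraMap_isUnit b))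

theorem awayMap_awayMap {a b c : A} (h : a ∣ b) (h' : b ∣ c) (h'' : a ∣ c)
    (x : Localization.Away a) : awayMap h' (awayMap h x) = awayMap h'' x :=
  AlgHom.congr_fun (Subsingleton.elim
    (h := IsLocalization.algHom_subsingleton (Submonoid.powers a))
    ((awayMap h').comp (awayMap h)) (awayMap h'')) x

variable {m : ℕ} (v : Fin m → A)

/-- The product of the elements indexed by a `(k + 1)`-element set. -/
def cechElt {k : ℕ} (σ : Fin (k + 1) ↪o Fin m) : A := ∏ i, v (σ i)

/-- The module of `k`-cochains of the Čech complex of `A`: the sum of all localizations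
`A[1/v_S]` over the `(k + 1)`-element sets `S`, which are enumerated in increasing order. -/
abbrev CechCochain (k : ℕ) : Type := ∀ σ : Fin (k + 1) ↪o Fin m, Localization.Away (cechElt v σ)

/-- Omit the element with the given position. -/
def cechFace {k : ℕ} (i : Fin (k + 2)) (σ : Fin (k + 2) ↪o Fin m) : Fin (k + 1) ↪o Fin m :=
  (Fin.succAboveOrderEmb i).trans σ

theorem cechElt_face_dvd {k : ℕ} (i : Fin (k + 2)) (σ : Fin (k + 2) ↪o Fin m) :
    cechElt v (cechFace i σ) ∣ cechElt v σ :=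
  ⟨v (σ i), by
    rw [cechElt, cechElt, Fin.prod_univ_succAbove _ i, mul_comm]
    rfl⟩

/-- The differential of the Čech complex of `A`. -/
def cechD (k : ℕ) : CechCochain v k →ₗ[A] CechCochain v (k + 1) :=
  LinearMap.pi fun σ => ∑ i : Fin (k + 2), (-1 : A) ^ (i : ℕ) •
    ((awayMap (cechElt_face_dvd v i σ)).toLinearMap ∘ₗ LinearMap.proj (cechFace i σ))

theorem cechD_apply {k : ℕ} (x : CechCochain v k) (σ : Fin (k + 2) ↪o Fin m) :
    cechD v k x σ = ∑ i : Fin (k + 2), (-1 : A) ^ (i : ℕ) •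
      awayMap (cechElt_face_dvd v i σ) (x (cechFace i σ)) := by
  simp [cechD]

theorem cechFace_cechFace {k : ℕ} (i : Fin (k + 3)) (j : Fin (k + 2)) (σ : Fin (k + 3) ↪o Fin m) :
    cechFace (j.predAbove i) (cechFace (i.succAbove j) σ) = cechFace j (cechFace i σ) := by
  ext t
  exact congrArg (fun x => (σ x : ℕ)) (Fin.succAbove_succAbove_succAbove_predAbove i j t)

theorem awayMap_congr {k l : ℕ} (x : CechCochain v k) {σ τ : Fin (k + 1) ↪o Fin m}
    (ρ : Fin (l + 1) ↪o Fin m) (h : σ = τ) (h1 : cechElt v σ ∣ cechElt v ρ)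
    (h2 : cechElt v τ ∣ cechElt v ρ) : awayMap h1 (x σ) = awayMap h2 (x τ) := by
  subst h; rfl

theorem cechD_cechD {k : ℕ} : cechD v (k + 1) ∘ₗ cechD v k = 0 := by
  refine LinearMap.ext fun x => funext fun σ => ?_
  have h : ∀ (i : Fin (k + 3)) (j : Fin (k + 2)),
      cechElt v (cechFace j (cechFace i σ)) ∣ cechElt v σ := fun i j =>
    (cechElt_face_dvd v j _).trans (cechElt_face_dvd v i σ)
  have h1 : cechD v (k + 1) (cechD v k x) σ = ∑ q : Fin (k + 3) × Fin (k + 2),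
      (-1 : A) ^ (q.1 + q.2 : ℕ) • awayMap (h q.1 q.2) (x (cechFace q.2 (cechFace q.1 σ))) := by
    rw [Fintype.sum_prod_type, cechD_apply]
    refine Finset.sum_congr rfl fun i _ => ?_
    rw [cechD_apply, map_sum, Finset.smul_sum]
    refine Finset.sum_congr rfl fun j _ => ?_
    rw [map_smul, smul_smul, ← pow_add, awayMap_awayMap _ _ (h i j)]
  rw [LinearMap.comp_apply, h1, LinearMap.zero_apply, Pi.zero_apply]
  refine Finset.sum_involution (fun q _ => (q.1.succAbove q.2, q.2.predAbove q.1))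
    (fun q _ => ?_) (fun q _ _ => ?_) (fun _ _ => Finset.mem_univ _) fun q _ => ?_
  · rw [Fin.neg_one_pow_succAbove_add_predAbove, neg_smul,
      awayMap_congr v x σ (cechFace_cechFace q.1 q.2 σ) (h _ _) (h _ _), add_neg_cancel]
  · exact fun e => Fin.succAbove_ne _ _ (congrArg Prod.fst e)
  · exact Prod.ext (Fin.succAbove_succAbove_predAbove _ _) (Fin.predAbove_predAbove_succAbove _ _)

/-- The Čech complex of a module `M`: the tensor product of the Čech complex of `A` with `M`. -/
def cechComplex : ModuleCat.{0} A ⥤ CochainComplex (ModuleCat.{0} A) ℕ where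
  obj M := CochainComplex.of (fun k => ModuleCat.of A (CechCochain v k ⊗[A] M))
    (fun k => ModuleCat.ofHom ((cechD v k).rTensor M)) fun k => by
      rw [← ModuleCat.ofHom_comp, ← LinearMap.rTensor_comp, cechD_cechD, LinearMap.rTensor_zero]
      rfl
  map {M N} f := CochainComplex.ofHom (fun k => ModuleCat.ofHom (f.hom.lTensor (CechCochain v k)))
    fun k => by
      dsimp only
      rw [CochainComplex.of_d, CochainComplex.of_d, ← ModuleCat.ofHom_comp, ← ModuleCat.ofHom_comp,
        LinearMap.rTensor_comp_lTensor, LinearMap.lTensor_comp_rTensor]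
  map_id M := by
    ext k : 1
    exact congrArg ModuleCat.ofHom (LinearMap.lTensor_id _ _)
  map_comp f g := by
    ext k : 1
    exact congrArg ModuleCat.ofHom (LinearMap.lTensor_comp _ _ _)

/-- Čech cohomology as a functor. -/
def cechCohomology (i : ℕ) : ModuleCat.{0} A ⥤ ModuleCat.{0} A :=
  cechComplex v ⋙ HomologicalComplex.homologyFunctor _ _ i

end Cech

section CechGrading

variable {p : ℕ} [hp : Fact p.Prime]

/-- `x` in `BP_*[1/s]`, for `s` homogeneous, is homogeneous of degree `d` if it is the quotient of
a homogeneous element by a power of `s`, with degrees that differ by `d`. -/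
def IsAwayHomogeneous {s : BP p} (d : ℤ) (x : Localization.Away s) : Prop :=
  ∃ (N : ℕ) (e : ℤ) (a : BP p), s ^ N ∈ BPdeg p e ∧ a ∈ BPdeg p (d + e) ∧
    s ^ N • x = algebraMap _ _ a

variable (p) in
/-- The generators `v_0 = p, v_1, …, v_n` of `I_{n+1}`. -/
def gens (n : ℕ) (i : Fin (n + 1)) : BP p := vGen p i

/-- The cochains of degree `d` in the Čech complex of a comodule. -/
def cechCochainDeg (n : ℕ) (M : Comod p) (k : ℕ) (d : ℤ) :
    AddSubgroup (CechCochain (gens p n) k ⊗[BP p] M.carrier) :=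
  AddSubgroup.closure {z | ∃ (i j : ℤ) (x : CechCochain (gens p n) k) (m : M.carrier),
    i + j = d ∧ (∀ σ, IsAwayHomogeneous i (x σ)) ∧ m ∈ M.deg j ∧ z = x ⊗ₜ m}

variable (p) in
/-- The Čech cohomology of comodules with respect to `I_{n+1}`. -/
def cechI (n i : ℕ) : Comod p ⥤ ModuleCat.{0} (BP p) := forgetMod p ⋙ cechCohomology (gens p n) i

/-- The elements of degree `d` in Čech cohomology: the classes of cocycles of degree `d`. -/
def cechDeg (n : ℕ) (M : Comod p) (i : ℕ) (d : ℤ) : Set ((cechI p n i).obj M) :=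
  let K := (cechComplex (gens p n)).obj ((forgetMod p).obj M)
  {x | ∃ z : K.cycles i, (K.iCycles i).hom z ∈ cechCochainDeg n M i d ∧ (K.homologyπ i).hom z = x}

end CechGrading

section Chromatic

variable {p : ℕ} [hp : Fact p.Prime]

/-- `IsChromatic k j M` says that `M` is isomorphic to the comodule
`BP_* / (p, v_1, …, v_{k-1}, v_k^∞, …, v_{j-1}^∞)`. This is `BP_* / I_k` for `j = k`, and the
comodule for `j + 1` is the cokernel of the inclusion of the one for `j` in its localization
obtained by inverting `v_j`. -/
inductive IsChromatic (k : ℕ) : ℕ → Comod p → Prop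
  | base (N : Comod p) (e : N ≅ BPmod p k) : IsChromatic k k N
  | step (j : ℕ) (N P M : Comod p) (f : N ⟶ P) (g : P ⟶ M) (hN : IsChromatic k j N)
      (hf : Function.Injective f.toLin)
      (hP : IsLocalizedModule (Submonoid.powers (vGen p j)) f.toLin)
      (hfg : Function.Exact f.toLin g.toLin) (hg : Function.Surjective g.toLin) :
      IsChromatic k (j + 1) M

end Chromatic

end BPcomod

end

open BPcomod

noncomputable section

/-! The arithmetic heart is that `v_n`-torsion in a comodule is automatically torsion for every
`v_j` with `j ≤ n` (`vGen_mem_nilIdeal`). If `v_n ^ N x = 0`, then `η_R(v_n) ^ N ψ(x) = 0`. Put all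
the `t_i` but one equal to zero. Then `ψ(x)` becomes a polynomial with coefficients in `M` and
constant coefficient `x`, and every coefficient of `η_R(v_n)` is nilpotent on it
(`C_coeff_mem_radical`). By the congruence for `η_R` in one variable (`etaEval_single`) these
coefficients include `p`, and `v_j` modulo lower generators. Hence the torsion elements form a
subcomodule, and `v_n`-torsion is the same as `I_{n+1}`-power torsion.

The forgetful functor to modules has a right adjoint, the cofree comodule `BP_*BP[T, T⁻¹] ⊗ N`,
where the powers of `T` carry the grading. This gives enough injectives. The cofree comodule on an
injective module on which `v_n` is bijective is local, and `L_n M` is cut out of such a hull as the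
elements that become torsion modulo `M`.

Since `v_0, v_1, …` is a regular sequence, an injective comodule `J` is divisible: `v_j` is
surjective on the elements on which `v_0, …, v_{j-1}` are nilpotent (`isQDivisible_of_injective`).
Filtering by these elements shows that the quotient of `J` by its torsion is an iterated extension
of modules on which some `v_j` is bijective. Such modules have an exact augmented Čech complex, and
therefore the quotient is `L_n J` and its augmented Čech complex is exact. On the other hand the
Čech complex does not change under `M → L_n M`, whose kernel and cokernel are torsion. For an
injective resolution `J^•` of `M`, the double complex of Čech cochains of `L_n J^•` thus compares
the complex `L_n J^•` with the Čech complex of `M`, which identifies `L_n^i M` with Čech cohomology.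
Vanishing above `n`, the case of an invertible `v_j`, and compatibility with colimits are then
visible on the Čech side.

The comparison works for every resolution whose localizations have exact augmented Čech complexes.
For `BP_* / I_k` the chromatic resolution is of this kind. Its term in degree `b` is local if `k + b
≤ n` and has zero localization otherwise, so the localized complex is the chromatic complex cut off
after degree `n - k`; this leaves cohomology only in degrees `0` and `n - k`. -/

namespace BPcomod

/-! ### Counit and coassociativity identities for the structure polynomials -/

section Identities

/-- An identity between natural operations on commutative rings holds if it holds over `ℚ`. -/
theorem eq_of_rat {σ : Type} (F G : ∀ (B : Type) [CommRing B], (σ → B) → B)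
    (hF : ∀ (B C : Type) [CommRing B] [CommRing C] (f : B →+* C) (x : σ → B),
      f (F B x) = F C (f ∘ x))
    (hG : ∀ (B C : Type) [CommRing B] [CommRing C] (f : B →+* C) (x : σ → B),
      f (G B x) = G C (f ∘ x))
    (h : ∀ (B : Type) [CommRing B] [Algebra ℚ B] (x : σ → B), F B x = G B x)
    (B : Type) [CommRing B] (x : σ → B) : F B x = G B x := by
  -- By naturality it suffices to treat the universal point with values in integral polynomials, and
  -- these embed into rational polynomials.
  have hZ : F (MvPolynomial σ ℤ) MvPolynomial.X = G (MvPolynomial σ ℤ) MvPolynomial.X := by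
    apply MvPolynomial.map_injective (Int.castRingHom ℚ) Int.cast_injective
    rw [hF, hG]
    exact h _ _
  have := congrArg (MvPolynomial.aeval x : MvPolynomial σ ℤ →ₐ[ℤ] B).toRingHom hZ
  rw [hF, hG] at this
  have h1 : (MvPolynomial.aeval x : MvPolynomial σ ℤ →ₐ[ℤ] B).toRingHom ∘ MvPolynomial.X = x := by
    funext i; simp
  rwa [h1] at this

variable {p : ℕ} {B : Type} [CommRing B]

/-- Since `l 0 = 1`, the summand with `i = 0` is the term `s n` itself, and all other summands
involve only earlier terms; the sequence is recovered recursively. -/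
theorem formalSum_injective [Algebra ℚ B] {l s s' : ℕ → B} (h0 : l 0 = 1)
    (h : formalSum p l s = formalSum p l s') : s = s' := by
  funext n
  induction n using Nat.strong_induction_on with
  | _ n ih =>
  have h1 := congrFun h n
  rw [formalSum, formalSum, Finset.sum_range_succ', Finset.sum_range_succ'] at h1
  simp only [h0, Nat.sub_zero, pow_zero, pow_one, one_mul] at h1
  rw [Finset.sum_congr rfl fun i hi => ?_] at h1
  · exact add_left_cancel h1
  · rw [ih _ (by rw [Finset.mem_range] at hi; omega)]

theorem tHat_injective {s s' : ℕ → B} (h : tHat s = tHat s') : s = s' :=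
  funext fun n => congrFun h (n + 1)

theorem formalSum_tHat_zero [hp : Fact p.Prime] (l : ℕ → B) : formalSum p l (tHat 0) = l := by
  funext n
  rw [formalSum, Finset.sum_range_succ, Finset.sum_eq_zero]
  · simp [tHat]
  · intro i hi
    rw [Finset.mem_range] at hi
    obtain ⟨m, hm⟩ : ∃ m, n - i = m + 1 := ⟨n - i - 1, by omega⟩
    rw [hm, tHat, Pi.zero_apply, zero_pow (pow_ne_zero _ hp.out.ne_zero), mul_zero]

variable (p) [hp : Fact p.Prime]

/-- One counit law for `Δ` on the generators. Over `ℚ` both sequences have the same formal sum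
against the logarithm, which determines them. -/
theorem deltaEval_zero_right (v t : ℕ → B) : deltaEval p v t 0 = t := by
  funext n
  refine eq_of_rat (σ := ℕ ⊕ ℕ) (fun B _ x => deltaEval p (x ∘ Sum.inl) (x ∘ Sum.inr) 0 n)
    (fun B _ x => x (Sum.inr n)) (fun B C _ _ f x => ?_) (fun B C _ _ f x => rfl)
    (fun B _ _ x => ?_) B (Sum.elim v t)
  · rw [map_deltaEval]
    congr 1
    funext i
    simp
  · have h : deltaEval p (x ∘ Sum.inl) (x ∘ Sum.inr) 0 = x ∘ Sum.inr := by
      refine tHat_injective (formalSum_injective (p := p)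
        (logSeq_zero (p := p) (vHat p (x ∘ Sum.inl))) ?_)
      rw [formalSum_deltaEval, formalSum_tHat_zero]
    exact congrFun h n

theorem deltaEval_zero_left (v s : ℕ → B) : deltaEval p v 0 s = s := by
  funext n
  refine eq_of_rat (σ := ℕ ⊕ ℕ) (fun B _ x => deltaEval p (x ∘ Sum.inl) 0 (x ∘ Sum.inr) n)
    (fun B _ x => x (Sum.inr n)) (fun B C _ _ f x => ?_) (fun B C _ _ f x => rfl)
    (fun B _ _ x => ?_) B (Sum.elim v s)
  · rw [map_deltaEval]
    congr 1
    funext i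
    simp
  · have h : deltaEval p (x ∘ Sum.inl) 0 (x ∘ Sum.inr) = x ∘ Sum.inr := by
      refine tHat_injective (formalSum_injective (p := p)
        (logSeq_zero (p := p) (vHat p (x ∘ Sum.inl))) ?_)
      rw [formalSum_deltaEval, formalSum_tHat_zero]
    exact congrFun h n

/-- Coassociativity on the generators: over `ℚ` both sides have the triple formal sum of `t`, `s`
and `r` against the logarithm. The inner `Δ` on the right is formed over `η_R(v)`, because the left
unit of the second factor of `Γ ⊗ Γ` is identified with the right unit of the first. -/
theorem deltaEval_assoc (v t s r : ℕ → B) : deltaEval p v (deltaEval p v t s) r =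
    deltaEval p v t (deltaEval p (etaEval p v t) s r) := by
  funext n
  refine eq_of_rat (σ := (ℕ ⊕ ℕ) ⊕ (ℕ ⊕ ℕ))
    (fun B _ x => deltaEval p (fun i => x (.inl (.inl i))) (deltaEval p
      (fun i => x (.inl (.inl i))) (fun i => x (.inl (.inr i))) (fun i => x (.inr (.inl i))))
      (fun i => x (.inr (.inr i))) n)
    (fun B _ x => deltaEval p (fun i => x (.inl (.inl i))) (fun i => x (.inl (.inr i)))
      (deltaEval p (etaEval p (fun i => x (.inl (.inl i))) (fun i => x (.inl (.inr i))))
      (fun i => x (.inr (.inl i))) (fun i => x (.inr (.inr i)))) n)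
    (fun B C _ _ f x => ?_) (fun B C _ _ f x => ?_)
    (fun B _ _ x => ?_) B (Sum.elim (Sum.elim v t) (Sum.elim s r))
  · rw [map_deltaEval]
    congr 1
    funext i
    exact map_deltaEval p f _ _ _ _
  · rw [map_deltaEval]
    congr 1
    funext i
    refine (map_deltaEval p f _ _ _ _).trans ?_
    congr 1
    funext i
    exact map_etaEval p f _ _ _
  · refine congrFun (tHat_injective (formalSum_injective (p := p)
      (logSeq_zero (p := p) (vHat p fun i => x (.inl (.inl i)))) ?_)) n
    rw [formalSum_deltaEval, formalSum_deltaEval, formalSum_deltaEval, ← logSeq_etaEval,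
      formalSum_deltaEval]

end Identities

/-! ### Homogeneity of the comultiplication as invariance under rescaling -/

section Scaling

variable {B : Type*} [CommRing B]

/-- Here `U` stands for the powers of a unit. Homogeneity of degree `d` means that rescaling each
variable by its weight rescales the value by `d`; in this form a grading can be tested inside any
ring. -/
theorem aeval_scale {σ : Type} {w : σ → ℤ} {d : ℤ} {P : MvPolynomial σ ℤ}
    (hP : P.IsWeightedHomogeneous w d) (U : Multiplicative ℤ →* B) (x : σ → B) :
    MvPolynomial.aeval (fun i => x i * U (Multiplicative.ofAdd (w i))) P =
      MvPolynomial.aeval x P * U (Multiplicative.ofAdd d) := by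
  rw [MvPolynomial.aeval_def, MvPolynomial.aeval_def, MvPolynomial.eval₂_eq,
    MvPolynomial.eval₂_eq, Finset.sum_mul]
  refine Finset.sum_congr rfl fun e he => ?_
  rw [mul_assoc]
  congr 1
  simp only [mul_pow, Finset.prod_mul_distrib]
  congr 1
  rw [← hP (MvPolynomial.mem_support_iff.1 he), Finsupp.weight_apply, Finsupp.sum, ofAdd_sum,
    map_prod]
  refine Finset.prod_congr rfl fun i _ => ?_
  rw [← map_pow, ofAdd_nsmul]

variable (p : ℕ) [hp : Fact p.Prime]

theorem isWH_expSeq {σ : Type} {w : σ → ℤ} {l c : ℕ → MvPolynomial σ ℚ}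
    (hl : ∀ n, (l n).IsWeightedHomogeneous w (2 * ((p : ℤ) ^ n - 1)))
    (hc : ∀ n, (c n).IsWeightedHomogeneous w (2 * ((p : ℤ) ^ n - 1))) (n : ℕ) :
    (expSeq p l c n).IsWeightedHomogeneous w (2 * ((p : ℤ) ^ n - 1)) := by
  induction n using Nat.strong_induction_on with
  | _ n ih =>
  cases n with
  | zero => rw [expSeq]; exact hc 0
  | succ n =>
    rw [expSeq]
    refine (hc _).sub (MvPolynomial.IsWeightedHomogeneous.sum _ _ _ fun i _ => ?_)
    have h : 2 * ((p : ℤ) ^ (n + 1) - 1) = 2 * ((p : ℤ) ^ ((i : ℕ) + 1) - 1) +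
        p ^ ((i : ℕ) + 1) • (2 * ((p : ℤ) ^ (n - i) - 1)) := by
      have : (p : ℤ) ^ (n + 1) = p ^ (i + 1 : ℕ) * p ^ (n - i) := by
        rw [← pow_add]; congr 1; omega
      rw [this, nsmul_eq_mul]
      push_cast
      ring
    rw [h]
    exact (hl (i + 1)).mul ((ih (n - i) (by omega)).pow (p ^ (i + 1 : ℕ)))

theorem deltaPoly_isWH (n : ℕ) : (deltaPoly p n).IsWeightedHomogeneous
    (Sum.elim (genDeg p) (Sum.elim (genDeg p) (genDeg p))) (genDeg p n) := by
  set w := Sum.elim (genDeg p) (Sum.elim (genDeg p) (genDeg p)) with hw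
  have hX : ∀ (f : ℕ → ℕ ⊕ ℕ ⊕ ℕ), (∀ i, w (f i) = genDeg p i) →
      ∀ i, (MvPolynomial.X (f i) : MvPolynomial (ℕ ⊕ ℕ ⊕ ℕ) ℚ).IsWeightedHomogeneous
      w (2 * ((p : ℤ) ^ (i + 1) - 1)) := fun f hf i => by
    have := MvPolynomial.isWeightedHomogeneous_X ℚ w (f i)
    rwa [hf] at this
  have hl : ∀ n, (univLog p Sum.inl n : MvPolynomial (ℕ ⊕ ℕ ⊕ ℕ) ℚ).IsWeightedHomogeneous
      w (2 * ((p : ℤ) ^ n - 1)) := isWH_logSeq p fun i => by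
    cases i with
    | zero => simpa [vHat] using MvPolynomial.isWeightedHomogeneous_C _ (p : ℚ)
    | succ i => exact hX _ (fun _ => rfl) i
  have ht : ∀ (f : ℕ → ℕ ⊕ ℕ ⊕ ℕ), (∀ i, w (f i) = genDeg p i) →
      ∀ i, (tHat (fun i => MvPolynomial.X (f i)) i :
        MvPolynomial (ℕ ⊕ ℕ ⊕ ℕ) ℚ).IsWeightedHomogeneous w (2 * ((p : ℤ) ^ i - 1)) :=
    fun f hf i => by
      cases i with
      | zero => simpa [tHat] using MvPolynomial.isWeightedHomogeneous_one ℚ _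
      | succ i => exact hX _ hf i
  have h : (deltaRat p n).IsWeightedHomogeneous w (genDeg p n) :=
    isWH_expSeq p hl (isWH_formalSum p (isWH_formalSum p hl (ht _ fun _ => rfl))
      (ht _ fun _ => rfl)) (n + 1)
  rw [← (exists_deltaInt p n).choose_spec] at h
  intro d hd
  refine h (d := d) ?_
  rw [MvPolynomial.coeff_map]
  simpa [deltaPoly] using hd

/-- It moves powers of `T` out of `Δ` when the twisted coaction is proved coassociative in
`psi_coassoc`. -/
theorem deltaEval_scale (U : Multiplicative ℤ →* B) (v t s : ℕ → B) (n : ℕ) :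
    deltaEval p (fun i => v i * U (Multiplicative.ofAdd (genDeg p i)))
      (fun i => t i * U (Multiplicative.ofAdd (genDeg p i)))
      (fun i => s i * U (Multiplicative.ofAdd (genDeg p i))) n =
      deltaEval p v t s n * U (Multiplicative.ofAdd (genDeg p n)) := by
  rw [deltaEval, deltaEval, ← aeval_scale (deltaPoly_isWH p n)]
  congr 2
  funext i
  rcases i with i | i | i <;> rfl

end Scaling

/-! ### An exact formula for the right unit from the functional equation -/

section Frobenius

variable {p : ℕ} {B : Type*} [CommRing B] [Algebra ℚ B] {R : Type*} [CommRing R]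

/-- The functional equation of `formalSum` for a sequence of elements on which the Frobenius lift
is the `p`-th power. -/
theorem formalSum_frob (ι : R →+* B) (φR : R →+* R) (φ : B →+* B)
    (hφ : ∀ r, φ (ι r) = ι (φR r)) (hp : p ≠ 0) (v : ℕ → R)
    (hv : ∀ i, φR (v (i + 1)) = v (i + 1) ^ p) (s : ℕ → R) (hs : ∀ i, φR (s i) = s i ^ p)
    (n : ℕ) : (p : B) * formalSum p (logSeq p (ι ∘ v)) (ι ∘ s) n = p * ι (s n) +
      ∑ j ∈ Finset.range n, ι (v (j + 1)) *
        (φ ^ (j + 1)) (formalSum p (logSeq p (ι ∘ v)) (ι ∘ s) (n - 1 - j)) := by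
  have hsφ : ∀ i j : ℕ, (φ ^ j) (ι (s i)) = ι (s i) ^ p ^ j := fun i j => by
    induction j with
    | zero => simp
    | succ j ih => rw [pow_succ', RingHom.mul_def, RingHom.comp_apply, ih, map_pow, hφ, hs,
        map_pow, ← pow_mul, pow_succ']
  -- Reindexing the pairs `j ≤ i` by `(j, i - j)` makes the inner sum the Frobenius twist of an
  -- earlier formal sum.
  have key := Finset.sum_range_diag_flip n (fun j k : ℕ =>
        ι (v (j + 1)) * ((φ ^ (j + 1)) (logSeq p (ι ∘ v) k) *
          ι (s (n - 1 - j - k)) ^ p ^ (j + 1 + k)))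
  have e1 : (p : B) * formalSum p (logSeq p (ι ∘ v)) (ι ∘ s) n = p * ι (s n) +
      ∑ j ∈ Finset.range n, ∑ k ∈ Finset.range (n - j), ι (v (j + 1)) *
        ((φ ^ (j + 1)) (logSeq p (ι ∘ v) k) * ι (s (n - 1 - j - k)) ^ p ^ (j + 1 + k)) := by
    rw [← key, formalSum, Finset.sum_range_succ', mul_add, add_comm]
    congr 1
    · simp [logSeq_zero]
    · rw [Finset.mul_sum]
      refine Finset.sum_congr rfl fun i hi => ?_
      rw [Finset.mem_range] at hi
      rw [← mul_assoc, logSeq_frob ι φR φ hφ hp v hv, Finset.sum_mul]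
      refine Finset.sum_congr rfl fun j hj => ?_
      rw [Finset.mem_range] at hj
      have h1 : n - 1 - j - (i - j) = n - (i + 1) := by omega
      have h2 : j + 1 + (i - j) = i + 1 := by omega
      rw [h1, h2, Function.comp_apply]
      ring
  rw [e1]
  congr 1
  refine Finset.sum_congr rfl fun j hj => ?_
  rw [Finset.mem_range] at hj
  have h3 : n - 1 - j + 1 = n - j := by omega
  rw [formalSum, h3, map_sum, Finset.mul_sum]
  refine Finset.sum_congr rfl fun k hk => ?_
  rw [map_mul, map_pow, Function.comp_apply, hsφ, ← pow_mul, ← pow_add]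

/-- A formula for the sequence `w` of generators which belongs to the logarithm with coefficients
`c`. -/
theorem unlogSeq_formula (ι : R →+* B) (φ : B →+* B)
    (hp : p ≠ 0) (v : ℕ → R) (c : ℕ → B) (h0 : c 0 = 1) (e w : ℕ → R)
    (hc : ∀ n, (p : B) * c n = p * ι (e n) +
      ∑ j ∈ Finset.range n, ι (v (j + 1)) * (φ ^ (j + 1)) (c (n - 1 - j)))
    (hw : ∀ n, unlogSeq p c (n + 1) = ι (w n)) (n : ℕ)
    (z : ℕ → ℕ → R) (hz : ∀ j k, (φ ^ (j + 1)) (c k) * (ι (w (n - 1 - j - k)) ^ p ^ (j + 1 + k) -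
        (φ ^ (j + 1)) (ι (w (n - 1 - j - k))) ^ p ^ k) = p * ι (z j k)) :
    ι (w n) = ι (v (n + 1) + p * e (n + 1) -
      ∑ i ∈ Finset.range n, e (i + 1) * w (n - 1 - i) ^ p ^ (i + 1) -
      ∑ j ∈ Finset.range n, ∑ k ∈ Finset.range (n - j), v (j + 1) * z j k) := by
  rw [← hw]
  apply p_cancel hp
  have key := Finset.sum_range_diag_flip n (fun j k : ℕ =>
      ι (v (j + 1)) * ((φ ^ (j + 1)) (c k) * ι (w (n - 1 - j - k)) ^ p ^ (j + 1 + k)))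
  -- The sum is evaluated in two ways: `e1` inserts the functional equation for `p c_{i+1}`, and
  -- `e2` inserts the recursion that defines `w` into the Frobenius twists. In `e3` the two double
  -- sums are compared term by term, and they differ exactly by the corrections `p z`.
  have e1 : ∑ i ∈ Finset.range n, (p : B) * (c (i + 1) * unlogSeq p c (n - i) ^ p ^ (i + 1)) =
      ∑ i ∈ Finset.range n, (p : B) * (ι (e (i + 1)) * ι (w (n - 1 - i)) ^ p ^ (i + 1)) +
      ∑ j ∈ Finset.range n, ∑ k ∈ Finset.range (n - j), ι (v (j + 1)) * ((φ ^ (j + 1)) (c k) *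
        ι (w (n - 1 - j - k)) ^ p ^ (j + 1 + k)) := by
    rw [← key, ← Finset.sum_add_distrib]
    refine Finset.sum_congr rfl fun i hi => ?_
    rw [Finset.mem_range] at hi
    obtain ⟨m, hm⟩ : ∃ m, n - i = m + 1 := ⟨n - i - 1, by omega⟩
    have h1 : n - 1 - i = m := by omega
    rw [← mul_assoc, hc, hm, hw, h1, add_mul, Finset.sum_mul]
    congr 1
    · ring
    · refine Finset.sum_congr rfl fun j hj => ?_
      rw [Finset.mem_range] at hj
      have h2 : n - 1 - j - (i - j) = m := by omega
      have h3 : j + 1 + (i - j) = i + 1 := by omega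
      have h4 : i + 1 - 1 - j = i - j := by omega
      rw [h2, h3, h4]
      ring
  have e2 : ∑ j ∈ Finset.range n, (p : B) * (ι (v (j + 1)) * (φ ^ (j + 1)) (c (n - j))) =
      ∑ j ∈ Finset.range n, ∑ k ∈ Finset.range (n - j), ι (v (j + 1)) * ((φ ^ (j + 1)) (c k) *
        (φ ^ (j + 1)) (ι (w (n - 1 - j - k))) ^ p ^ k) := by
    refine Finset.sum_congr rfl fun j hj => ?_
    rw [Finset.mem_range] at hj
    obtain ⟨m, hm⟩ : ∃ m, n - j = m + 1 := ⟨n - j - 1, by omega⟩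
    have h5 : (p : B) * (φ ^ (j + 1)) (c (m + 1)) = (φ ^ (j + 1)) ((p : B) * c (m + 1)) := by
      rw [map_mul, map_natCast]
    rw [hm, mul_left_comm, h5, ← unlogSeq_spec c h0, map_sum, Finset.mul_sum]
    refine Finset.sum_congr rfl fun k hk => ?_
    rw [Finset.mem_range] at hk
    have h6 : m + 1 - k = (n - 1 - j - k) + 1 := by omega
    rw [h6, hw, map_mul, map_pow]
  have e3 : ∑ j ∈ Finset.range n, ∑ k ∈ Finset.range (n - j), ι (v (j + 1)) *
        ((φ ^ (j + 1)) (c k) * (φ ^ (j + 1)) (ι (w (n - 1 - j - k))) ^ p ^ k) =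
      ∑ j ∈ Finset.range n, ∑ k ∈ Finset.range (n - j), ι (v (j + 1)) * ((φ ^ (j + 1)) (c k) *
        ι (w (n - 1 - j - k)) ^ p ^ (j + 1 + k)) -
      p * ∑ j ∈ Finset.range n, ∑ k ∈ Finset.range (n - j), ι (v (j + 1)) * ι (z j k) := by
    rw [Finset.mul_sum, ← Finset.sum_sub_distrib]
    refine Finset.sum_congr rfl fun j _ => ?_
    rw [Finset.mul_sum, ← Finset.sum_sub_distrib]
    refine Finset.sum_congr rfl fun k _ => ?_
    linear_combination (-ι (v (j + 1))) * hz j k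
  rw [unlogSeq_succ, mul_sub, hc (n + 1), Finset.sum_range_succ, mul_add, mul_add,
    Finset.mul_sum, Finset.mul_sum, e1]
  simp only [Nat.add_sub_cancel] at e2 ⊢
  rw [e2, e3]
  simp only [Nat.sub_self, h0, map_one, map_add, map_sub, map_sum, map_mul, map_pow,
    map_natCast, ← Finset.mul_sum]
  ring

end Frobenius

/-! ### The right unit when a single `t_i` is non-zero -/

section SingleVariable

variable (p : ℕ) [hp : Fact p.Prime]

theorem unlogSeq_eq_etaEval {B : Type*} [CommRing B] [Algebra ℚ B] (v t : ℕ → B) (n : ℕ) :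
    unlogSeq p (formalSum p (logSeq p (vHat p v)) (tHat t)) (n + 1) = etaEval p v t n := by
  rw [← logSeq_etaEval, unlogSeq_logSeq hp.out.ne_zero]
  rfl

/-- The universal case of `etaEval_single`. -/
theorem etaEval_single_aux (m : ℕ) (v : ℕ → MvPolynomial (Option ℕ) ℤ)
    (hv : v = fun i => MvPolynomial.X (some i)) (s : MvPolynomial (Option ℕ) ℤ)
    (hs : s = MvPolynomial.X none) :
    (∀ r < m, etaEval p v (Pi.single m s) r = v r) ∧
    etaEval p v (Pi.single m s) m = v m + p * s ∧
    ∀ k, etaEval p v (Pi.single m s) (m + k + 1) -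
      (v (m + k + 1) + v k * s ^ p ^ (k + 1) - s * v k ^ p ^ (m + 1)) ∈
        Ideal.span {x | x = (p : MvPolynomial (Option ℕ) ℤ) ∨ ∃ j, j < k ∧ x = v j} := by
  have hp0 := hp.out.ne_zero
  set ι := MvPolynomial.map (σ := Option ℕ) (Int.castRingHom ℚ) with hι
  have hιi : Function.Injective ι :=
    MvPolynomial.map_injective (Int.castRingHom ℚ) Int.cast_injective
  -- Substituting `p`-th powers for the variables lifts the Frobenius and is exactly the `p`-th
  -- power on each `v_i` and on `s`. The functional equation for `c` therefore holds with the
  -- explicit error term `p e`.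
  set φR := (MvPolynomial.expand p : MvPolynomial (Option ℕ) ℤ →ₐ[ℤ] _).toRingHom with hφR
  set φ := (MvPolynomial.expand p : MvPolynomial (Option ℕ) ℚ →ₐ[ℚ] _).toRingHom with hφd
  have hφ : ∀ r, φ (ι r) = ι (φR r) := univ_comm p
  set e : ℕ → MvPolynomial (Option ℕ) ℤ := tHat (Pi.single m s) with he
  have he' : ∀ i, e (i + 1) = if i = m then s else 0 := fun i => by
    rw [he, tHat, Pi.single_apply]
  have hvφ : ∀ i, φR (vHat p v (i + 1)) = vHat p v (i + 1) ^ p := fun i => by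
    simp [vHat, hv, hφR]
  have heφ : ∀ i, φR (e i) = e i ^ p := fun i => by
    cases i with
    | zero => simp [he, tHat]
    | succ i =>
      rw [he']
      split_ifs
      · simp [hs, hφR]
      · rw [map_zero, zero_pow hp0]
  set w := etaEval p v (Pi.single m s) with hw
  set c := formalSum p (logSeq p (ι ∘ vHat p v)) (ι ∘ e) with hc
  have hcw : ∀ n, unlogSeq p c (n + 1) = ι (w n) := fun n => by
    rw [hc, he, comp_vHat, comp_tHat, unlogSeq_eq_etaEval, hw, map_etaEval]
  have hc0 : c 0 = 1 := by simp [hc, formalSum, logSeq_zero, he, tHat]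
  have hci : ∀ n, ∃ r, (p : MvPolynomial (Option ℕ) ℚ) ^ n * c n = ι r := fun n => by
    choose r hr using logSeq_int ι hp0 (vHat p v)
    refine ⟨∑ i ∈ Finset.range (n + 1), (p : MvPolynomial (Option ℕ) ℤ) ^ (n - i) * r i *
      e (n - i) ^ p ^ i, ?_⟩
    rw [hc, formalSum, Finset.mul_sum, map_sum]
    refine Finset.sum_congr rfl fun i hi => ?_
    rw [Finset.mem_range] at hi
    rw [map_mul, map_mul, ← hr, map_pow, map_pow, map_natCast, Function.comp_apply,
      ← mul_assoc, ← mul_assoc, ← pow_add]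
    congr 4
    omega
  have hcf := formalSum_frob ι φR φ hφ hp0 (vHat p v) hvφ e heφ
  have hb : ∀ n j k : ℕ, ∃ z, (φ ^ (j + 1)) (c k) * (ι (w (n - 1 - j - k)) ^ p ^ (j + 1 + k) -
      (φ ^ (j + 1)) (ι (w (n - 1 - j - k))) ^ p ^ k) = p * ι z := fun n j k =>
    bracket_int ι φR φ hφ (univ_frob p) (j + 1) k _ (hci k) _
  choose z hz using hb
  have formula : ∀ n, w n = v n + p * e (n + 1) -
      ∑ i ∈ Finset.range n, e (i + 1) * w (n - 1 - i) ^ p ^ (i + 1) -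
      ∑ j ∈ Finset.range n, ∑ k ∈ Finset.range (n - j), v j * z n j k := fun n =>
    hιi (unlogSeq_formula ι φ hp0 (vHat p v) c hc0 e w hcf hcw n (z n) (hz n))
  -- The correction `z` measures how far the Frobenius lift is from the `p`-th power on `w`, so it
  -- vanishes wherever `w` still equals `v`.
  have hz0 : ∀ n j k, w (n - 1 - j - k) = v (n - 1 - j - k) → z n j k = 0 := fun n j k h => by
    apply hιi
    apply p_cancel hp0
    rw [← hz, h, phi_iterate ι φR φ hφ]
    have := phi_iterate_v φR (vHat p v) hvφ (j + 1) (n - 1 - j - k)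
    rw [vHat] at this
    rw [this, map_pow, ← pow_mul, ← pow_add, sub_self, mul_zero, map_zero, mul_zero]
  have hlow : ∀ r < m, w r = v r := fun r => by
    induction r using Nat.strong_induction_on with
    | _ r ih =>
    intro hr
    rw [formula, he', if_neg (by omega), Finset.sum_eq_zero, Finset.sum_eq_zero]
    · ring
    · intro j hj
      refine Finset.sum_eq_zero fun k hk => ?_
      rw [Finset.mem_range] at hj
      rw [hz0 _ _ _ (ih _ (by omega) (by omega)), mul_zero]
    · intro i hi
      rw [Finset.mem_range] at hi
      rw [he', if_neg (by omega), zero_mul]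
  have hmid : w m = v m + p * s := by
    rw [formula, he', if_pos rfl, Finset.sum_eq_zero, Finset.sum_eq_zero]
    · ring
    · intro j hj
      refine Finset.sum_eq_zero fun k hk => ?_
      rw [Finset.mem_range] at hj
      rw [hz0 _ _ _ (hlow _ (by omega)), mul_zero]
    · intro i hi
      rw [Finset.mem_range] at hi
      rw [he', if_neg (by omega), zero_mul]
  refine ⟨hlow, hmid, fun k => ?_⟩
  set I := Ideal.span {x | x = (p : MvPolynomial (Option ℕ) ℤ) ∨ ∃ j, j < k ∧ x = v j} with hI
  have hpI : ∀ x, (p : MvPolynomial (Option ℕ) ℤ) * x ∈ I := fun x =>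
    Ideal.mul_mem_right _ _ (Ideal.subset_span (Or.inl rfl))
  have hvI : ∀ j x, j < k → v j * x ∈ I := fun j x hj =>
    Ideal.mul_mem_right _ _ (Ideal.subset_span (Or.inr ⟨j, hj, rfl⟩))
  have hs1 : ∑ i ∈ Finset.range (m + k + 1), e (i + 1) * w (m + k + 1 - 1 - i) ^ p ^ (i + 1) =
      s * w k ^ p ^ (m + 1) := by
    rw [Finset.sum_eq_single m]
    · rw [he', if_pos rfl]
      congr 3
      omega
    · intro i _ hi
      rw [he', if_neg hi, zero_mul]
    · intro h
      exact absurd (Finset.mem_range.2 (by omega)) h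
  have hwk : w k - v k ∈ I := etaEval_sub_mem p _ _ _
  have hwk' : s * w k ^ p ^ (m + 1) - s * v k ^ p ^ (m + 1) ∈ I := by
    rw [← mul_sub]
    obtain ⟨y, hy⟩ := sub_dvd_pow_sub_pow (w k) (v k) (p ^ (m + 1))
    rw [hy]
    exact Ideal.mul_mem_left _ _ (Ideal.mul_mem_right _ _ hwk)
  -- The first change of `w` is `w m = v m + p s`. The `p ^ (k + 1)`-th powers of `w m` and `v m`
  -- agree modulo `p ^ (k + 2)`, so the equation defining `z` forces `z ≡ -s ^ p ^ (k + 1)` modulo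
  -- `p`. This is the source of the term `v k * s ^ p ^ (k + 1)`.
  have hzk : v k * z (m + k + 1) k 0 + v k * s ^ p ^ (k + 1) ∈ I := by
    have h1 := hz (m + k + 1) k 0
    have h2 : m + k + 1 - 1 - k - 0 = m := by omega
    have h3 : (φR ^ (k + 1)) (v m) = v m ^ p ^ (k + 1) :=
      phi_iterate_v φR (vHat p v) hvφ (k + 1) m
    have h4 : (φR ^ (k + 1)) s = s ^ p ^ (k + 1) := by
      exact phi_iterate_v (p := p) φR (fun _ => s) (fun _ => by simp [hs, hφR]) (k + 1) 0
    have h4' : (φR ^ (k + 1)) (v m + p * s) = v m ^ p ^ (k + 1) + p * s ^ p ^ (k + 1) := by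
      rw [map_add, map_mul, h3, h4, map_natCast]
    rw [h2, hc0, map_one, one_mul, phi_iterate ι φR φ hφ, hmid, h4', add_zero, pow_zero, pow_one,
      ← map_pow, ← map_sub] at h1
    have h5 : (p : MvPolynomial (Option ℕ) ℚ) = ι p := by rw [map_natCast]
    rw [h5, ← map_mul] at h1
    have h6 := hιi h1
    have h7 : (p : MvPolynomial (Option ℕ) ℤ) ∣ (v m + p * s) - v m := ⟨s, by ring⟩
    obtain ⟨y, hy⟩ := dvd_sub_pow_of_dvd_sub h7 (k + 1)
    have h8 : (p : MvPolynomial (Option ℕ) ℤ) * (z (m + k + 1) k 0 + s ^ p ^ (k + 1)) =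
        p * (p * (p ^ k * y)) := by
      rw [mul_add, ← h6]
      linear_combination hy
    have h9 := mul_left_cancel₀ (by exact_mod_cast hp0 :
      (p : MvPolynomial (Option ℕ) ℤ) ≠ 0) h8
    rw [← mul_add, h9]
    exact Ideal.mul_mem_left _ _ (hpI _)
  -- Of the remaining summands, those with `j < k` lie in the ideal, and all others involve `w` only
  -- at indices below `m`, where the correction is zero.
  have hs2 : ∑ j ∈ Finset.range (m + k + 1), ∑ i ∈ Finset.range (m + k + 1 - j),
      v j * z (m + k + 1) j i + v k * s ^ p ^ (k + 1) ∈ I := by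
    rw [← Finset.add_sum_erase _ _ (Finset.mem_range.2 (by omega : k < m + k + 1)),
      ← Finset.add_sum_erase _ _ (Finset.mem_range.2 (by omega : 0 < m + k + 1 - k))]
    have h1 : ∑ i ∈ (Finset.range (m + k + 1 - k)).erase 0, v k * z (m + k + 1) k i ∈ I := by
      rw [Finset.sum_eq_zero]
      · exact zero_mem _
      · intro i hi
        rw [Finset.mem_erase, Finset.mem_range] at hi
        rw [hz0 _ _ _ (hlow _ (by omega)), mul_zero]
    have h2 : ∑ j ∈ (Finset.range (m + k + 1)).erase k, ∑ i ∈ Finset.range (m + k + 1 - j),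
        v j * z (m + k + 1) j i ∈ I := by
      refine Ideal.sum_mem _ fun j hj => Ideal.sum_mem _ fun i hi => ?_
      rw [Finset.mem_erase, Finset.mem_range] at hj
      rw [Finset.mem_range] at hi
      rcases lt_or_gt_of_ne hj.1 with h | h
      · exact hvI _ _ h
      · rw [hz0 _ _ _ (hlow _ (by omega)), mul_zero]
        exact zero_mem _
    convert add_mem (add_mem h1 hzk) h2 using 1
    ring
  rw [formula, he', if_neg (by omega), hs1]
  have := sub_mem (neg_mem hwk') hs2
  convert this using 1
  ring

/-- The right unit on `v_{n+1}`, if only one of the `t_i` is non-zero. -/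
theorem etaEval_single {B : Type} [CommRing B] (m : ℕ) (v : ℕ → B) (s : B) :
    etaEval p v (Pi.single m s) m = v m + p * s ∧
    ∀ k, etaEval p v (Pi.single m s) (m + k + 1) -
      (v (m + k + 1) + v k * s ^ p ^ (k + 1) - s * v k ^ p ^ (m + 1)) ∈
        Ideal.span {x | x = (p : B) ∨ ∃ j, j < k ∧ x = v j} := by
  obtain ⟨-, h1, h2⟩ := etaEval_single_aux p m _ rfl _ rfl
  set f := (MvPolynomial.aeval (fun i => i.elim s v) :
    MvPolynomial (Option ℕ) ℤ →ₐ[ℤ] B).toRingHom with hf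
  have hfv : f ∘ (fun i => MvPolynomial.X (some i)) = v := by funext i; simp [hf]
  have hfv' : ∀ i, f (MvPolynomial.X (some i)) = v i := congrFun hfv
  have hfs : f (MvPolynomial.X none) = s := by simp [hf]
  have hft : f ∘ (Pi.single m (MvPolynomial.X none)) = Pi.single m s := by
    funext i
    rw [Function.comp_apply, Pi.single_apply, Pi.single_apply]
    split_ifs
    · exact hfs
    · exact map_zero f
  constructor
  · have := congrArg f h1
    rwa [map_etaEval, hfv, hft, map_add, map_mul, map_natCast, hfv', hfs] at this
  · intro k
    have := Ideal.mem_map_of_mem f (h2 k)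
    rw [Ideal.map_span, map_sub, map_etaEval, hfv, hft] at this
    simp only [map_add, map_sub, map_mul, map_pow, hfv', hfs] at this
    refine Ideal.span_mono ?_ this
    rintro _ ⟨x, rfl | ⟨j, hj, rfl⟩, rfl⟩
    · exact Or.inl (map_natCast f p)
    · exact Or.inr ⟨j, hj, hfv' j⟩

end SingleVariable

/-! ### Annihilators of polynomials with coefficients in a module -/

section PolynomialAnnihilator

variable {A : Type*} [CommRing A] {M : Type*} [AddCommGroup M] [Module A M]

/-- The coefficient of `h • F` in the highest possible degree is the leading coefficient of `h`
times the top coefficient of `F`. Multiplication by the leading coefficient thus lowers the degree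
bound `N` by one. -/
theorem leadingCoeff_pow_smul_eq_zero (h : Polynomial A) (N : ℕ) (F : PolynomialModule A M)
    (hF : ∀ k, N ≤ k → F.coeff k = 0) (hh : h • F = 0) :
    (Polynomial.C h.leadingCoeff) ^ N • F = 0 := by
  induction N generalizing F with
  | zero =>
    rw [pow_zero, one_smul]
    exact PolynomialModule.coeff_injective (Finsupp.ext fun k => hF k (Nat.zero_le k))
  | succ N ih =>
    have hC : ∀ k, (Polynomial.C h.leadingCoeff • F).coeff k = h.leadingCoeff • F.coeff k := fun k => by
      rw [← Polynomial.monomial_zero_left, PolynomialModule.monomial_smul_apply]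
      simp
    rw [pow_succ, mul_smul]
    apply ih
    · intro k hk
      rw [hC]
      rcases Nat.eq_or_lt_of_le hk with rfl | hk
      · have h1 : (h • F).coeff (h.natDegree + N) = 0 := by rw [hh]; rfl
        rw [PolynomialModule.smul_apply, Finset.sum_eq_single (h.natDegree, N)] at h1
        · exact h1
        · rintro ⟨i, j⟩ hij hne
          rw [Finset.HasAntidiagonal.mem_antidiagonal] at hij
          simp only at hij ⊢
          rcases lt_trichotomy i h.natDegree with hi | hi | hi
          · rw [hF j (by omega), smul_zero]
          · exact absurd (Prod.ext hi (by simp only; omega)) hne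
          · rw [Polynomial.coeff_eq_zero_of_natDegree_lt hi, zero_smul]
        · intro h2
          exact (h2 (by simp)).elim
      · rw [hF k hk, smul_zero]
    · rw [smul_comm, hh, smul_zero]

theorem exists_leadingCoeff_pow_smul_eq_zero (h : Polynomial A) (F : PolynomialModule A M)
    (hh : h • F = 0) : ∃ N, (Polynomial.C h.leadingCoeff) ^ N • F = 0 := by
  refine ⟨F.coeff.support.sup id + 1, leadingCoeff_pow_smul_eq_zero h _ F (fun k hk => ?_) hh⟩
  by_contra hne
  have := Finset.le_sup (f := id) (Finsupp.mem_support_iff.2 hne)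
  simp only [id] at this
  omega

/-- The coefficients of a polynomial which is nilpotent on an element `F` are nilpotent on `F`. -/
theorem C_coeff_mem_radical [IsDomain A] (F : PolynomialModule A M) (h : Polynomial A)
    (hh : h ∈ (Ideal.torsionOf (Polynomial A) _ F).radical) (i : ℕ) :
    Polynomial.C (h.coeff i) ∈ (Ideal.torsionOf (Polynomial A) _ F).radical := by
  induction hc : h.support.card using Nat.strong_induction_on generalizing h with
  | _ c ih =>
  by_cases h0 : h = 0
  · rw [h0, Polynomial.coeff_zero, map_zero]
    exact zero_mem _
  -- Over a domain the leading coefficient of `h ^ K` is the `K`-th power of that of `h`. Once the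
  -- leading coefficient is known to lie in the radical, the leading term can be removed, and the
  -- number of terms drops.
  have hlead : Polynomial.C h.leadingCoeff ∈ (Ideal.torsionOf (Polynomial A) _ F).radical := by
    obtain ⟨K, hK⟩ := hh
    rw [Ideal.mem_torsionOf_iff] at hK
    obtain ⟨N, hN⟩ := exists_leadingCoeff_pow_smul_eq_zero _ _ hK
    refine ⟨K * N, ?_⟩
    rw [Ideal.mem_torsionOf_iff, pow_mul, ← map_pow, ← Polynomial.leadingCoeff_pow]
    exact hN
  by_cases hi : i = h.natDegree
  · subst hi; exact hlead
  · rw [← Polynomial.eraseLead_coeff_of_ne i hi]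
    refine ih _ (hc ▸ Polynomial.eraseLead_support_card_lt h0) _ ?_ rfl
    rw [← Polynomial.self_sub_C_mul_X_pow]
    exact sub_mem hh (Ideal.mul_mem_right _ _ hlead)

end PolynomialAnnihilator

/-! ### `v_n`-torsion elements of a comodule are `v_j`-torsion for `j ≤ n` -/

section Torsion

variable {p : ℕ} [hp : Fact p.Prime]

instance : IsDomain (ZLoc p) := inferInstanceAs (IsDomain (Localization.AtPrime _))

instance : IsDomain (BP p) := inferInstanceAs (IsDomain (MvPolynomial ℕ (ZLoc p)))

section

variable {M : Type} [AddCommGroup M] [Module (BP p) M]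

variable (M) in
/-- Substitution of a single variable for `t_{m+1}` and of `0` for the other `t_i`. -/
def toPolyModule (m : ℕ) : BPBP p ⊗[BP p] M →+ PolynomialModule (BP p) M :=
  TensorProduct.liftAddHom
    (AddMonoidHom.mk' (fun g => AddMonoidHom.mk'
      (fun x => MvPolynomial.aeval (Pi.single m (Polynomial.X : Polynomial (BP p))) g •
        PolynomialModule.single (BP p) 0 x)
      (fun x y => by rw [PolynomialModule.single_add, smul_add]))
      (fun g g' => AddMonoidHom.ext fun x => by
        simp only [AddMonoidHom.mk'_apply, AddMonoidHom.add_apply]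
        rw [map_add, add_smul]))
    (fun a g x => by
      simp only [AddMonoidHom.mk'_apply]
      rw [map_smul, smul_assoc, ← smul_comm, PolynomialModule.single_smul])

theorem toPolyModule_tmul (m : ℕ) (g : BPBP p) (x : M) : toPolyModule M m (g ⊗ₜ x) =
    MvPolynomial.aeval (Pi.single m (Polynomial.X : Polynomial (BP p))) g •
        PolynomialModule.single (BP p) 0 x := rfl

theorem toPolyModule_smul (m : ℕ) (g : BPBP p) (z : BPBP p ⊗[BP p] M) :
    toPolyModule M m (g • z) =
      MvPolynomial.aeval (Pi.single m (Polynomial.X : Polynomial (BP p))) g •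
        toPolyModule M m z := by
  induction z using TensorProduct.induction_on with
  | zero => simp
  | tmul a x => rw [TensorProduct.smul_tmul', toPolyModule_tmul, toPolyModule_tmul, smul_eq_mul,
      map_mul, mul_smul]
  | add x y hx hy => rw [smul_add, map_add, hx, hy, map_add, smul_add]

/-- Setting the remaining variable to zero is the counit, so the polynomial attached to `ψ(x)` has
constant coefficient `x`. -/
theorem toPolyModule_zero (m : ℕ) (z : BPBP p ⊗[BP p] M) : (toPolyModule M m z).coeff 0 =
    TensorProduct.lid (BP p) M ((counit p).toLinearMap.rTensor M z) := by
  induction z using TensorProduct.induction_on with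
  | zero => simp
  | tmul g x =>
    have h : ∀ g : BPBP p, (MvPolynomial.aeval (Pi.single m (Polynomial.X : Polynomial (BP p)))
        g).coeff 0 = counit p g := fun g => by
      have : (Polynomial.aeval (0 : BP p)).comp (MvPolynomial.aeval (Pi.single m
          (Polynomial.X : Polynomial (BP p)))) = counit p := by
        refine MvPolynomial.algHom_ext fun i => ?_
        rw [AlgHom.comp_apply, MvPolynomial.aeval_X, counit, MvPolynomial.aeval_X, Pi.single_apply]
        split_ifs <;> simp
      rw [← this, AlgHom.comp_apply, Polynomial.coeff_zero_eq_aeval_zero]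
    rw [toPolyModule_tmul, PolynomialModule.smul_single_apply, if_pos (Nat.zero_le _), h]
    simp
  | add x y hx hy =>
    rw [map_add, map_add, map_add, ← hx, ← hy]
    rfl

end

theorem coact_smul_pow (M : Comod p) (a : BP p) (N : ℕ) (x : M.carrier) :
    M.coact (a ^ N • x) = etaR p a ^ N • M.coact x := by
  rw [LinearMap.map_smulₛₗ, map_pow]

/-- The elements of `BP_*` which are nilpotent on an element. -/
def nilIdeal {M : Type*} [AddCommGroup M] [Module (BP p) M] (x : M) : Ideal (BP p) :=
  (Ideal.torsionOf (BP p) M x).radical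

theorem mem_nilIdeal {M : Type*} [AddCommGroup M] [Module (BP p) M] {x : M} {a : BP p} :
    a ∈ nilIdeal x ↔ ∃ N : ℕ, a ^ N • x = 0 := Iff.rfl

/-- From `a ^ N x = 0` semilinearity gives `η_R(a) ^ N ψ(x) = 0`. After restriction to one variable,
each coefficient of `η_R(a)` is nilpotent on the polynomial of `ψ(x)`, and in particular on its
constant coefficient `x`. -/
theorem coeff_etaR_mem_nilIdeal (M : Comod p) (x : M.carrier) (a : BP p) (ha : a ∈ nilIdeal x)
    (m i : ℕ) : (MvPolynomial.aeval (Pi.single m (Polynomial.X : Polynomial (BP p)))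
      (etaR p a)).coeff i ∈ nilIdeal x := by
  set F := toPolyModule M.carrier m (M.coact x) with hF
  have h1 : MvPolynomial.aeval (Pi.single m (Polynomial.X : Polynomial (BP p))) (etaR p a) ∈
      (Ideal.torsionOf (Polynomial (BP p)) _ F).radical := by
    obtain ⟨N, hN⟩ := ha
    refine ⟨N, ?_⟩
    rw [Ideal.mem_torsionOf_iff] at hN ⊢
    rw [hF, ← map_pow, ← toPolyModule_smul, ← coact_smul_pow, hN, map_zero, map_zero]
  obtain ⟨K, hK⟩ := C_coeff_mem_radical F _ h1 i
  refine ⟨K, ?_⟩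
  rw [Ideal.mem_torsionOf_iff] at hK ⊢
  have h2 := congrArg (fun G : PolynomialModule (BP p) M.carrier => G.coeff 0) hK
  rw [← map_pow, ← Polynomial.monomial_zero_left, PolynomialModule.monomial_smul_apply,
    if_pos le_rfl, Nat.sub_zero, hF, toPolyModule_zero, M.counit_coact] at h2
  exact h2

theorem vGen_succ (n : ℕ) : vGen p (n + 1) = vVar p n := rfl

theorem vGen_zero : vGen p 0 = p := rfl

/-- A `v_n`-torsion element of a comodule is `v_j`-torsion for all `j ≤ n`. -/
theorem vGen_mem_nilIdeal (M : Comod p) (x : M.carrier) {n : ℕ} (hx : vGen p n ∈ nilIdeal x)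
    {j : ℕ} (hj : j ≤ n) : vGen p j ∈ nilIdeal x := by
  cases n with
  | zero => rwa [Nat.le_zero.1 hj]
  | succ r =>
  rw [vGen_succ] at hx
  have hχ : ∀ m, MvPolynomial.aeval (Pi.single m (Polynomial.X : Polynomial (BP p)))
      (etaR p (vVar p r)) = etaEval p (fun i => Polynomial.C (vVar p i))
        (Pi.single m Polynomial.X) r := fun m => by
    rw [etaR_X]
    refine (map_etaEval p (B := BPBP p) (C := Polynomial (BP p)) (MvPolynomial.aeval
      (Pi.single m (Polynomial.X : Polynomial (BP p)))).toRingHom _ _ _).trans ?_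
    congr 1
    · funext i
      exact (MvPolynomial.aeval (Pi.single m (Polynomial.X : Polynomial (BP p)))).commutes _
    · funext i
      exact MvPolynomial.aeval_X _ _
  have hmem := coeff_etaR_mem_nilIdeal M x _ hx
  simp only [hχ] at hmem
  -- With `t_{r+1}` as the variable, the right unit of `v_{r+1}` is `v_{r+1} + p t`; its linear
  -- coefficient is `p`.
  have hp' : (p : BP p) ∈ nilIdeal x := by
    have := hmem r 1
    rw [(etaEval_single p r _ _).1] at this
    simpa [Polynomial.coeff_C] using this
  -- With `t_{m+1}` as the variable, for `r = m + k + 1`, the coefficient of `t ^ p ^ (k + 1)` in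
  -- `η_R(v_{r+1})` is `v_{k+1}` modulo `p, v_1, …, v_k`, and these are nilpotent on `x` by
  -- induction.
  have hv : ∀ k ≤ r, vVar p k ∈ nilIdeal x := fun k => by
    induction k using Nat.strong_induction_on with
    | _ k ih =>
    intro hk
    rcases Nat.eq_or_lt_of_le hk with rfl | hk
    · exact hx
    obtain ⟨m, rfl⟩ : ∃ m, r = m + k + 1 := ⟨r - k - 1, by omega⟩
    have h1 := (etaEval_single p m (fun i => Polynomial.C (vVar p i)) Polynomial.X).2 k
    have h2 : (Ideal.span {x : Polynomial (BP p) | x = p ∨ ∃ j, j < k ∧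
        x = Polynomial.C (vVar p j)}) ≤ (nilIdeal x).map Polynomial.C := by
      refine Ideal.span_le.2 ?_
      rintro _ (rfl | ⟨j, hj, rfl⟩)
      · have := Ideal.mem_map_of_mem Polynomial.C hp'
        rwa [map_natCast] at this
      · exact Ideal.mem_map_of_mem _ (ih j hj (by omega))
    have h3 := Ideal.mem_map_C_iff.1 (h2 h1) (p ^ (k + 1))
    -- The term with the first power of `t` does not interfere, because the relevant exponent is
    -- larger than `1`.
    have h4 : 1 ≠ p ^ (k + 1) := (Nat.one_lt_pow (by omega) hp.out.one_lt).ne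
    have h5 : p ^ (k + 1) ≠ 0 := pow_ne_zero _ hp.out.ne_zero
    rw [Polynomial.coeff_sub, Polynomial.coeff_sub, Polynomial.coeff_add, Polynomial.coeff_C,
      if_neg h5, Polynomial.coeff_C_mul_X_pow, if_pos rfl, ← Polynomial.C_pow,
      Polynomial.coeff_mul_C,
      Polynomial.coeff_X_of_ne_one h4.symm, zero_mul, sub_zero, zero_add] at h3
    have := sub_mem (hmem m (p ^ (k + 1))) h3
    rwa [sub_sub_cancel] at this
  cases j with
  | zero => exact hp'
  | succ j => exact hv j (by omega)

/-- If the generators of `I_{n+1}` are nilpotent on an element of a comodule, then they are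
nilpotent on the components of its coaction. -/
theorem vGen_mem_nilIdeal_tcoeff (M : Comod p) (x : M.carrier) {n : ℕ}
    (hx : vGen p n ∈ nilIdeal x) (e : ℕ →₀ ℕ) : vGen p n ∈ nilIdeal (tcoeff e (M.coact x)) := by
  have h1 : ∀ j ≤ n, etaR p (vGen p j) ∈ (Ideal.torsionOf (BPBP p) _ (M.coact x)).radical :=
    fun j hj => by
      obtain ⟨N, hN⟩ := vGen_mem_nilIdeal M x hx hj
      refine ⟨N, ?_⟩
      rw [Ideal.mem_torsionOf_iff] at hN ⊢
      rw [← coact_smul_pow, hN, map_zero]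
  -- Left and right unit of `v_j` agree modulo the lower generators, so nilpotence on `ψ(x)` passes
  -- from the right to the left unit by induction on `j`.
  have h2 : ∀ j ≤ n, MvPolynomial.C (vGen p j) ∈
      (Ideal.torsionOf (BPBP p) _ (M.coact x)).radical := fun j => by
    induction j using Nat.strong_induction_on with
    | _ j ih =>
    intro hj
    have h3 : (idealI p j).map (MvPolynomial.C : BP p →+* BPBP p) ≤
        (Ideal.torsionOf (BPBP p) _ (M.coact x)).radical := by
      rw [idealI, Ideal.map_span, Ideal.span_le]
      rintro _ ⟨_, ⟨i, hi, rfl⟩, rfl⟩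
      have hi : i < j := by exact_mod_cast hi
      exact ih i hi (by omega)
    have := sub_mem (h1 j hj) (h3 (etaR_vGen p j))
    rwa [sub_sub_cancel] at this
  obtain ⟨N, hN⟩ := h2 n le_rfl
  refine ⟨N, ?_⟩
  rw [Ideal.mem_torsionOf_iff] at hN ⊢
  rw [← map_smul, ← map_zero (tcoeff (p := p) (M := M.carrier) e), ← hN, ← map_pow,
    ← MvPolynomial.algebraMap_eq, algebraMap_smul]

end Torsion

/-! ### Laurent polynomials as a device for gradings -/

section Laurent

variable {R S : Type*} [CommRing R] [CommRing S]

/-- The ring homomorphism from Laurent polynomials given by a homomorphism on coefficients and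
the images of the powers of `T`. -/
def laurentLift (f : R →+* S) (u : Multiplicative ℤ →* S) : LaurentPolynomial R →+* S :=
  AddMonoidAlgebra.liftNCRingHom f u fun _ _ => Commute.all _ _

theorem laurentLift_C_mul_T (f : R →+* S) (u : Multiplicative ℤ →* S) (a : R) (d : ℤ) :
    laurentLift f u (LaurentPolynomial.C a * LaurentPolynomial.T d) =
      f a * u (Multiplicative.ofAdd d) := by
  rw [← LaurentPolynomial.single_eq_C_mul_T]
  exact AddMonoidAlgebra.liftNC_single (f : R →+ S) _ d a

theorem laurentLift_C (f : R →+* S) (u : Multiplicative ℤ →* S) (a : R) :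
    laurentLift f u (LaurentPolynomial.C a) = f a := by
  rw [← mul_one (LaurentPolynomial.C a), ← LaurentPolynomial.T_zero, laurentLift_C_mul_T, ofAdd_zero,
    map_one, mul_one]

theorem laurentLift_T (f : R →+* S) (u : Multiplicative ℤ →* S) (d : ℤ) :
    laurentLift f u (LaurentPolynomial.T d) = u (Multiplicative.ofAdd d) := by
  rw [← one_mul (LaurentPolynomial.T d), ← map_one LaurentPolynomial.C, laurentLift_C_mul_T,
    map_one, one_mul]

theorem laurent_hom_ext {f g : LaurentPolynomial R →+* S}
    (hC : ∀ a, f (LaurentPolynomial.C a) = g (LaurentPolynomial.C a))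
    (hT : ∀ d, f (LaurentPolynomial.T d) = g (LaurentPolynomial.T d)) : f = g :=
  RingHom.ext fun x => by
    induction x using LaurentPolynomial.induction_on' with
    | add x y hx hy => rw [map_add, map_add, hx, hy]
    | C_mul_T d a => rw [map_mul, map_mul, hC, hT]

variable (R) in
/-- The powers of `T`. -/
def laurentT : Multiplicative ℤ →* LaurentPolynomial R where
  toFun d := LaurentPolynomial.T d.toAdd
  map_one' := LaurentPolynomial.T_zero
  map_mul' _ _ := LaurentPolynomial.T_add _ _

end Laurent

/-! ### Ring homomorphisms that differ by a twist by the degree -/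

section Scaling

variable {R S : Type*} [CommRing R] [CommRing S]

theorem map_monomial_scale {σ : Type} {w : σ → ℤ} (U : Multiplicative ℤ →* S)
    {f g : MvPolynomial σ R →+* S}
    (hX : ∀ i, f (MvPolynomial.X i) = g (MvPolynomial.X i) * U (Multiplicative.ofAdd (w i)))
    (e : σ →₀ ℕ) (c : R) : f (MvPolynomial.monomial e c) = f (MvPolynomial.C c) *
      g (MvPolynomial.monomial e 1) * U (Multiplicative.ofAdd (Finsupp.weight w e)) := by
  rw [MvPolynomial.monomial_eq, MvPolynomial.monomial_eq, map_mul, map_mul, mul_assoc, map_one,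
    map_one, one_mul, Finsupp.weight_apply, Finsupp.sum, ofAdd_sum, map_prod, Finsupp.prod,
    map_prod, map_prod, ← Finset.prod_mul_distrib]
  congr 1
  refine Finset.prod_congr rfl fun i _ => ?_
  rw [map_pow, map_pow, hX, mul_pow, ofAdd_nsmul, map_pow]

variable (p : ℕ) [hp : Fact p.Prime]

/-- Degrees add under multiplication and `U` turns sums into products, so two homomorphisms that
differ on the generators by the twist differ by it on all homogeneous elements. -/
theorem BP_map_scale (U : Multiplicative ℤ →* S) {f g : BP p →+* S}
    (hC : ∀ r : ZLoc p, f (algebraMap _ _ r) = g (algebraMap _ _ r))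
    (hX : ∀ i, f (vVar p i) = g (vVar p i) * U (Multiplicative.ofAdd (genDeg p i)))
    {d : ℤ} {a : BP p} (ha : a ∈ BPdeg p d) : f a = g a * U (Multiplicative.ofAdd d) := by
  have has := MvPolynomial.as_sum (R := ZLoc p) (σ := ℕ) a
  have h1 : ∀ (h : BP p →+* S), h a = ∑ e ∈ MvPolynomial.support (R := ZLoc p) (σ := ℕ) a,
      h (MvPolynomial.monomial (R := ZLoc p) (σ := ℕ) e (MvPolynomial.coeff (R := ZLoc p) e a)) :=
    fun h => by
      conv_lhs => rw [has]
      exact map_sum h _ _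
  rw [h1 f, h1 g, Finset.sum_mul]
  refine Finset.sum_congr rfl fun e he => ?_
  refine (map_monomial_scale (R := ZLoc p) (σ := ℕ) U (f := f) (g := g) hX e _).trans ?_
  have h2 : Finsupp.weight (genDeg p) e = d := ha (MvPolynomial.mem_support_iff.1 he)
  have h3 : ∀ c, MvPolynomial.monomial (R := ZLoc p) e c = MvPolynomial.C c *
      MvPolynomial.monomial e 1 := fun c => by rw [MvPolynomial.C_mul_monomial, mul_one]
  rw [h2, h3 (MvPolynomial.coeff (R := ZLoc p) e a)]
  congr 1
  refine Eq.trans ?_ (map_mul g _ _).symm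
  congr 1
  exact hC _

theorem BPBP_map_scale (U : Multiplicative ℤ →* S) {f g : BPBP p →+* S}
    (hC : ∀ (d : ℤ), ∀ a ∈ BPdeg p d, f (MvPolynomial.C a) =
      g (MvPolynomial.C a) * U (Multiplicative.ofAdd d))
    (hX : ∀ i, f (MvPolynomial.X i) =
      g (MvPolynomial.X i) * U (Multiplicative.ofAdd (genDeg p i)))
    {d : ℤ} {a : BPBP p} (ha : a ∈ BPBPdeg p d) : f a = g a * U (Multiplicative.ofAdd d) := by
  have h1 : ∀ (h : BPBP p →+* S), h a = ∑ e ∈ a.support,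
      h (MvPolynomial.monomial e (MvPolynomial.coeff e a)) := fun h => by
    conv_lhs => rw [MvPolynomial.as_sum a]
    exact map_sum h _ _
  rw [h1 f, h1 g, Finset.sum_mul]
  refine Finset.sum_congr rfl fun e he => ?_
  have h3 : ∀ c : BP p, MvPolynomial.monomial e c = MvPolynomial.C c *
      MvPolynomial.monomial e 1 := fun c => by rw [MvPolynomial.C_mul_monomial, mul_one]
  rw [map_monomial_scale U hX e, hC _ _ (ha e), h3 (MvPolynomial.coeff e a), map_mul]
  have h4 : U (Multiplicative.ofAdd (d - Finsupp.weight (genDeg p) e)) *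
      U (Multiplicative.ofAdd (Finsupp.weight (genDeg p) e)) = U (Multiplicative.ofAdd d) := by
    rw [← map_mul, ← ofAdd_add, sub_add_cancel]
  linear_combination g (MvPolynomial.C (MvPolynomial.coeff e a)) *
    g (MvPolynomial.monomial e 1) * h4

end Scaling

/-! ### The ring `BP_*BP[T, T⁻¹]` and its coaction -/

section CofreeRing

variable (p : ℕ) [hp : Fact p.Prime]

/-- The right unit for `BP_*BP[T, T⁻¹]`, which sends an element `a` of degree `d` to
`η_R(a) T ^ d`. -/
def rho : BP p →+* LaurentPolynomial (BPBP p) :=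
  MvPolynomial.eval₂Hom (R := ZLoc p) (σ := ℕ)
    (LaurentPolynomial.C.comp (MvPolynomial.C.comp (algebraMap (ZLoc p) (BP p))))
    (fun i => LaurentPolynomial.C (etaR p (vVar p i)) * LaurentPolynomial.T (genDeg p i))

theorem rho_C (r : ZLoc p) : rho p (algebraMap _ _ r) =
    LaurentPolynomial.C (MvPolynomial.C (algebraMap _ _ r)) :=
  MvPolynomial.eval₂Hom_C _ _ _

theorem rho_vVar (i : ℕ) : rho p (vVar p i) =
    LaurentPolynomial.C (etaR p (vVar p i)) * LaurentPolynomial.T (genDeg p i) :=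
  MvPolynomial.eval₂Hom_X' _ _ _

theorem rho_of_mem {d : ℤ} {a : BP p} (ha : a ∈ BPdeg p d) :
    rho p a = LaurentPolynomial.C (etaR p a) * LaurentPolynomial.T d :=
  BP_map_scale p (laurentT _) (f := rho p) (g := LaurentPolynomial.C.comp (etaR p))
    (fun r => by rw [rho_C, RingHom.comp_apply, etaR_C]) (rho_vVar p) ha

/-- The ring `BP_*BP[T, T⁻¹]`, as an algebra by the right unit. -/
def Gr : Type := LaurentPolynomial (BPBP p)

instance : CommRing (Gr p) := inferInstanceAs (CommRing (LaurentPolynomial (BPBP p)))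

/-- The right unit is the structure for which the coaction will be semilinear. The degree is carried
by `T` alone, whatever the degree of the coefficient, since linear maps out of a comodule need not
respect degrees. -/
instance : Algebra (BP p) (Gr p) := (rho p).toAlgebra

/-- The inclusion of the coefficients. -/
def grC : BPBP p →+* Gr p := (LaurentPolynomial.C : BPBP p →+* LaurentPolynomial (BPBP p))

/-- The powers of `T`. -/
def grT : Multiplicative ℤ →* Gr p := laurentT (BPBP p)

theorem algebraMap_Gr_of_mem {d : ℤ} {a : BP p} (ha : a ∈ BPdeg p d) :
    algebraMap (BP p) (Gr p) a = grC p (etaR p a) * grT p (Multiplicative.ofAdd d) :=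
  rho_of_mem p ha

/-- The ring homomorphism from `Gr` given by a homomorphism on coefficients and
the images of the powers of `T`. -/
def grLift {S : Type*} [CommRing S] (f : BPBP p →+* S) (u : Multiplicative ℤ →* S) : Gr p →+* S :=
  laurentLift f u

theorem grLift_C {S : Type*} [CommRing S] (f : BPBP p →+* S) (u : Multiplicative ℤ →* S)
    (a : BPBP p) : grLift p f u (grC p a) = f a := laurentLift_C f u a

theorem grLift_T {S : Type*} [CommRing S] (f : BPBP p →+* S) (u : Multiplicative ℤ →* S)
    (d : Multiplicative ℤ) : grLift p f u (grT p d) = u d := laurentLift_T f u d.toAdd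

theorem BPBP_hom_ext {S : Type*} [CommRing S] {f g : BPBP p →+* S}
    (hC : ∀ a : BP p, f (MvPolynomial.C a) = g (MvPolynomial.C a))
    (hX : ∀ i, f (tOne p i) = g (tOne p i)) : f = g :=
  MvPolynomial.ringHom_ext hC hX

theorem gr_hom_ext {S : Type*} [CommRing S] {f g : Gr p →+* S}
    (hC : ∀ a, f (grC p (MvPolynomial.C a)) = g (grC p (MvPolynomial.C a)))
    (hX : ∀ i, f (grC p (tOne p i)) = g (grC p (tOne p i)))
    (hT : ∀ d, f (grT p d) = g (grT p d)) : f = g :=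
  laurent_hom_ext (fun a => RingHom.congr_fun (BPBP_hom_ext p (f := f.comp (grC p))
    (g := g.comp (grC p)) hC hX) a) hT

/-- The degree `d` part of `Gr`. -/
def grDeg (d : ℤ) : AddSubgroup (Gr p) :=
  AddMonoidHom.range ((AddMonoidHom.mulRight (grT p (Multiplicative.ofAdd d))).comp
    (grC p : BPBP p →+ Gr p))

/-- The target of the coaction of `Gr`. -/
abbrev GrTensor : Type := BPBP p ⊗[BP p] Gr p

/-- `1 ⊗ T ^ d`. -/
def gtT : Multiplicative ℤ →* GrTensor p :=
  ((Algebra.TensorProduct.includeRight : Gr p →ₐ[BP p] GrTensor p) : Gr p →* GrTensor p).comp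
    (grT p)

/-- `1 ⊗ T ^ (-d)`. -/
def gtTinv : Multiplicative ℤ →* GrTensor p := (gtT p).comp invMonoidHom

theorem gtT_apply (d : Multiplicative ℤ) : gtT p d = 1 ⊗ₜ grT p d := rfl

theorem gtTinv_apply (d : Multiplicative ℤ) : gtTinv p d = 1 ⊗ₜ grT p d⁻¹ := rfl

/-- `g ↦ 1 ⊗ g`. -/
def gtC : BPBP p →+* GrTensor p :=
  ((Algebra.TensorProduct.includeRight : Gr p →ₐ[BP p] GrTensor p) : Gr p →+* GrTensor p).comp
    (grC p)

theorem gtC_apply (g : BPBP p) : gtC p g = 1 ⊗ₜ grC p g := rfl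

/-- `g ↦ g ⊗ 1`. -/
def gtL : BPBP p →+* GrTensor p :=
  ((Algebra.TensorProduct.includeLeft : BPBP p →ₐ[BP p] GrTensor p) : BPBP p →+* GrTensor p)

theorem gtL_apply (g : BPBP p) : gtL p g = g ⊗ₜ 1 := rfl

/-- The map sending `x ⊗ y`, for `y` of degree `d`, to `y ⊗ x T ^ (-d)`. -/
def theta : BPBP2 p →+* GrTensor p :=
  MvPolynomial.eval₂Hom (gtC p) fun i =>
    gtL p (tOne p i) * gtTinv p (Multiplicative.ofAdd (genDeg p i))

theorem theta_inl (g : BPBP p) : theta p (inl p g) = gtC p g :=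
  MvPolynomial.eval₂Hom_C _ _ _

theorem theta_tRight (i : ℕ) : theta p (tRight p i) =
    gtL p (tOne p i) * gtTinv p (Multiplicative.ofAdd (genDeg p i)) :=
  MvPolynomial.eval₂Hom_X' _ _ _

/-- The tensor product is balanced between the left unit of `Γ` and the twisted right unit of `Gr`,
so an element of degree `d` crosses it at the price of `T ^ d`. -/
theorem gtL_C_of_mem {d : ℤ} {a : BP p} (ha : a ∈ BPdeg p d) :
    gtL p (MvPolynomial.C a) = gtC p (etaR p a) * gtT p (Multiplicative.ofAdd d) := by
  rw [gtL_apply, gtC_apply, gtT_apply, Algebra.TensorProduct.tmul_mul_tmul, one_mul,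
    ← algebraMap_Gr_of_mem p ha, Algebra.algebraMap_eq_smul_one, ← smul_tmul,
    MvPolynomial.smul_eq_C_mul, mul_one]

theorem gtT_mul_gtTinv (d : Multiplicative ℤ) : gtT p d * gtTinv p d = 1 := by
  rw [gtTinv, MonoidHom.comp_apply, ← map_mul, invMonoidHom_apply, mul_inv_cancel, map_one]

theorem gtC_etaR_of_mem {d : ℤ} {a : BP p} (ha : a ∈ BPdeg p d) : gtC p (etaR p a) =
    gtL p (MvPolynomial.C a) * gtTinv p (Multiplicative.ofAdd d) := by
  rw [gtL_C_of_mem p ha, mul_assoc, gtT_mul_gtTinv, mul_one]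

/-- The power `T ^ (-d)` compensates for the twist in the balancing relation `gtL_C_of_mem`. Without
it `theta` would not be compatible with the identification of units in `Γ ⊗ Γ`. -/
theorem theta_inr {d : ℤ} {g : BPBP p} (hg : g ∈ BPBPdeg p d) :
    theta p (inr p g) = gtL p g * gtTinv p (Multiplicative.ofAdd d) := by
  refine BPBP_map_scale p (gtTinv p) (f := (theta p).comp (inr p)) (g := gtL p)
    (fun d a ha => ?_) (fun i => ?_) hg
  · rw [RingHom.comp_apply, inr_C, theta_inl, gtC_etaR_of_mem p ha]
  · rw [RingHom.comp_apply, inr, MvPolynomial.eval₂Hom_X', theta_tRight]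
    rfl

/-- The coaction of `Gr`. -/
def psi : Gr p →+* GrTensor p := grLift p ((theta p).comp (comul p).toRingHom) (gtT p)

theorem psi_C (g : BPBP p) : psi p (grC p g) = theta p (comul p g) := grLift_C p _ _ g

theorem psi_T (d : Multiplicative ℤ) : psi p (grT p d) = gtT p d := grLift_T p _ _ d

theorem theta_C (a : BP p) : theta p (algebraMap _ _ a) = gtC p (MvPolynomial.C a) :=
  theta_inl p (MvPolynomial.C a)

theorem psi_C_C (a : BP p) : psi p (grC p (MvPolynomial.C a)) = gtC p (MvPolynomial.C a) := by
  rw [psi_C, ← theta_C]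
  exact congrArg (theta p) ((comul p).commutes a)

theorem psi_C_tOne (i : ℕ) : psi p (grC p (tOne p i)) = deltaEval p (gtC p ∘ vOne p)
    (gtC p ∘ tOne p) (fun i => gtL p (tOne p i) * gtTinv p (Multiplicative.ofAdd (genDeg p i))) i := by
  have h : comul p (tOne p i) = deltaEval p (vTwo p) (tLeft p) (tRight p) i :=
    MvPolynomial.aeval_X _ _
  rw [psi_C, h, map_deltaEval]
  congr 1
  · funext i; exact theta_inl p _
  · funext i; exact theta_inl p _
  · funext i; exact theta_tRight p i

/-- This is the semilinearity of the coaction: `Δ η_R(a) = 1 ⊗ η_R(a)`, and the power `T ^ (-d)`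
which `theta` attaches to it cancels the `T ^ d` contained in `ρ(a)`. -/
theorem psi_rho (a : BP p) : psi p (algebraMap _ _ a) = gtL p (etaR p a) := by
  refine RingHom.congr_fun (BP_hom_ext p (f := (psi p).comp (algebraMap _ _))
    (g := (gtL p).comp (etaR p)) (fun r => ?_) fun i => ?_) a
  · rw [RingHom.comp_apply, RingHom.comp_apply, etaR_C, gtL_C_of_mem p (algebraMap_mem p r),
      algebraMap_Gr_of_mem p (algebraMap_mem p r), map_mul, psi_T, etaR_C, psi_C_C]
  · rw [RingHom.comp_apply, RingHom.comp_apply, algebraMap_Gr_of_mem p (vVar_mem p i), map_mul,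
      psi_C, psi_T, comul_etaR, theta_inr p (etaR_mem p (vVar_mem p i)), mul_assoc,
      mul_comm (gtTinv p _), gtT_mul_gtTinv, mul_one]

/-- Evaluation of `Gr` at `t_i = 0` and `T = 1`. -/
def grCounit : Gr p →+* BP p := grLift p (counit p).toRingHom 1

theorem grCounit_C (g : BPBP p) : grCounit p (grC p g) = counit p g := grLift_C p _ _ g

theorem grCounit_T (d : Multiplicative ℤ) : grCounit p (grT p d) = 1 := grLift_T p _ _ d

theorem grCounit_algebraMap (a : BP p) : grCounit p (algebraMap _ _ a) = a := by
  refine RingHom.congr_fun (BP_hom_ext p (f := (grCounit p).comp (algebraMap _ _))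
    (g := RingHom.id _) (fun r => ?_) fun i => ?_) a
  · rw [RingHom.comp_apply, algebraMap_Gr_of_mem p (algebraMap_mem p r), map_mul, grCounit_C,
      counit_etaR, grCounit_T, mul_one]
    rfl
  · rw [RingHom.comp_apply, algebraMap_Gr_of_mem p (vVar_mem p i), map_mul, grCounit_C,
      counit_etaR, grCounit_T, mul_one]
    rfl

/-- The linear form of `grCounit`. -/
def grCounitAlg : Gr p →ₐ[BP p] BP p :=
  { grCounit p with commutes' := grCounit_algebraMap p }

/-- Both sides are ring homomorphisms, so the generators suffice; on the `t_i` this is the law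
`deltaEval_zero_right`. -/
theorem counit_psi (x : Gr p) : TensorProduct.lid (BP p) (Gr p)
    ((counit p).toLinearMap.rTensor (Gr p) (psi p x)) = x := by
  let F : GrTensor p →+* Gr p :=
    ((Algebra.TensorProduct.lid (BP p) (Gr p) : _ →ₐ[BP p] _).comp
      (Algebra.TensorProduct.map (counit p) (AlgHom.id (BP p) (Gr p)))).toRingHom
  have hF : ∀ z, TensorProduct.lid (BP p) (Gr p) ((counit p).toLinearMap.rTensor (Gr p) z) =
    F z := fun z => rfl
  have hFt : ∀ g x, F (g ⊗ₜ x) = counit p g • x := fun g x => by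
    rw [← hF, LinearMap.rTensor_tmul, lid_tmul]; rfl
  have hC : ∀ g, F (gtC p g) = grC p g := fun g => by rw [gtC_apply, hFt, map_one, one_smul]
  rw [hF]
  refine RingHom.congr_fun (gr_hom_ext p (f := F.comp (psi p)) (g := RingHom.id _) (fun a => ?_)
    (fun i => ?_) fun d => ?_) x
  · rw [RingHom.comp_apply, psi_C_C, hC]; rfl
  · rw [RingHom.comp_apply, psi_C_tOne, map_deltaEval]
    have h1 : F ∘ gtC p ∘ tOne p = grC p ∘ tOne p := funext fun i => hC _
    have h2 : (F ∘ fun i => gtL p (tOne p i) * gtTinv p (Multiplicative.ofAdd (genDeg p i))) = 0 :=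
      funext fun i => by
        rw [Function.comp_apply, map_mul, gtL_apply, hFt, counit, tOne, MvPolynomial.aeval_X,
          zero_smul, zero_mul]
        rfl
    rw [h1, h2, deltaEval_zero_right]
    rfl
  · rw [RingHom.comp_apply, psi_T, gtT_apply, hFt, map_one, one_smul]
    rfl

/-- The other counit law: here the factor `Gr` is evaluated at `t_i = 0` and `T = 1`. It shows that
a homogeneous element can be recovered from its coaction, which becomes a triangle identity of the
adjunction. -/
theorem lid_grCounit_psi (g : BPBP p) (d : Multiplicative ℤ) : TensorProduct.rid (BP p) (BPBP p)
    ((grCounitAlg p).toLinearMap.lTensor (BPBP p) (psi p (grC p g * grT p d))) = g := by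
  let F : GrTensor p →+* BPBP p :=
    ((Algebra.TensorProduct.rid (BP p) (BP p) (BPBP p) : _ →ₐ[BP p] _).comp
      (Algebra.TensorProduct.map (AlgHom.id (BP p) (BPBP p)) (grCounitAlg p))).toRingHom
  have hF : ∀ z, TensorProduct.rid (BP p) (BPBP p)
    ((grCounitAlg p).toLinearMap.lTensor (BPBP p) z) = F z := fun z => rfl
  have hFt : ∀ g x, F (g ⊗ₜ x) = grCounit p x • g := fun g x => by
    rw [← hF, LinearMap.lTensor_tmul, rid_tmul]; rfl
  have hC : ∀ g, F (gtC p g) = MvPolynomial.C (counit p g) := fun g => by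
    rw [gtC_apply, hFt, grCounit_C, MvPolynomial.smul_eq_C_mul, mul_one]
  rw [hF, map_mul, map_mul, psi_T, gtT_apply, hFt, grCounit_T, one_smul, mul_one]
  refine RingHom.congr_fun (BPBP_hom_ext p (f := (F.comp (psi p)).comp (grC p))
    (g := RingHom.id _) (fun a => ?_) fun i => ?_) g
  · rw [RingHom.comp_apply, RingHom.comp_apply, psi_C_C, hC]
    exact congrArg _ ((counit p).commutes a)
  · rw [RingHom.comp_apply, RingHom.comp_apply, psi_C_tOne, map_deltaEval]
    have h1 : F ∘ gtC p ∘ tOne p = 0 := funext fun i => by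
      rw [Function.comp_apply, Function.comp_apply, hC, counit, tOne, MvPolynomial.aeval_X, map_zero]
      rfl
    have h2 : (F ∘ fun i => gtL p (tOne p i) * gtTinv p (Multiplicative.ofAdd (genDeg p i))) =
        tOne p := funext fun i => by
      rw [Function.comp_apply, map_mul, gtL_apply, hFt, gtTinv_apply, hFt, grCounit_T, map_one,
        one_smul, one_smul, mul_one]
    rw [h1, h2, deltaEval_zero_left]
    rfl

end CofreeRing

/-! ### Coassociativity of the coaction on `BP_*BP[T, T⁻¹]` -/

section CofreeCoassoc

variable (p : ℕ) [hp : Fact p.Prime]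

theorem gtL_mul (g : BPBP p) (z : GrTensor p) : gtL p g * z = g • z :=
  (Algebra.smul_def g z).symm

/-- The coaction of `Gr` as a semilinear map. -/
def psiLin : Gr p →ₛₗ[etaR p] GrTensor p where
  toFun := psi p
  map_add' := map_add _
  map_smul' a x := by
    rw [Algebra.smul_def, map_mul, psi_rho, gtL_mul]

theorem psiLin_apply (x : Gr p) : psiLin p x = psi p x := rfl

/-- The ring homomorphism on `Γ ⊗ Gr` induced by a homomorphism from `Γ`. -/
def gtMap (f : BPBP p →ₐ[BP p] BPBP2 p) : GrTensor p →+* BPBP2 p ⊗[BP p] Gr p :=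
  (Algebra.TensorProduct.map f (AlgHom.id (BP p) (Gr p))).toRingHom

theorem gtMap_eq (f : BPBP p →ₐ[BP p] BPBP2 p) (z : GrTensor p) :
    f.toLinearMap.rTensor (Gr p) z = gtMap p f z := rfl

theorem gtMap_tmul (f : BPBP p →ₐ[BP p] BPBP2 p) (g : BPBP p) (x : Gr p) :
    gtMap p f (g ⊗ₜ x) = f g ⊗ₜ x := rfl

theorem coactTensor_psi (g : BPBP p) (x : Gr p) : coactTensor (psiLin p) (g ⊗ₜ x) =
    (inr p g ⊗ₜ 1) * gtMap p (inl p) (psi p x) := by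
  rw [coactTensor_tmul, gtMap_eq, psiLin_apply]
  exact Algebra.smul_def (inr p g) (gtMap p (inl p) (psi p x))

/-- In general `coactTensor` is only additive. Here the coaction is a ring homomorphism, so
`coactTensor` is one as well, and coassociativity can be tested on ring generators. -/
theorem coactTensor_psi_mul (x y : GrTensor p) : coactTensor (psiLin p) (x * y) =
    coactTensor (psiLin p) x * coactTensor (psiLin p) y := by
  induction x using TensorProduct.induction_on with
  | zero => rw [zero_mul, map_zero, zero_mul]
  | add x x' hx hx' => rw [add_mul, map_add, map_add, add_mul, hx, hx']
  | tmul g x =>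
  induction y using TensorProduct.induction_on with
  | zero => rw [mul_zero, map_zero, mul_zero]
  | add x x' hx hx' => rw [mul_add, map_add, map_add, mul_add, hx, hx']
  | tmul g' x' =>
    rw [Algebra.TensorProduct.tmul_mul_tmul, coactTensor_psi, coactTensor_psi, coactTensor_psi,
      map_mul, map_mul, map_mul, mul_mul_mul_comm, Algebra.TensorProduct.tmul_mul_tmul, one_mul]

/-- `coactTensor` for `Gr` as a ring homomorphism. -/
def psiTensor : GrTensor p →+* BPBP2 p ⊗[BP p] Gr p :=
  { coactTensor (psiLin p) with
    map_one' := by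
      change coactTensor (psiLin p) (1 ⊗ₜ 1) = 1
      rw [coactTensor_psi, map_one, map_one, map_one, mul_one]
      rfl
    map_mul' := coactTensor_psi_mul p }

theorem psiTensor_apply (z : GrTensor p) : psiTensor p z = coactTensor (psiLin p) z := rfl

theorem psiTensor_tmul (g : BPBP p) (x : Gr p) : psiTensor p (g ⊗ₜ x) =
    (inr p g ⊗ₜ 1) * gtMap p (inl p) (psi p x) := coactTensor_psi p g x

/-- The powers of `T⁻¹` in `Γ ⊗ Γ ⊗ Gr`. -/
def gt2Tinv : Multiplicative ℤ →* BPBP2 p ⊗[BP p] Gr p :=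
  ((Algebra.TensorProduct.includeRight : Gr p →ₐ[BP p] BPBP2 p ⊗[BP p] Gr p) :
    Gr p →* BPBP2 p ⊗[BP p] Gr p).comp ((grT p).comp invMonoidHom)

/-- `g ↦ g ⊗ 1`. -/
def gt2L : BPBP2 p →+* BPBP2 p ⊗[BP p] Gr p :=
  ((Algebra.TensorProduct.includeLeft : BPBP2 p →ₐ[BP p] BPBP2 p ⊗[BP p] Gr p) :
    BPBP2 p →+* BPBP2 p ⊗[BP p] Gr p)

theorem psi_coassoc (x : Gr p) : (comul p).toLinearMap.rTensor (Gr p) (psiLin p x) =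
    coactTensor (psiLin p) (psiLin p x) := by
  rw [gtMap_eq, ← psiTensor_apply, psiLin_apply]
  have hC : ∀ (f : BPBP p →ₐ[BP p] BPBP2 p) g, gtMap p f (gtC p g) = 1 ⊗ₜ grC p g := fun f g => by
    rw [gtC_apply, gtMap_tmul, map_one]
  have hC' : ∀ g, psiTensor p (gtC p g) = gtMap p (inl p) (psi p (grC p g)) := fun g => by
    rw [gtC_apply, psiTensor_tmul, map_one, ← Algebra.TensorProduct.one_def, one_mul]
  have hT : ∀ d, psiTensor p (1 ⊗ₜ grT p d) = 1 ⊗ₜ grT p d := fun d => by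
    rw [psiTensor_tmul, map_one, ← Algebra.TensorProduct.one_def, one_mul, psi_T, gtT_apply,
      gtMap_tmul, map_one]
  have hLT : ∀ (f : BPBP p →ₐ[BP p] BPBP2 p) g d, gtMap p f (gtL p g * gtTinv p d) =
      gt2L p (f g) * gt2Tinv p d := fun f g d => by
    rw [map_mul, gtL_apply, gtTinv_apply, gtMap_tmul, gtMap_tmul, map_one]
    rfl
  have hLT' : ∀ g d, psiTensor p (gtL p g * gtTinv p d) =
      gt2L p (inr p g) * gt2Tinv p d := fun g d => by
    rw [map_mul, gtL_apply, gtTinv_apply, psiTensor_tmul, hT, map_one, map_one, mul_one]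
    rfl
  have hδ : ∀ (f : GrTensor p →+* BPBP2 p ⊗[BP p] Gr p) v t s n, f (deltaEval p v t s n) =
      deltaEval p (f ∘ v) (f ∘ t) (f ∘ s) n := fun f v t s n =>
    map_deltaEval p (B := GrTensor p) (C := BPBP2 p ⊗[BP p] Gr p) f v t s n
  have hη : ∀ (f : GrTensor p →+* BPBP2 p ⊗[BP p] Gr p) v t n, f (etaEval p v t n) =
      etaEval p (f ∘ v) (f ∘ t) n := fun f v t n =>
    map_etaEval p (B := GrTensor p) (C := BPBP2 p ⊗[BP p] Gr p) f v t n
  refine RingHom.congr_fun (gr_hom_ext p (S := BPBP2 p ⊗[BP p] Gr p) (f := (gtMap p (comul p)).comp (psi p))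
    (g := (psiTensor p).comp (psi p)) (fun a => ?_) (fun i => ?_) fun d => ?_) x
  · rw [RingHom.comp_apply, RingHom.comp_apply, psi_C_C, hC, hC', psi_C_C, hC]
  · rw [RingHom.comp_apply, RingHom.comp_apply, psi_C_tOne, hδ, hδ]
    set v : ℕ → BPBP2 p ⊗[BP p] Gr p := fun i => 1 ⊗ₜ grC p (vOne p i) with hv
    set t : ℕ → BPBP2 p ⊗[BP p] Gr p := fun i => 1 ⊗ₜ grC p (tOne p i) with ht
    set s : ℕ → BPBP2 p ⊗[BP p] Gr p := fun i =>
      gt2L p (tLeft p i) * gt2Tinv p (Multiplicative.ofAdd (genDeg p i)) with hs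
    set r : ℕ → BPBP2 p ⊗[BP p] Gr p := fun i =>
      gt2L p (tRight p i) * gt2Tinv p (Multiplicative.ofAdd (genDeg p i)) with hr
    have e1 : gtMap p (comul p) ∘ gtC p ∘ vOne p = v := funext fun i => hC _ _
    have e2 : gtMap p (comul p) ∘ gtC p ∘ tOne p = t := funext fun i => hC _ _
    have e1' : gtMap p (inl p) ∘ gtC p ∘ vOne p = v := funext fun i => hC _ _
    have e2' : gtMap p (inl p) ∘ gtC p ∘ tOne p = t := funext fun i => hC _ _
    have e3 : psiTensor p ∘ gtC p ∘ vOne p = v := funext fun i =>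
      (hC' _).trans ((congrArg _ (psi_C_C p _)).trans (hC _ _))
    have e4 : psiTensor p ∘ gtC p ∘ tOne p = deltaEval p v t s := funext fun i => by
      refine (hC' _).trans ?_
      rw [psi_C_tOne, hδ, e1', e2']
      congr 1
      funext j
      exact hLT _ _ _
    have e5 : (psiTensor p ∘ fun i => gtL p (tOne p i) *
        gtTinv p (Multiplicative.ofAdd (genDeg p i))) = r := funext fun i => by
      refine (hLT' _ _).trans ?_
      rw [hr, inr, tOne, MvPolynomial.eval₂Hom_X']
    -- Balancing carries `η_R(v_i)` out of the factor `Gr` and turns it into `v_i ⊗ 1` with a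
    -- compensating power of `T`. After this all arguments of the second `Δ` carry the same kind of
    -- twist.
    have e6 : etaEval p v t = fun i => gt2L p (vTwo p i) *
        gt2Tinv p (Multiplicative.ofAdd (genDeg p i)) := funext fun i => by
      have h1 : gtMap p (inl p) (gtC p (etaR p (vVar p i))) = etaEval p v t i := by
        rw [etaR_X, map_etaEval, hη]
        exact congrFun (congrArg₂ (etaEval p) e1' e2') i
      rw [← h1, gtC_etaR_of_mem p (vVar_mem p i), hLT]
      rfl
    -- Homogeneity of `Δ` pulls the twist outside, and what remains is the comultiplication of `t_i`
    -- in the two factors `Γ`.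
    have e7 : (gtMap p (comul p) ∘ fun i => gtL p (tOne p i) *
        gtTinv p (Multiplicative.ofAdd (genDeg p i))) = deltaEval p (etaEval p v t) s r :=
      funext fun i => by
        refine (hLT _ _ _).trans ?_
        rw [e6, hs, hr, deltaEval_scale]
        congr 1
        have : comul p (tOne p i) = deltaEval p (vTwo p) (tLeft p) (tRight p) i :=
          MvPolynomial.aeval_X _ _
        rw [this]
        exact map_deltaEval p (B := BPBP2 p) (C := BPBP2 p ⊗[BP p] Gr p) (gt2L p) _ _ _ _
    rw [e1, e2, e3, e4, e5, e7, deltaEval_assoc]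
  · rw [RingHom.comp_apply, RingHom.comp_apply, psi_T, gtT_apply, hT, gtMap_tmul, map_one]

end CofreeCoassoc

/-! ### The cofree comodule on a module -/

section CofreeComodule

variable {p : ℕ} [hp : Fact p.Prime]

section

variable (p) (N : Type) [AddCommGroup N] [Module (BP p) N]

/-- The underlying group of the cofree comodule. -/
def CofreeCarrier : Type := LaurentPolynomial (BPBP p) ⊗[BP p] N

instance : AddCommGroup (CofreeCarrier p N) :=
  inferInstanceAs (AddCommGroup (LaurentPolynomial (BPBP p) ⊗[BP p] N))

instance : Module (LaurentPolynomial (BPBP p)) (CofreeCarrier p N) :=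
  inferInstanceAs (Module (LaurentPolynomial (BPBP p)) (LaurentPolynomial (BPBP p) ⊗[BP p] N))

/-- The tensor product is formed over the left unit, while `BP_*` acts on the comodule by the
twisted right unit; the separate type keeps the two actions apart. -/
instance : Module (BP p) (CofreeCarrier p N) := Module.compHom _ (rho p)

variable {N}

/-- Pure tensors in the cofree comodule. -/
def cofreeMk (x : LaurentPolynomial (BPBP p)) (n : N) : CofreeCarrier p N := x ⊗ₜ[BP p] n

theorem cofree_smul (a : BP p) (z : CofreeCarrier p N) : a • z = rho p a • z := rfl

theorem smul_cofreeMk (y x : LaurentPolynomial (BPBP p)) (n : N) :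
    y • cofreeMk p x n = cofreeMk p (y * x) n := rfl

theorem cofreeMk_add (x y : LaurentPolynomial (BPBP p)) (n : N) :
    cofreeMk p (x + y) n = cofreeMk p x n + cofreeMk p y n := TensorProduct.add_tmul _ _ _

theorem cofreeMk_add' (x : LaurentPolynomial (BPBP p)) (n n' : N) :
    cofreeMk p x (n + n') = cofreeMk p x n + cofreeMk p x n' := TensorProduct.tmul_add _ _ _

theorem laurent_smul (a : BP p) (x : LaurentPolynomial (BPBP p)) :
    a • x = LaurentPolynomial.C (MvPolynomial.C a) * x := by
  rw [← LaurentPolynomial.smul_eq_C_mul, ← MvPolynomial.algebraMap_eq, algebraMap_smul]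

theorem cofreeMk_smul (a : BP p) (x : LaurentPolynomial (BPBP p)) (n : N) :
    cofreeMk p x (a • n) =
      cofreeMk p (LaurentPolynomial.C (MvPolynomial.C a) * x) n := by
  rw [← laurent_smul]
  exact TensorProduct.tmul_smul _ _ _

variable {p} in
theorem cofree_induction {P : CofreeCarrier p N → Prop} (z : CofreeCarrier p N)
    (h0 : P 0) (ha : ∀ x y, P x → P y → P (x + y)) (hm : ∀ x n, P (cofreeMk p x n)) : P z :=
  TensorProduct.induction_on (motive := P) z h0 hm ha

/-- The identification of `Gr` with the ring of Laurent polynomials. -/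
def toGr : LaurentPolynomial (BPBP p) ≃+* Gr p := RingEquiv.refl _

/-- The inclusion of `Gr` as the multiples of an element of `N`. -/
def cofreeIncl (n : N) : Gr p →ₗ[BP p] CofreeCarrier p N where
  toFun x := cofreeMk p ((toGr p).symm x) n
  map_add' _ _ := cofreeMk_add p _ _ n
  map_smul' _ _ := rfl

/-- The image of an element of `Γ ⊗ Gr` in `Γ ⊗ C(N)` associated with an element of `N`. -/
def kappa (z : GrTensor p) : N →+ BPBP p ⊗[BP p] CofreeCarrier p N :=
  AddMonoidHom.mk' (fun n => (cofreeIncl p n).lTensor (BPBP p) z) fun n n' => by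
    have : cofreeIncl p (n + n') = cofreeIncl p n + cofreeIncl p n' :=
      LinearMap.ext fun x => cofreeMk_add' p _ n n'
    rw [this, LinearMap.lTensor_add, LinearMap.add_apply]

theorem kappa_apply (z : GrTensor p) (n : N) :
    kappa p z n = (cofreeIncl p n).lTensor (BPBP p) z := rfl

theorem kappa_tmul (g : BPBP p) (x : Gr p) (n : N) :
    kappa p (g ⊗ₜ x) n = g ⊗ₜ cofreeMk p ((toGr p).symm x) n := rfl

theorem kappa_add (z z' : GrTensor p) (n : N) : kappa p (z + z') n = kappa p z n + kappa p z' n :=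
  map_add ((cofreeIncl p n).lTensor (BPBP p)) z z'

theorem kappa_gtL_mul (g : BPBP p) (z : GrTensor p) (n : N) :
    kappa p (gtL p g * z) n = g • kappa p z n := by
  rw [gtL_mul, kappa_apply, lTensor_smul]
  rfl

theorem kappa_gtC_mul (a : BP p) (z : GrTensor p) (n : N) :
    kappa p (gtC p (MvPolynomial.C a) * z) n = kappa p z (a • n) := by
  induction z using TensorProduct.induction_on with
  | zero => rw [mul_zero]; rfl
  | tmul g x => rw [gtC_apply, Algebra.TensorProduct.tmul_mul_tmul, one_mul, kappa_tmul, kappa_tmul]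
                exact congrArg (fun y => g ⊗ₜ y) (cofreeMk_smul p a ((toGr p).symm x) n).symm
  | add x y hx hy => rw [mul_add, kappa_add, hx, hy, kappa_add]

/-- The maps to `Γ ⊗ C(N)` induced by maps to `Γ ⊗ Gr`. -/
def kappaLift {X : Type*} [AddCommGroup X] [Module (BP p) X] (φ : X →+ GrTensor p)
    (hφ : ∀ (a : BP p) x, φ (a • x) = gtC p (MvPolynomial.C a) * φ x) :
    X ⊗[BP p] N →+ BPBP p ⊗[BP p] CofreeCarrier p N :=
  TensorProduct.liftAddHom
    (AddMonoidHom.mk' (fun x => kappa p (φ x)) fun x y => AddMonoidHom.ext fun n => by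
      rw [map_add, kappa_add]; rfl) fun a x n => by
    simp only [AddMonoidHom.mk'_apply]
    rw [hφ, kappa_gtC_mul]

theorem psi_C_mul (a : BP p) (x : Gr p) :
    psi p (grC p (MvPolynomial.C a) * x) = gtC p (MvPolynomial.C a) * psi p x := by
  rw [map_mul, psi_C_C]

variable (N) in
/-- The additive map underlying the coaction on the cofree comodule. -/
def cofreeCoactAdd : CofreeCarrier p N →+ BPBP p ⊗[BP p] CofreeCarrier p N :=
  kappaLift p (X := LaurentPolynomial (BPBP p)) ((psi p : Gr p →+ GrTensor p).comp (toGr p : _ →+ Gr p))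
    fun a x => by
      rw [laurent_smul]
      exact psi_C_mul p a (toGr p x)

theorem cofreeCoactAdd_mk (x : LaurentPolynomial (BPBP p)) (n : N) :
    cofreeCoactAdd p N (cofreeMk p x n) = kappa p (psi p (toGr p x)) n := rfl

theorem psi_rho_mul (a : BP p) (x : LaurentPolynomial (BPBP p)) :
    psi p (toGr p (rho p a * x)) = gtL p (etaR p a) * psi p (toGr p x) := by
  rw [← psi_rho, ← map_mul, map_mul (toGr p)]
  rfl

theorem cofreeCoactAdd_smul (a : BP p) (z : CofreeCarrier p N) :
    cofreeCoactAdd p N (a • z) = etaR p a • cofreeCoactAdd p N z := by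
  induction z using cofree_induction with
  | h0 => rw [smul_zero, map_zero, smul_zero]
  | ha x y hx hy => rw [smul_add, map_add, map_add, smul_add, hx, hy]
  | hm x n =>
    rw [cofree_smul, smul_cofreeMk, cofreeCoactAdd_mk, cofreeCoactAdd_mk, ← kappa_gtL_mul,
      psi_rho_mul]

variable (N) in
/-- The coaction on the cofree comodule. -/
def cofreeCoact : CofreeCarrier p N →ₛₗ[etaR p] BPBP p ⊗[BP p] CofreeCarrier p N where
  toFun := cofreeCoactAdd p N
  map_add' := map_add _
  map_smul' := cofreeCoactAdd_smul p

theorem cofreeCoact_mk (x : LaurentPolynomial (BPBP p)) (n : N) :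
    cofreeCoact p N (cofreeMk p x n) = (cofreeIncl p n).lTensor (BPBP p) (psiLin p (toGr p x)) := rfl

variable (N) in
/-- The inclusion of the summand of degree `d` into the cofree comodule. -/
def cofreeJ (d : ℤ) : BPBP p ⊗[BP p] N →+ CofreeCarrier p N :=
  TensorProduct.liftAddHom
    (AddMonoidHom.mk' (fun g => AddMonoidHom.mk'
      (fun n => cofreeMk p (LaurentPolynomial.C g * LaurentPolynomial.T d) n)
      (fun _ _ => cofreeMk_add' _ _ _ _))
      fun g g' => AddMonoidHom.ext fun n => by
        simp only [AddMonoidHom.mk'_apply, AddMonoidHom.add_apply]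
        rw [map_add, add_mul, cofreeMk_add]) fun a g n => by
    simp only [AddMonoidHom.mk'_apply]
    rw [cofreeMk_smul, MvPolynomial.smul_eq_C_mul, map_mul, mul_assoc]

theorem cofreeJ_tmul (d : ℤ) (g : BPBP p) (n : N) : cofreeJ p N d (g ⊗ₜ n) =
    cofreeMk p (LaurentPolynomial.C g * LaurentPolynomial.T d) n := rfl

variable (N) in
/-- The projection of the cofree comodule to the summand of degree `d`. -/
def cofreeQ (d : ℤ) : CofreeCarrier p N →+ BPBP p ⊗[BP p] N :=
  TensorProduct.liftAddHom (R := BP p) (M := LaurentPolynomial (BPBP p))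
    (AddMonoidHom.mk' (fun x : LaurentPolynomial (BPBP p) =>
      AddMonoidHom.mk' (fun n : N => x.coeff d ⊗ₜ[BP p] n)
        (fun _ _ => TensorProduct.tmul_add _ _ _))
      fun x y => AddMonoidHom.ext fun n => TensorProduct.add_tmul (x.coeff d) (y.coeff d) n)
    fun a x n =>
    TensorProduct.smul_tmul a (x.coeff d) n

theorem cofreeQ_mk (d : ℤ) (x : LaurentPolynomial (BPBP p)) (n : N) :
    cofreeQ p N d (cofreeMk p x n) = x.coeff d ⊗ₜ n := rfl

theorem cofreeQ_cofreeJ (d e : ℤ) (z : BPBP p ⊗[BP p] N) :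
    cofreeQ p N e (cofreeJ p N d z) = if d = e then z else 0 := by
  induction z using TensorProduct.induction_on with
  | zero => simp
  | tmul g n =>
    rw [cofreeJ_tmul, cofreeQ_mk, ← LaurentPolynomial.single_eq_C_mul_T, AddMonoidAlgebra.coeff_single,
      Finsupp.single_apply]
    split_ifs <;> simp
  | add x y hx hy => rw [map_add, map_add, hx, hy]; split_ifs <;> simp

variable (N) in
/-- The grading of the cofree comodule. -/
def cofreeDeg (d : ℤ) : AddSubgroup (CofreeCarrier p N) := (cofreeJ p N d).range

theorem cofreeDeg_isInternal : DirectSum.IsInternal (cofreeDeg p N) := by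
  refine isInternal_of_proj (fun e => (cofreeJ p N e).comp (cofreeQ p N e)) ?_ fun x => ?_
  · rintro d _ ⟨z, rfl⟩ e
    rw [AddMonoidHom.comp_apply, cofreeQ_cofreeJ]
    split_ifs with h
    · rw [h]
    · rw [map_zero]
  · induction x using cofree_induction with
    | h0 => exact zero_mem _
    | ha x y hx hy => exact add_mem hx hy
    | hm x n =>
      induction x using LaurentPolynomial.induction_on' with
      | add x y hx hy => rw [cofreeMk_add]; exact add_mem hx hy
      | C_mul_T d a =>
        exact ⟨DirectSum.of (fun d => cofreeDeg p N d) d ⟨_, a ⊗ₜ n, rfl⟩,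
          DirectSum.coeAddMonoidHom_of _ _ _⟩

theorem smul_cofreeJ {i : ℤ} {a : BP p} (ha : a ∈ BPdeg p i) (d : ℤ) (z : BPBP p ⊗[BP p] N) :
    a • cofreeJ p N d z = cofreeJ p N (i + d) (etaR p a • z) := by
  induction z using TensorProduct.induction_on with
  | zero => simp
  | tmul g n =>
    rw [cofreeJ_tmul, cofree_smul, smul_cofreeMk, smul_tmul', cofreeJ_tmul, rho_of_mem p ha,
      smul_eq_mul, map_mul, LaurentPolynomial.T_add, mul_mul_mul_comm]
  | add x y hx hy => rw [map_add, smul_add, hx, hy, smul_add, map_add]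

theorem gtL_mul_mem {i j : ℤ} {g : BPBP p} (hg : g ∈ BPBPdeg p i) {z : GrTensor p}
    (hz : z ∈ tensorDeg (grDeg p) j) : gtL p g * z ∈ tensorDeg (grDeg p) (i + j) := by
  induction hz using AddSubgroup.closure_induction with
  | mem z hz =>
    obtain ⟨k, l, rfl, g', hg', m, hm, rfl⟩ := hz
    rw [gtL_apply, Algebra.TensorProduct.tmul_mul_tmul, one_mul]
    exact AddSubgroup.subset_closure ⟨i + k, l, by ring, _, BPBPdeg_mul p hg hg', m, hm, rfl⟩
  | zero => rw [mul_zero]; exact zero_mem _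
  | add x y _ _ hx hy => rw [mul_add]; exact add_mem hx hy
  | neg x _ hx =>
    have : gtL p g * -x = -(gtL p g * x) := by rw [gtL_mul, gtL_mul, smul_neg]
    rw [this]
    exact neg_mem hx

theorem tOne_mem (i : ℕ) : tOne p i ∈ BPBPdeg p (genDeg p i) := fun e => by
  classical
  rw [tOne, MvPolynomial.coeff_X]
  split_ifs with h
  · subst h; simpa [Finsupp.weight_single] using BPdeg_one p
  · exact zero_mem _

/-- Induction on the polynomial in the `1 ⊗ t_i`: each new factor `t_i` raises the degree of the
factor `Γ` and lowers the exponent of `T` by the same amount. Coefficients from the first copy of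
`Γ` contribute nothing, since they have degree zero in `Gr`. -/
theorem theta_mul_gtT_mem (h : BPBP2 p) (d : ℤ) :
    theta p h * gtT p (Multiplicative.ofAdd d) ∈ tensorDeg (grDeg p) d := by
  induction h using MvPolynomial.induction_on generalizing d with
  | C g =>
    refine AddSubgroup.subset_closure ⟨0, d, zero_add d, 1, C_mem_BPBPdeg p (BPdeg_one p),
      grC p g * grT p (Multiplicative.ofAdd d), ⟨g, rfl⟩, ?_⟩
    refine (congrArg (· * _) (theta_inl p g)).trans ?_
    rw [gtC_apply, gtT_apply, Algebra.TensorProduct.tmul_mul_tmul, one_mul]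
  | add x y hx hy => rw [map_add, add_mul]; exact add_mem (hx d) (hy d)
  | mul_X x i hx =>
    have h1 := gtL_mul_mem p (tOne_mem p i) (hx (d - genDeg p i))
    have h2 : theta p (MvPolynomial.X i) = _ := theta_tRight p i
    rw [add_sub_cancel] at h1
    convert h1 using 1
    rw [map_mul, h2, ofAdd_sub, div_eq_mul_inv, map_mul]
    have h3 : gtT p (Multiplicative.ofAdd (genDeg p i))⁻¹ =
      gtTinv p (Multiplicative.ofAdd (genDeg p i)) := rfl
    rw [h3]
    ring

variable (N) in
/-- The cofree comodule on a `BP_*`-module. -/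
def cofreeObj : Comod p where
  carrier := CofreeCarrier p N
  deg := cofreeDeg p N
  isInternal := cofreeDeg_isInternal p
  smul_mem := by
    rintro i j a _ ha ⟨z, rfl⟩
    exact ⟨_, (smul_cofreeJ p ha j z).symm⟩
  coact := cofreeCoact p N
  coact_mem := by
    rintro d _ ⟨z, rfl⟩
    induction z using TensorProduct.induction_on with
    | zero => rw [map_zero, map_zero]; exact zero_mem _
    | add x y hx hy => rw [map_add, map_add]; exact add_mem hx hy
    | tmul g n =>
      rw [cofreeJ_tmul, cofreeCoact_mk]
      refine tensorDeg_nat (deg := grDeg p) (cofreeIncl p n) ?_ ?_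
      · rintro d _ ⟨g, rfl⟩
        exact ⟨g ⊗ₜ n, rfl⟩
      · have h : psiLin p (toGr p (LaurentPolynomial.C g * LaurentPolynomial.T d)) =
            theta p (comul p g) * gtT p (Multiplicative.ofAdd d) := by
          rw [← psi_C, ← psi_T, ← map_mul (psi p)]; rfl
        rw [h]
        exact theta_mul_gtT_mem p _ d
  counit_coact z := by
    induction z using cofree_induction with
    | h0 => simp only [map_zero]
    | ha x y hx hy => simp only [map_add, hx, hy]
    | hm x n =>
      rw [cofreeCoact_mk, counit_nat, psiLin_apply, counit_psi]
      rfl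
  coassoc z := by
    induction z using cofree_induction with
    | h0 => simp only [map_zero]
    | ha x y hx hy => simp only [map_add, hx, hy]
    | hm x n =>
      rw [cofreeCoact_mk, rTensor_nat, psi_coassoc]
      exact (coactTensor_nat (ψ := psiLin p) (ψ' := cofreeCoact p N) (cofreeIncl p n)
        (fun m => rfl) _).symm

end

section Graded

variable {M : Type*} [AddCommGroup M] {deg : ℤ → AddSubgroup M}

/-- The additive map given by additive maps on the components of a graded group. -/
def gradedLift (h : DirectSum.IsInternal deg) {X : Type*} [AddCommGroup X] (φ : ℤ → M →+ X) :
    M →+ X :=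
  (DirectSum.toAddMonoid fun d => (φ d).comp (deg d).subtype).comp
    (AddEquiv.ofBijective (DirectSum.coeAddMonoidHom deg) h).symm.toAddMonoidHom

theorem gradedLift_of_mem (h : DirectSum.IsInternal deg) {X : Type*} [AddCommGroup X]
    (φ : ℤ → M →+ X) {d : ℤ} {x : M} (hx : x ∈ deg d) : gradedLift h φ x = φ d x := by
  have : (AddEquiv.ofBijective (DirectSum.coeAddMonoidHom deg) h).symm x =
      DirectSum.of (fun d => deg d) d ⟨x, hx⟩ := by
    rw [AddEquiv.symm_apply_eq]
    exact (DirectSum.coeAddMonoidHom_of deg d ⟨x, hx⟩).symm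
  simp only [gradedLift, AddMonoidHom.comp_apply, AddEquiv.toAddMonoidHom_eq_coe,
    AddMonoidHom.coe_coe, this, DirectSum.toAddMonoid_of]
  rfl

end Graded

end CofreeComodule

/-! ### The cofree comodule is right adjoint to the forgetful functor -/

section Adjunction

variable {p : ℕ} [hp : Fact p.Prime]

theorem cofree_graded_induction {N : Type} [AddCommGroup N] [Module (BP p) N]
    {P : CofreeCarrier p N → Prop} (z : CofreeCarrier p N)
    (h0 : P 0) (ha : ∀ x y, P x → P y → P (x + y))
    (hm : ∀ d g n, P (cofreeJ p N d (g ⊗ₜ n))) : P z := by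
  induction z using cofree_induction with
  | h0 => exact h0
  | ha x y hx hy => exact ha _ _ hx hy
  | hm x n =>
    induction x using LaurentPolynomial.induction_on' with
    | add x y hx hy => rw [cofreeMk_add]; exact ha _ _ hx hy
    | C_mul_T d a => exact hm d a n

section

variable (p) {N N' : Type} [AddCommGroup N] [Module (BP p) N] [AddCommGroup N'] [Module (BP p) N']

/-- The map of cofree comodules induced by a linear map, as an additive map. -/
def cofreeMapAdd (f : N →ₗ[BP p] N') : CofreeCarrier p N →+ CofreeCarrier p N' :=
  (f.lTensor (LaurentPolynomial (BPBP p))).toAddMonoidHom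

/-- The map of cofree comodules induced by a linear map. -/
def cofreeMapLin (f : N →ₗ[BP p] N') : CofreeCarrier p N →ₗ[BP p] CofreeCarrier p N' where
  toFun := cofreeMapAdd p f
  map_add' := map_add _
  map_smul' a z := by
    rw [RingHom.id_apply]
    induction z using cofree_induction with
    | h0 => rw [smul_zero, map_zero, smul_zero]
    | ha x y hx hy => rw [smul_add, map_add, map_add, smul_add, hx, hy]
    | hm x n => rfl

theorem cofreeMapLin_mk (f : N →ₗ[BP p] N') (x : LaurentPolynomial (BPBP p)) (n : N) :
    cofreeMapLin p f (cofreeMk p x n) = cofreeMk p x (f n) := rfl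

theorem cofreeMapLin_cofreeJ (f : N →ₗ[BP p] N') (d : ℤ) (z : BPBP p ⊗[BP p] N) :
    cofreeMapLin p f (cofreeJ p N d z) = cofreeJ p N' d (f.lTensor (BPBP p) z) := by
  induction z using TensorProduct.induction_on with
  | zero => simp only [map_zero]
  | tmul g n => rfl
  | add x y hx hy => simp only [map_add, hx, hy]

theorem cofreeMapLin_coact (f : N →ₗ[BP p] N') (z : CofreeCarrier p N) :
    cofreeCoact p N' (cofreeMapLin p f z) =
      (cofreeMapLin p f).lTensor (BPBP p) (cofreeCoact p N z) := by
  induction z using cofree_induction with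
  | h0 => simp only [map_zero]
  | ha x y hx hy => simp only [map_add, hx, hy]
  | hm x n =>
    rw [cofreeMapLin_mk, cofreeCoact_mk, cofreeCoact_mk, ← LinearMap.lTensor_comp_apply]
    rfl

/-- The homomorphism of cofree comodules induced by a linear map. -/
def cofreeMap (f : N →ₗ[BP p] N') : cofreeObj p N ⟶ cofreeObj p N' where
  toLin := cofreeMapLin p f
  map_deg := by
    rintro d _ ⟨z, rfl⟩
    exact ⟨_, (cofreeMapLin_cofreeJ p f d z).symm⟩
  map_coact := cofreeMapLin_coact p f

variable (N) in
/-- The additive map underlying `cofreeEps`. -/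
def cofreeEpsAdd : CofreeCarrier p N →+ N :=
  TensorProduct.liftAddHom (R := BP p) (M := LaurentPolynomial (BPBP p))
    (AddMonoidHom.mk' (fun x =>
      AddMonoidHom.mk' (fun n : N => grCounit p (toGr p x) • n) fun _ _ => smul_add _ _ _)
      fun x y => AddMonoidHom.ext fun n => by
        simp only [AddMonoidHom.mk'_apply, AddMonoidHom.add_apply]
        rw [map_add, map_add, add_smul]) fun a x n => by
    simp only [AddMonoidHom.mk'_apply]
    have h : grCounit p (toGr p (LaurentPolynomial.C (MvPolynomial.C a))) = a :=
      (grCounit_C p _).trans ((counit p).commutes a)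
    rw [laurent_smul, map_mul, map_mul, h, smul_smul, mul_comm]

theorem cofreeEpsAdd_mk (x : LaurentPolynomial (BPBP p)) (n : N) :
    cofreeEpsAdd p N (cofreeMk p x n) = grCounit p (toGr p x) • n := rfl

variable (N) in
/-- The counit of the adjunction between the forgetful functor and the cofree comodule. -/
def cofreeEps : CofreeCarrier p N →ₗ[BP p] N where
  toFun := cofreeEpsAdd p N
  map_add' := map_add _
  map_smul' a z := by
    rw [RingHom.id_apply]
    induction z using cofree_induction with
    | h0 => rw [smul_zero, map_zero, smul_zero]
    | ha x y hx hy => rw [smul_add, map_add, map_add, smul_add, hx, hy]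
    | hm x n =>
      have h : grCounit p (toGr p (rho p a)) = a := grCounit_algebraMap p a
      rw [cofree_smul, smul_cofreeMk, cofreeEpsAdd_mk, cofreeEpsAdd_mk, map_mul, map_mul, h,
        mul_smul]

theorem cofreeEps_mk (x : LaurentPolynomial (BPBP p)) (n : N) :
    cofreeEps p N (cofreeMk p x n) = grCounit p (toGr p x) • n := rfl

theorem cofreeEps_map (f : N →ₗ[BP p] N') (z : CofreeCarrier p N) :
    cofreeEps p N' (cofreeMapLin p f z) = f (cofreeEps p N z) := by
  induction z using cofree_induction with
  | h0 => simp only [map_zero]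
  | ha x y hx hy => simp only [map_add, hx, hy]
  | hm x n => rw [cofreeMapLin_mk, cofreeEps_mk, cofreeEps_mk, map_smul]

theorem cofreeEps_cofreeJ (d : ℤ) (z : BPBP p ⊗[BP p] N) : cofreeEps p N (cofreeJ p N d z) =
    TensorProduct.lid (BP p) N ((counit p).toLinearMap.rTensor N z) := by
  induction z using TensorProduct.induction_on with
  | zero => simp only [map_zero]
  | tmul g n =>
    have h : grCounit p (toGr p (LaurentPolynomial.C g * LaurentPolynomial.T d)) = counit p g := by
      rw [map_mul, map_mul]
      exact (congrArg₂ _ (grCounit_C p g) (grCounit_T p _)).trans (mul_one _)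
    rw [cofreeJ_tmul, cofreeEps_mk, h]
    rfl
  | add x y hx hy => simp only [map_add, hx, hy]

/-- This is `lid_grCounit_psi` with coefficients in `N`; it shows that each homogeneous summand of
the cofree comodule is recovered from its coaction by applying the counit of the adjunction to the
second factor. -/
theorem lTensor_cofreeEps_coact (d : ℤ) (z : BPBP p ⊗[BP p] N) :
    (cofreeEps p N).lTensor (BPBP p) (cofreeCoact p N (cofreeJ p N d z)) = z := by
  induction z using TensorProduct.induction_on with
  | zero => simp only [map_zero]
  | add x y hx hy => simp only [map_add, hx, hy]
  | tmul g n =>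
    have h1 : cofreeEps p N ∘ₗ cofreeIncl p n =
        (LinearMap.toSpanSingleton (BP p) N n) ∘ₗ (grCounitAlg p).toLinearMap :=
      LinearMap.ext fun x => rfl
    have h2 := lid_grCounit_psi p g (Multiplicative.ofAdd d)
    rw [← LinearEquiv.eq_symm_apply, TensorProduct.rid_symm_apply] at h2
    rw [cofreeJ_tmul, cofreeCoact_mk, ← LinearMap.lTensor_comp_apply, h1,
      LinearMap.lTensor_comp_apply]
    refine (congrArg _ h2).trans ?_
    rw [LinearMap.lTensor_tmul, LinearMap.toSpanSingleton_apply, one_smul]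

end

variable (M : Comod p)

/-- The additive map underlying the unit of the adjunction. -/
def cofreeUnitAdd : M.carrier →+ CofreeCarrier p M.carrier :=
  gradedLift M.isInternal fun d => (cofreeJ p M.carrier d).comp M.coact.toAddMonoidHom

theorem cofreeUnitAdd_of_mem {d : ℤ} {x : M.carrier} (hx : x ∈ M.deg d) :
    cofreeUnitAdd M x = cofreeJ p M.carrier d (M.coact x) :=
  gradedLift_of_mem M.isInternal _ hx

/-- The linear map underlying the unit of the adjunction. -/
def cofreeUnitLin : M.carrier →ₗ[BP p] CofreeCarrier p M.carrier where
  toFun := cofreeUnitAdd M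
  map_add' := map_add _
  map_smul' a x := by
    rw [RingHom.id_apply]
    refine graded_induction (P := fun a => cofreeUnitAdd M (a • x) = a • cofreeUnitAdd M x)
      (BPdeg_isInternal p) a ?_ (fun a b ha hb => ?_) fun i a ha => ?_
    · rw [zero_smul, zero_smul, map_zero]
    · rw [add_smul, map_add, add_smul, ha, hb]
    refine graded_induction (P := fun x => cofreeUnitAdd M (a • x) = a • cofreeUnitAdd M x)
      M.isInternal x ?_ (fun a b ha hb => ?_) fun d x hx => ?_
    · rw [smul_zero, map_zero, smul_zero]
    · rw [smul_add, map_add, map_add, smul_add, ha, hb]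
    rw [cofreeUnitAdd_of_mem M hx, cofreeUnitAdd_of_mem M (M.smul_mem ha hx), smul_cofreeJ p ha,
      LinearMap.map_smulₛₗ]

theorem cofreeUnitLin_of_mem {d : ℤ} {x : M.carrier} (hx : x ∈ M.deg d) :
    cofreeUnitLin M x = cofreeJ p M.carrier d (M.coact x) := cofreeUnitAdd_of_mem M hx

/-- The degree bookkeeping for the unit: an element `b` of degree `i` produces `T ^ (-i)` under
`theta`, which reduces the exponent `i + d` to `d`. -/
theorem kappa_mul_inr {d : ℤ} {b : BPBP p} {i : ℤ} (hb : b ∈ BPBPdeg p i) (z : BPBP p ⊗[BP p] M.carrier)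
    (Λ : BPBP2 p ⊗[BP p] M.carrier →+ BPBP p ⊗[BP p] CofreeCarrier p M.carrier)
    (hΛ : ∀ h x, Λ (h ⊗ₜ x) = kappa p (theta p h * gtT p (Multiplicative.ofAdd (i + d))) x) :
    Λ (inr p b • (inl p).toLinearMap.rTensor M.carrier z) = b ⊗ₜ cofreeJ p M.carrier d z := by
  induction z using TensorProduct.induction_on with
  | zero => simp only [map_zero, smul_zero, TensorProduct.tmul_zero]
  | add x y hx hy => simp only [map_add, smul_add, TensorProduct.tmul_add, hx, hy]
  | tmul g x =>
    have h : theta p (inr p b * inl p g) * gtT p (Multiplicative.ofAdd (i + d)) =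
        b ⊗ₜ (grC p g * grT p (Multiplicative.ofAdd d)) := by
      have h1 : gtTinv p (Multiplicative.ofAdd i) * gtT p (Multiplicative.ofAdd (i + d)) =
          gtT p (Multiplicative.ofAdd d) := by
        rw [ofAdd_add, map_mul, ← mul_assoc, mul_comm (gtTinv p _), gtT_mul_gtTinv, one_mul]
      rw [map_mul, theta_inr p hb, theta_inl, mul_right_comm, mul_assoc (gtL p b), mul_comm _ (gtC p g), h1,
        gtC_apply, gtL_apply, gtT_apply, Algebra.TensorProduct.tmul_mul_tmul,
        Algebra.TensorProduct.tmul_mul_tmul, one_mul, one_mul, mul_one]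
    rw [LinearMap.rTensor_tmul, smul_tmul', hΛ]
    refine (congrArg (fun z => kappa p z x) h).trans ?_
    rw [kappa_tmul]
    rfl

/-- The unit of the adjunction between the forgetful functor and the cofree comodule. -/
def cofreeUnit : M ⟶ cofreeObj p M.carrier where
  toLin := cofreeUnitLin M
  map_deg {d x} hx := ⟨_, (cofreeUnitLin_of_mem M hx).symm⟩
  map_coact x := by
    change cofreeCoact p _ _ = _
    refine graded_induction (P := fun x => cofreeCoact p _ (cofreeUnitLin M x) =
      (cofreeUnitLin M).lTensor (BPBP p) (M.coact x)) M.isInternal x ?_ (fun a b ha hb => ?_)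
      fun d x hx => ?_
    · simp only [map_zero]
    · simp only [map_add, ha, hb]
    let Λ : BPBP2 p ⊗[BP p] M.carrier →+ BPBP p ⊗[BP p] CofreeCarrier p M.carrier :=
      kappaLift p ((AddMonoidHom.mulRight (gtT p (Multiplicative.ofAdd d))).comp
        (theta p : BPBP2 p →+ GrTensor p)) fun a x => by
          rw [Algebra.smul_def]
          simp only [AddMonoidHom.comp_apply, AddMonoidHom.mulRight_apply]
          refine (congrArg (· * _) (map_mul (theta p) _ _)).trans ?_
          rw [theta_C, mul_assoc]
          rfl
    have hΛ : ∀ h x, Λ (h ⊗ₜ x) = kappa p (theta p h * gtT p (Multiplicative.ofAdd d)) x :=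
      fun h x => rfl
    -- The coaction of the cofree comodule is `Δ ⊗ 1` followed by `Λ`, and `Λ` after `ψ ⊗ 1` is `1
    -- ⊗` the unit map. Coassociativity of `M` identifies the two composites on `ψ(x)`.
    have h1 : ∀ z : BPBP p ⊗[BP p] M.carrier, cofreeCoact p _ (cofreeJ p M.carrier d z) =
        Λ ((comul p).toLinearMap.rTensor M.carrier z) := fun z => by
      induction z using TensorProduct.induction_on with
      | zero => simp only [map_zero]
      | add x y hx hy => simp only [map_add, hx, hy]
      | tmul g x =>
        rw [LinearMap.rTensor_tmul, hΛ, cofreeJ_tmul, cofreeCoact_mk]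
        refine congrArg (fun z => kappa p z x) ?_
        rw [AlgHom.toLinearMap_apply, ← psi_C, ← psi_T, ← map_mul (psi p)]
        rfl
    have h2 : ∀ z ∈ tensorDeg M.deg d, Λ (coactTensor M.coact z) =
        (cofreeUnitLin M).lTensor (BPBP p) z := fun z hz => by
      induction hz using AddSubgroup.closure_induction with
      | zero => simp only [map_zero]
      | add x y _ _ hx hy => simp only [map_add, hx, hy]
      | neg x _ hx => simp only [map_neg, hx]
      | mem z hz =>
        obtain ⟨i, j, rfl, g, hg, x, hx, rfl⟩ := hz
        rw [coactTensor_tmul, kappa_mul_inr M hg _ Λ hΛ, LinearMap.lTensor_tmul,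
          cofreeUnitLin_of_mem M hx]
    rw [cofreeUnitLin_of_mem M hx, h1, M.coassoc, h2 _ (M.coact_mem hx)]

/-- A triangle identity. For homogeneous `x` the value `F x` is some `cofreeJ d w`, and `w` is read
off from the coaction of `F x`, that is, from `F` applied to the coaction of `x`. So `F` is
determined by its composite with the counit. -/
theorem cofreeMapLin_eps_comp {N : Type} [AddCommGroup N] [Module (BP p) N]
    (F : M.carrier →ₗ[BP p] CofreeCarrier p N)
    (hdeg : ∀ {d : ℤ} {x : M.carrier}, x ∈ M.deg d → F x ∈ cofreeDeg p N d)
    (hco : ∀ x, cofreeCoact p N (F x) = F.lTensor (BPBP p) (M.coact x)) (x : M.carrier) :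
    cofreeMapLin p (cofreeEps p N ∘ₗ F) (cofreeUnitLin M x) = F x := by
  refine graded_induction (P := fun x => cofreeMapLin p (cofreeEps p N ∘ₗ F)
    (cofreeUnitLin M x) = F x) M.isInternal x ?_ (fun a b ha hb => ?_) fun d x hx => ?_
  · simp only [map_zero]
  · rw [map_add, map_add, map_add, ha, hb]
  · obtain ⟨w, hw⟩ := hdeg hx
    rw [cofreeUnitLin_of_mem M hx, cofreeMapLin_cofreeJ, LinearMap.lTensor_comp_apply,
      ← hco, ← hw, lTensor_cofreeEps_coact p d w]

/-- Homomorphisms to a cofree comodule are linear maps. -/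
def cofreeEquiv (M : Comod p) (N : Type) [AddCommGroup N] [Module (BP p) N] :
    (M.carrier →ₗ[BP p] N) ≃ (M ⟶ cofreeObj p N) where
  toFun f := cofreeUnit M ≫ cofreeMap p f
  invFun F := cofreeEps p N ∘ₗ F.toLin
  left_inv f := LinearMap.ext fun x => by
    change cofreeEps p N (cofreeMapLin p f (cofreeUnitLin M x)) = f x
    rw [cofreeEps_map]
    congr 1
    refine graded_induction (P := fun x => cofreeEps p M.carrier (cofreeUnitLin M x) = x)
      M.isInternal x ?_ (fun a b ha hb => ?_) fun d x hx => ?_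
    · simp only [map_zero]
    · simp only [map_add, ha, hb]
    · rw [cofreeUnitLin_of_mem M hx, cofreeEps_cofreeJ, M.counit_coact]
  right_inv F := Comod.hom_ext fun x => cofreeMapLin_eps_comp M F.toLin F.map_deg F.map_coact x

theorem cofreeEquiv_symm_comp {M M' : Comod p} (N : Type) [AddCommGroup N] [Module (BP p) N]
    (h : M ⟶ M') (F : M' ⟶ cofreeObj p N) :
    (cofreeEquiv M N).symm (h ≫ F) = (cofreeEquiv M' N).symm F ∘ₗ h.toLin := rfl

variable (p) in
/-- The equivalence of the adjunction. -/
def cofreeHomEquiv (M : Comod p) (N : ModuleCat.{0} (BP p)) :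
    ((forgetMod p).obj M ⟶ N) ≃ (M ⟶ cofreeObj p N) :=
  ModuleCat.homEquiv.trans (cofreeEquiv M N)

theorem cofreeHomEquiv_nat (M' M : Comod p) (N : ModuleCat.{0} (BP p)) (f : M' ⟶ M)
    (g : (forgetMod p).obj M ⟶ N) : cofreeHomEquiv p M' N ((forgetMod p).map f ≫ g) =
      f ≫ cofreeHomEquiv p M N g := by
  rw [← Equiv.eq_symm_apply]
  refine ModuleCat.hom_ext ?_
  change _ = (cofreeEquiv M' N).symm (f ≫ cofreeEquiv M N g.hom)
  rw [cofreeEquiv_symm_comp]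
  exact congrArg (· ∘ₗ f.toLin) ((cofreeEquiv M N).symm_apply_apply g.hom).symm

variable (p) in
/-- The cofree comodule functor. -/
def cofree : ModuleCat.{0} (BP p) ⥤ Comod p :=
  Adjunction.rightAdjointOfEquiv (cofreeHomEquiv p) cofreeHomEquiv_nat

variable (p) in
/-- The cofree comodule functor is right adjoint to the forgetful functor. -/
def forgetCofreeAdj : forgetMod p ⊣ cofree p :=
  Adjunction.adjunctionOfEquivRight (cofreeHomEquiv p) cofreeHomEquiv_nat

instance : (forgetMod p).PreservesMonomorphisms where
  preserves f _ := (ModuleCat.mono_iff_injective _).2 (Comod.injective_of_mono f)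

instance : (forgetMod p).ReflectsMonomorphisms where
  reflects f h := Comod.mono_of_injective f ((ModuleCat.mono_iff_injective _).1 h)

instance : (forgetMod p).IsLeftAdjoint := (forgetCofreeAdj p).isLeftAdjoint

/-- A right adjoint of a functor that preserves monomorphisms preserves injectives, and a comodule
embeds in the cofree comodule on any injective module that contains it. -/
instance : EnoughInjectives (Comod p) := EnoughInjectives.of_adjunction (forgetCofreeAdj p)

end Adjunction

/-! ### Exactness of comodules on underlying modules -/

section ForgetExact

variable {p : ℕ} [hp : Fact p.Prime]

instance : (forgetMod p).Additive where

instance : (forgetMod p).Faithful where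
  map_injective h := Comod.Hom.ext (ModuleCat.hom_ext_iff.1 h)

instance : (forgetMod p).PreservesHomology :=
  Functor.preservesHomology_of_preservesMonos_and_cokernels _

theorem Comod.exact_iff (S : ShortComplex (Comod p)) :
    S.Exact ↔ ∀ x, S.g.toLin x = 0 → ∃ y, S.f.toLin y = x := by
  rw [← S.exact_map_iff_of_faithful (forgetMod p), ShortComplex.moduleCat_exact_iff]
  rfl

theorem Comod.isIso_of_bijective {M N : Comod p} (f : M ⟶ N) (hf : Function.Bijective f.toLin) :
    IsIso f :=
  haveI := Comod.mono_of_injective f hf.1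
  haveI := Comod.epi_of_surjective f hf.2
  isIso_of_mono_of_epi f

theorem Comod.bijective_of_isIso {M N : Comod p} (f : M ⟶ N) [IsIso f] :
    Function.Bijective f.toLin :=
  ⟨Comod.injective_of_mono f, Comod.surjective_of_epi f⟩

theorem Comod.isZero_iff (M : Comod p) : IsZero M ↔ ∀ x : M.carrier, x = 0 := by
  rw [IsZero.iff_id_eq_zero]
  exact ⟨fun h x => LinearMap.congr_fun (congrArg Comod.Hom.toLin h) x,
    fun h => Comod.hom_ext fun x => h x⟩

theorem Comod.gproj_smul (M : Comod p) {e : ℤ} {a : BP p} (ha : a ∈ BPdeg p e) (d : ℤ)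
    (x : M.carrier) : gproj M.isInternal d (a • x) = a • gproj M.isInternal (d - e) x := by
  refine graded_induction (P := fun x => gproj M.isInternal d (a • x) =
    a • gproj M.isInternal (d - e) x) M.isInternal x ?_
    (fun x y hx hy => ?_) fun i x hx => ?_
  · rw [smul_zero, map_zero, map_zero, smul_zero]
  · rw [smul_add, map_add, hx, hy, map_add, smul_add]
  · rw [gproj_of_mem _ (M.smul_mem ha hx), gproj_of_mem _ hx, smul_ite, smul_zero]
    congr 1
    exact propext ⟨fun h => by omega, fun h => by omega⟩

theorem vGen_pow_mem (n N : ℕ) : ∃ d, vGen p n ^ N ∈ BPdeg p d := by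
  obtain ⟨d, hd⟩ := vGen_mem p n
  induction N with
  | zero => exact ⟨0, by rw [pow_zero]; exact BPdeg_one p⟩
  | succ N ih =>
    obtain ⟨e, he⟩ := ih
    exact ⟨e + d, by rw [pow_succ]; exact BPdeg_mul p he hd⟩

end ForgetExact

/-! ### The `v_n`-torsion theory and the existence of `L_n` -/

section Torsion

section

variable (p : ℕ) [hp : Fact p.Prime] (n : ℕ)

/-- Elements killed by a power of `v_n`. -/
def vTorsion (M : Type*) [AddCommGroup M] [Module (BP p) M] : Submodule (BP p) M where
  carrier := {x | vGen p n ∈ nilIdeal x}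
  zero_mem' := ⟨0, by rw [Ideal.mem_torsionOf_iff, smul_zero]⟩
  add_mem' := by
    intro x y hx hy
    obtain ⟨N, hN⟩ := mem_nilIdeal.1 hx
    obtain ⟨K, hK⟩ := mem_nilIdeal.1 hy
    refine mem_nilIdeal.2 ⟨N + K, ?_⟩
    rw [smul_add, pow_add, mul_comm, mul_smul, hN, smul_zero, mul_comm, mul_smul, hK, smul_zero,
      add_zero]
  smul_mem' := by
    intro a x hx
    obtain ⟨N, hN⟩ := mem_nilIdeal.1 hx
    exact mem_nilIdeal.2 ⟨N, by rw [smul_comm, hN, smul_zero]⟩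

/-- There is no `v_n`-torsion. -/
def IsVTorsionFree (M : Type*) [AddCommGroup M] [Module (BP p) M] : Prop :=
  ∀ x : M, ∀ N : ℕ, vGen p n ^ N • x = 0 → x = 0

end

variable {p : ℕ} [hp : Fact p.Prime] {n : ℕ}

theorem mem_vTorsion {M : Type*} [AddCommGroup M] [Module (BP p) M] {x : M} :
    x ∈ vTorsion p n M ↔ ∃ N : ℕ, vGen p n ^ N • x = 0 := Iff.rfl

theorem vTorsion_gproj (M : Comod p) (x : M.carrier) (hx : x ∈ vTorsion p n M.carrier) (d : ℤ) :
    gproj M.isInternal d x ∈ vTorsion p n M.carrier := by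
  obtain ⟨N, hN⟩ := hx
  rw [Ideal.mem_torsionOf_iff] at hN
  obtain ⟨e, he⟩ := vGen_pow_mem (p := p) n N
  refine ⟨N, ?_⟩
  rw [Ideal.mem_torsionOf_iff]
  have := M.gproj_smul he (d + e) x
  rw [hN, map_zero, add_sub_cancel_right] at this
  exact this.symm

/-- The coefficients of `ψ(x)` at the monomials `t ^ e` are again torsion by
`vGen_mem_nilIdeal_tcoeff`; this is what makes the torsion elements a subcomodule. -/
theorem vTorsion_coact (M : Comod p) (x : M.carrier) (hx : x ∈ vTorsion p n M.carrier) :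
    M.coact x ∈ LinearMap.range ((vTorsion p n M.carrier).subtype.lTensor (BPBP p)) := by
  obtain ⟨s, hs⟩ := eq_sum_tcoeff (M.coact x)
  rw [hs]
  exact sum_mem fun e _ => ⟨_ ⊗ₜ ⟨_, vGen_mem_nilIdeal_tcoeff M x hx e⟩, rfl⟩

variable (n) in
/-- The subcomodule of `v_n`-torsion elements. -/
def torsionComod (M : Comod p) : Comod p :=
  M.sub (vTorsion p n M.carrier) (vTorsion_gproj M) (vTorsion_coact M)

variable (n) in
/-- The inclusion of the subcomodule of `v_n`-torsion elements. -/
def torsionι (M : Comod p) : torsionComod n M ⟶ M := Comod.subι _ _ _ _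

theorem range_torsionι (M : Comod p) :
    LinearMap.range (torsionι n M).toLin = vTorsion p n M.carrier := Submodule.range_subtype _

theorem isVTorsion_torsionComod (M : Comod p) : IsVTorsion p n (torsionComod n M) := fun x => by
  obtain ⟨N, hN⟩ := x.2
  exact ⟨N, Subtype.ext hN⟩

variable (n) in
/-- The quotient of a comodule by its `v_n`-torsion elements. -/
def torsionQuot (M : Comod p) : Comod p := Comod.coker (torsionι n M)

variable (n) in
/-- The projection to the quotient by the `v_n`-torsion elements. -/
def torsionπ (M : Comod p) : M ⟶ torsionQuot n M := Comod.cokerπ (torsionι n M)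

theorem torsionπ_surjective (M : Comod p) : Function.Surjective (torsionπ n M).toLin :=
  Comod.cokerπ_surjective _

theorem torsionπ_eq_zero (M : Comod p) (x : M.carrier) :
    (torsionπ n M).toLin x = 0 ↔ ∃ N : ℕ, vGen p n ^ N • x = 0 := by
  have h : (torsionπ n M).toLin x = 0 ↔ x ∈ LinearMap.ker (Comod.cokerπ (torsionι n M)).toLin :=
    Iff.rfl
  rw [h, Comod.ker_cokerπ, range_torsionι, mem_vTorsion]

theorem isVTorsionFree_torsionQuot (M : Comod p) :
    IsVTorsionFree p n (torsionQuot n M).carrier := fun x N hx => by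
  obtain ⟨x, rfl⟩ := torsionπ_surjective M x
  rw [← map_smul, torsionπ_eq_zero] at hx
  obtain ⟨K, hK⟩ := hx
  exact (torsionπ_eq_zero M x).2 ⟨K + N, by rw [pow_add, mul_smul, hK]⟩

theorem torsionEquiv_iff {M N : Comod p} (f : M ⟶ N) : torsionEquiv p n f ↔
    (∀ x, f.toLin x = 0 → ∃ K : ℕ, vGen p n ^ K • x = 0) ∧
      ∀ y, ∃ (K : ℕ) (x : M.carrier), f.toLin x = vGen p n ^ K • y := by
  refine and_congr ⟨fun h x hx => ?_, fun h x => ?_⟩ ⟨fun h y => ?_, fun h y => ?_⟩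
  · obtain ⟨K, hK⟩ := h ⟨x, hx⟩
    exact ⟨K, congrArg Subtype.val hK⟩
  · obtain ⟨K, hK⟩ := h x.1 x.2
    exact ⟨K, Subtype.ext hK⟩
  · obtain ⟨K, hK⟩ := h ((Comod.cokerπ f).toLin y)
    rw [← map_smul, ← LinearMap.mem_ker, Comod.ker_cokerπ] at hK
    exact ⟨K, hK⟩
  · obtain ⟨y, rfl⟩ := Comod.cokerπ_surjective f y
    obtain ⟨K, x, hx⟩ := h y
    refine ⟨K, ?_⟩
    rw [← map_smul, ← LinearMap.mem_ker, Comod.ker_cokerπ]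
    exact ⟨x, hx⟩

/-- Homomorphisms to a torsion-free comodule are determined on a subobject with torsion
cokernel. -/
theorem hom_eq_of_torsionFree {M N Z : Comod p} (hZ : IsVTorsionFree p n Z.carrier) (f : M ⟶ N)
    (hf : ∀ y, ∃ (K : ℕ) (x : M.carrier), f.toLin x = vGen p n ^ K • y) (g h : N ⟶ Z)
    (e : f ≫ g = f ≫ h) : g = h := Comod.hom_ext fun y => by
  obtain ⟨K, x, hx⟩ := hf y
  have h1 : g.toLin (f.toLin x) = h.toLin (f.toLin x) :=
    LinearMap.congr_fun (congrArg Comod.Hom.toLin e) x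
  rw [hx, map_smul, map_smul, ← sub_eq_zero, ← smul_sub] at h1
  exact sub_eq_zero.1 (hZ _ K h1)

/-- The map from the torsion subcomodule to `0` has torsion kernel and cokernel, so every
homomorphism from the torsion subcomodule to a local object factors through `0`. -/
theorem isVTorsionFree_of_isLocal {Z : Comod p} (hZ : (torsionEquiv p n).isLocal Z) :
    IsVTorsionFree p n Z.carrier := fun x N hx => by
  have h1 : torsionEquiv p n (0 : torsionComod n Z ⟶ Comod.zero p) :=
    (torsionEquiv_iff _).2 ⟨fun x _ => isVTorsion_torsionComod Z x, fun y => ⟨0, 0, rfl⟩⟩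
  obtain ⟨g, hg⟩ := (hZ _ h1).2 (torsionι n Z)
  have h2 : torsionι n Z = 0 := by rw [← hg]; exact zero_comp
  have h3 : x ∈ LinearMap.range (torsionι n Z).toLin := by
    rw [range_torsionι]; exact ⟨N, hx⟩
  obtain ⟨y, rfl⟩ := h3
  rw [h2]; rfl

/-- Locality of `Z` provides a retraction of `f`. It is a two-sided inverse, because endomorphisms
of the torsion-free `X` are determined on the image of `f`. -/
theorem bijective_of_isLocal {Z X : Comod p} (hZ : (torsionEquiv p n).isLocal Z)
    (hX : IsVTorsionFree p n X.carrier) (f : Z ⟶ X) (hf : torsionEquiv p n f) :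
    Function.Bijective f.toLin := by
  obtain ⟨r, hr⟩ := (hZ f hf).2 (𝟙 Z)
  have h1 : r ≫ f = 𝟙 X := hom_eq_of_torsionFree hX f ((torsionEquiv_iff f).1 hf).2 _ _ (by
    have hr : f ≫ r = 𝟙 Z := hr
    rw [← Category.assoc, hr, Category.id_comp, Category.comp_id])
  have : IsIso f := ⟨r, hr, h1⟩
  exact Comod.bijective_of_isIso f

/-- The kernel of a map from a local comodule to a torsion-free comodule is local. -/
theorem isLocal_of_exact {Z E Y : Comod p} (hE : (torsionEquiv p n).isLocal E)
    (hY : IsVTorsionFree p n Y.carrier) (i : Z ⟶ E) (g : E ⟶ Y) (hi : Function.Injective i.toLin)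
    (h : ∀ x, g.toLin x = 0 ↔ ∃ z, i.toLin z = x) : (torsionEquiv p n).isLocal Z := by
  intro M N f hf
  have := Comod.mono_of_injective i hi
  refine ⟨fun a b hab => ?_, fun a => ?_⟩
  · have hab : f ≫ a = f ≫ b := hab
    rw [← cancel_mono i]
    apply (hE f hf).1
    change f ≫ a ≫ i = f ≫ b ≫ i
    rw [← Category.assoc, hab, Category.assoc]
  · obtain ⟨b, hb⟩ := (hE f hf).2 (a ≫ i)
    have hb : f ≫ b = a ≫ i := hb
    -- The composite vanishes on the image of `f`, whose cokernel is torsion, and `Y` is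
    -- torsion-free. Hence the extension `b` takes values in the kernel of `g`, which is `Z`.
    have h1 : b ≫ g = 0 := hom_eq_of_torsionFree hY f ((torsionEquiv_iff f).1 hf).2 _ _ (by
      rw [← Category.assoc, hb, comp_zero]
      refine Comod.hom_ext fun x => (h _).2 ⟨a.toLin x, rfl⟩)
    have h2 : ∀ x, b.toLin x ∈ LinearMap.range i.toLin := fun x => (h _).1
      (LinearMap.congr_fun (congrArg Comod.Hom.toLin h1) x)
    refine ⟨Comod.liftOfInjective i hi b h2, ?_⟩
    change f ≫ _ = a
    rw [← cancel_mono i, Category.assoc, Comod.liftOfInjective_comp, hb]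

theorem isLocal_of_bijective {Z E : Comod p} (hE : (torsionEquiv p n).isLocal E) (f : Z ⟶ E)
    (hf : Function.Bijective f.toLin) : (torsionEquiv p n).isLocal Z :=
  isLocal_of_exact (Y := Comod.zero p) hE (fun _ _ _ => rfl) f 0 hf.1
    fun x => ⟨fun _ => hf.2 x, fun _ => rfl⟩

section Existence

/-- A cofree comodule on an injective module on which `v_n` is bijective is local. -/
theorem isLocal_cofreeObj (I : ModuleCat.{0} (BP p)) [Injective I]
    (hI : Function.Bijective fun x : I => vGen p n • x) :
    (torsionEquiv p n).isLocal (cofreeObj p I) := by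
  have hpow : ∀ (K : ℕ) (x : I), vGen p n ^ K • x = 0 → x = 0 := fun K => by
    induction K with
    | zero => intro x hx; rwa [pow_zero, one_smul] at hx
    | succ K ih =>
      intro x hx
      rw [pow_succ, mul_smul] at hx
      exact hI.1 (show vGen p n • x = vGen p n • (0 : I) by rw [ih _ hx, smul_zero])
  intro M N f hf
  rw [torsionEquiv_iff] at hf
  refine ⟨fun a b hab => ?_, fun a => ?_⟩
  · apply (cofreeEquiv N I).symm.injective
    have h1 := congrArg (cofreeEquiv M I).symm (show f ≫ a = f ≫ b from hab)
    rw [cofreeEquiv_symm_comp, cofreeEquiv_symm_comp] at h1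
    refine LinearMap.ext fun y => ?_
    obtain ⟨K, x, hx⟩ := hf.2 y
    have h2 := LinearMap.congr_fun h1 x
    rw [LinearMap.comp_apply, LinearMap.comp_apply, hx, map_smul, map_smul, ← sub_eq_zero,
      ← smul_sub] at h2
    exact sub_eq_zero.1 (hpow K _ h2)
  · set φ := (cofreeEquiv M I).symm a with hφ
    -- By adjunction the problem is to extend a linear map to `I` along `f`. The kernel of `f` is
    -- torsion and `I` has no torsion, so the map descends to the image of `f`, from where
    -- injectivity of `I` extends it.
    have hker : LinearMap.ker f.toLin ≤ LinearMap.ker φ := fun x hx => by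
      obtain ⟨K, hK⟩ := hf.1 x hx
      exact hpow K _ (by rw [← map_smul, hK, map_zero])
    let j : ModuleCat.of (BP p) (M.carrier ⧸ LinearMap.ker f.toLin) ⟶ ModuleCat.of (BP p) N.carrier :=
      ModuleCat.ofHom ((LinearMap.ker f.toLin).liftQ f.toLin le_rfl)
    have : Mono j := (ModuleCat.mono_iff_injective _).2 (by
      refine LinearMap.ker_eq_bot.1 ?_
      exact Submodule.ker_liftQ_eq_bot _ _ _ le_rfl)
    let k : ModuleCat.of (BP p) (M.carrier ⧸ LinearMap.ker f.toLin) ⟶ I :=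
      ModuleCat.ofHom ((LinearMap.ker f.toLin).liftQ φ hker)
    have hjk : j ≫ Injective.factorThru k j = k := Injective.comp_factorThru k j
    refine ⟨cofreeEquiv N I (Injective.factorThru k j).hom, ?_⟩
    apply (cofreeEquiv M I).symm.injective
    refine (cofreeEquiv_symm_comp I f _).trans ?_
    rw [Equiv.symm_apply_apply]
    refine LinearMap.ext fun x => ?_
    exact LinearMap.congr_fun (ModuleCat.hom_ext_iff.1 hjk) (Submodule.Quotient.mk x)

/-- Every module maps, with `v_n`-torsion kernel, to an injective module on which `v_n` is
bijective. -/
theorem exists_injective_hull (N : ModuleCat.{0} (BP p)) : ∃ (I : ModuleCat.{0} (BP p))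
    (_ : Injective I) (φ : N ⟶ I), (Function.Bijective fun x : I => vGen p n • x) ∧
      ∀ x, φ.hom x = 0 → ∃ K : ℕ, vGen p n ^ K • x = 0 := by
  let A' := Localization.Away (vGen p n)
  let f := algebraMap (BP p) A'
  -- An injective module over `BP_*[1/v_n]` remains injective over `BP_*`, because extension of
  -- scalars along a flat map is an exact left adjoint of restriction.
  have hflat : f.Flat := (RingHom.flat_algebraMap_iff).2
    (IsLocalization.flat A' (Submonoid.powers (vGen p n)))
  have := ModuleCat.preservesFiniteLimits_extendScalars_of_flat hflat
  let Q := ModuleCat.of A' (LocalizedModule (Submonoid.powers (vGen p n)) N)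
  let J := Injective.under Q
  let ι : LocalizedModule (Submonoid.powers (vGen p n)) N →ₗ[A'] J :=
    ModuleCat.Hom.hom (Injective.ι Q)
  let adj := ModuleCat.extendRestrictScalarsAdj.{0} f
  have hinj : Injective ((ModuleCat.restrictScalars f).obj J) :=
    Injective.injective_of_adjoint adj J
  let φ : N →ₗ[BP p] (ModuleCat.restrictScalars f).obj J :=
    { toFun := fun x => ι (LocalizedModule.mkLinearMap _ N x)
      map_add' := fun x y => by rw [map_add, map_add]; rfl
      map_smul' := fun a x =>
        (congrArg ι (LinearMap.map_smul (LocalizedModule.mkLinearMap _ N) a x)).trans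
          ((congrArg ι (algebraMap_smul A' a _).symm).trans (LinearMap.map_smul ι _ _)) }
  refine ⟨(ModuleCat.restrictScalars f).obj J, hinj,
    @ModuleCat.ofHom (BP p) _ N ((ModuleCat.restrictScalars f).obj J) _ _ _ _ φ, ?_,
    fun x hx => ?_⟩
  · obtain ⟨u, hu⟩ := IsLocalization.Away.algebraMap_isUnit (S := A') (vGen p n)
    have h1 : Function.Bijective fun x : J => u • x := MulAction.bijective u
    have h2 : (fun x : J => u • x) = fun x : J => f (vGen p n) • x := by
      funext x
      rw [← hu]
      rfl
    rw [h2] at h1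
    exact h1
  · have h1 : Function.Injective ι := (ModuleCat.mono_iff_injective (Injective.ι Q)).1 inferInstance
    have h2 : LocalizedModule.mkLinearMap (Submonoid.powers (vGen p n)) N x = 0 :=
      h1 (hx.trans (map_zero ι).symm)
    obtain ⟨⟨_, K, rfl⟩, hK⟩ := (IsLocalizedModule.eq_zero_iff (Submonoid.powers (vGen p n))
      (LocalizedModule.mkLinearMap (Submonoid.powers (vGen p n)) N)).1 h2
    exact ⟨K, hK⟩

/-- The adjoint of a linear map has the original map as its composite with the counit, so its kernel
is no larger than that of the linear map, and in particular torsion. -/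
theorem exists_local_hull (M : Comod p) : ∃ (X : Comod p) (f : M ⟶ X),
    (torsionEquiv p n).isLocal X ∧ ∀ x, f.toLin x = 0 → ∃ K : ℕ, vGen p n ^ K • x = 0 := by
  obtain ⟨I, hI, φ, hbij, hφ⟩ := exists_injective_hull (n := n) ((forgetMod p).obj M)
  refine ⟨cofreeObj p I, cofreeEquiv M I φ.hom, isLocal_cofreeObj I hbij, fun x hx => hφ x ?_⟩
  have h1 := LinearMap.congr_fun ((cofreeEquiv M I).symm_apply_apply φ.hom) x
  have h2 : cofreeEps p I ((cofreeEquiv M I φ.hom).toLin x) = φ.hom x := h1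
  rw [← h2, hx]
  exact map_zero _

/-- Take the elements of a local hull `X` that become torsion modulo the image of `M`. This is the
kernel of a map from the local `X` to a torsion-free comodule, hence local, and it is torsion modulo
`M` by construction. -/
theorem exists_localization (M : Comod p) : ∃ (Z : Comod p) (f : M ⟶ Z),
    (torsionEquiv p n).isLocal Z ∧ torsionEquiv p n f := by
  obtain ⟨X, f, hX, hf⟩ := exists_local_hull (n := n) M
  let g := Comod.cokerπ f ≫ torsionπ n (Comod.coker f)
  have hg : ∀ x, g.toLin x = 0 ↔ ∃ K y, f.toLin y = vGen p n ^ K • x := fun x => by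
    refine (torsionπ_eq_zero (n := n) (Comod.coker f) ((Comod.cokerπ f).toLin x)).trans
      (exists_congr fun K => ?_)
    rw [← map_smul, ← LinearMap.mem_ker, Comod.ker_cokerπ]
    rfl
  have hfg : ∀ x, f.toLin x ∈ LinearMap.range (Comod.kerι g).toLin := fun x =>
    Comod.mem_range_kerι g ((hg _).2 ⟨0, x, by rw [pow_zero, one_smul]⟩)
  have hl := Comod.liftOfInjective_comp (Comod.kerι g) (Comod.kerι_injective g) f hfg
  have hl' : ∀ x, (Comod.kerι g).toLin ((Comod.liftOfInjective (Comod.kerι g)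
      (Comod.kerι_injective g) f hfg).toLin x) = f.toLin x := fun x =>
    LinearMap.congr_fun (congrArg Comod.Hom.toLin hl) x
  refine ⟨Comod.ker g, Comod.liftOfInjective (Comod.kerι g) (Comod.kerι_injective g) f hfg,
    isLocal_of_exact hX (isVTorsionFree_torsionQuot _) (Comod.kerι g) g (Comod.kerι_injective g)
      fun x => ⟨fun h => Comod.mem_range_kerι g h, ?_⟩, ?_⟩
  · rintro ⟨z, rfl⟩
    exact z.2
  · rw [torsionEquiv_iff]
    refine ⟨fun x hx => hf x ?_, fun y => ?_⟩
    · rw [← hl', hx, map_zero]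
    · obtain ⟨K, x, hx⟩ := (hg ((Comod.kerι g).toLin y)).1 y.2
      refine ⟨K, x, Comod.kerι_injective g ?_⟩
      rw [hl', hx, map_smul]

variable (n) in
/-- The localization of a comodule. -/
def localizationObj (M : Comod p) : Comod p := (exists_localization (n := n) M).choose

variable (n) in
/-- The map to the localization of a comodule. -/
def localizationUnit (M : Comod p) : M ⟶ localizationObj n M :=
  (exists_localization (n := n) M).choose_spec.choose

theorem isLocal_localizationObj (M : Comod p) : (torsionEquiv p n).isLocal (localizationObj n M) :=
  (exists_localization (n := n) M).choose_spec.choose_spec.1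

theorem torsionEquiv_localizationUnit (M : Comod p) : torsionEquiv p n (localizationUnit n M) :=
  (exists_localization (n := n) M).choose_spec.choose_spec.2

/-- The map of localizations induced by a homomorphism. -/
def localizationMap {M N : Comod p} (f : M ⟶ N) : localizationObj n M ⟶ localizationObj n N :=
  ((isLocal_localizationObj N (localizationUnit n M) (torsionEquiv_localizationUnit M)).2
    (f ≫ localizationUnit n N)).choose

theorem localizationUnit_map {M N : Comod p} (f : M ⟶ N) :
    localizationUnit n M ≫ localizationMap f = f ≫ localizationUnit n N :=
  ((isLocal_localizationObj N (localizationUnit n M) (torsionEquiv_localizationUnit M)).2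
    (f ≫ localizationUnit n N)).choose_spec

theorem localization_hom_ext {M N : Comod p} {g h : localizationObj n M ⟶ localizationObj n N}
    (e : localizationUnit n M ≫ g = localizationUnit n M ≫ h) : g = h :=
  (isLocal_localizationObj N (localizationUnit n M) (torsionEquiv_localizationUnit M)).1 e

variable (p n) in
theorem nonempty_torsionLocalization : Nonempty (TorsionLocalization p n) :=
  ⟨{functor :=
      { obj := localizationObj n
        map := localizationMap
        map_id := fun M => localization_hom_ext (by
          rw [localizationUnit_map, Category.id_comp, Category.comp_id])
        map_comp := fun f g => localization_hom_ext (by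
          rw [localizationUnit_map, ← Category.assoc, localizationUnit_map, Category.assoc,
            Category.assoc, localizationUnit_map]) }
    unit :=
      { app := localizationUnit n
        naturality := fun M N f => (localizationUnit_map f).symm }
    unit_mem := torsionEquiv_localizationUnit
    isLocal := isLocal_localizationObj }⟩

end Existence

end Torsion

/-! ### Local comodules and left exactness of `L_n` -/

section LocalProperties

variable {p : ℕ} [hp : Fact p.Prime] {n : ℕ}

theorem vGen_pow_smul_injective {M : Type*} [AddCommGroup M] [Module (BP p) M] {j : ℕ}
    (hM : Function.Injective fun x : M => vGen p j • x) : IsVTorsionFree p j M := fun x N => by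
  induction N with
  | zero => intro hx; rwa [pow_zero, one_smul] at hx
  | succ N ih =>
    intro hx
    rw [pow_succ', mul_smul] at hx
    exact ih (hM (show vGen p j • _ = vGen p j • (0 : M) by rw [hx, smul_zero]))

theorem vGen_pow_smul_surjective {M : Type*} [AddCommGroup M] [Module (BP p) M] {j : ℕ}
    (hM : Function.Surjective fun x : M => vGen p j • x) (N : ℕ) (x : M) :
    ∃ y, vGen p j ^ N • y = x := by
  induction N with
  | zero => exact ⟨x, by rw [pow_zero, one_smul]⟩
  | succ N ih =>
    obtain ⟨y, hy⟩ := ih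
    obtain ⟨z, rfl⟩ := hM y
    exact ⟨z, by rw [pow_succ, mul_smul]; exact hy⟩

/-- For comodules, `v_n`-torsion is contained in `v_j`-torsion; this is where torsion-freeness goes
up in the index. -/
theorem IsVTorsionFree.of_le {M : Comod p} {j : ℕ} (hj : j ≤ n)
    (hM : IsVTorsionFree p j M.carrier) : IsVTorsionFree p n M.carrier := fun x N hx => by
  obtain ⟨K, hK⟩ := mem_nilIdeal.1 (vGen_mem_nilIdeal M x (mem_nilIdeal.2 ⟨N, hx⟩) hj)
  exact hM x K hK

variable (L : TorsionLocalization p n)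

theorem TorsionLocalization.torsionFree (M : Comod p) :
    IsVTorsionFree p n (L.functor.obj M).carrier := isVTorsionFree_of_isLocal (L.isLocal M)

theorem TorsionLocalization.unit_ker (M : Comod p) (x : M.carrier) :
    (L.unit.app M).toLin x = 0 ↔ ∃ K : ℕ, vGen p n ^ K • x = 0 :=
  ⟨((torsionEquiv_iff _).1 (L.unit_mem M)).1 x, fun ⟨K, hK⟩ => L.torsionFree M _ K
    ((map_smul (L.unit.app M).toLin (vGen p n ^ K) x).symm.trans
      ((congrArg _ hK).trans (map_zero _)))⟩

theorem TorsionLocalization.unit_coker (M : Comod p) (y : (L.functor.obj M).carrier) :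
    ∃ (K : ℕ) (x : M.carrier), (L.unit.app M).toLin x = vGen p n ^ K • y :=
  ((torsionEquiv_iff _).1 (L.unit_mem M)).2 y

theorem TorsionLocalization.unit_naturality {M N : Comod p} (f : M ⟶ N) (x : M.carrier) :
    (L.functor.map f).toLin ((L.unit.app M).toLin x) = (L.unit.app N).toLin (f.toLin x) :=
  LinearMap.congr_fun (congrArg Comod.Hom.toLin (L.unit.naturality f).symm) x

theorem TorsionLocalization.isIso_unit {M : Comod p} (hM : (torsionEquiv p n).isLocal M) :
    IsIso (L.unit.app M) :=
  Comod.isIso_of_bijective _ (bijective_of_isLocal hM (L.torsionFree M) _ (L.unit_mem M))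

theorem TorsionLocalization.isZero_obj {M : Comod p} (hM : IsVTorsion p n M) :
    IsZero (L.functor.obj M) := (Comod.isZero_iff _).2 fun y => by
  obtain ⟨K, x, hx⟩ := L.unit_coker M y
  obtain ⟨N, hN⟩ := hM x
  rw [(L.unit_ker M x).2 ⟨N, hN⟩] at hx
  exact L.torsionFree M y K hx.symm

variable (p n) in
/-- A chosen localization functor. -/
def someLocalization : TorsionLocalization p n := (nonempty_torsionLocalization p n).some

/-- A comodule on which some `v_j` with `j ≤ n` is bijective is local. -/
theorem isLocal_of_vGen_bijective {M : Comod p} {j : ℕ} (hj : j ≤ n)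
    (hM : Function.Bijective fun x : M.carrier => vGen p j • x) :
    (torsionEquiv p n).isLocal M := by
  let L := someLocalization p n
  have htf := vGen_pow_smul_injective hM.1
  have hinj : ∀ x, (L.unit.app M).toLin x = 0 → x = 0 := fun x hx => by
    obtain ⟨K, hK⟩ := (L.unit_ker M x).1 hx
    exact htf.of_le hj x K hK
  refine isLocal_of_bijective (L.isLocal M) (L.unit.app M)
    ⟨(injective_iff_map_eq_zero _).2 hinj, fun y => ?_⟩
  -- The cokernel of the unit is a `v_n`-torsion comodule, hence `v_j`-torsion. A power of `v_j`
  -- moves `y` into `M`, where it can be divided out; this gives `m'`.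
  have h1 : vGen p n ∈ nilIdeal ((Comod.cokerπ (L.unit.app M)).toLin y) :=
    mem_nilIdeal.2 ((L.unit_mem M).2 _)
  obtain ⟨K, hK⟩ := mem_nilIdeal.1 (vGen_mem_nilIdeal _ _ h1 hj)
  rw [← map_smul, ← LinearMap.mem_ker, Comod.ker_cokerπ] at hK
  obtain ⟨m, hm⟩ := hK
  obtain ⟨m', rfl⟩ := vGen_pow_smul_surjective hM.2 K m
  have h2 : vGen p j ^ K • (y - (L.unit.app M).toLin m') = 0 := by
    rw [smul_sub, ← hm, sub_eq_zero]
    exact map_smul (L.unit.app M).toLin (vGen p j ^ K) m'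
  refine ⟨m', ?_⟩
  rw [eq_comm, ← sub_eq_zero]
  -- The difference is killed by a power of `v_j`. A `v_n`-power multiple of it comes from `x` in
  -- `M`, and `x` is `v_j`-torsion, hence zero; as `L_n M` has no `v_n`-torsion, the difference is
  -- zero.
  obtain ⟨N, x, hx⟩ := L.unit_coker M (y - (L.unit.app M).toLin m')
  refine L.torsionFree M _ N ?_
  rw [← hx]
  have h3 : (L.unit.app M).toLin (vGen p j ^ K • x) = 0 := by
    refine (map_smul (L.unit.app M).toLin (vGen p j ^ K) x).trans ?_
    rw [hx, smul_comm, h2, smul_zero]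
  rw [htf x K (hinj _ h3)]
  exact map_zero _

/-- Localization is left exact. -/
theorem TorsionLocalization.map_injective {M N : Comod p} (f : M ⟶ N)
    (hf : Function.Injective f.toLin) : Function.Injective (L.functor.map f).toLin := by
  refine (injective_iff_map_eq_zero _).2 fun y hy => ?_
  obtain ⟨K, x, hx⟩ := L.unit_coker M y
  have h1 : (L.unit.app N).toLin (f.toLin x) = 0 := by
    rw [← L.unit_naturality, hx, map_smul, hy, smul_zero]
  obtain ⟨J, hJ⟩ := (L.unit_ker N _).1 h1
  have h2 : (L.unit.app M).toLin x = 0 :=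
    (L.unit_ker M x).2 ⟨J, hf (by rw [map_smul, hJ, map_zero])⟩
  exact L.torsionFree M y K (by rw [← hx, h2])

/-- The kernel of `L.functor.map g` is local, and the map from `M` to it has torsion kernel and
cokernel. Locality of `L_n M` therefore extends the unit of `M` over this kernel, and the extension
exhibits every element of the kernel as an image from `L_n M`. -/
theorem TorsionLocalization.map_exact {M N P : Comod p} (f : M ⟶ N) (g : N ⟶ P)
    (hf : Function.Injective f.toLin) (h : ∀ x, g.toLin x = 0 ↔ ∃ y, f.toLin y = x)
    (x : (L.functor.obj N).carrier) (hx : (L.functor.map g).toLin x = 0) :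
    ∃ y, (L.functor.map f).toLin y = x := by
  let G := L.functor.map g
  have hZ : (torsionEquiv p n).isLocal (Comod.ker G) :=
    isLocal_of_exact (L.isLocal N) (L.torsionFree P) (Comod.kerι G) G (Comod.kerι_injective G)
      fun x => ⟨fun h => Comod.mem_range_kerι G h, by rintro ⟨z, rfl⟩; exact z.2⟩
  let F := f ≫ L.unit.app N
  have hF : ∀ z, F.toLin z ∈ LinearMap.range (Comod.kerι G).toLin := fun z =>
    Comod.mem_range_kerι G (by
      change (L.functor.map g).toLin ((L.unit.app N).toLin (f.toLin z)) = 0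
      rw [L.unit_naturality, (h _).2 ⟨z, rfl⟩]
      exact map_zero _)
  let i := Comod.liftOfInjective (Comod.kerι G) (Comod.kerι_injective G) F hF
  have hi : i ≫ Comod.kerι G = F := Comod.liftOfInjective_comp _ _ _ _
  have hi' : ∀ z, (Comod.kerι G).toLin (i.toLin z) = F.toLin z := fun z =>
    LinearMap.congr_fun (congrArg Comod.Hom.toLin hi) z
  have hW : torsionEquiv p n i := by
    rw [torsionEquiv_iff]
    refine ⟨fun z hz => ?_, fun y => ?_⟩
    · have h1 : (L.unit.app N).toLin (f.toLin z) = 0 := by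
        refine (hi' z).symm.trans ?_
        rw [hz, map_zero]
      obtain ⟨J, hJ⟩ := (L.unit_ker N _).1 h1
      exact ⟨J, hf (by rw [map_smul, hJ, map_zero])⟩
    · obtain ⟨K, w, hw⟩ := L.unit_coker N ((Comod.kerι G).toLin y)
      have h1 : (L.unit.app P).toLin (g.toLin w) = 0 := by
        rw [← L.unit_naturality, hw, map_smul]
        exact (congrArg _ (show (L.functor.map g).toLin ((Comod.kerι G).toLin y) = 0 from y.2)).trans
          (smul_zero _)
      obtain ⟨J, hJ⟩ := (L.unit_ker P _).1 h1
      rw [← map_smul, h] at hJ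
      obtain ⟨z, hz⟩ := hJ
      refine ⟨J + K, z, Comod.kerι_injective G ?_⟩
      rw [hi', map_smul, pow_add, mul_smul, ← hw]
      change (L.unit.app N).toLin (f.toLin z) = _
      rw [hz]
      exact map_smul (L.unit.app N).toLin _ _
  obtain ⟨r, hr⟩ := (L.isLocal M i hW).2 (L.unit.app M)
  have hr : i ≫ r = L.unit.app M := hr
  have h2 : r ≫ L.functor.map f = Comod.kerι G := (L.isLocal N i hW).1 (by
    change i ≫ r ≫ L.functor.map f = i ≫ Comod.kerι G
    rw [← Category.assoc, hr, hi]
    exact (L.unit.naturality f).symm)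
  obtain ⟨z, rfl⟩ := Comod.mem_range_kerι G hx
  exact ⟨r.toLin z, LinearMap.congr_fun (congrArg Comod.Hom.toLin h2) z⟩

instance : PreservesFiniteLimits L.functor := by
  rw [Functor.preservesFiniteLimits_iff_forall_exact_map_and_mono]
  intro S hS
  have hf : Function.Injective S.f.toLin := @Comod.injective_of_mono p _ _ _ S.f hS.mono_f
  refine ⟨(Comod.exact_iff _).2 fun x hx => L.map_exact S.f S.g hf (fun x =>
    ⟨(Comod.exact_iff S).1 hS.exact x, ?_⟩) x hx,
    Comod.mono_of_injective _ (L.map_injective _ hf)⟩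
  rintro ⟨y, rfl⟩
  exact LinearMap.congr_fun (congrArg Comod.Hom.toLin S.zero) y

end LocalProperties

/-! ### Regularity of `v_0, v_1, …` and divisibility of injective modules -/

section Divisibility

variable {p : ℕ} [hp : Fact p.Prime]

variable (p) in
/-- The ideal `(v_i ^ κ(i), …, v_{j-1} ^ κ(j-1))`. -/
def powIdeal (κ : ℕ → ℕ) (i j : ℕ) : Ideal (BP p) :=
  Ideal.span {x | ∃ l, i ≤ l ∧ l < j ∧ x = vGen p l ^ κ l}

/-- The ideal is generated by the constant `p ^ κ 0` and by powers of variables, so membership is a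
condition on coefficients of monomials with small exponents. Variable `i` is `v_{i+1}`, whence `κ (i
+ 1)`. -/
theorem coeff_of_mem_powIdeal {j : ℕ} {κ : ℕ → ℕ} {f : BP p} (hf : f ∈ powIdeal p κ 0 (j + 1)) (e : ℕ →₀ ℕ)
    (he : ∀ i < j, e i < κ (i + 1)) : (p : ZLoc p) ^ κ 0 ∣ MvPolynomial.coeff (R := ZLoc p) e f := by
  classical
  induction hf using Submodule.span_induction generalizing e with
  | mem x hx =>
    obtain ⟨i, -, hi, rfl⟩ := hx
    cases i with
    | zero =>
      have h1 : vGen p 0 ^ κ 0 = MvPolynomial.C (R := ZLoc p) (σ := ℕ) ((p : ZLoc p) ^ κ 0) := by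
        rw [vGen_zero, map_pow, map_natCast]; rfl
      rw [h1, MvPolynomial.coeff_C]
      split_ifs
      · exact dvd_rfl
      · exact dvd_zero _
    | succ i =>
      have h1 : vGen p (i + 1) ^ κ (i + 1) = MvPolynomial.monomial (R := ZLoc p) (σ := ℕ)
          (Finsupp.single i (κ (i + 1))) 1 := MvPolynomial.X_pow_eq_monomial
      rw [h1, MvPolynomial.coeff_monomial, if_neg]
      · exact dvd_zero _
      · rintro rfl
        have := he i (by omega)
        rw [Finsupp.single_eq_same] at this
        exact lt_irrefl _ this
  | zero => exact dvd_zero _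
  | add x y _ _ hx hy =>
    have : MvPolynomial.coeff (R := ZLoc p) e (x + y : BP p) = _ :=
      MvPolynomial.coeff_add (R := ZLoc p) (σ := ℕ) e x y
    rw [this]
    exact dvd_add (hx e he) (hy e he)
  | smul a x _ hx =>
    have : MvPolynomial.coeff (R := ZLoc p) e (a • x : BP p) = _ :=
      MvPolynomial.coeff_mul (R := ZLoc p) (σ := ℕ) a x e
    rw [this]
    refine Finset.dvd_sum fun q hq => Dvd.dvd.mul_left (hx _ fun i hi => ?_) _
    have h1 := Finset.HasAntidiagonal.mem_antidiagonal.1 hq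
    have h2 := he i hi
    rw [← h1, Finsupp.add_apply] at h2
    omega

theorem mem_powIdeal_of_coeff {j : ℕ} {κ : ℕ → ℕ} {f : BP p} (hf : ∀ e : ℕ →₀ ℕ, (∀ i < j, e i < κ (i + 1)) →
    (p : ZLoc p) ^ κ 0 ∣ MvPolynomial.coeff (R := ZLoc p) e f) : f ∈ powIdeal p κ 0 (j + 1) := by
  have has := MvPolynomial.as_sum (R := ZLoc p) (σ := ℕ) f
  have hsum : ∀ (s : Finset (ℕ →₀ ℕ)), (∑ e ∈ s, MvPolynomial.monomial (R := ZLoc p) (σ := ℕ) e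
      (MvPolynomial.coeff (R := ZLoc p) e f) : BP p) ∈ powIdeal p κ 0 (j + 1) := fun s => by
    refine sum_mem fun e _ => ?_
    by_cases he : ∀ i < j, e i < κ (i + 1)
    · obtain ⟨c, hc⟩ := hf e he
      have h1 : (MvPolynomial.monomial (R := ZLoc p) (σ := ℕ) e (MvPolynomial.coeff (R := ZLoc p) e f)
          : BP p) = (show BP p from MvPolynomial.monomial (R := ZLoc p) (σ := ℕ) e c) * vGen p 0 ^ κ 0 := by
        have h2 : vGen p 0 ^ κ 0 = MvPolynomial.C (R := ZLoc p) (σ := ℕ) ((p : ZLoc p) ^ κ 0) := by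
          rw [vGen_zero, map_pow, map_natCast]; rfl
        rw [hc, h2]
        exact ((mul_comm _ _).trans (MvPolynomial.C_mul_monomial (R := ZLoc p) (σ := ℕ))).symm
      rw [h1]
      exact Ideal.mul_mem_left _ _ (Ideal.subset_span ⟨0, le_rfl, by omega, rfl⟩)
    · push Not at he
      obtain ⟨i, hi, hik⟩ := he
      have h1 : (MvPolynomial.monomial (R := ZLoc p) (σ := ℕ) e (MvPolynomial.coeff (R := ZLoc p) e f)
          : BP p) = (show BP p from MvPolynomial.monomial (R := ZLoc p) (σ := ℕ)
            (e - Finsupp.single i (κ (i + 1))) (MvPolynomial.coeff (R := ZLoc p) e f)) * vGen p (i + 1) ^ κ (i + 1) := by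
        have h2 : vGen p (i + 1) ^ κ (i + 1) = MvPolynomial.monomial (R := ZLoc p) (σ := ℕ)
          (Finsupp.single i (κ (i + 1))) 1 := MvPolynomial.X_pow_eq_monomial
        rw [h2]
        refine Eq.trans ?_ (MvPolynomial.monomial_mul (R := ZLoc p) (σ := ℕ)).symm
        rw [mul_one, tsub_add_cancel_of_le (Finsupp.single_le_iff.2 hik)]
      rw [h1]
      exact Ideal.mul_mem_left _ _ (Ideal.subset_span ⟨i + 1, Nat.zero_le _, by omega, rfl⟩)
  have h := hsum (MvPolynomial.support (R := ZLoc p) (σ := ℕ) f)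
  exact has ▸ h

theorem natCast_p_ne_zero : (p : BP p) ≠ 0 := by
  have h1 : (p : BP p) = MvPolynomial.C (R := ZLoc p) (σ := ℕ) (p : ZLoc p) := by
    rw [map_natCast]; rfl
  rw [h1]
  refine MvPolynomial.C_ne_zero.2 ?_
  intro h
  have h2 : algebraMap ℤ (Localization.AtPrime (Ideal.span {(p : ℤ)})) (p : ℤ) = 0 :=
    (map_natCast _ _).trans h
  have h3 := (IsLocalization.to_map_eq_zero_iff (Localization.AtPrime (Ideal.span {(p : ℤ)}))
    (Ideal.primeCompl_le_nonZeroDivisors (Ideal.span {(p : ℤ)}))).1 h2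
  exact hp.out.ne_zero (by exact_mod_cast h3)

/-- `v_0, v_1, …` is a regular sequence, also after replacing the generators by powers. -/
theorem mem_powIdeal_of_vGen_mul {j : ℕ} {κ : ℕ → ℕ} {f : BP p} (hf : vGen p j * f ∈ powIdeal p κ 0 j) :
    f ∈ powIdeal p κ 0 j := by
  cases j with
  | zero =>
    have h1 : powIdeal p κ 0 0 = ⊥ := by
      rw [powIdeal, Ideal.span_eq_bot]
      rintro x ⟨i, _, hi, _⟩
      omega
    rw [h1, Ideal.mem_bot] at hf ⊢
    exact (mul_eq_zero.1 hf).resolve_left (by rw [vGen_zero]; exact natCast_p_ne_zero)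
  | succ j =>
    refine mem_powIdeal_of_coeff fun e he => ?_
    -- The variable with index `j` is `v_{j+1}` and does not occur among the generators, so raising
    -- its exponent by one does not affect the test.
    have h1 := coeff_of_mem_powIdeal hf (Finsupp.single j 1 + e) fun i hi => by
      rw [Finsupp.add_apply, Finsupp.single_eq_of_ne (by omega), zero_add]
      exact he i hi
    have h2 : MvPolynomial.coeff (R := ZLoc p) (Finsupp.single j 1 + e) (vGen p (j + 1) * f) =
      MvPolynomial.coeff (R := ZLoc p) e f := MvPolynomial.coeff_X_mul (R := ZLoc p) (σ := ℕ) e j f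
    rwa [h2] at h1

/-- In an injective module, elements killed by `(v_0 ^ k, …, v_{j-1} ^ k)` are divisible
by `v_j`. -/
theorem exists_vGen_smul_eq_of_injective (I : ModuleCat.{0} (BP p)) [Injective I] (j k : ℕ) (z : I)
    (hz : ∀ i < j, vGen p i ^ k • z = 0) :
    ∃ y : I, (∀ i < j, vGen p i ^ k • y = 0) ∧ vGen p j • y = z := by
  have hJ : powIdeal p (fun _ => k) 0 j ≤ LinearMap.ker (LinearMap.toSpanSingleton (BP p) I z) := by
    refine Ideal.span_le.2 ?_
    rintro _ ⟨i, -, hi, rfl⟩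
    exact hz i hi
  let Q := ModuleCat.of (BP p) (BP p ⧸ powIdeal p (fun _ => k) 0 j)
  -- By regularity, multiplication by `v_j` is injective on `BP_* / (v_0 ^ k, …, v_{j-1} ^ k)`. The
  -- map `1 ↦ z` to `I` extends along it, and the value of the extension at `1` is the required
  -- quotient.
  let f : Q ⟶ Q := ModuleCat.ofHom (vGen p j • LinearMap.id)
  have hf : Mono f := (ModuleCat.mono_iff_injective _).2 (by
    refine (injective_iff_map_eq_zero (vGen p j • LinearMap.id :
      (BP p ⧸ powIdeal p (fun _ => k) 0 j) →ₗ[BP p] (BP p ⧸ powIdeal p (fun _ => k) 0 j))).2 fun x hx => ?_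
    obtain ⟨x, rfl⟩ := Submodule.Quotient.mk_surjective _ x
    have h1 : vGen p j * x ∈ powIdeal p (fun _ => k) 0 j := (Submodule.Quotient.mk_eq_zero _).1 hx
    exact (Submodule.Quotient.mk_eq_zero _).2 (mem_powIdeal_of_vGen_mul h1))
  let g : Q ⟶ I := ModuleCat.ofHom ((powIdeal p (fun _ => k) 0 j).liftQ (LinearMap.toSpanSingleton (BP p) I z) hJ)
  have hg := ModuleCat.hom_ext_iff.1 (Injective.comp_factorThru g f)
  set h : (BP p ⧸ powIdeal p (fun _ => k) 0 j) →ₗ[BP p] I := (Injective.factorThru g f).hom with hh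
  have h1 : ∀ a ∈ powIdeal p (fun _ => k) 0 j, a • h (Submodule.Quotient.mk 1) = 0 := fun a ha => by
    rw [← map_smul, ← Submodule.Quotient.mk_smul, smul_eq_mul, mul_one,
      (Submodule.Quotient.mk_eq_zero _).2 ha, map_zero]
  refine ⟨h (Submodule.Quotient.mk 1), fun i hi => h1 _ (Ideal.subset_span ⟨i, Nat.zero_le _, hi, rfl⟩), ?_⟩
  have h2 : h (vGen p j • Submodule.Quotient.mk 1) = (1 : BP p) • z := LinearMap.congr_fun hg
    (Submodule.Quotient.mk 1)
  rw [← map_smul, h2, one_smul]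

end Divisibility

/-! ### Divisibility of cofree and of injective comodules -/

section CofreeDivisibility

variable {p : ℕ} [hp : Fact p.Prime]

variable (p) in
/-- The left unit of `BP_*BP[T, T⁻¹]`. -/
def lam : BP p →+* LaurentPolynomial (BPBP p) := LaurentPolynomial.C.comp MvPolynomial.C

section

variable {N : Type} [AddCommGroup N] [Module (BP p) N]

theorem lam_smul_cofreeJ (a : BP p) (d : ℤ) (z : BPBP p ⊗[BP p] N) :
    lam p a • cofreeJ p N d z = cofreeJ p N d (a • z) := by
  induction z using TensorProduct.induction_on with
  | zero => simp only [smul_zero, map_zero]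
  | add x y hx hy => simp only [smul_add, map_add, hx, hy]
  | tmul g n =>
    rw [cofreeJ_tmul, smul_tmul', cofreeJ_tmul, smul_cofreeMk, MvPolynomial.smul_eq_C_mul, map_mul,
      mul_assoc]
    rfl

theorem cofreeQ_lam_smul (a : BP p) (d : ℤ) (z : CofreeCarrier p N) :
    cofreeQ p N d (lam p a • z) = a • cofreeQ p N d z := by
  induction z using cofree_graded_induction with
  | h0 => simp only [smul_zero, map_zero]
  | ha x y hx hy => simp only [smul_add, map_add, hx, hy]
  | hm e g n =>
    rw [lam_smul_cofreeJ, cofreeQ_cofreeJ, cofreeQ_cofreeJ]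
    split_ifs
    · rfl
    · rw [smul_zero]

theorem eq_sum_cofreeJ (z : CofreeCarrier p N) : ∃ s : Finset ℤ,
    z = ∑ d ∈ s, cofreeJ p N d (cofreeQ p N d z) := by
  classical
  suffices h : ∃ s : Finset ℤ, ∀ s', s ⊆ s' → z = ∑ d ∈ s', cofreeJ p N d (cofreeQ p N d z) by
    obtain ⟨s, hs⟩ := h
    exact ⟨s, hs s subset_rfl⟩
  induction z using cofree_graded_induction with
  | h0 => exact ⟨∅, fun s' _ => by simp⟩
  | ha x y hx hy =>
    obtain ⟨s, hs⟩ := hx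
    obtain ⟨t, ht⟩ := hy
    refine ⟨s ∪ t, fun s' hs' => ?_⟩
    conv_lhs => rw [hs s' (Finset.union_subset_left hs'), ht s' (Finset.union_subset_right hs')]
    rw [← Finset.sum_add_distrib]
    refine Finset.sum_congr rfl fun e _ => ?_
    rw [map_add, map_add]
  | hm e g n =>
    refine ⟨{e}, fun s' hs' => ?_⟩
    rw [Finset.sum_eq_single e]
    · rw [cofreeQ_cofreeJ, if_pos rfl]
    · intro d _ hd
      rw [cofreeQ_cofreeJ, if_neg hd.symm, map_zero]
    · intro he
      exact (he (hs' (Finset.mem_singleton_self e))).elim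

end

theorem rho_vGen (i : ℕ) : ∃ u : (LaurentPolynomial (BPBP p))ˣ,
    rho p (vGen p i) = LaurentPolynomial.C (etaR p (vGen p i)) * u := by
  obtain ⟨d, hd⟩ := vGen_mem p i
  obtain ⟨u, hu⟩ := LaurentPolynomial.isUnit_T (R := BPBP p) d
  exact ⟨u, by rw [rho_of_mem p hd, hu]⟩

theorem C_etaR_vGen_sub_mem (j : ℕ) : LaurentPolynomial.C (etaR p (vGen p j)) - lam p (vGen p j) ∈
    Ideal.span {x | ∃ i < j, x = lam p (vGen p i)} := by
  have h := Ideal.mem_map_of_mem LaurentPolynomial.C (etaR_vGen p j)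
  rw [idealI, Ideal.map_span, Ideal.map_span, map_sub] at h
  refine Ideal.span_mono ?_ h
  rintro _ ⟨_, ⟨_, ⟨i, hi, rfl⟩, rfl⟩, rfl⟩
  exact ⟨i, by exact_mod_cast hi, rfl⟩

/-- A radical ideal contains the first right units of the `v_i` if it contains
the left units. -/
theorem rho_mem_radical_iff (J : Ideal (LaurentPolynomial (BPBP p))) (j : ℕ) :
    (∀ i < j, rho p (vGen p i) ∈ J.radical) ↔ ∀ i < j, lam p (vGen p i) ∈ J.radical := by
  have hu : ∀ i, rho p (vGen p i) ∈ J.radical ↔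
      LaurentPolynomial.C (etaR p (vGen p i)) ∈ J.radical := fun i => by
    obtain ⟨u, hu⟩ := rho_vGen (p := p) i
    rw [hu, Ideal.mul_unit_mem_iff_mem _ u.isUnit]
  simp only [hu]
  induction j with
  | zero => exact ⟨fun _ i hi => absurd hi (by omega), fun _ i hi => absurd hi (by omega)⟩
  | succ j ih =>
    -- Modulo the lower left units the two units of `v_j` coincide, so membership in the radical is
    -- transferred from one to the other by induction on `j`.
    have key : (∀ i < j, lam p (vGen p i) ∈ J.radical) →
        LaurentPolynomial.C (etaR p (vGen p j)) - lam p (vGen p j) ∈ J.radical := fun h =>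
      Ideal.span_le.2 (by rintro _ ⟨i, hi, rfl⟩; exact h i hi) (C_etaR_vGen_sub_mem j)
    constructor
    · intro h i hi
      have h1 := ih.1 fun i hi => h i (by omega)
      rcases Nat.lt_succ_iff_lt_or_eq.1 hi with hi | rfl
      · exact h1 i hi
      · have := sub_mem (h i (by omega)) (key h1)
        rwa [sub_sub_cancel] at this
    · intro h i hi
      have h1 := ih.2 fun i hi => h i (by omega)
      rcases Nat.lt_succ_iff_lt_or_eq.1 hi with hi | rfl
      · exact h1 i hi
      · have := add_mem (key fun i hi => h i (by omega)) (h i (by omega))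
        rwa [sub_add_cancel] at this

/-- Divisibility by `v_j` of the elements killed by powers of the `lam v_i`. -/
theorem exists_lam_smul_eq (I : ModuleCat.{0} (BP p)) [Injective I] (j k : ℕ)
    (z : CofreeCarrier p I) (hz : ∀ i < j, lam p (vGen p i) ^ k • z = 0) :
    ∃ y : CofreeCarrier p I, (∀ i < j, lam p (vGen p i) ^ k • y = 0) ∧ lam p (vGen p j) • y = z := by
  -- For the left unit, the cofree comodule is a direct sum of copies of `I`, indexed by the
  -- exponent `d` of `T` and the monomial `t ^ e`. Division is done in each component.
  have hco : ∀ d e i, i < j → vGen p i ^ k • tcoeff e (cofreeQ p I d z) = 0 := fun d e i hi => by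
    rw [← map_smul, ← cofreeQ_lam_smul, map_pow, hz i hi, map_zero, map_zero]
  choose Y hY hY' using fun d e => exists_vGen_smul_eq_of_injective I j k _ (hco d e)
  obtain ⟨s, hs⟩ := eq_sum_cofreeJ z
  choose t ht using fun d => eq_sum_tcoeff (cofreeQ p I d z)
  refine ⟨∑ d ∈ s, cofreeJ p I d (∑ e ∈ t d, MvPolynomial.monomial e (1 : BP p) ⊗ₜ[BP p] Y d e),
    fun i hi => ?_, ?_⟩
  · rw [Finset.smul_sum]
    refine Finset.sum_eq_zero fun d _ => ?_
    rw [← map_pow, lam_smul_cofreeJ, Finset.smul_sum, Finset.sum_eq_zero, map_zero]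
    intro e _
    rw [← TensorProduct.tmul_smul, hY d e i hi, TensorProduct.tmul_zero]
  · conv_rhs => rw [hs]
    rw [Finset.smul_sum]
    refine Finset.sum_congr rfl fun d _ => ?_
    rw [lam_smul_cofreeJ, Finset.smul_sum]
    conv_rhs => rw [ht d]
    congr 1
    refine Finset.sum_congr rfl fun e _ => ?_
    rw [← TensorProduct.tmul_smul, hY']

variable (p) in
/-- Elements killed by powers of `v_0, …, v_{j-1}` are divisible by `v_j` among such elements,
for `j ≤ n`. -/
def IsQDivisible (n : ℕ) (M : Type*) [AddCommGroup M] [Module (BP p) M] : Prop :=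
  ∀ j ≤ n, ∀ x : M, (∀ i < j, vGen p i ∈ nilIdeal x) →
    ∃ y : M, (∀ i < j, vGen p i ∈ nilIdeal y) ∧ vGen p j • y = x

theorem mem_nilIdeal_cofree {N : Type} [AddCommGroup N] [Module (BP p) N] (a : BP p)
    (z : CofreeCarrier p N) : a ∈ nilIdeal z ↔
      rho p a ∈ (Ideal.torsionOf (LaurentPolynomial (BPBP p)) (CofreeCarrier p N) z).radical := by
  rw [mem_nilIdeal]
  refine exists_congr fun K => ?_
  rw [Ideal.mem_torsionOf_iff, ← map_pow]
  rfl

/-- The comodule structure uses the right unit, while `exists_lam_smul_eq` divides by the left unit.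
Up to a unit the right unit of `v_j` is `b`, the left unit is `a`, and `a - b` is nilpotent modulo
the ideal `J` that kills the elements in question. Since `b` divides `a ^ K - (a - b) ^ K`, division
by `a ^ K` yields division by `b`. -/
theorem isQDivisible_cofree (n : ℕ) (I : ModuleCat.{0} (BP p)) [Injective I] :
    IsQDivisible p n (CofreeCarrier p I) := fun j _ x hx => by
  simp only [mem_nilIdeal_cofree] at hx
  rw [rho_mem_radical_iff] at hx
  obtain ⟨k, hk⟩ : ∃ k, ∀ i < j, lam p (vGen p i) ^ k • x = 0 := by
    choose! K hK using hx
    simp only [Ideal.mem_torsionOf_iff] at hK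
    refine ⟨(Finset.range j).sup K, fun i hi => ?_⟩
    rw [← Nat.sub_add_cancel (Finset.le_sup (f := K) (Finset.mem_range.2 hi)), pow_add, mul_smul,
      hK i hi, smul_zero]
  set J : Ideal (LaurentPolynomial (BPBP p)) := Ideal.span {x | ∃ i < j, x = lam p (vGen p i) ^ k}
    with hJ
  set X : Submodule (LaurentPolynomial (BPBP p)) (CofreeCarrier p I) :=
    { carrier := {z | ∀ i < j, lam p (vGen p i) ^ k • z = 0}
      zero_mem' := fun i _ => smul_zero _
      add_mem' := fun ha hb i hi => by rw [smul_add, ha i hi, hb i hi, add_zero]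
      smul_mem' := fun a z hz i hi => by rw [smul_comm, hz i hi, smul_zero] } with hX
  have hXJ : ∀ z ∈ X, ∀ a ∈ J, a • z = 0 := fun z hz a ha => by
    induction ha using Submodule.span_induction with
    | mem a ha => obtain ⟨i, hi, rfl⟩ := ha; exact hz i hi
    | zero => exact zero_smul _ _
    | add a b _ _ ha hb => rw [add_smul, ha, hb, add_zero]
    | smul a b _ hb => rw [smul_eq_mul, mul_smul, hb, smul_zero]
  -- One exponent `k` serves for all the generators and is preserved by each division, so the
  -- division by the left unit can be iterated inside `X`.
  have hdiv : ∀ (K : ℕ), ∀ z ∈ X, ∃ y ∈ X, lam p (vGen p j) ^ K • y = z := fun K => by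
    induction K with
    | zero => intro z hz; exact ⟨z, hz, by rw [pow_zero, one_smul]⟩
    | succ K ih =>
      intro z hz
      obtain ⟨y, hy, rfl⟩ := exists_lam_smul_eq I j k z hz
      obtain ⟨w, hw, rfl⟩ := ih y hy
      exact ⟨w, hw, by rw [pow_succ', mul_smul]⟩
  set a := lam p (vGen p j) with ha
  set b := LaurentPolynomial.C (etaR p (vGen p j)) with hb
  obtain ⟨K, hK⟩ : a - b ∈ J.radical := by
    rw [← neg_sub]
    refine neg_mem ?_
    refine Ideal.span_le.2 ?_ (C_etaR_vGen_sub_mem j)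
    rintro _ ⟨i, hi, rfl⟩
    exact ⟨k, Ideal.subset_span ⟨i, hi, rfl⟩⟩
  obtain ⟨y, hy, hyx⟩ := hdiv K x hk
  obtain ⟨c, hc⟩ : b ∣ (a ^ K - (a - b) ^ K) := by
    have := sub_dvd_pow_sub_pow a (a - b) K
    rwa [sub_sub_cancel] at this
  have h1 : (a - b) ^ K • y = 0 := hXJ y hy _ hK
  obtain ⟨u, hu⟩ := rho_vGen (p := p) j
  have hmem : (↑u⁻¹ * c) • y ∈ X := X.smul_mem _ hy
  refine ⟨(↑u⁻¹ * c : LaurentPolynomial (BPBP p)) • y, ?_, ?_⟩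
  · simp only [mem_nilIdeal_cofree]
    rw [rho_mem_radical_iff]
    exact fun i hi => ⟨k, hmem i hi⟩
  · rw [cofree_smul, hu, smul_smul]
    have h2 : b * ↑u * (↑u⁻¹ * c) = a ^ K - (a - b) ^ K := by
      rw [hc, mul_assoc, Units.mul_inv_cancel_left]
    rw [h2, sub_smul, h1, sub_zero, hyx]

theorem nilIdeal_le_map {M N : Type*} [AddCommGroup M] [Module (BP p) M] [AddCommGroup N]
    [Module (BP p) N] (f : M →ₗ[BP p] N) (x : M) :
    (nilIdeal x : Ideal (BP p)) ≤ nilIdeal (f x) := fun a ha => by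
  obtain ⟨K, hK⟩ := mem_nilIdeal.1 ha
  exact mem_nilIdeal.2 ⟨K, by rw [← map_smul, hK, map_zero]⟩

/-- An injective comodule is a retract of the cofree comodule on an injective module, and
divisibility passes to retracts. -/
theorem isQDivisible_of_injective (n : ℕ) (M : Comod p) [Injective M] :
    IsQDivisible p n M.carrier := fun j hj x hx => by
  let I := Injective.under ((forgetMod p).obj M)
  let f : M ⟶ cofreeObj p I := cofreeHomEquiv p M I (Injective.ι _)
  have hf : Mono f := by
    refine Comod.mono_of_injective f ((injective_iff_map_eq_zero _).2 fun x hx => ?_)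
    have h1 := LinearMap.congr_fun (ModuleCat.hom_ext_iff.1
      ((cofreeHomEquiv p M I).symm_apply_apply (Injective.ι _))) x
    have h2 : cofreeEps p I (f.toLin x) = (Injective.ι ((forgetMod p).obj M)).hom x := h1
    rw [hx] at h2
    exact (ModuleCat.mono_iff_injective (Injective.ι ((forgetMod p).obj M))).1 inferInstance
      (h2.symm.trans ((map_zero _).trans (map_zero _).symm))
  let r : cofreeObj p I ⟶ M := Injective.factorThru (𝟙 M) f
  have hr : f ≫ r = 𝟙 M := Injective.comp_factorThru _ _
  obtain ⟨y, hy, hyx⟩ := isQDivisible_cofree n I j hj (f.toLin x)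
    fun i hi => nilIdeal_le_map f.toLin x (hx i hi)
  refine ⟨r.toLin y, fun i hi => nilIdeal_le_map r.toLin y (hy i hi), ?_⟩
  have h1 : r.toLin (f.toLin x) = x := LinearMap.congr_fun (congrArg Comod.Hom.toLin hr) x
  refine Eq.trans ?_ h1
  rw [← hyx]
  exact (map_smul r.toLin (vGen p j) y).symm

end CofreeDivisibility

/-! ### Čech cochains with coefficients in a module -/

section CechModules

variable {A : Type} [CommRing A]

section AwayTensor

variable (M : Type) [AddCommGroup M] [Module A M]

/-- The map `M[1/a] → M[1/b]` for `a ∣ b`. -/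
def awayTensor {a b : A} (h : a ∣ b) : Localization.Away a ⊗[A] M →ₗ[A] Localization.Away b ⊗[A] M :=
  (awayMap h).toLinearMap.rTensor M

variable {M}

theorem awayTensor_tmul {a b : A} (h : a ∣ b) (l : Localization.Away a) (x : M) :
    awayTensor M h (l ⊗ₜ x) = awayMap h l ⊗ₜ x := rfl

theorem awayTensor_one_tmul {a b : A} (h : a ∣ b) (x : M) :
    awayTensor M h (1 ⊗ₜ x) = 1 ⊗ₜ x := by rw [awayTensor_tmul, map_one]

theorem awayTensor_awayTensor {a b c : A} (h : a ∣ b) (h' : b ∣ c) (h'' : a ∣ c)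
    (z : Localization.Away a ⊗[A] M) : awayTensor M h' (awayTensor M h z) = awayTensor M h'' z := by
  induction z using TensorProduct.induction_on with
  | zero => simp only [map_zero]
  | add x y hx hy => simp only [map_add, hx, hy]
  | tmul l x => rw [awayTensor_tmul, awayTensor_tmul, awayTensor_tmul, awayMap_awayMap]

theorem exists_pow_smul_away (a : A) (z : Localization.Away a ⊗[A] M) :
    ∃ (N : ℕ) (x : M), a ^ N • z = 1 ⊗ₜ x := by
  obtain ⟨⟨x, ⟨_, N, rfl⟩⟩, h⟩ := IsLocalizedModule.surj (Submonoid.powers a)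
    (TensorProduct.mk A (Localization.Away a) M 1) z
  exact ⟨N, x, h⟩

theorem pow_smul_away_injective (a : A) (N : ℕ) {z w : Localization.Away a ⊗[A] M}
    (h : a ^ N • z = a ^ N • w) : z = w :=
  IsLocalizedModule.smul_injective (TensorProduct.mk A (Localization.Away a) M 1)
    (⟨a ^ N, N, rfl⟩ : Submonoid.powers a) h

theorem exists_pow_smul_eq_away (a : A) (N : ℕ) (z : Localization.Away a ⊗[A] M) :
    ∃ w, a ^ N • w = z := by
  obtain ⟨u, hu⟩ := (IsLocalization.Away.algebraMap_isUnit (S := Localization.Away a) a).pow N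
  refine ⟨(↑u⁻¹ : Localization.Away a) • z, ?_⟩
  rw [← algebraMap_smul (Localization.Away a) (a ^ N), map_pow, ← hu, smul_smul, Units.mul_inv,
    one_smul]

theorem one_tmul_away_eq_zero (a : A) (x : M) :
    (1 : Localization.Away a) ⊗ₜ[A] x = 0 ↔ ∃ N : ℕ, a ^ N • x = 0 := by
  refine (IsLocalizedModule.eq_zero_iff (Submonoid.powers a)
    (TensorProduct.mk A (Localization.Away a) M 1)).trans ⟨?_, ?_⟩
  · rintro ⟨⟨_, N, rfl⟩, h⟩
    exact ⟨N, h⟩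
  · rintro ⟨N, h⟩
    exact ⟨⟨_, N, rfl⟩, h⟩

/-- If `c` is already invertible on `M`, then inverting `a c` is no more than inverting `a`. -/
theorem awayTensor_bijective {a b c : A} (h : a ∣ b) (hb : b = a * c)
    (hc : Function.Bijective fun x : M => c • x) : Function.Bijective (awayTensor M h) := by
  have hinj : ∀ (N : ℕ) (x : M), c ^ N • x = 0 → x = 0 := fun N => by
    induction N with
    | zero => intro x hx; rwa [pow_zero, one_smul] at hx
    | succ N ih =>
      intro x hx
      rw [pow_succ', mul_smul] at hx
      exact ih x (hc.1 (hx.trans (smul_zero c).symm))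
  have hsurj : ∀ (N : ℕ) (x : M), ∃ y, c ^ N • y = x := fun N => by
    induction N with
    | zero => intro x; exact ⟨x, by rw [pow_zero, one_smul]⟩
    | succ N ih =>
      intro x
      obtain ⟨y, rfl⟩ := hc.2 x
      obtain ⟨z, rfl⟩ := ih y
      exact ⟨z, by rw [pow_succ', mul_smul]⟩
  constructor
  · refine (injective_iff_map_eq_zero _).2 fun w hw => ?_
    obtain ⟨N, x, hx⟩ := exists_pow_smul_away a w
    have h1 : (1 : Localization.Away b) ⊗ₜ[A] x = 0 := by
      rw [← awayTensor_one_tmul h, ← hx, map_smul, hw, smul_zero]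
    obtain ⟨K, hK⟩ := (one_tmul_away_eq_zero b x).1 h1
    rw [hb, mul_pow, mul_comm, mul_smul] at hK
    have h2 := (one_tmul_away_eq_zero a x).2 ⟨K, hinj K _ hK⟩
    exact pow_smul_away_injective a N (hx.trans (h2.trans (smul_zero _).symm))
  · intro z
    obtain ⟨N, x, hx⟩ := exists_pow_smul_away b z
    obtain ⟨y, rfl⟩ := hsurj N x
    obtain ⟨w, hw⟩ := exists_pow_smul_eq_away a N (1 ⊗ₜ[A] y : Localization.Away a ⊗[A] M)
    refine ⟨w, pow_smul_away_injective b N ?_⟩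
    subst hb
    rw [hx, mul_pow, mul_comm (a ^ N), mul_smul, ← map_smul, hw, awayTensor_one_tmul, tmul_smul]

end AwayTensor

variable {m : ℕ} (v : Fin m → A)

section Cochains

variable (M : Type) [AddCommGroup M] [Module A M]

/-- The module of Čech cochains of `M`. -/
abbrev CechMod (k : ℕ) : Type := CechCochain v k ⊗[A] M

/-- The component of a Čech cochain. -/
def cechProj {k : ℕ} (σ : Fin (k + 1) ↪o Fin m) :
    CechMod v M k →ₗ[A] Localization.Away (cechElt v σ) ⊗[A] M :=
  LinearMap.rTensor M (LinearMap.proj σ)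

/-- The cochain with one given component. -/
def cechSingle {k : ℕ} (σ : Fin (k + 1) ↪o Fin m) :
    Localization.Away (cechElt v σ) ⊗[A] M →ₗ[A] CechMod v M k :=
  open Classical in
  LinearMap.rTensor M (LinearMap.single A (fun σ => Localization.Away (cechElt v σ)) σ)

variable {M}

theorem cechProj_tmul {k : ℕ} (σ : Fin (k + 1) ↪o Fin m) (x : CechCochain v k) (y : M) :
    cechProj v M σ (x ⊗ₜ y) = x σ ⊗ₜ y := rfl

theorem sum_cechSingle_cechProj {k : ℕ} (z : CechMod v M k) :
    ∑ σ, cechSingle v M σ (cechProj v M σ z) = z := by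
  classical
  induction z using TensorProduct.induction_on with
  | zero => simp only [map_zero, Finset.sum_const_zero]
  | add x y hx hy => simp only [map_add, Finset.sum_add_distrib, hx, hy]
  | tmul l x =>
    have : ∀ σ, cechSingle v M σ (cechProj v M σ (l ⊗ₜ x)) = Pi.single σ (l σ) ⊗ₜ[A] x := fun σ => by
      rw [cechProj_tmul, cechSingle, LinearMap.rTensor_tmul]
      congr 1
    simp only [this]
    rw [← TensorProduct.sum_tmul, Finset.univ_sum_single]

theorem cechProj_cechSingle_same {k : ℕ} (σ : Fin (k + 1) ↪o Fin m)
    (z : Localization.Away (cechElt v σ) ⊗[A] M) : cechProj v M σ (cechSingle v M σ z) = z := by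
  classical
  rw [cechProj, cechSingle, ← LinearMap.rTensor_comp_apply]
  have : LinearMap.proj σ ∘ₗ LinearMap.single A (fun σ => Localization.Away (cechElt v σ)) σ =
      LinearMap.id := LinearMap.proj_comp_single_same _ _ _
  convert LinearMap.congr_fun (LinearMap.rTensor_id M (Localization.Away (cechElt v σ))) z
  rfl

theorem cechProj_cechSingle_ne {k : ℕ} {σ τ : Fin (k + 1) ↪o Fin m} (h : σ ≠ τ)
    (z : Localization.Away (cechElt v τ) ⊗[A] M) : cechProj v M σ (cechSingle v M τ z) = 0 := by
  classical
  rw [cechProj, cechSingle, ← LinearMap.rTensor_comp_apply]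
  have : LinearMap.proj σ ∘ₗ LinearMap.single A (fun σ => Localization.Away (cechElt v σ)) τ =
      0 := LinearMap.proj_comp_single_ne _ _ _ _ h
  convert LinearMap.congr_fun (LinearMap.rTensor_zero (R := A) M) z
  rfl

theorem cechMod_ext {k : ℕ} {z w : CechMod v M k}
    (h : ∀ σ, cechProj v M σ z = cechProj v M σ w) : z = w := by
  rw [← sum_cechSingle_cechProj v z, ← sum_cechSingle_cechProj v w]
  simp only [h]

theorem exists_cechProj_eq {k : ℕ}
    (f : ∀ σ : Fin (k + 1) ↪o Fin m, Localization.Away (cechElt v σ) ⊗[A] M) :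
    ∃ z : CechMod v M k, ∀ σ, cechProj v M σ z = f σ := by
  refine ⟨∑ σ, cechSingle v M σ (f σ), fun σ => ?_⟩
  rw [map_sum, Finset.sum_eq_single σ, cechProj_cechSingle_same]
  · exact fun τ _ h => cechProj_cechSingle_ne v h.symm _
  · exact fun h => (h (Finset.mem_univ _)).elim

variable (M) in
/-- The differential of the Čech complex of `M`. -/
def cechModD (k : ℕ) : CechMod v M k →ₗ[A] CechMod v M (k + 1) := (cechD v k).rTensor M

theorem cechProj_cechModD {k : ℕ} (z : CechMod v M k) (σ : Fin (k + 2) ↪o Fin m) :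
    cechProj v M σ (cechModD v M k z) = ∑ i : Fin (k + 2), (-1 : A) ^ (i : ℕ) •
      awayTensor M (cechElt_face_dvd v i σ) (cechProj v M (cechFace i σ) z) := by
  induction z using TensorProduct.induction_on with
  | zero => simp only [map_zero, smul_zero, Finset.sum_const_zero]
  | add x y hx hy => simp only [map_add, smul_add, Finset.sum_add_distrib, hx, hy]
  | tmul l x =>
    have : cechProj v M σ (cechModD v M k (l ⊗ₜ x)) = cechD v k l σ ⊗ₜ[A] x := rfl
    rw [this, cechD_apply, TensorProduct.sum_tmul]
    rfl

theorem cechModD_cechModD {k : ℕ} (z : CechMod v M k) :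
    cechModD v M (k + 1) (cechModD v M k z) = 0 := by
  rw [cechModD, cechModD, ← LinearMap.rTensor_comp_apply, cechD_cechD, LinearMap.rTensor_zero]
  rfl

variable (M) in
/-- The augmentation of the Čech complex. -/
def cechAug : M →ₗ[A] CechMod v M 0 := TensorProduct.mk A (CechCochain v 0) M 1

theorem cechProj_cechAug (x : M) (σ : Fin 1 ↪o Fin m) :
    cechProj v M σ (cechAug v M x) = 1 ⊗ₜ x := rfl

theorem cechModD_cechAug (x : M) : cechModD v M 0 (cechAug v M x) = 0 := by
  refine cechMod_ext v fun σ => ?_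
  rw [cechProj_cechModD, map_zero, Fin.sum_univ_two, cechProj_cechAug, cechProj_cechAug,
    awayTensor_one_tmul, awayTensor_one_tmul, Fin.val_zero, Fin.val_one, pow_zero, pow_one, one_smul]
  exact ((congrArg _ (neg_one_smul A (1 ⊗ₜ x : Localization.Away (cechElt v σ) ⊗[A] M))).trans
    (add_neg_cancel _))

end Cochains

section Functoriality

variable {M N : Type} [AddCommGroup M] [Module A M] [AddCommGroup N] [Module A N]

/-- Functoriality of Čech cochains. -/
def cechMap (k : ℕ) (f : M →ₗ[A] N) : CechMod v M k →ₗ[A] CechMod v N k := f.lTensor _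

theorem cechProj_cechMap {k : ℕ} (f : M →ₗ[A] N) (z : CechMod v M k)
    (σ : Fin (k + 1) ↪o Fin m) :
    cechProj v N σ (cechMap v k f z) = f.lTensor _ (cechProj v M σ z) := by
  rw [cechProj, cechProj, cechMap, ← LinearMap.comp_apply, ← LinearMap.comp_apply,
    LinearMap.rTensor_comp_lTensor, LinearMap.lTensor_comp_rTensor]

theorem cechModD_cechMap {k : ℕ} (f : M →ₗ[A] N) (z : CechMod v M k) :
    cechModD v N k (cechMap v k f z) = cechMap v (k + 1) f (cechModD v M k z) := by
  rw [cechModD, cechModD, cechMap, cechMap, ← LinearMap.comp_apply, ← LinearMap.comp_apply,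
    LinearMap.rTensor_comp_lTensor, LinearMap.lTensor_comp_rTensor]

theorem cechAug_map (f : M →ₗ[A] N) (x : M) :
    cechAug v N (f x) = cechMap v 0 f (cechAug v M x) := rfl

theorem cechMap_comp {P : Type} [AddCommGroup P] [Module A P] (k : ℕ) (f : M →ₗ[A] N)
    (g : N →ₗ[A] P) (z : CechMod v M k) :
    cechMap v k g (cechMap v k f z) = cechMap v k (g ∘ₗ f) z :=
  (LinearMap.lTensor_comp_apply _ _ _ z).symm

theorem cechMap_zero (k : ℕ) (z : CechMod v M k) : cechMap v k (0 : M →ₗ[A] N) z = 0 :=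
  LinearMap.congr_fun (LinearMap.lTensor_zero _) z

theorem cechMap_injective (k : ℕ) {f : M →ₗ[A] N} (hf : Function.Injective f) :
    Function.Injective (cechMap v k f) := fun z w h => cechMod_ext v fun σ => by
  refine Module.Flat.lTensor_preserves_injective_linearMap
    (M := Localization.Away (cechElt v σ)) f hf ?_
  rw [← cechProj_cechMap, ← cechProj_cechMap, h]

theorem cechMap_surjective (k : ℕ) {f : M →ₗ[A] N} (hf : Function.Surjective f) :
    Function.Surjective (cechMap v k f) := LinearMap.lTensor_surjective _ hf

theorem cechMap_exact {P : Type} [AddCommGroup P] [Module A P] (k : ℕ) {f : M →ₗ[A] N}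
    {g : N →ₗ[A] P} (h : Function.Exact f g) :
    Function.Exact (cechMap v k f) (cechMap v k g) := fun z => by
  constructor
  · intro hz
    have h1 : ∀ σ, ∃ w, f.lTensor _ w = cechProj v N σ z := fun σ =>
      (Module.Flat.lTensor_exact (Localization.Away (cechElt v σ)) h _).1 (by
        rw [← cechProj_cechMap, hz, map_zero])
    choose w hw using h1
    obtain ⟨y, hy⟩ := exists_cechProj_eq v w
    exact ⟨y, cechMod_ext v fun σ => by rw [cechProj_cechMap, hy, hw]⟩
  · rintro ⟨y, rfl⟩
    rw [cechMap_comp]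
    have : g ∘ₗ f = 0 := LinearMap.ext fun x => (h _).2 ⟨x, rfl⟩
    rw [this, cechMap_zero]

/-- Every summand inverts at least one `v j`, and this kills a torsion module. -/
theorem cechMod_eq_zero (h : ∀ (j : Fin m) (x : M), ∃ K : ℕ, v j ^ K • x = 0) {k : ℕ}
    (z : CechMod v M k) : z = 0 := by
  refine cechMod_ext v fun σ => ?_
  rw [map_zero]
  obtain ⟨N, x, hx⟩ := exists_pow_smul_away (cechElt v σ) (cechProj v M σ z)
  obtain ⟨K, hK⟩ := h (σ 0) x
  have h1 : (1 : Localization.Away (cechElt v σ)) ⊗ₜ[A] x = 0 := by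
    refine (one_tmul_away_eq_zero _ x).2 ⟨K, ?_⟩
    have : cechElt v σ = (∏ i : Fin k, v (σ i.succ)) * v (σ 0) := by
      rw [cechElt, Fin.prod_univ_succ, mul_comm]
    rw [this, mul_pow, mul_smul, hK, smul_zero]
  exact pow_smul_away_injective _ N (hx.trans (h1.trans (smul_zero _).symm))

/-- The Čech complex does not see maps whose kernel and cokernel are torsion. -/
theorem cechMap_bijective (f : M →ₗ[A] N)
    (hk : ∀ (j : Fin m) (x : M), f x = 0 → ∃ K : ℕ, v j ^ K • x = 0)
    (hc : ∀ (j : Fin m) (y : N), ∃ K : ℕ, ∃ x, f x = v j ^ K • y) (k : ℕ) :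
    Function.Bijective (cechMap v k f) := by
  constructor
  · refine (injective_iff_map_eq_zero _).2 fun z hz => ?_
    have h1 : Function.Exact (LinearMap.ker f).subtype f := fun x => by
      rw [Submodule.coe_subtype, Subtype.range_coe]
      rfl
    obtain ⟨w, rfl⟩ := (cechMap_exact v k h1 z).1 hz
    rw [cechMod_eq_zero v (M := LinearMap.ker f) (fun j x => by
      obtain ⟨K, hK⟩ := hk j x.1 x.2
      exact ⟨K, Subtype.ext hK⟩) w, map_zero]
  · intro z
    refine (cechMap_exact v k (f.exact_map_mkQ_range) z).1 (cechMod_eq_zero v (fun j y => ?_) _)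
    obtain ⟨y, rfl⟩ := Submodule.Quotient.mk_surjective _ y
    obtain ⟨K, x, hx⟩ := hc j y
    exact ⟨K, (Submodule.Quotient.mk_eq_zero _).2 ⟨x, hx⟩⟩

end Functoriality

end CechModules

/-! ### Adding an index to a Čech simplex and omitting it -/

section Insertion

variable {m : ℕ}

theorem range_eq_insert_cechFace {k : ℕ} (i : Fin (k + 2)) (σ : Fin (k + 2) ↪o Fin m) :
    Set.range σ = insert (σ i) (Set.range (cechFace i σ)) := by
  ext x
  constructor
  · rintro ⟨l, rfl⟩
    by_cases h : l = i
    · exact Or.inl (by rw [h])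
    · obtain ⟨l', rfl⟩ := Fin.exists_succAbove_eq h
      exact Or.inr ⟨l', rfl⟩
  · rintro (rfl | ⟨l, rfl⟩)
    · exact ⟨i, rfl⟩
    · exact ⟨i.succAbove l, rfl⟩

theorem notMem_range_cechFace {k : ℕ} (i : Fin (k + 2)) (σ : Fin (k + 2) ↪o Fin m) :
    σ i ∉ Set.range (cechFace i σ) := by
  rintro ⟨l, hl⟩
  exact Fin.succAbove_ne i l (σ.injective hl)

theorem orderEmbedding_eq_of_range_eq {k : ℕ} {σ τ : Fin k ↪o Fin m}
    (h : Set.range σ = Set.range τ) : σ = τ :=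
  DFunLike.coe_injective ((σ.strictMono.range_inj τ.strictMono).1 h)

/-- A finite set is determined by an element and its complement; since simplices are enumerated in
increasing order, the position of the element is determined as well. -/
theorem cechFace_inj {k : ℕ} {i i' : Fin (k + 2)} {σ σ' : Fin (k + 2) ↪o Fin m}
    (h : cechFace i σ = cechFace i' σ') (hj : σ i = σ' i') : σ = σ' ∧ i = i' := by
  have h1 : σ = σ' := orderEmbedding_eq_of_range_eq (by
    rw [range_eq_insert_cechFace i, range_eq_insert_cechFace i', h, hj])
  subst h1
  exact ⟨rfl, σ.injective hj⟩

theorem exists_cechFace_eq {k : ℕ} (σ : Fin (k + 1) ↪o Fin m) {j : Fin m} (hj : j ∉ Set.range σ) :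
    ∃ (ρ : Fin (k + 2) ↪o Fin m) (i : Fin (k + 2)), cechFace i ρ = σ ∧ ρ i = j := by
  classical
  let s : Finset (Fin m) := insert j (Finset.univ.image σ)
  have hs : s.card = k + 2 := by
    rw [Finset.card_insert_of_notMem, Finset.card_image_of_injective _ σ.injective,
      Finset.card_univ, Fintype.card_fin]
    simpa using hj
  let ρ := s.orderEmbOfFin hs
  have hr : Set.range ρ = insert j (Set.range σ) := by
    rw [Finset.range_orderEmbOfFin, Finset.coe_insert, Finset.coe_image, Finset.coe_univ,
      Set.image_univ]
  obtain ⟨i, hi⟩ : j ∈ Set.range ρ := by rw [hr]; exact Set.mem_insert _ _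
  refine ⟨ρ, i, orderEmbedding_eq_of_range_eq ?_, hi⟩
  have h1 := range_eq_insert_cechFace i ρ
  rw [hr, hi] at h1
  have h2 : j ∉ Set.range (cechFace i ρ) := hi ▸ notMem_range_cechFace i ρ
  ext x
  have h3 : x ∈ insert j (Set.range σ) ↔ x ∈ insert j (Set.range (cechFace i ρ)) := by rw [h1]
  simp only [Set.mem_insert_iff] at h3
  by_cases hx : x = j
  · subst hx; exact ⟨fun h => (h2 h).elim, fun h => (hj h).elim⟩
  · simp only [hx, false_or] at h3
    exact h3.symm

theorem orderEmbedding_one_ext {σ τ : Fin 1 ↪o Fin m} (h : σ 0 = τ 0) : σ = τ := by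
  ext i
  rw [Fin.fin_one_eq_zero i, h]

end Insertion

/-! ### Exactness of the augmented Čech complex -/

section CechExactness

variable {A : Type} [CommRing A] {m : ℕ} (v : Fin m → A)

/-- The augmented Čech complex of `M` is exact. -/
structure CechExact (M : Type) [AddCommGroup M] [Module A M] : Prop where
  injective : Function.Injective (cechAug v M)
  exact_zero : Function.Exact (cechAug v M) (cechModD v M 0)
  exact_succ : ∀ k, Function.Exact (cechModD v M k) (cechModD v M (k + 1))

section Contraction

variable {M : Type} [AddCommGroup M] [Module A M]

theorem cechElt_eq_face_mul {k : ℕ} (i : Fin (k + 2)) (σ : Fin (k + 2) ↪o Fin m) :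
    cechElt v σ = cechElt v (cechFace i σ) * v (σ i) := by
  rw [cechElt, cechElt, Fin.prod_univ_succAbove _ i, mul_comm]
  rfl

theorem awayTensor_cechProj_congr {k l : ℕ} (z : CechMod v M k) {σ τ : Fin (k + 1) ↪o Fin m}
    (ρ : Fin (l + 1) ↪o Fin m) (h : σ = τ) (h1 : cechElt v σ ∣ cechElt v ρ)
    (h2 : cechElt v τ ∣ cechElt v ρ) :
    awayTensor M h1 (cechProj v M σ z) = awayTensor M h2 (cechProj v M τ z) := by
  subst h; rfl

theorem neg_one_pow_smul_smul {N : Type} [AddCommGroup N] [Module A N] (i : ℕ) (x : N) :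
    (-1 : A) ^ i • (-1 : A) ^ i • x = x := by
  rw [smul_smul, ← pow_add, ← two_mul, pow_mul, neg_one_sq, one_pow, one_smul]

/-- A cocycle is a coboundary if one of the `v j` acts isomorphically. -/
theorem exists_cechModD_eq (j : Fin m) (hj : Function.Bijective fun x : M => v j • x) {k : ℕ}
    (z : CechMod v M (k + 1)) (hz : cechModD v M (k + 1) z = 0) : ∃ y, cechModD v M k y = z := by
  classical
  -- As `v j` is invertible on `M`, inserting `j` into an index set does not change the localization
  -- of `M`.
  have hβ : ∀ {k : ℕ} (i : Fin (k + 2)) (σ : Fin (k + 2) ↪o Fin m), σ i = j →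
      Function.Bijective (awayTensor M (cechElt_face_dvd v i σ)) := fun i σ h =>
    awayTensor_bijective _ (cechElt_eq_face_mul v i σ) (by rwa [h])
  -- The contraction: the component at `τ` is zero if `j` belongs to `τ`, and otherwise corresponds
  -- to the component of `z` at `τ ∪ {j}`, with the sign given by the position of `j`. The
  -- divisibility is a variable so that equal faces with different descriptions can be exchanged.
  have hf : ∀ τ : Fin (k + 1) ↪o Fin m, ∃ w : Localization.Away (cechElt v τ) ⊗[A] M,
      (j ∈ Set.range τ → w = 0) ∧ ∀ (ρ : Fin (k + 2) ↪o Fin m) (i : Fin (k + 2))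
        (h : cechFace i ρ = τ), ρ i = j → ∀ (hd : cechElt v τ ∣ cechElt v ρ),
        awayTensor M hd w = (-1 : A) ^ (i : ℕ) • cechProj v M ρ z := fun τ => by
    by_cases hτ : j ∈ Set.range τ
    · refine ⟨0, fun _ => rfl, fun ρ i h hi => ?_⟩
      subst h
      exact (notMem_range_cechFace i ρ (hi ▸ hτ)).elim
    · obtain ⟨ρ, i, rfl, hi⟩ := exists_cechFace_eq τ hτ
      obtain ⟨w, hw⟩ := (hβ i ρ hi).2 ((-1 : A) ^ (i : ℕ) • cechProj v M ρ z)
      refine ⟨w, fun h => (hτ h).elim, fun ρ' i' h hi' hd => ?_⟩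
      obtain ⟨rfl, rfl⟩ := cechFace_inj h (hi'.trans hi.symm)
      exact hw
  choose f hf0 hf1 using hf
  obtain ⟨y, hy⟩ := exists_cechProj_eq v f
  refine ⟨y, cechMod_ext v fun σ => ?_⟩
  rw [cechProj_cechModD]
  simp only [hy]
  by_cases hσ : j ∈ Set.range σ
  · obtain ⟨q, hq⟩ := hσ
    rw [Finset.sum_eq_single q, hf1 _ σ q rfl hq]
    · exact neg_one_pow_smul_smul (A := A) (N := Localization.Away (cechElt v σ) ⊗[A] M) q _
    · intro i _ hi
      rw [hf0 _, map_zero, smul_zero]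
      obtain ⟨l, hl⟩ := Fin.exists_succAbove_eq hi.symm
      exact ⟨l, by rw [← hq, ← hl]; rfl⟩
    · exact fun h => (h (Finset.mem_univ _)).elim
  -- If `j` is not in `σ`, the equation is checked after inserting `j`. The cocycle condition at `ρ
  -- = σ ∪ {j}` expresses the component at `σ` by the other faces of `ρ`, all of which contain `j`.
  · obtain ⟨ρ, q, rfl, hq⟩ := exists_cechFace_eq σ hσ
    refine (hβ q ρ hq).1 ?_
    have h1 : cechProj v M ρ (cechModD v M (k + 1) z) = 0 := by rw [hz, map_zero]
    rw [cechProj_cechModD, Fin.sum_univ_succAbove _ q] at h1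
    have h2 : ∀ i : Fin (k + 2), awayTensor M (cechElt_face_dvd v q ρ) ((-1 : A) ^ (i : ℕ) •
        awayTensor M (cechElt_face_dvd v i (cechFace q ρ)) (f (cechFace i (cechFace q ρ)))) =
        -((-1 : A) ^ (q : ℕ) • (-1 : A) ^ (q.succAbove i : ℕ) •
          awayTensor M (cechElt_face_dvd v (q.succAbove i) ρ)
            (cechProj v M (cechFace (q.succAbove i) ρ) z)) := fun i => by
      have hface := cechFace_cechFace q i ρ
      have hval : cechFace (q.succAbove i) ρ (i.predAbove q) = j := by
        rw [← hq]
        exact congrArg ρ (Fin.succAbove_succAbove_predAbove _ _)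
      have hd : cechElt v (cechFace i (cechFace q ρ)) ∣ cechElt v (cechFace (q.succAbove i) ρ) :=
        hface ▸ cechElt_face_dvd v _ _
      have h3 := hf1 _ (cechFace (q.succAbove i) ρ) (i.predAbove q) hface hval hd
      have hd' : cechElt v (cechFace i (cechFace q ρ)) ∣ cechElt v ρ :=
        (cechElt_face_dvd v _ _).trans (cechElt_face_dvd v _ _)
      rw [map_smul, awayTensor_awayTensor _ _ hd',
        ← awayTensor_awayTensor hd (cechElt_face_dvd v _ _) hd', h3, map_smul, smul_smul,
        smul_smul, ← neg_smul]
      congr 1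
      have h4 := Fin.neg_one_pow_succAbove_add_predAbove (R := A) q i
      rw [pow_add, pow_add] at h4
      have h5 : (-1 : A) ^ (q.succAbove i : ℕ) * (-1 : A) ^ (q.succAbove i : ℕ) = 1 := by
        rw [← pow_add, ← two_mul, pow_mul, neg_one_sq, one_pow]
      have h6 : (-1 : A) ^ (i : ℕ) * (-1 : A) ^ (i : ℕ) = 1 := by
        rw [← pow_add, ← two_mul, pow_mul, neg_one_sq, one_pow]
      linear_combination (-1 : A) ^ (q.succAbove i : ℕ) * (-1 : A) ^ (i : ℕ) * h4 -
        (-1 : A) ^ (i : ℕ) * (-1 : A) ^ (i.predAbove q : ℕ) * h5 -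
        (-1 : A) ^ (q : ℕ) * (-1 : A) ^ (q.succAbove i : ℕ) * h6
    rw [map_sum, Finset.sum_congr rfl fun i _ => h2 i, Finset.sum_neg_distrib, ← Finset.smul_sum]
    refine (congrArg (fun t => -((-1 : A) ^ (q : ℕ) • t)) (eq_neg_of_add_eq_zero_right h1)).trans ?_
    refine (congrArg Neg.neg (smul_neg _ _)).trans ((neg_neg _).trans ?_)
    exact neg_one_pow_smul_smul (A := A) (N := Localization.Away (cechElt v ρ) ⊗[A] M) q _

theorem cechElt_of_one (σ : Fin 1 ↪o Fin m) : cechElt v σ = v (σ 0) := Fin.prod_univ_one _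

theorem smul_pow_bijective {a : A} (ha : Function.Bijective fun x : M => a • x) (N : ℕ) :
    Function.Bijective fun x : M => a ^ N • x := by
  induction N with
  | zero => simp only [pow_zero, one_smul]; exact Function.bijective_id
  | succ N ih =>
    have := ih.comp ha
    simpa only [Function.comp_def, smul_smul, ← pow_succ] using this

/-- A cocycle of degree zero is determined by its component at `{j}`, which lies in `M[1/v_j] = M`
and provides the preimage under the augmentation. In higher degrees the contraction applies. -/
theorem cechExact_of_bijective (j : Fin m) (hj : Function.Bijective fun x : M => v j • x) :
    CechExact v M := by
  let τ : Fin 1 ↪o Fin m := OrderEmbedding.ofStrictMono (fun _ => j) (Subsingleton.strictMono _)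
  have hτ : ∀ N, Function.Bijective fun x : M => cechElt v τ ^ N • x := fun N => by
    rw [cechElt_of_one]
    exact smul_pow_bijective hj N
  constructor
  · refine (injective_iff_map_eq_zero _).2 fun x hx => ?_
    have h1 : (1 : Localization.Away (cechElt v τ)) ⊗ₜ[A] x = 0 := by
      rw [← cechProj_cechAug, hx, map_zero]
    obtain ⟨N, hN⟩ := (one_tmul_away_eq_zero _ x).1 h1
    exact (hτ N).1 (hN.trans (smul_zero _).symm)
  · refine fun z => ⟨fun hz => ?_, by rintro ⟨x, rfl⟩; exact cechModD_cechAug v x⟩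
    obtain ⟨N, x, hx⟩ := exists_pow_smul_away _ (cechProj v M τ z)
    obtain ⟨y, rfl⟩ := (hτ N).2 x
    have hy : cechProj v M τ z = 1 ⊗ₜ y := pow_smul_away_injective _ N (by
      rw [hx]; exact tmul_smul _ _ _)
    refine ⟨y, cechMod_ext v fun σ => ?_⟩
    rw [cechProj_cechAug]
    by_cases hσ : j ∈ Set.range σ
    · obtain ⟨i, hi⟩ := hσ
      obtain rfl : σ = τ := orderEmbedding_one_ext (by rw [← Fin.fin_one_eq_zero i, hi]; rfl)
      exact hy.symm
    · obtain ⟨ρ, i, rfl, hi⟩ := exists_cechFace_eq σ hσ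
      have hz' := congrArg (cechProj v M ρ) hz
      rw [cechProj_cechModD, map_zero, Fin.sum_univ_two] at hz'
      have h1 : awayTensor M (cechElt_face_dvd v 0 ρ) (cechProj v M (cechFace 0 ρ) z) =
          awayTensor M (cechElt_face_dvd v 1 ρ) (cechProj v M (cechFace 1 ρ) z) := by
        rw [Fin.val_zero, Fin.val_one, pow_zero, pow_one, one_smul] at hz'
        refine (eq_neg_of_add_eq_zero_left hz').trans ((congrArg Neg.neg (neg_smul (1 : A)
          (_ : Localization.Away (cechElt v ρ) ⊗[A] M))).trans ((neg_neg _).trans (one_smul A _)))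
      have hβ := awayTensor_bijective (M := M) (cechElt_face_dvd v i ρ) (cechElt_eq_face_mul v i ρ) (by rwa [hi])
      have h3 : ∀ l, l ≠ i → awayTensor M (cechElt_face_dvd v l ρ) (cechProj v M (cechFace l ρ) z) =
          1 ⊗ₜ y := fun l hl => by
        have h4 : cechFace l ρ = τ := orderEmbedding_one_ext (by
          obtain ⟨t, ht⟩ := Fin.exists_succAbove_eq hl.symm
          rw [Fin.fin_one_eq_zero t] at ht
          change ρ (l.succAbove 0) = j
          rw [ht, hi])
        have hd : cechElt v τ ∣ cechElt v ρ := h4 ▸ cechElt_face_dvd v l ρ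
        rw [awayTensor_cechProj_congr v z ρ h4 _ hd, hy, awayTensor_one_tmul]
      refine hβ.1 ?_
      rw [awayTensor_one_tmul]
      fin_cases i
      · exact (h3 1 (by decide)).symm.trans h1.symm
      · exact (h3 0 (by decide)).symm.trans h1
  · exact fun k z => ⟨exists_cechModD_eq v j hj z, by rintro ⟨y, rfl⟩; exact cechModD_cechModD v y⟩

end Contraction

section Extensions

variable {M' M M'' : Type} [AddCommGroup M'] [Module A M'] [AddCommGroup M] [Module A M]
  [AddCommGroup M''] [Module A M'']

/-- A chase in three consecutive positions: the image of `y` in the quotient row is a boundary,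
which is lifted and subtracted, and the rest comes from the first row. It is stated for abstract
maps so that it covers the augmentation as well as the differentials. -/
theorem exact_middle {A₁ A₂ A₃ B₁ B₂ B₃ C₁ C₂ C₃ : Type} [AddCommGroup A₁] [AddCommGroup A₂]
    [AddCommGroup A₃] [AddCommGroup B₁] [AddCommGroup B₂] [AddCommGroup B₃] [AddCommGroup C₁]
    [AddCommGroup C₂] [AddCommGroup C₃] {α : A₁ →+ A₂} {α' : A₂ →+ A₃} {β : B₁ →+ B₂}
    {β' : B₂ →+ B₃} {γ : C₁ →+ C₂} {γ' : C₂ →+ C₃} {f₁ : A₁ →+ B₁} {f₂ : A₂ →+ B₂} {f₃ : A₃ →+ B₃}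
    {g₁ : B₁ →+ C₁} {g₂ : B₂ →+ C₂} (g₃ : B₃ →+ C₃) (hf₁ : ∀ x, f₂ (α x) = β (f₁ x))
    (hf₂ : ∀ x, f₃ (α' x) = β' (f₂ x)) (hg₁ : ∀ x, g₂ (β x) = γ (g₁ x))
    (hg₂ : ∀ x, g₃ (β' x) = γ' (g₂ x)) (hf₃ : Function.Injective f₃) (h₂ : Function.Exact f₂ g₂)
    (hg : Function.Surjective g₁) (hα : Function.Exact α α') (hγ : Function.Exact γ γ')
    (hβ : ∀ x, β' (β x) = 0) : Function.Exact β β' := fun y => by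
  refine ⟨fun hy => ?_, by rintro ⟨x, rfl⟩; exact hβ x⟩
  obtain ⟨c, hc⟩ := (hγ (g₂ y)).1 (by rw [← hg₂, hy, map_zero])
  obtain ⟨b, rfl⟩ := hg c
  obtain ⟨a, ha⟩ := (h₂ (y - β b)).1 (by rw [map_sub, hg₁, hc, sub_self])
  obtain ⟨a', rfl⟩ := (hα a).1 (hf₃ (by rw [hf₂, ha, map_sub, hy, hβ, sub_zero, map_zero]))
  exact ⟨f₁ a' + b, by rw [map_add, ← hf₁, ha, sub_add_cancel]⟩

/-- Exactness of the augmented Čech complex is closed under extensions. -/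
theorem CechExact.extension (f : M' →ₗ[A] M) (g : M →ₗ[A] M'') (hf : Function.Injective f)
    (hfg : Function.Exact f g) (hg : Function.Surjective g) (h' : CechExact v M')
    (h'' : CechExact v M'') : CechExact v M where
  injective := by
    refine (injective_iff_map_eq_zero _).2 fun x hx => ?_
    obtain ⟨y, rfl⟩ := (hfg x).1 (h''.injective (by
      rw [cechAug_map, hx, map_zero, map_zero]))
    rw [cechAug_map, ← map_zero (cechMap v 0 f)] at hx
    rw [h'.injective ((cechMap_injective v 0 hf hx).trans (map_zero _).symm), map_zero]
  exact_zero := exact_middle (α := (cechAug v M').toAddMonoidHom)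
    (α' := (cechModD v M' 0).toAddMonoidHom) (β := (cechAug v M).toAddMonoidHom)
    (β' := (cechModD v M 0).toAddMonoidHom) (γ := (cechAug v M'').toAddMonoidHom)
    (γ' := (cechModD v M'' 0).toAddMonoidHom) (f₁ := f.toAddMonoidHom)
    (f₂ := (cechMap v 0 f).toAddMonoidHom) (f₃ := (cechMap v 1 f).toAddMonoidHom)
    (g₁ := g.toAddMonoidHom) (g₂ := (cechMap v 0 g).toAddMonoidHom)
    (cechMap v 1 g).toAddMonoidHom (fun x => (cechAug_map v f x).symm)
    (fun x => (cechModD_cechMap v f x).symm) (fun x => (cechAug_map v g x).symm)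
    (fun x => (cechModD_cechMap v g x).symm) (cechMap_injective v 1 hf) (cechMap_exact v 0 hfg) hg
    h'.exact_zero h''.exact_zero (cechModD_cechAug v)
  exact_succ k := exact_middle (α := (cechModD v M' k).toAddMonoidHom)
    (α' := (cechModD v M' (k + 1)).toAddMonoidHom) (β := (cechModD v M k).toAddMonoidHom)
    (β' := (cechModD v M (k + 1)).toAddMonoidHom) (γ := (cechModD v M'' k).toAddMonoidHom)
    (γ' := (cechModD v M'' (k + 1)).toAddMonoidHom) (f₁ := (cechMap v k f).toAddMonoidHom)
    (f₂ := (cechMap v (k + 1) f).toAddMonoidHom) (f₃ := (cechMap v (k + 2) f).toAddMonoidHom)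
    (g₁ := (cechMap v k g).toAddMonoidHom) (g₂ := (cechMap v (k + 1) g).toAddMonoidHom)
    (cechMap v (k + 2) g).toAddMonoidHom (fun x => (cechModD_cechMap v f x).symm)
    (fun x => (cechModD_cechMap v f x).symm) (fun x => (cechModD_cechMap v g x).symm)
    (fun x => (cechModD_cechMap v g x).symm) (cechMap_injective v _ hf) (cechMap_exact v _ hfg)
    (cechMap_surjective v k hg) (h'.exact_succ k) (h''.exact_succ k) (cechModD_cechModD v)

theorem CechExact.of_subsingleton [Subsingleton M] : CechExact v M where
  injective := Function.injective_of_subsingleton _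
  exact_zero z := by
    have : z = 0 := cechMod_eq_zero v (fun _ x => ⟨0, Subsingleton.elim _ _⟩) z
    subst this
    exact ⟨fun _ => ⟨0, map_zero _⟩, fun _ => map_zero _⟩
  exact_succ k z := by
    have : z = 0 := cechMod_eq_zero v (fun _ x => ⟨0, Subsingleton.elim _ _⟩) z
    subst this
    exact ⟨fun _ => ⟨0, map_zero _⟩, fun _ => map_zero _⟩

/-- A map with torsion kernel and cokernel that is surjective preserves exactness of the
augmented Čech complex, if its target has no torsion. -/
theorem CechExact.of_torsion_cokernel (f : M →ₗ[A] M'')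
    (hk : ∀ (j : Fin m) (x : M), f x = 0 → ∃ K : ℕ, v j ^ K • x = 0)
    (hc : ∀ (j : Fin m) (y : M''), ∃ K : ℕ, ∃ x, f x = v j ^ K • y) (h : CechExact v M)
    (h'' : Function.Injective (cechAug v M'')) : Function.Bijective f ∧ CechExact v M'' := by
  have hK := cechMap_bijective v f hk hc
  -- The two Čech complexes coincide, and only the augmentations can differ. A cocycle of degree
  -- zero comes from `M`; applied to the cocycle of an element of `M''`, this shows that `f` is
  -- surjective.
  have hsurj : ∀ z, cechModD v M'' 0 z = 0 → ∃ x, cechAug v M'' (f x) = z := fun z hz => by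
    obtain ⟨w, rfl⟩ := (hK 0).2 z
    rw [cechModD_cechMap] at hz
    obtain ⟨x, rfl⟩ := (h.exact_zero w).1 ((hK 1).1 (hz.trans (map_zero _).symm))
    exact ⟨x, rfl⟩
  refine ⟨⟨fun x y hxy => h.injective ((hK 0).1 ?_), fun y => ?_⟩, h'', fun z =>
    ⟨fun hz => ?_, by rintro ⟨x, rfl⟩; exact cechModD_cechAug v x⟩, fun k z =>
    ⟨fun hz => ?_, by rintro ⟨x, rfl⟩; exact cechModD_cechModD v x⟩⟩
  · rw [← cechAug_map, ← cechAug_map, hxy]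
  · obtain ⟨x, hx⟩ := hsurj _ (cechModD_cechAug v y)
    exact ⟨x, h'' hx⟩
  · obtain ⟨x, hx⟩ := hsurj z hz
    exact ⟨_, hx⟩
  · obtain ⟨w, rfl⟩ := (hK _).2 z
    rw [cechModD_cechMap] at hz
    obtain ⟨x, rfl⟩ := (h.exact_succ k w).1 ((hK _).1 (hz.trans (map_zero _).symm))
    exact ⟨cechMap v k f x, cechModD_cechMap v f x⟩

end Extensions

end CechExactness

/-! ### Čech complexes of localizations of divisible comodules -/

section CechLocal

variable {p : ℕ} [hp : Fact p.Prime] {n : ℕ}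

section Filtration

variable {M : Type} [AddCommGroup M] [Module (BP p) M]

variable (p M) in
/-- The elements on which `v_0, …, v_{j-1}` are nilpotent. -/
def nilSub (j : ℕ) : Submodule (BP p) M where
  carrier := {x | ∀ i < j, vGen p i ∈ nilIdeal x}
  zero_mem' := fun _ _ => mem_nilIdeal.2 ⟨0, smul_zero _⟩
  add_mem' {x y} hx hy i hi := by
    obtain ⟨K, hK⟩ := mem_nilIdeal.1 (hx i hi)
    obtain ⟨N, hN⟩ := mem_nilIdeal.1 (hy i hi)
    refine mem_nilIdeal.2 ⟨N + K, ?_⟩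
    rw [smul_add, pow_add, mul_smul, hK, smul_zero, mul_comm, mul_smul, hN, smul_zero, add_zero]
  smul_mem' a x hx i hi := by
    obtain ⟨K, hK⟩ := mem_nilIdeal.1 (hx i hi)
    exact mem_nilIdeal.2 ⟨K, by rw [smul_comm, hK, smul_zero]⟩

theorem nilSub_succ_le (j : ℕ) : nilSub p M (j + 1) ≤ nilSub p M j :=
  fun _ hx i hi => hx i (by omega)

/-- On the subquotient of elements nilpotent under `v_0, …, v_{j-1}` modulo those also nilpotent
under `v_j`, multiplication by `v_j` is injective by construction and surjective by divisibility.
The claim follows by adding up these extensions. -/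
theorem cechExact_quotient_nilSub (h : IsQDivisible p n M) (j : ℕ) (hj : j ≤ n + 1) :
    CechExact (gens p n) (M ⧸ nilSub p M j) := by
  induction j with
  | zero =>
    have : Subsingleton (M ⧸ nilSub p M 0) := subsingleton_of_forall_eq 0 fun y => by
      obtain ⟨x, rfl⟩ := Submodule.Quotient.mk_surjective _ y
      exact (Submodule.Quotient.mk_eq_zero _).2 fun i hi => absurd hi (by omega)
    exact CechExact.of_subsingleton _
  | succ j ih =>
    let N := (nilSub p M j).map (nilSub p M (j + 1)).mkQ
    let g := (nilSub p M (j + 1)).mapQ (nilSub p M j) LinearMap.id (nilSub_succ_le j)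
    refine CechExact.extension (gens p n) N.subtype g N.injective_subtype (fun x => ?_)
      (fun y => ?_) (cechExact_of_bijective _ ⟨j, by omega⟩ ⟨?_, ?_⟩) (ih (by omega))
    · obtain ⟨x, rfl⟩ := Submodule.Quotient.mk_surjective _ x
      rw [Submodule.coe_subtype, Subtype.range_coe]
      constructor
      · intro hx
        exact ⟨x, (Submodule.Quotient.mk_eq_zero _).1 hx, rfl⟩
      · rintro ⟨y, hy, hyx⟩
        have h1 : g (Submodule.Quotient.mk x) = Submodule.Quotient.mk y :=
          (congrArg g hyx).symm
        rw [h1]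
        exact (Submodule.Quotient.mk_eq_zero _).2 hy
    · obtain ⟨x, rfl⟩ := Submodule.Quotient.mk_surjective _ y
      exact ⟨Submodule.Quotient.mk x, rfl⟩
    · have h1 : ∀ x : N, vGen p j • x = 0 → x = 0 := by
        rintro ⟨_, x, hx, rfl⟩ h
        have h2 : vGen p j • x ∈ nilSub p M (j + 1) :=
          (Submodule.Quotient.mk_eq_zero _).1 (congrArg Subtype.val h)
        refine Subtype.ext ((Submodule.Quotient.mk_eq_zero _).2 fun i hi => ?_)
        rcases Nat.lt_succ_iff_lt_or_eq.1 hi with hi | rfl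
        · exact hx i hi
        · obtain ⟨K, hK⟩ := mem_nilIdeal.1 (h2 i hi)
          exact mem_nilIdeal.2 ⟨K + 1, by rw [pow_succ, mul_smul, hK]⟩
      intro x y hxy
      exact sub_eq_zero.1 (h1 (x - y) ((smul_sub _ _ _).trans (sub_eq_zero.2 hxy)))
    · rintro ⟨_, x, hx, rfl⟩
      obtain ⟨y, hy, rfl⟩ := h j (by omega) x hx
      exact ⟨⟨_, y, hy, rfl⟩, rfl⟩

end Filtration

/-- For comodules, nilpotence of `v_n` alone implies that of the lower generators, so the last step
of the filtration is the kernel of the localization map. -/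
theorem mem_nilSub_iff (M : Comod p) (x : M.carrier) :
    x ∈ nilSub p M.carrier (n + 1) ↔ ∃ K : ℕ, vGen p n ^ K • x = 0 :=
  ⟨fun h => mem_nilIdeal.1 (h n (by omega)), fun h _ hi =>
    vGen_mem_nilIdeal M x (mem_nilIdeal.2 h) (Nat.lt_succ_iff.1 hi)⟩

theorem cechAug_injective {M : Comod p} (hM : IsVTorsionFree p n M.carrier) :
    Function.Injective (cechAug (gens p n) M.carrier) := by
  refine (injective_iff_map_eq_zero _).2 fun x hx => ?_
  let τ : Fin 1 ↪o Fin (n + 1) :=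
    OrderEmbedding.ofStrictMono (fun _ => Fin.last n) (Subsingleton.strictMono _)
  have h1 : (1 : Localization.Away (cechElt (gens p n) τ)) ⊗ₜ[BP p] x = 0 := by
    rw [← cechProj_cechAug, hx, map_zero]
  obtain ⟨N, hN⟩ := (one_tmul_away_eq_zero _ x).1 h1
  rw [cechElt_of_one] at hN
  exact hM x N hN

variable (L : TorsionLocalization p n)

theorem exists_pow_smul_eq_zero {M : Comod p} {x : M.carrier} (h : ∃ K : ℕ, vGen p n ^ K • x = 0)
    (j : Fin (n + 1)) : ∃ K : ℕ, gens p n j ^ K • x = 0 :=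
  mem_nilIdeal.1 (vGen_mem_nilIdeal M x (mem_nilIdeal.2 h) (Nat.lt_succ_iff.1 j.2))

/-- The passage from `v_n` to `v_j` is made in the cokernel, which is a comodule. -/
theorem exists_pow_smul_mem_range {M N : Comod p} (f : M ⟶ N) (y : N.carrier)
    (h : ∃ (K : ℕ) (x : M.carrier), f.toLin x = vGen p n ^ K • y) (j : Fin (n + 1)) :
    ∃ (K : ℕ) (x : M.carrier), f.toLin x = gens p n j ^ K • y := by
  obtain ⟨K, x, hx⟩ := h
  have h1 : vGen p n ^ K • (Comod.cokerπ f).toLin y = 0 := by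
    rw [← map_smul, ← LinearMap.mem_ker, Comod.ker_cokerπ]
    exact ⟨x, hx⟩
  obtain ⟨N, hN⟩ := exists_pow_smul_eq_zero ⟨K, h1⟩ j
  rw [← map_smul, ← LinearMap.mem_ker, Comod.ker_cokerπ] at hN
  obtain ⟨x', hx'⟩ := hN
  exact ⟨N, x', hx'⟩

/-- The Čech complex does not change under localization. -/
theorem TorsionLocalization.cechMap_unit_bijective (M : Comod p) (k : ℕ) :
    Function.Bijective (cechMap (gens p n) k (L.unit.app M).toLin) :=
  cechMap_bijective (gens p n) (L.unit.app M).toLin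
    (fun j x hx => exists_pow_smul_eq_zero (M := M) ((L.unit_ker M x).1 hx) j)
    (fun j y => exists_pow_smul_mem_range _ _ (L.unit_coker M y) j) k

/-- The localization of a divisible comodule is a quotient of it, and its augmented Čech complex
is exact. -/
theorem TorsionLocalization.surjective_and_cechExact_of_isQDivisible {M : Comod p}
    (hM : IsQDivisible p n M.carrier) : Function.Surjective (L.unit.app M).toLin ∧
      CechExact (gens p n) (L.functor.obj M).carrier := by
  have hle : nilSub p M.carrier (n + 1) ≤ LinearMap.ker (L.unit.app M).toLin := fun x hx =>
    (L.unit_ker M x).2 ((mem_nilSub_iff M x).1 hx)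
  let f := (nilSub p M.carrier (n + 1)).liftQ (L.unit.app M).toLin hle
  obtain ⟨h1, h2⟩ : Function.Bijective f ∧ CechExact (gens p n) (L.functor.obj M).carrier := by
    refine CechExact.of_torsion_cokernel (gens p n) f (fun j x hx => ⟨0, ?_⟩) (fun j y => ?_)
      (cechExact_quotient_nilSub hM (n + 1) le_rfl) (cechAug_injective (L.torsionFree M))
    · obtain ⟨x, rfl⟩ := Submodule.Quotient.mk_surjective _ x
      have h1 : x ∈ nilSub p M.carrier (n + 1) := (mem_nilSub_iff M x).2 ((L.unit_ker M x).1 hx)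
      rw [(Submodule.Quotient.mk_eq_zero _).2 h1, smul_zero]
    · obtain ⟨K, x, hx⟩ := exists_pow_smul_mem_range _ _ (L.unit_coker M y) j
      exact ⟨K, Submodule.Quotient.mk x, hx⟩
  refine ⟨fun y => ?_, h2⟩
  obtain ⟨x, rfl⟩ := h1.2 y
  obtain ⟨x, rfl⟩ := Submodule.Quotient.mk_surjective _ x
  exact ⟨x, rfl⟩

theorem TorsionLocalization.cechExact_of_injective (M : Comod p) [Injective M] :
    CechExact (gens p n) (L.functor.obj M).carrier :=
  (L.surjective_and_cechExact_of_isQDivisible (isQDivisible_of_injective n M)).2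

theorem cechExact_of_vGen_bijective {M : Comod p} {j : ℕ} (hj : j ≤ n)
    (hM : Function.Bijective fun x : M.carrier => vGen p j • x) :
    CechExact (gens p n) M.carrier :=
  cechExact_of_bijective _ ⟨j, by omega⟩ hM

end CechLocal

/-! ### Comparing the two augmentations of a double complex -/

section Staircase

variable (A : Type) [CommRing A]

/-- A first quadrant commutative double complex `X`, augmented by a complex `N` to the left of
the rows and by a complex `P` below the columns. -/
structure AugDouble where
  X : ℕ → ℕ → Type
  N : ℕ → Type
  P : ℕ → Type
  [gX : ∀ a b, AddCommGroup (X a b)]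
  [gN : ∀ b, AddCommGroup (N b)]
  [gP : ∀ a, AddCommGroup (P a)]
  [mX : ∀ a b, Module A (X a b)]
  [mN : ∀ b, Module A (N b)]
  [mP : ∀ a, Module A (P a)]
  dh : ∀ a b, X a b →ₗ[A] X (a + 1) b
  dv : ∀ a b, X a b →ₗ[A] X a (b + 1)
  dN : ∀ b, N b →ₗ[A] N (b + 1)
  dP : ∀ a, P a →ₗ[A] P (a + 1)
  η : ∀ b, N b →ₗ[A] X 0 b
  ε : ∀ a, P a →ₗ[A] X a 0
  comm : ∀ a b x, dv (a + 1) b (dh a b x) = dh a (b + 1) (dv a b x)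
  η_comm : ∀ b x, dv 0 b (η b x) = η (b + 1) (dN b x)
  ε_comm : ∀ a x, dh a 0 (ε a x) = ε (a + 1) (dP a x)
  η_injective : ∀ b, Function.Injective (η b)
  η_exact : ∀ b, Function.Exact (η b) (dh 0 b)
  dh_exact : ∀ a b, Function.Exact (dh a b) (dh (a + 1) b)
  ε_injective : ∀ a, Function.Injective (ε a)
  ε_exact : ∀ a, Function.Exact (ε a) (dv a 0)
  dv_exact : ∀ a b, Function.Exact (dv a b) (dv a (b + 1))

attribute [instance] AugDouble.gX AugDouble.gN AugDouble.gP AugDouble.mX AugDouble.mN AugDouble.mP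

namespace AugDouble

variable {A} (D : AugDouble A)

theorem dh_dh (a b : ℕ) (x : D.X a b) : D.dh (a + 1) b (D.dh a b x) = 0 :=
  (D.dh_exact a b _).2 ⟨x, rfl⟩

theorem dv_dv (a b : ℕ) (x : D.X a b) : D.dv a (b + 1) (D.dv a b x) = 0 :=
  (D.dv_exact a b _).2 ⟨x, rfl⟩

/-- `Stair n a b x` says that `x` is connected to `n` by a staircase in the double complex. -/
inductive Stair {c : ℕ} (n : D.N c) : ∀ a b, D.X a b → Prop
  | base : Stair n 0 c (D.η c n)
  | step {a b : ℕ} (w : D.X a b) (h : Stair n a (b + 1) (D.dv a b w)) :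
      Stair n (a + 1) b (D.dh a b w)

variable {D}

theorem Stair.dh_eq_zero {c : ℕ} {n : D.N c} {a b : ℕ} {x : D.X a b} (h : D.Stair n a b x) :
    D.dh a b x = 0 := by
  cases h with
  | base => exact (D.η_exact c _).2 ⟨n, rfl⟩
  | step w h => exact D.dh_dh _ _ w

theorem Stair.dv_eq_zero {c : ℕ} {n : D.N c} (hn : D.dN c n = 0) {a b : ℕ} {x : D.X a b}
    (h : D.Stair n a b x) : D.dv a b x = 0 := by
  cases h with
  | base => rw [D.η_comm, hn, map_zero]
  | step w h => rw [D.comm, h.dh_eq_zero]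

theorem Stair.add_eq {c : ℕ} {n : D.N c} {a b : ℕ} {x : D.X a b} (h : D.Stair n a b x) :
    a + b = c := by
  induction h with
  | base => exact zero_add _
  | step w h ih => omega

theorem Stair.smul {c : ℕ} {n : D.N c} {a b : ℕ} {x : D.X a b} (r : A) (h : D.Stair n a b x) :
    D.Stair (r • n) a b (r • x) := by
  induction h with
  | base => rw [← map_smul]; exact .base
  | step w h ih =>
    rw [← map_smul] at ih ⊢
    exact .step _ ih

theorem Stair.add {c : ℕ} {n n' : D.N c} {a b : ℕ} {x x' : D.X a b} (h : D.Stair n a b x)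
    (h' : D.Stair n' a b x') : D.Stair (n + n') a b (x + x') := by
  induction h with
  | base =>
    cases h' with
    | base => rw [← map_add]; exact .base
  | step w h ih =>
    cases h' with
    | step w' h' =>
      have := ih h'
      rw [← map_add] at this ⊢
      exact .step _ this

/-- Each element of a staircase that starts at a cocycle is a vertical cocycle. By exactness of the
columns it is the vertical differential of some `w`, and the horizontal differential of `w` is the
next element. -/
theorem exists_stair {c : ℕ} (n : D.N c) (hn : D.dN c n = 0) (a b : ℕ) (h : a + b = c) :
    ∃ x, D.Stair n a b x := by
  induction a generalizing b with
  | zero =>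
    obtain rfl : b = c := by omega
    exact ⟨_, .base⟩
  | succ a ih =>
    obtain ⟨x, hx⟩ := ih (b + 1) (by omega)
    obtain ⟨w, rfl⟩ := (D.dv_exact a b x).1 (hx.dv_eq_zero hn)
    exact ⟨_, .step w hx⟩

theorem exists_stair_from (a b : ℕ) (x : D.X a b) (hh : D.dh a b x = 0) (hv : D.dv a b x = 0) :
    ∃ n : D.N (a + b), D.dN (a + b) n = 0 ∧ D.Stair n a b x := by
  induction a generalizing b with
  | zero =>
    rw [zero_add]
    obtain ⟨n, rfl⟩ := (D.η_exact b x).1 hh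
    refine ⟨n, D.η_injective _ ?_, .base⟩
    rw [← D.η_comm, hv, map_zero]
  | succ a ih =>
    obtain ⟨w, rfl⟩ := (D.dh_exact a b x).1 hh
    obtain ⟨n, hn, h⟩ := ih (b + 1) (D.dv a b w) (by rw [← D.comm, hv]) (D.dv_dv _ _ _)
    rw [Nat.succ_add_eq_add_succ]
    exact ⟨n, hn, .step w h⟩

/-- The staircase of a boundary consists of vertical differentials of horizontal cocycles. In the
step, `w - u` is a vertical cocycle, hence of the form `dv t`, and `dh t` is the next choice. The
index `b'` with an equation, instead of `b + 1`, permits induction on the staircase. -/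
theorem Stair.exists_dv_of_boundary {c : ℕ} {m : D.N c} {a b b' : ℕ} {x : D.X a b'}
    (h : D.Stair (D.dN c m) a b' x) (hb : b' = b + 1) :
    ∃ u : D.X a b, D.dh a b u = 0 ∧ D.dv a b u = hb ▸ x := by
  induction h generalizing b with
  | base =>
    obtain rfl : c = b := by omega
    exact ⟨D.η c m, (D.η_exact c _).2 ⟨m, rfl⟩, D.η_comm c m⟩
  | step w h ih =>
    subst hb
    obtain ⟨u, hu, hu'⟩ := ih rfl
    obtain ⟨t, ht⟩ := (D.dv_exact _ _ (w - u)).1 (by rw [map_sub, hu', sub_self])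
    exact ⟨D.dh _ _ t, D.dh_dh _ _ t, by rw [D.comm, ht, map_sub, hu, sub_zero]⟩

/-- The converse chase, upwards: `w - u` is a horizontal cocycle, hence a horizontal differential
`dh t`, and `dv t` does for the previous element. At the left edge exactness produces an element of
the augmentation instead. -/
theorem Stair.boundary_of_exists_dh {c : ℕ} {n : D.N (c + 1)} {a a' b : ℕ} {x : D.X a' b}
    (h : D.Stair n a' b x) (ha : a' = a + 1) {u : D.X a b} (hu : D.dv a b u = 0)
    (hx : D.dh a b u = ha ▸ x) : ∃ m, D.dN c m = n := by
  induction h generalizing a with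
  | base => omega
  | @step a₁ b₁ w h ih =>
    obtain rfl : a₁ = a := by omega
    have h1 : D.dh _ _ (w - u) = 0 := by rw [map_sub, hx, sub_self]
    cases a₁ with
    | zero =>
      obtain ⟨t, ht⟩ := (D.η_exact _ _).1 h1
      have h2 : D.dv 0 _ w = D.η _ (D.dN _ t) := by
        rw [← D.η_comm, ht, map_sub, hu, sub_zero]
      rw [h2] at h
      have hc := h.add_eq
      obtain rfl : b₁ = c := by omega
      generalize hy : D.η (b₁ + 1) (D.dN b₁ t) = y at h
      cases h with
      | base => exact ⟨t, D.η_injective _ hy⟩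
    | succ a₂ =>
      obtain ⟨t, ht⟩ := (D.dh_exact _ _ _).1 h1
      refine ih rfl (u := D.dv _ _ t) (D.dv_dv _ _ _) ?_
      rw [← D.comm, ht, map_sub, hu, sub_zero]

variable (D)

/-- The relation between cocycles of the two augmentations of a double complex. -/
def Rel {c : ℕ} (n : D.N c) (q : D.P c) : Prop := D.Stair n c 0 (D.ε c q)

variable {D} {c : ℕ} {n n' : D.N c} {q q' : D.P c}

theorem Rel.add (h : D.Rel n q) (h' : D.Rel n' q') : D.Rel (n + n') (q + q') := by
  rw [Rel, map_add]; exact Stair.add h h'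

theorem Rel.smul (r : A) (h : D.Rel n q) : D.Rel (r • n) (r • q) := by
  rw [Rel, map_smul]; exact Stair.smul r h

theorem Rel.dP_eq_zero (h : D.Rel n q) : D.dP c q = 0 := by
  apply D.ε_injective
  rw [← D.ε_comm, map_zero]
  exact Stair.dh_eq_zero h

theorem exists_rel (n : D.N c) (hn : D.dN c n = 0) : ∃ q, D.Rel n q := by
  obtain ⟨x, hx⟩ := exists_stair n hn c 0 rfl
  obtain ⟨q, rfl⟩ := (D.ε_exact c x).1 (hx.dv_eq_zero hn)
  exact ⟨q, hx⟩

theorem exists_rel_from (q : D.P c) (hq : D.dP c q = 0) : ∃ n, D.dN c n = 0 ∧ D.Rel n q :=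
  exists_stair_from c 0 (D.ε c q) (by rw [D.ε_comm, hq, map_zero]) ((D.ε_exact c _).2 ⟨q, rfl⟩)

theorem Rel.zero_iff {n : D.N 0} {q : D.P 0} (h : D.Rel n q) : n = 0 ↔ q = 0 := by
  have h1 : D.η 0 n = D.ε 0 q := by
    have h : D.Stair n 0 0 (D.ε 0 q) := h
    generalize D.ε 0 q = x at h ⊢
    cases h
    rfl
  rw [← map_eq_zero_iff _ (D.η_injective 0), h1, map_eq_zero_iff _ (D.ε_injective 0)]

theorem Rel.boundary_iff {n : D.N (c + 1)} {q : D.P (c + 1)} (h : D.Rel n q) :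
    (∃ m, D.dN c m = n) ↔ ∃ r, D.dP c r = q := by
  constructor
  · rintro ⟨m, rfl⟩
    have h : D.Stair (D.dN c m) (c + 1) 0 (D.ε (c + 1) q) := h
    generalize hx : D.ε (c + 1) q = x at h
    cases h with
    | step w h =>
      obtain ⟨u, hu, hu'⟩ := h.exists_dv_of_boundary rfl
      obtain ⟨t, ht⟩ := (D.ε_exact _ (w - u)).1 (by rw [map_sub, hu', sub_self])
      refine ⟨t, D.ε_injective _ ?_⟩
      rw [hx, ← D.ε_comm, ht, map_sub, hu, sub_zero]
  · rintro ⟨r, rfl⟩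
    exact Stair.boundary_of_exists_dh h rfl (u := D.ε c r) ((D.ε_exact c _).2 ⟨r, rfl⟩)
      (D.ε_comm c r)

/-- Compatibility of the relation with maps between double complexes (not necessarily
linear, and possibly only relations between the terms `X`). -/
theorem Stair.map {D' : AugDouble A} (φN : D.N c → D'.N c)
    (φX : ∀ a b, D.X a b → D'.X a b)
    (hη : φX 0 c (D.η c n) = D'.η c (φN n))
    (hh : ∀ a b x, D'.dh a b (φX a b x) = φX (a + 1) b (D.dh a b x))
    (hv : ∀ a b x, D'.dv a b (φX a b x) = φX a (b + 1) (D.dv a b x)) {a b : ℕ} {x : D.X a b}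
    (h : D.Stair n a b x) : D'.Stair (φN n) a b (φX a b x) := by
  induction h with
  | base => rw [hη]; exact .base
  | step w h ih =>
    rw [← hv] at ih
    rw [← hh]
    exact .step _ ih

theorem Rel.map {D' : AugDouble A} (φN : D.N c → D'.N c) (φP : D.P c → D'.P c)
    (φX : ∀ a b, D.X a b → D'.X a b)
    (hη : φX 0 c (D.η c n) = D'.η c (φN n)) (hε : φX c 0 (D.ε c q) = D'.ε c (φP q))
    (hh : ∀ a b x, D'.dh a b (φX a b x) = φX (a + 1) b (D.dh a b x))
    (hv : ∀ a b x, D'.dv a b (φX a b x) = φX a (b + 1) (D.dv a b x))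
    (h : D.Rel n q) : D'.Rel (φN n) (φP q) := by
  rw [Rel, ← hε]
  exact Stair.map φN φX hη hh hv h

end AugDouble

end Staircase

/-! ### Cohomology classes and the cocycles that represent them -/

section HomologyClasses

section Modules

variable {A : Type} [CommRing A] (K : CochainComplex (ModuleCat.{0} A) ℕ)

/-- `h` is the cohomology class of the cocycle `z`. -/
def IsModClass (i : ℕ) (z : K.X i) (h : K.homology i) : Prop :=
  ∃ w : K.cycles i, (K.iCycles i).hom w = z ∧ (K.homologyπ i).hom w = h

variable {K}

theorem IsModClass.d_eq_zero {i : ℕ} {z : K.X i} {h : K.homology i} (H : IsModClass K i z h)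
    (j : ℕ) : (K.d i j).hom z = 0 := by
  obtain ⟨w, rfl, -⟩ := H
  exact LinearMap.congr_fun (ModuleCat.hom_ext_iff.1 (K.iCycles_d i j)) w

theorem exists_isModClass {i : ℕ} {z : K.X i} (hz : (K.d i (i + 1)).hom z = 0) :
    ∃ h, IsModClass K i z h := by
  have hex : (ShortComplex.mk (K.iCycles i) (K.d i (i + 1)) (K.iCycles_d i (i + 1))).Exact :=
    ShortComplex.exact_of_f_is_kernel _ (K.cyclesIsKernel i (i + 1) (by simp))
  obtain ⟨w, hw⟩ := (ShortComplex.moduleCat_exact_iff _).1 hex z hz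
  exact ⟨_, w, hw, rfl⟩

theorem exists_modRep {i : ℕ} (h : K.homology i) : ∃ z, IsModClass K i z h := by
  obtain ⟨w, rfl⟩ := (ModuleCat.epi_iff_surjective (K.homologyπ i)).1 inferInstance h
  exact ⟨_, w, rfl, rfl⟩

theorem IsModClass.add {i : ℕ} {z z' : K.X i} {h h' : K.homology i} (H : IsModClass K i z h)
    (H' : IsModClass K i z' h') : IsModClass K i (z + z') (h + h') := by
  obtain ⟨w, rfl, rfl⟩ := H
  obtain ⟨w', rfl, rfl⟩ := H'
  exact ⟨w + w', map_add _ _ _, map_add _ _ _⟩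

theorem IsModClass.smul {i : ℕ} {z : K.X i} {h : K.homology i} (a : A) (H : IsModClass K i z h) :
    IsModClass K i (a • z) (a • h) := by
  obtain ⟨w, rfl, rfl⟩ := H
  exact ⟨a • w, map_smul _ _ _, map_smul _ _ _⟩

/-- The predecessor of degree `0` in the complex shape is `0` itself, with zero differential;
writing `j` for the predecessor covers this case. -/
theorem IsModClass.eq_zero_iff {i j : ℕ} {z : K.X i} {h : K.homology i} (H : IsModClass K i z h)
    (hj : (ComplexShape.up ℕ).prev i = j) : h = 0 ↔ ∃ m, (K.d j i).hom m = z := by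
  obtain ⟨w, rfl, rfl⟩ := H
  have hinj := (ModuleCat.mono_iff_injective (K.iCycles i)).1 inferInstance
  have hex : (ShortComplex.mk (K.toCycles j i) (K.homologyπ i)
      (K.toCycles_comp_homologyπ j i)).Exact :=
    ShortComplex.exact_of_g_is_cokernel _ (K.homologyIsCokernel j i hj)
  have hi : ∀ m, (K.iCycles i).hom ((K.toCycles j i).hom m) = (K.d j i).hom m := fun m =>
    LinearMap.congr_fun (ModuleCat.hom_ext_iff.1 (K.toCycles_i j i)) m
  constructor
  · intro h
    obtain ⟨m, hm⟩ := (ShortComplex.moduleCat_exact_iff _).1 hex w h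
    exact ⟨m, (hi m).symm.trans (congrArg _ hm)⟩
  · rintro ⟨m, hm⟩
    rw [← hinj ((hi m).trans hm)]
    exact LinearMap.congr_fun (ModuleCat.hom_ext_iff.1 (K.toCycles_comp_homologyπ j i)) m

theorem IsModClass.map {K' : CochainComplex (ModuleCat.{0} A) ℕ} (φ : K ⟶ K') {i : ℕ} {z : K.X i}
    {h : K.homology i} (H : IsModClass K i z h) :
    IsModClass K' i ((φ.f i).hom z) ((HomologicalComplex.homologyMap φ i).hom h) := by
  obtain ⟨w, rfl, rfl⟩ := H
  refine ⟨(HomologicalComplex.cyclesMap φ i).hom w, ?_, ?_⟩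
  · exact LinearMap.congr_fun (ModuleCat.hom_ext_iff.1 (HomologicalComplex.cyclesMap_i φ i)) w
  · exact (LinearMap.congr_fun (ModuleCat.hom_ext_iff.1
      (HomologicalComplex.homologyπ_naturality φ i)) w).symm

end Modules

section Comodules

variable {p : ℕ} [hp : Fact p.Prime] (K : CochainComplex (Comod p) ℕ)

/-- `h` is the cohomology class of the cocycle `z`. -/
def IsComodClass (i : ℕ) (z : (K.X i).carrier) (h : (K.homology i).carrier) : Prop :=
  ∃ w : (K.cycles i).carrier, (K.iCycles i).toLin w = z ∧ (K.homologyπ i).toLin w = h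

theorem Comod.congr_toLin {M N : Comod p} {f g : M ⟶ N} (h : f = g) (x : M.carrier) :
    f.toLin x = g.toLin x := LinearMap.congr_fun (congrArg Comod.Hom.toLin h) x

variable {K}

theorem IsComodClass.d_eq_zero {i : ℕ} {z : (K.X i).carrier} {h : (K.homology i).carrier}
    (H : IsComodClass K i z h) (j : ℕ) : (K.d i j).toLin z = 0 := by
  obtain ⟨w, rfl, -⟩ := H
  exact Comod.congr_toLin (K.iCycles_d i j) w

theorem exists_isComodClass {i : ℕ} {z : (K.X i).carrier} (hz : (K.d i (i + 1)).toLin z = 0) :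
    ∃ h, IsComodClass K i z h := by
  have hex : (ShortComplex.mk (K.iCycles i) (K.d i (i + 1)) (K.iCycles_d i (i + 1))).Exact :=
    ShortComplex.exact_of_f_is_kernel _ (K.cyclesIsKernel i (i + 1) (by simp))
  obtain ⟨w, hw⟩ := (Comod.exact_iff _).1 hex z hz
  exact ⟨_, w, hw, rfl⟩

theorem exists_comodRep {i : ℕ} (h : (K.homology i).carrier) : ∃ z, IsComodClass K i z h := by
  obtain ⟨w, rfl⟩ := Comod.surjective_of_epi (K.homologyπ i) h
  exact ⟨_, w, rfl, rfl⟩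

theorem IsComodClass.add {i : ℕ} {z z' : (K.X i).carrier} {h h' : (K.homology i).carrier}
    (H : IsComodClass K i z h) (H' : IsComodClass K i z' h') :
    IsComodClass K i (z + z') (h + h') := by
  obtain ⟨w, rfl, rfl⟩ := H
  obtain ⟨w', rfl, rfl⟩ := H'
  exact ⟨w + w', map_add _ _ _, map_add _ _ _⟩

theorem IsComodClass.smul {i : ℕ} {z : (K.X i).carrier} {h : (K.homology i).carrier} (a : BP p)
    (H : IsComodClass K i z h) : IsComodClass K i (a • z) (a • h) := by
  obtain ⟨w, rfl, rfl⟩ := H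
  exact ⟨a • w, map_smul _ _ _, map_smul _ _ _⟩

theorem IsComodClass.eq_zero_iff {i j : ℕ} {z : (K.X i).carrier} {h : (K.homology i).carrier}
    (H : IsComodClass K i z h) (hj : (ComplexShape.up ℕ).prev i = j) :
    h = 0 ↔ ∃ m, (K.d j i).toLin m = z := by
  obtain ⟨w, rfl, rfl⟩ := H
  have hinj := Comod.injective_of_mono (K.iCycles i)
  have hex : (ShortComplex.mk (K.toCycles j i) (K.homologyπ i)
      (K.toCycles_comp_homologyπ j i)).Exact :=
    ShortComplex.exact_of_g_is_cokernel _ (K.homologyIsCokernel j i hj)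
  have hi : ∀ m, (K.iCycles i).toLin ((K.toCycles j i).toLin m) = (K.d j i).toLin m := fun m =>
    Comod.congr_toLin (K.toCycles_i j i) m
  constructor
  · intro h
    obtain ⟨m, hm⟩ := (Comod.exact_iff _).1 hex w h
    exact ⟨m, (hi m).symm.trans (congrArg _ hm)⟩
  · rintro ⟨m, hm⟩
    rw [← hinj ((hi m).trans hm)]
    exact Comod.congr_toLin (K.toCycles_comp_homologyπ j i) m

theorem IsComodClass.map {K' : CochainComplex (Comod p) ℕ} (φ : K ⟶ K') {i : ℕ}
    {z : (K.X i).carrier} {h : (K.homology i).carrier} (H : IsComodClass K i z h) :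
    IsComodClass K' i ((φ.f i).toLin z) ((HomologicalComplex.homologyMap φ i).toLin h) := by
  obtain ⟨w, rfl, rfl⟩ := H
  refine ⟨(HomologicalComplex.cyclesMap φ i).toLin w, ?_, ?_⟩
  · exact Comod.congr_toLin (HomologicalComplex.cyclesMap_i φ i) w
  · exact (Comod.congr_toLin (HomologicalComplex.homologyπ_naturality φ i) w).symm

/-- A homogeneous class has a homogeneous representative. -/
theorem exists_comodRep_mem {i : ℕ} {d : ℤ} {h : (K.homology i).carrier}
    (hh : h ∈ (K.homology i).deg d) : ∃ z ∈ (K.X i).deg d, IsComodClass K i z h := by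
  obtain ⟨w, rfl⟩ := Comod.surjective_of_epi (K.homologyπ i) h
  refine ⟨_, (K.iCycles i).map_deg (gproj_mem (K.cycles i).isInternal d w), _, rfl, ?_⟩
  rw [Comod.hom_gproj, gproj_of_mem _ hh, if_pos rfl]

theorem IsComodClass.mem_deg {i : ℕ} {d : ℤ} {z : (K.X i).carrier} {h : (K.homology i).carrier}
    (H : IsComodClass K i z h) (hz : z ∈ (K.X i).deg d) : h ∈ (K.homology i).deg d := by
  obtain ⟨w, rfl, rfl⟩ := H
  have h1 : gproj (K.cycles i).isInternal d w = w := Comod.injective_of_mono (K.iCycles i) (by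
    rw [Comod.hom_gproj, gproj_of_mem _ hz, if_pos rfl])
  rw [← h1]
  exact (K.homologyπ i).map_deg (gproj_mem _ _ _)

end Comodules

end HomologyClasses

/-- A linear equivalence from a linear relation. -/
theorem exists_linearEquiv_of_rel {A H H' : Type} [CommRing A] [AddCommGroup H] [Module A H]
    [AddCommGroup H'] [Module A H'] (T : H → H' → Prop)
    (hadd : ∀ x y x' y', T x x' → T y y' → T (x + y) (x' + y'))
    (hsmul : ∀ (a : A) x x', T x x' → T (a • x) (a • x')) (hl : ∀ x, ∃ x', T x x')
    (hr : ∀ x', ∃ x, T x x') (h0 : ∀ x x', T x x' → (x = 0 ↔ x' = 0)) :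
    ∃ e : H ≃ₗ[A] H', ∀ x x', T x x' ↔ e x = x' := by
  have hsub : ∀ x y x' y', T x x' → T y y' → T (x - y) (x' - y') := fun x y x' y' hx hy => by
    have := hadd _ _ _ _ hx (hsmul (-1) _ _ hy)
    rwa [neg_one_smul, neg_one_smul, ← sub_eq_add_neg, ← sub_eq_add_neg] at this
  have hu : ∀ x x' y', T x x' → T x y' → x' = y' := fun x x' y' hx hy =>
    sub_eq_zero.1 ((h0 _ _ (hsub _ _ _ _ hx hy)).1 (sub_self x))
  choose f hf using hl
  let F : H →ₗ[A] H' :=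
    { toFun := f
      map_add' := fun x y => hu _ _ _ (hf _) (hadd _ _ _ _ (hf x) (hf y))
      map_smul' := fun a x => hu _ _ _ (hf _) (hsmul _ _ _ (hf x)) }
  refine ⟨LinearEquiv.ofBijective F ⟨(injective_iff_map_eq_zero _).2 fun x hx =>
    (h0 _ _ (hf x)).2 hx, fun x' => ?_⟩, fun x x' => ⟨fun h => hu _ _ _ (hf x) h, fun h => ?_⟩⟩
  · obtain ⟨x, hx⟩ := hr x'
    exact ⟨x, hu _ _ _ (hf x) hx⟩
  · rw [← h]
    exact hf x

/-! ### Homogeneous components of Čech cochains -/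

section CechGradingProjection

variable {p : ℕ} [hp : Fact p.Prime]

theorem BPdeg_pow {s : BP p} {e : ℤ} (h : s ∈ BPdeg p e) (N : ℕ) : s ^ N ∈ BPdeg p (N * e) := by
  induction N with
  | zero => simpa using BPdeg_one p
  | succ N ih =>
    rw [pow_succ]
    have := BPdeg_mul p ih h
    rwa [show (N : ℤ) * e + e = ((N + 1 : ℕ) : ℤ) * e by push_cast; ring] at this

/-- `z'` is the component of degree `d` of `z` in `M[1/s]`. -/
def IsAwayProj (M : Comod p) {s : BP p} (d : ℤ) (z z' : Localization.Away s ⊗[BP p] M.carrier) :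
    Prop :=
  ∃ (N : ℕ) (e : ℤ) (m : M.carrier), s ^ N ∈ BPdeg p e ∧ s ^ N • z = 1 ⊗ₜ m ∧
    s ^ N • z' = 1 ⊗ₜ gproj M.isInternal (d + e) m

section Away

variable {M : Comod p} {s : BP p} {d : ℤ} {z z' w w' : Localization.Away s ⊗[BP p] M.carrier}

theorem exists_isAwayProj {e : ℤ} (hs : s ∈ BPdeg p e) (d : ℤ)
    (z : Localization.Away s ⊗[BP p] M.carrier) : ∃ z', IsAwayProj M d z z' := by
  obtain ⟨N, m, hm⟩ := exists_pow_smul_away s z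
  obtain ⟨z', hz'⟩ := exists_pow_smul_eq_away s N
    (1 ⊗ₜ gproj M.isInternal (d + N * e) m : Localization.Away s ⊗[BP p] M.carrier)
  exact ⟨z', N, N * e, m, BPdeg_pow hs N, hm, hz'⟩

theorem IsAwayProj.exists_common (H : IsAwayProj M d z z') (H' : IsAwayProj M d w w') :
    ∃ (N : ℕ) (e : ℤ) (m m' : M.carrier), s ^ N ∈ BPdeg p e ∧ s ^ N • z = 1 ⊗ₜ m ∧
      s ^ N • z' = 1 ⊗ₜ gproj M.isInternal (d + e) m ∧ s ^ N • w = 1 ⊗ₜ m' ∧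
      s ^ N • w' = 1 ⊗ₜ gproj M.isInternal (d + e) m' := by
  obtain ⟨N, e, m, he, h1, h2⟩ := H
  obtain ⟨N', e', m', he', h1', h2'⟩ := H'
  have hsum : s ^ (N' + N) ∈ BPdeg p (e' + e) := by rw [pow_add]; exact BPdeg_mul p he' he
  refine ⟨N' + N, e' + e, s ^ N' • m, s ^ N • m', hsum, ?_, ?_, ?_, ?_⟩
  · rw [pow_add, mul_smul, h1, tmul_smul]
  · rw [pow_add, mul_smul, h2, M.gproj_smul he', tmul_smul]
    congr 4
    ring
  · rw [pow_add, mul_comm, mul_smul, h1', tmul_smul]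
  · rw [pow_add, mul_comm, mul_smul, h2', M.gproj_smul he, tmul_smul]
    congr 4
    ring

/-- Two descriptions of `z` with a common denominator have numerators that agree after
multiplication by a power of `s`. As `s` is homogeneous, so do the homogeneous components of the
numerators. -/
theorem IsAwayProj.unique {e : ℤ} (hs : s ∈ BPdeg p e) (H : IsAwayProj M d z z')
    (H' : IsAwayProj M d z w') : z' = w' := by
  obtain ⟨N, f, m, m', hf, h1, h2, h3, h4⟩ := H.exists_common H'
  have h5 : (1 : Localization.Away s) ⊗ₜ[BP p] (m - m') = 0 := by
    rw [tmul_sub, ← h1, ← h3, sub_self]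
  obtain ⟨K, hK⟩ := (one_tmul_away_eq_zero _ _).1 h5
  have h6 := congrArg (gproj M.isInternal (d + f + K * e)) hK
  rw [M.gproj_smul (BPdeg_pow hs K), map_zero, add_sub_cancel_right, map_sub] at h6
  refine pow_smul_away_injective s N ?_
  rw [h2, h4, ← sub_eq_zero, ← tmul_sub]
  exact (one_tmul_away_eq_zero _ _).2 ⟨K, h6⟩

theorem IsAwayProj.add (H : IsAwayProj M d z z') (H' : IsAwayProj M d w w') :
    IsAwayProj M d (z + w) (z' + w') := by
  obtain ⟨N, f, m, m', hf, h1, h2, h3, h4⟩ := H.exists_common H'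
  exact ⟨N, f, m + m', hf, by rw [smul_add, h1, h3, tmul_add],
    by rw [smul_add, h2, h4, map_add, tmul_add]⟩

theorem IsAwayProj.smul {a : BP p} (ha : a ∈ BPdeg p 0) (H : IsAwayProj M d z z') :
    IsAwayProj M d (a • z) (a • z') := by
  obtain ⟨N, f, m, hf, h1, h2⟩ := H
  refine ⟨N, f, a • m, hf, by rw [smul_comm, h1, tmul_smul], ?_⟩
  rw [smul_comm, h2, M.gproj_smul ha, tmul_smul, sub_zero]

theorem isAwayProj_zero : IsAwayProj M d (0 : Localization.Away s ⊗[BP p] M.carrier) 0 :=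
  ⟨0, 0, 0, by rw [pow_zero]; exact BPdeg_one p, by rw [smul_zero, tmul_zero],
    by rw [smul_zero, map_zero, tmul_zero]⟩

theorem IsAwayProj.sum {ι : Type*} (t : Finset ι)
    {f g : ι → Localization.Away s ⊗[BP p] M.carrier} (H : ∀ i ∈ t, IsAwayProj M d (f i) (g i)) :
    IsAwayProj M d (∑ i ∈ t, f i) (∑ i ∈ t, g i) := by
  classical
  induction t using Finset.induction_on with
  | empty => exact isAwayProj_zero
  | insert i t hi ih =>
    rw [Finset.sum_insert hi, Finset.sum_insert hi]
    exact (H i (Finset.mem_insert_self i t)).add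
      (ih fun j hj => H j (Finset.mem_insert_of_mem hj))

theorem isAwayProj_one (x : M.carrier) :
    IsAwayProj M d ((1 : Localization.Away s) ⊗ₜ[BP p] x) (1 ⊗ₜ gproj M.isInternal d x) :=
  ⟨0, 0, x, by rw [pow_zero]; exact BPdeg_one p, by rw [pow_zero, one_smul],
    by rw [pow_zero, one_smul, add_zero]⟩

theorem IsAwayProj.awayTensor {b c : BP p} (h : s ∣ b) (hb : b = s * c) {e : ℤ}
    (hc : c ∈ BPdeg p e) (H : IsAwayProj M d z z') :
    IsAwayProj M d (awayTensor M.carrier h z) (awayTensor M.carrier h z') := by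
  obtain ⟨N, f, m, hf, h1, h2⟩ := H
  subst hb
  refine ⟨N, N * e + f, c ^ N • m, ?_, ?_, ?_⟩
  · rw [mul_pow, mul_comm (s ^ N)]; exact BPdeg_mul p (BPdeg_pow hc N) hf
  · rw [mul_pow, mul_comm (s ^ N), mul_smul, ← map_smul, h1, awayTensor_one_tmul, tmul_smul]
  · rw [mul_pow, mul_comm (s ^ N), mul_smul, ← map_smul, h2, awayTensor_one_tmul,
      M.gproj_smul (BPdeg_pow hc N), tmul_smul]
    congr 4
    ring

theorem IsAwayProj.map {M' : Comod p} (f : M ⟶ M') (H : IsAwayProj M d z z') :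
    IsAwayProj M' d (f.toLin.lTensor _ z) (f.toLin.lTensor _ z') := by
  obtain ⟨N, e, m, he, h1, h2⟩ := H
  refine ⟨N, e, f.toLin m, he, ?_, ?_⟩
  · rw [← map_smul, h1, LinearMap.lTensor_tmul]
  · rw [← map_smul, h2, LinearMap.lTensor_tmul, Comod.hom_gproj]

end Away

variable {n : ℕ}

theorem cechElt_gens_mem {k : ℕ} (σ : Fin (k + 1) ↪o Fin (n + 1)) :
    ∃ e, cechElt (gens p n) σ ∈ BPdeg p e := by
  choose e he using vGen_mem p
  have : ∀ t : Finset (Fin (k + 1)), ∏ i ∈ t, gens p n (σ i) ∈ BPdeg p (∑ i ∈ t, e (σ i)) :=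
    fun t => by
      classical
      induction t using Finset.induction_on with
      | empty => exact BPdeg_one p
      | insert i t hi ih =>
        rw [Finset.prod_insert hi, Finset.sum_insert hi]
        exact BPdeg_mul p (he _) ih
  exact ⟨_, this Finset.univ⟩

/-- `z'` is the component of degree `d` of the cochain `z`. -/
def IsCechProj (M : Comod p) {k : ℕ} (d : ℤ) (z z' : CechMod (gens p n) M.carrier k) : Prop :=
  ∀ σ, IsAwayProj M d (cechProj (gens p n) M.carrier σ z) (cechProj (gens p n) M.carrier σ z')

theorem IsCechProj.unique {M : Comod p} {k : ℕ} {d : ℤ} {z z' w' : CechMod (gens p n) M.carrier k}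
    (H : IsCechProj M d z z') (H' : IsCechProj M d z w') : z' = w' := cechMod_ext _ fun σ => by
  obtain ⟨e, he⟩ := cechElt_gens_mem (p := p) σ
  exact (H σ).unique he (H' σ)

theorem exists_isCechProj (M : Comod p) {k : ℕ} (d : ℤ) (z : CechMod (gens p n) M.carrier k) :
    ∃ z', IsCechProj M d z z' := by
  have : ∀ σ, ∃ w, IsAwayProj M d (cechProj (gens p n) M.carrier σ z) w := fun σ => by
    obtain ⟨e, he⟩ := cechElt_gens_mem (p := p) σ
    exact exists_isAwayProj he d _
  choose f hf using this
  obtain ⟨y, hy⟩ := exists_cechProj_eq (gens p n) f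
  exact ⟨y, fun σ => by rw [hy]; exact hf σ⟩

/-- The component of degree `d` of a cochain. -/
def cechGproj (M : Comod p) {k : ℕ} (d : ℤ) (z : CechMod (gens p n) M.carrier k) :
    CechMod (gens p n) M.carrier k := (exists_isCechProj M d z).choose

theorem isCechProj_cechGproj (M : Comod p) {k : ℕ} (d : ℤ) (z : CechMod (gens p n) M.carrier k) :
    IsCechProj M d z (cechGproj M d z) := (exists_isCechProj M d z).choose_spec

theorem cechGproj_cechModD (M : Comod p) {k : ℕ} (d : ℤ) (z : CechMod (gens p n) M.carrier k) :
    cechModD (gens p n) M.carrier k (cechGproj M d z) =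
      cechGproj M d (cechModD (gens p n) M.carrier k z) := by
  refine IsCechProj.unique (fun σ => ?_) (isCechProj_cechGproj M d _)
  rw [cechProj_cechModD, cechProj_cechModD]
  refine IsAwayProj.sum _ fun i _ => IsAwayProj.smul ?_ ?_
  · have h1 : (-1 : BP p) ∈ BPdeg p 0 := neg_mem (BPdeg_one p)
    have := BPdeg_pow h1 (i : ℕ)
    rwa [mul_zero] at this
  · obtain ⟨e, he⟩ := vGen_mem p (σ i)
    exact (isCechProj_cechGproj M d z _).awayTensor _ (cechElt_eq_face_mul _ i σ) he

theorem cechGproj_cechMap {M M' : Comod p} (f : M ⟶ M') {k : ℕ} (d : ℤ)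
    (z : CechMod (gens p n) M.carrier k) :
    cechMap (gens p n) k f.toLin (cechGproj M d z) =
      cechGproj M' d (cechMap (gens p n) k f.toLin z) := by
  refine IsCechProj.unique (fun σ => ?_) (isCechProj_cechGproj M' d _)
  rw [cechProj_cechMap, cechProj_cechMap]
  exact (isCechProj_cechGproj M d z σ).map f

theorem cechGproj_cechAug (M : Comod p) (d : ℤ) (x : M.carrier) :
    cechAug (gens p n) M.carrier (gproj M.isInternal d x) =
      cechGproj M d (cechAug (gens p n) M.carrier x) := by
  refine IsCechProj.unique (fun σ => ?_) (isCechProj_cechGproj M d _)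
  exact isAwayProj_one x

theorem cechGproj_of_mem {M : Comod p} {k : ℕ} {d : ℤ} {z : CechMod (gens p n) M.carrier k}
    (hz : z ∈ cechCochainDeg n M k d) : cechGproj M d z = z := by
  refine IsCechProj.unique (isCechProj_cechGproj M d _) ?_
  induction hz using AddSubgroup.closure_induction with
  | mem z hz =>
    obtain ⟨i, j, x, m, rfl, hx, hm, rfl⟩ := hz
    intro σ
    obtain ⟨N, e, a, he, ha, hxa⟩ := hx σ
    have h1 : (cechElt (gens p n) σ) ^ N • cechProj (gens p n) M.carrier σ (x ⊗ₜ m) =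
        1 ⊗ₜ (a • m) := by
      rw [cechProj_tmul, smul_tmul', hxa, Algebra.algebraMap_eq_smul_one, smul_tmul]
    refine ⟨N, e, a • m, he, h1, h1.trans ?_⟩
    rw [gproj_of_mem _ (M.smul_mem ha hm), if_pos (by ring)]
  | zero => intro σ; rw [map_zero]; exact isAwayProj_zero
  | add z w _ _ hz hw => intro σ; rw [map_add]; exact (hz σ).add (hw σ)
  | neg z _ hz =>
    intro σ
    have := (hz σ).smul (neg_mem (BPdeg_one p))
    have h1 : cechProj (gens p n) M.carrier σ (-z) =
        (-1 : BP p) • cechProj (gens p n) M.carrier σ z :=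
      (map_neg _ _).trans (neg_one_smul (BP p)
        (_ : Localization.Away (cechElt (gens p n) σ) ⊗[BP p] M.carrier)).symm
    rwa [h1]

theorem cechSingle_tmul_mem {M : Comod p} {k : ℕ} {i j : ℤ} (σ : Fin (k + 1) ↪o Fin (n + 1))
    {u : Localization.Away (cechElt (gens p n) σ)} (hu : IsAwayHomogeneous i u) {m : M.carrier}
    (hm : m ∈ M.deg j) : cechSingle (gens p n) M.carrier σ (u ⊗ₜ m) ∈
      cechCochainDeg n M k (i + j) := by
  classical
  refine AddSubgroup.subset_closure ⟨i, j, Pi.single σ u, m, rfl, fun τ => ?_, hm, ?_⟩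
  · by_cases h : τ = σ
    · subst h; rwa [Pi.single_eq_same]
    · rw [Pi.single_eq_of_ne h]
      exact ⟨0, 0, 0, by rw [pow_zero]; exact BPdeg_one p, zero_mem _,
        by rw [smul_zero, map_zero]⟩
  · rw [cechSingle, LinearMap.rTensor_tmul]
    congr 1

/-- Each component is `s ^ (-N) ⊗ m` with `m` homogeneous of degree `d + e`, where `s ^ (-N)` is
homogeneous of degree `-e`. Together with `cechGproj_of_mem` this identifies the fixed cochains of
the projection with those of degree `d`. -/
theorem cechGproj_mem (M : Comod p) {k : ℕ} (d : ℤ) (z : CechMod (gens p n) M.carrier k) :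
    cechGproj M d z ∈ cechCochainDeg n M k d := by
  rw [← sum_cechSingle_cechProj (gens p n) (cechGproj M d z)]
  refine sum_mem fun σ _ => ?_
  obtain ⟨N, e, m, he, -, h⟩ := isCechProj_cechGproj M d z σ
  obtain ⟨u, hu⟩ := (IsLocalization.Away.algebraMap_isUnit
    (S := Localization.Away (cechElt (gens p n) σ)) (cechElt (gens p n) σ)).pow N
  have h1 : cechElt (gens p n) σ ^ N • (↑u⁻¹ : Localization.Away (cechElt (gens p n) σ)) = 1 := by
    rw [Algebra.smul_def, map_pow, ← hu, Units.mul_inv]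
  have h2 : cechProj (gens p n) M.carrier σ (cechGproj M d z) =
      (↑u⁻¹ : Localization.Away (cechElt (gens p n) σ)) ⊗ₜ gproj M.isInternal (d + e) m :=
    pow_smul_away_injective _ N (by rw [h, smul_tmul', h1])
  have h3 := cechSingle_tmul_mem σ (i := -e) (u := ↑u⁻¹) ⟨N, e, 1, he, ?_, ?_⟩
    (gproj_mem M.isInternal (d + e) m)
  · rw [h2]
    rwa [show -e + (d + e) = d by ring] at h3
  · rw [neg_add_cancel]; exact BPdeg_one p
  · rw [h1, map_one]

end CechGradingProjection

/-! ### The double complex between a localized resolution and Čech cochains -/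

section DerivedCech

variable {p : ℕ} [hp : Fact p.Prime] {n : ℕ}

/-- A resolution of `M` by comodules whose localizations have an exact augmented Čech complex. -/
structure LocalResolution (L : TorsionLocalization p n) (M : Comod p) where
  C : CochainComplex (Comod p) ℕ
  ι : M ⟶ C.X 0
  ι_injective : Function.Injective ι.toLin
  ι_exact : ∀ x, (C.d 0 1).toLin x = 0 ↔ ∃ y, ι.toLin y = x
  d_exact : ∀ b x, (C.d (b + 1) (b + 2)).toLin x = 0 → ∃ y, (C.d b (b + 1)).toLin y = x
  cechExact : ∀ b, CechExact (gens p n) (L.functor.obj (C.X b)).carrier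

namespace LocalResolution

variable {L : TorsionLocalization p n} {M : Comod p} (R : LocalResolution L M)

/-- The localized resolution. -/
abbrev LC : CochainComplex (Comod p) ℕ := (L.functor.mapHomologicalComplex _).obj R.C

theorem cechMap_square {N N₁ N₂ N' : Comod p} {f : N ⟶ N₁} {g : N₁ ⟶ N'} {f' : N ⟶ N₂}
    {g' : N₂ ⟶ N'} (h : f ≫ g = f' ≫ g') (k : ℕ) (z : CechMod (gens p n) N.carrier k) :
    cechMap (gens p n) k g.toLin (cechMap (gens p n) k f.toLin z) =
      cechMap (gens p n) k g'.toLin (cechMap (gens p n) k f'.toLin z) := by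
  have h1 : g.toLin ∘ₗ f.toLin = g'.toLin ∘ₗ f'.toLin := congrArg Comod.Hom.toLin h
  rw [cechMap_comp, cechMap_comp, h1]

theorem cechMap_map {N N' : Comod p} (f : N ⟶ N') (k : ℕ)
    (z : CechMod (gens p n) N.carrier k) :
    cechMap (gens p n) k (L.functor.map f).toLin (cechMap (gens p n) k (L.unit.app N).toLin z) =
      cechMap (gens p n) k (L.unit.app N').toLin (cechMap (gens p n) k f.toLin z) :=
  cechMap_square (L.unit.naturality f).symm k z

/-- Čech cochains do not see the localization, so the localized sequence may be replaced by the
original one, on which flatness of the localized rings gives exactness. -/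
theorem cechMap_map_exact {N N' N'' : Comod p} (f : N ⟶ N') (g : N' ⟶ N'')
    (h : Function.Exact f.toLin g.toLin) (k : ℕ) :
    Function.Exact (cechMap (gens p n) k (L.functor.map f).toLin)
      (cechMap (gens p n) k (L.functor.map g).toLin) := fun z => by
  have hb := fun N => L.cechMap_unit_bijective N k
  obtain ⟨w, rfl⟩ := (hb N').2 z
  rw [cechMap_map, map_eq_zero_iff _ (hb N'').1, cechMap_exact _ k h w]
  constructor
  · rintro ⟨y, rfl⟩
    exact ⟨_, cechMap_map f k y⟩
  · rintro ⟨y, hy⟩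
    obtain ⟨y, rfl⟩ := (hb N).2 y
    rw [cechMap_map] at hy
    exact ⟨y, (hb N').1 hy⟩

/-- The double complex that compares the cohomology of the localized resolution with
Čech cohomology. -/
def double : AugDouble (BP p) where
  X a b := CechMod (gens p n) (L.functor.obj (R.C.X b)).carrier a
  N b := (L.functor.obj (R.C.X b)).carrier
  P a := CechMod (gens p n) M.carrier a
  dh a b := cechModD (gens p n) _ a
  dv a b := cechMap (gens p n) a (L.functor.map (R.C.d b (b + 1))).toLin
  dN b := (L.functor.map (R.C.d b (b + 1))).toLin
  dP a := cechModD (gens p n) _ a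
  η b := cechAug (gens p n) _
  ε a := cechMap (gens p n) a (L.unit.app (R.C.X 0)).toLin ∘ₗ cechMap (gens p n) a R.ι.toLin
  comm a b x := (cechModD_cechMap _ _ _).symm
  η_comm b x := rfl
  ε_comm a x := by
    rw [LinearMap.comp_apply, LinearMap.comp_apply, cechModD_cechMap, cechModD_cechMap]
  η_injective b := (R.cechExact b).injective
  η_exact b := (R.cechExact b).exact_zero
  dh_exact a b := (R.cechExact b).exact_succ a
  ε_injective a := (L.cechMap_unit_bijective _ a).1.comp (cechMap_injective _ a R.ι_injective)
  ε_exact a z := by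
    have hb := fun N => L.cechMap_unit_bijective N a
    obtain ⟨w, rfl⟩ := (hb _).2 z
    have hex : Function.Exact R.ι.toLin (R.C.d 0 1).toLin := fun x => R.ι_exact x
    rw [cechMap_map, map_eq_zero_iff _ (hb _).1, cechMap_exact _ a hex w]
    exact exists_congr fun y => ⟨fun h => congrArg _ h, fun h => (hb _).1 h⟩
  dv_exact a b := cechMap_map_exact _ _ (fun x => ⟨R.d_exact b x, by
    rintro ⟨y, rfl⟩
    exact Comod.congr_toLin (R.C.d_comp_d b (b + 1) (b + 2)) y⟩) a

/-- The relation between the cohomology of the localized resolution and Čech cohomology. -/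
def ClassRel (i : ℕ) (h : (R.LC.homology i).carrier) (h' : (cechI p n i).obj M) : Prop :=
  ∃ (z : (R.LC.X i).carrier) (q : CechMod (gens p n) M.carrier i),
    IsComodClass R.LC i z h ∧ R.double.Rel (c := i) z q ∧
      IsModClass ((cechComplex (gens p n)).obj ((forgetMod p).obj M)) i q h'

theorem cechComplex_d (M : Comod p) (i : ℕ) :
    (((cechComplex (gens p n)).obj ((forgetMod p).obj M)).d i (i + 1)).hom =
      cechModD (gens p n) M.carrier i := by
  have : ((cechComplex (gens p n)).obj ((forgetMod p).obj M)).d i (i + 1) =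
      ModuleCat.ofHom (cechModD (gens p n) M.carrier i) := CochainComplex.of_d
        (fun k => ModuleCat.of (BP p) (CechCochain (gens p n) k ⊗[BP p] M.carrier))
        (fun k => ModuleCat.ofHom ((cechD (gens p n) k).rTensor M.carrier)) i
  rw [this]
  rfl

theorem ClassRel.eq_zero_iff {i : ℕ} {h : (R.LC.homology i).carrier} {h' : (cechI p n i).obj M}
    (H : R.ClassRel i h h') : h = 0 ↔ h' = 0 := by
  obtain ⟨z, q, H1, H2, H3⟩ := H
  cases i with
  -- In degree zero there are no boundaries on either side, and the relation is an equality in the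
  -- corner of the double complex.
  | zero =>
    have h1 := H1.eq_zero_iff CochainComplex.prev_nat_zero
    have h2 := H3.eq_zero_iff CochainComplex.prev_nat_zero
    have h3 := H2.zero_iff
    have e1 : R.LC.d 0 0 = 0 := R.LC.shape 0 0 (by simp)
    have e2 : ((cechComplex (gens p n)).obj ((forgetMod p).obj M)).d 0 0 = 0 :=
      HomologicalComplex.shape _ 0 0 (by simp)
    refine h1.trans (Iff.trans ?_ (h3.trans (Iff.trans ?_ h2.symm)))
    · rw [e1]
      exact ⟨fun ⟨_, h⟩ => h.symm, fun h => ⟨0, h.symm⟩⟩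
    · rw [e2]
      exact ⟨fun h => ⟨0, h.symm⟩, fun ⟨_, h⟩ => h.symm⟩
  | succ i =>
    refine (H1.eq_zero_iff (CochainComplex.prev_nat_succ i)).trans (Iff.trans H2.boundary_iff
      (Iff.trans ?_ (H3.eq_zero_iff (CochainComplex.prev_nat_succ i)).symm))
    rw [cechComplex_d]
    rfl

theorem exists_classRel_left {i : ℕ} (h : (R.LC.homology i).carrier) :
    ∃ h', R.ClassRel i h h' := by
  obtain ⟨z, hz⟩ := exists_comodRep h
  obtain ⟨q, hq⟩ := AugDouble.exists_rel (D := R.double) (c := i) z (hz.d_eq_zero (i + 1))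
  obtain ⟨h', hh'⟩ := exists_isModClass
    (K := (cechComplex (gens p n)).obj ((forgetMod p).obj M)) (i := i) (z := q) (by
      rw [cechComplex_d]; exact hq.dP_eq_zero)
  exact ⟨h', z, q, hz, hq, hh'⟩

theorem exists_classRel_right {i : ℕ} (h' : (cechI p n i).obj M) : ∃ h, R.ClassRel i h h' := by
  obtain ⟨q, hq⟩ := exists_modRep (K := (cechComplex (gens p n)).obj ((forgetMod p).obj M)) h'
  have hd := hq.d_eq_zero (i + 1)
  rw [cechComplex_d] at hd
  obtain ⟨z, hz, hzq⟩ := AugDouble.exists_rel_from (D := R.double) (c := i) q hd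
  obtain ⟨h, hh⟩ := exists_isComodClass (K := R.LC) (i := i) (z := z) hz
  exact ⟨h, z, q, hh, hzq, hq⟩

/-- The staircase relation on classes is linear and total on both sides, and it matches zero with
zero, so it is the graph of an isomorphism. -/
theorem exists_equiv (i : ℕ) : ∃ e : (R.LC.homology i).carrier ≃ₗ[BP p] (cechI p n i).obj M,
    ∀ h h', R.ClassRel i h h' ↔ e h = h' := by
  refine exists_linearEquiv_of_rel (R.ClassRel i) ?_ ?_ (exists_classRel_left R)
    (exists_classRel_right R) fun _ _ => ClassRel.eq_zero_iff R
  · rintro x y x' y' ⟨z, q, h1, h2, h3⟩ ⟨z', q', h1', h2', h3'⟩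
    exact ⟨_, _, h1.add h1', h2.add h2', h3.add h3'⟩
  · rintro a x x' ⟨z, q, h1, h2, h3⟩
    exact ⟨_, _, h1.smul a, h2.smul a, h3.smul a⟩

variable {M' : Comod p} (R' : LocalResolution L M')

/-- A map of resolutions over `f` induces a map of double complexes, which carries staircases to
staircases. -/
theorem ClassRel.map (f : M ⟶ M') (φ : R.C ⟶ R'.C) (hφ : R.ι ≫ φ.f 0 = f ≫ R'.ι) {i : ℕ}
    {h : (R.LC.homology i).carrier} {h' : (cechI p n i).obj M} (H : R.ClassRel i h h') :
    R'.ClassRel i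
      ((HomologicalComplex.homologyMap ((L.functor.mapHomologicalComplex _).map φ) i).toLin h)
      (((cechI p n i).map f).hom h') := by
  obtain ⟨z, q, h1, h2, h3⟩ := H
  have hcomm : ∀ b, L.functor.map (φ.f b) ≫ L.functor.map (R'.C.d b (b + 1)) =
      L.functor.map (R.C.d b (b + 1)) ≫ L.functor.map (φ.f (b + 1)) := fun b => by
    rw [← L.functor.map_comp, φ.comm, L.functor.map_comp]
  refine ⟨_, cechMap (gens p n) i f.toLin q, h1.map ((L.functor.mapHomologicalComplex _).map φ), ?_,
    h3.map ((cechComplex (gens p n)).map ((forgetMod p).map f))⟩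
  refine AugDouble.Rel.map (D := R.double) (D' := R'.double) (c := i)
    (L.functor.map (φ.f i)).toLin (cechMap (gens p n) i f.toLin)
    (fun a b => cechMap (gens p n) a (L.functor.map (φ.f b)).toLin) rfl ?_
    (fun a b x => cechModD_cechMap _ _ _) (fun a b x => ?_) h2
  · exact (cechMap_map (φ.f 0) i _).trans (congrArg _ (cechMap_square hφ i q))
  · exact cechMap_square (hcomm b) a x

/-- The projection to degree `d` is not `BP_*`-linear, but it commutes with all maps of the double
complex, and staircases require no more. -/
theorem rel_gproj {i : ℕ} {z : (R.LC.X i).carrier} {q : CechMod (gens p n) M.carrier i}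
    (d : ℤ) (H : R.double.Rel (c := i) z q) :
    R.double.Rel (c := i) (gproj (R.LC.X i).isInternal d z) (cechGproj M d q) := by
  refine AugDouble.Rel.map (D := R.double) (D' := R.double) (c := i)
    (gproj (R.LC.X i).isInternal d) (cechGproj M d)
    (fun a b => cechGproj (L.functor.obj (R.C.X b)) d) ?_ ?_ (fun a b x => ?_) (fun a b x => ?_) H
  · exact (cechGproj_cechAug _ d z).symm
  · change cechGproj (L.functor.obj (R.C.X 0)) d (cechMap (gens p n) i
      (L.unit.app (R.C.X 0)).toLin (cechMap (gens p n) i R.ι.toLin q)) =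
      cechMap (gens p n) i (L.unit.app (R.C.X 0)).toLin (cechMap (gens p n) i R.ι.toLin
        (cechGproj M d q))
    rw [cechGproj_cechMap, ← cechGproj_cechMap (L.unit.app (R.C.X 0))]
    rfl
  · exact cechGproj_cechModD _ d x
  · exact cechGproj_cechMap _ d x

/-- A homogeneous representative on either side can be joined to a homogeneous one on the other side
by projecting a staircase to its degree; uniqueness in `exists_equiv` then identifies the classes.
-/
theorem ClassRel.mem_deg_iff {i : ℕ} {h : (R.LC.homology i).carrier} {h' : (cechI p n i).obj M}
    (H : R.ClassRel i h h') (d : ℤ) : h ∈ (R.LC.homology i).deg d ↔ h' ∈ cechDeg n M i d := by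
  obtain ⟨e, he⟩ := R.exists_equiv i
  constructor
  · intro hd
    obtain ⟨z, hz, H1⟩ := exists_comodRep_mem hd
    obtain ⟨q, hq⟩ := AugDouble.exists_rel (D := R.double) (c := i) z (H1.d_eq_zero (i + 1))
    have hq' := R.rel_gproj d hq
    rw [gproj_of_mem _ hz, if_pos rfl] at hq'
    obtain ⟨h'', w, hw, hh''⟩ := exists_isModClass
      (K := (cechComplex (gens p n)).obj ((forgetMod p).obj M)) (i := i) (z := cechGproj M d q) (by
        rw [cechComplex_d]; exact hq'.dP_eq_zero)
    have h1 := (he _ _).1 ⟨z, _, H1, hq', w, hw, hh''⟩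
    rw [← (he _ _).1 H, h1]
    refine ⟨w, ?_, hh''⟩
    rw [hw]
    exact cechGproj_mem M d q
  · rintro ⟨w, hw, hw'⟩
    have H3 : IsModClass ((cechComplex (gens p n)).obj ((forgetMod p).obj M)) i _ h' := ⟨w, rfl, hw'⟩
    have hd := H3.d_eq_zero (i + 1)
    rw [cechComplex_d] at hd
    obtain ⟨z, hz, hzq⟩ := AugDouble.exists_rel_from (D := R.double) (c := i) _ hd
    have hzq' := R.rel_gproj d hzq
    rw [cechGproj_of_mem hw] at hzq'
    have hz' : (R.LC.d i (i + 1)).toLin (gproj (R.LC.X i).isInternal d z) = 0 :=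
      (Comod.hom_gproj (R.LC.d i (i + 1)) d z).trans ((congrArg _ hz).trans (map_zero _))
    obtain ⟨h₁, hh₁⟩ := exists_isComodClass hz'
    have h2 := (he _ _).1 ⟨_, _, hh₁, hzq', H3⟩
    rw [e.injective (((he _ _).1 H).trans h2.symm)]
    exact hh₁.mem_deg (gproj_mem _ _ _)

end LocalResolution

end DerivedCech

/-! ### The derived functors of `L_n` as Čech cohomology -/

section DerivedFunctors

variable {p : ℕ} [hp : Fact p.Prime] {n : ℕ} (L : TorsionLocalization p n)

/-- The resolution of a comodule given by an injective resolution. -/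
def injLocalResolution {M : Comod p} (P : InjectiveResolution M) : LocalResolution L M where
  C := P.cocomplex
  ι := P.ι.f 0
  ι_injective := Comod.injective_of_mono (P.ι.f 0)
  ι_exact x := ⟨(Comod.exact_iff _).1 P.exact₀ x, by
    rintro ⟨y, rfl⟩
    exact Comod.congr_toLin P.ι_f_zero_comp_complex_d y⟩
  d_exact b x := (Comod.exact_iff _).1 (P.exact_succ b) x
  cechExact b := L.cechExact_of_injective _

/-- The relation between the derived functors of a localization and Čech cohomology. -/
def DerivedRel {M : Comod p} (P : InjectiveResolution M) (i : ℕ)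
    (h : ((L.derived i).obj M).carrier) (h' : (cechI p n i).obj M) : Prop :=
  (injLocalResolution L P).ClassRel i ((P.isoRightDerivedObj L.functor i).hom.toLin h) h'

/-- An isomorphism of comodules as a linear equivalence. -/
def Comod.isoLinearEquiv {M N : Comod p} (e : M ≅ N) : M.carrier ≃ₗ[BP p] N.carrier :=
  LinearEquiv.ofBijective e.hom.toLin (Comod.bijective_of_isIso e.hom)

theorem exists_derived_equiv {M : Comod p} (P : InjectiveResolution M) (i : ℕ) :
    ∃ e : ((L.derived i).obj M).carrier ≃ₗ[BP p] (cechI p n i).obj M,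
      ∀ h h', DerivedRel L P i h h' ↔ e h = h' := by
  obtain ⟨e, he⟩ := (injLocalResolution L P).exists_equiv i
  exact ⟨(Comod.isoLinearEquiv (P.isoRightDerivedObj L.functor i)).trans e, fun h h' => he _ _⟩

theorem DerivedRel.map {M M' : Comod p} {P : InjectiveResolution M} {P' : InjectiveResolution M'}
    (f : M ⟶ M') {i : ℕ} {h : ((L.derived i).obj M).carrier} {h' : (cechI p n i).obj M}
    (H : DerivedRel L P i h h') :
    DerivedRel L P' i (((L.derived i).map f).toLin h) (((cechI p n i).map f).hom h') := by
  let φ := InjectiveResolution.desc f P' P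
  have hφ : P.ι.f 0 ≫ φ.f 0 = f ≫ P'.ι.f 0 := InjectiveResolution.desc_commutes_zero f P' P
  have h1 := LocalResolution.ClassRel.map _ (injLocalResolution L P') f φ hφ H
  have h2 := Comod.congr_toLin
    (InjectiveResolution.isoRightDerivedObj_hom_naturality f P P' φ hφ L.functor i) h
  rw [DerivedRel]
  have h3 : (P'.isoRightDerivedObj L.functor i).hom.toLin (((L.derived i).map f).toLin h) = _ := h2
  rw [h3]
  exact h1

theorem DerivedRel.mem_deg_iff {M : Comod p} {P : InjectiveResolution M} {i : ℕ}
    {h : ((L.derived i).obj M).carrier} {h' : (cechI p n i).obj M} (H : DerivedRel L P i h h')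
    (d : ℤ) : h ∈ ((L.derived i).obj M).deg d ↔ h' ∈ cechDeg n M i d := by
  rw [← LocalResolution.ClassRel.mem_deg_iff _ H d]
  refine ⟨fun hd => (P.isoRightDerivedObj L.functor i).hom.map_deg hd, fun hd => ?_⟩
  have h1 := (P.isoRightDerivedObj L.functor i).inv.map_deg hd
  have h2 := Comod.congr_toLin (P.isoRightDerivedObj L.functor i).hom_inv_id h
  exact (show (P.isoRightDerivedObj L.functor i).inv.toLin
    ((P.isoRightDerivedObj L.functor i).hom.toLin h) = h from h2) ▸ h1

theorem exists_cech_iso (i : ℕ) : ∃ e : L.derived i ⋙ forgetMod p ≅ cechI p n i,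
    (∀ (M : Comod p) (h : ((L.derived i).obj M).carrier) (h' : (cechI p n i).obj M),
      DerivedRel L (injectiveResolution M) i h h' ↔ (e.hom.app M).hom h = h') ∧
    ∀ (M : Comod p) (d : ℤ) (x : ((L.derived i).obj M).carrier),
      x ∈ ((L.derived i).obj M).deg d ↔ (e.hom.app M).hom x ∈ cechDeg n M i d := by
  choose e he using fun M : Comod p => exists_derived_equiv L (injectiveResolution M) i
  refine ⟨NatIso.ofComponents (fun M => (e M).toModuleIso) (fun {M N} f => ?_),
    fun M h h' => he M h h', fun M d x => DerivedRel.mem_deg_iff L ((he M x _).2 rfl) d⟩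
  ext x
  exact (he N _ _).1 (DerivedRel.map L f ((he M x _).2 rfl))

theorem isZero_derived_of_cech {M : Comod p} {i : ℕ} (h : ∀ x : (cechI p n i).obj M, x = 0) :
    IsZero ((L.derived i).obj M) := (Comod.isZero_iff _).2 fun x => by
  obtain ⟨e, -⟩ := exists_derived_equiv L (injectiveResolution M) i
  exact e.injective ((h _).trans (map_zero e).symm)

theorem cechI_eq_zero_of_subsingleton {M : Comod p} {i : ℕ}
    (h : ∀ z : CechMod (gens p n) M.carrier i, z = 0) (x : (cechI p n i).obj M) : x = 0 := by
  obtain ⟨z, hz⟩ := exists_modRep (K := (cechComplex (gens p n)).obj ((forgetMod p).obj M)) x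
  exact (hz.eq_zero_iff rfl).2 ⟨0, (map_zero _).trans (h z).symm⟩

/-- The derived functors vanish above degree `n`. -/
theorem isZero_derived_of_lt (M : Comod p) {i : ℕ} (hi : n < i) :
    IsZero ((L.derived i).obj M) :=
  isZero_derived_of_cech L (cechI_eq_zero_of_subsingleton fun z => cechMod_ext _ fun σ => by
    have := Fintype.card_le_of_injective σ σ.injective
    simp only [Fintype.card_fin] at this
    omega)

/-- The derived functors vanish on torsion comodules. -/
theorem isZero_derived_of_isVTorsion {M : Comod p} (hM : IsVTorsion p n M) (i : ℕ) :
    IsZero ((L.derived i).obj M) :=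
  isZero_derived_of_cech L (cechI_eq_zero_of_subsingleton fun z =>
    cechMod_eq_zero (gens p n) (fun j x => exists_pow_smul_eq_zero (hM x) j) z)

theorem cechI_eq_zero_of_exact {M : Comod p} {i : ℕ}
    (h : Function.Exact (cechModD (gens p n) M.carrier i) (cechModD (gens p n) M.carrier (i + 1)))
    (x : (cechI p n (i + 1)).obj M) : x = 0 := by
  obtain ⟨z, hz⟩ := exists_modRep (K := (cechComplex (gens p n)).obj ((forgetMod p).obj M)) x
  refine (hz.eq_zero_iff (CochainComplex.prev_nat_succ i)).2 ?_
  have := hz.d_eq_zero (i + 2)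
  rw [LocalResolution.cechComplex_d] at this ⊢
  exact (h z).1 this

/-- The derived functors vanish if the augmented Čech complex of the localization is exact. -/
theorem isZero_derived_of_cechExact {M : Comod p}
    (h : CechExact (gens p n) (L.functor.obj M).carrier) {i : ℕ} (hi : 0 < i) :
    IsZero ((L.derived i).obj M) := by
  obtain ⟨i, rfl⟩ := Nat.exists_eq_succ_of_ne_zero hi.ne'
  refine isZero_derived_of_cech L (cechI_eq_zero_of_exact fun z => ⟨fun hz => ?_, ?_⟩)
  · have hb := fun k => L.cechMap_unit_bijective M k
    have h1 : cechModD (gens p n) (L.functor.obj M).carrier (i + 1)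
        (cechMap (gens p n) (i + 1) (L.unit.app M).toLin z) = 0 :=
      (cechModD_cechMap (gens p n) (L.unit.app M).toLin z).trans ((congrArg _ hz).trans (map_zero _))
    obtain ⟨w, hw⟩ := (h.exact_succ i _).1 h1
    obtain ⟨w, rfl⟩ := (hb i).2 w
    rw [cechModD_cechMap] at hw
    exact ⟨w, (hb _).1 hw⟩
  · rintro ⟨y, rfl⟩
    exact cechModD_cechModD _ y

/-- The higher derived functors are torsion. -/
theorem isVTorsion_derived (M : Comod p) {i : ℕ} (hi : 0 < i) :
    IsVTorsion p n ((L.derived i).obj M) := fun x => by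
  obtain ⟨i, rfl⟩ := Nat.exists_eq_succ_of_ne_zero hi.ne'
  let P := injectiveResolution M
  let K := (L.functor.mapHomologicalComplex (ComplexShape.up ℕ)).obj P.cocomplex
  let e := Comod.isoLinearEquiv (P.isoRightDerivedObj L.functor (i + 1))
  obtain ⟨z, hz⟩ : ∃ z : (L.functor.obj (P.cocomplex.X (i + 1))).carrier,
    IsComodClass K (i + 1) z (e x) := exists_comodRep (e x)
  -- After multiplication by powers of `v_n`, the cocycle `z` comes from a cocycle of the injective
  -- resolution itself, and that is a boundary because the degree is positive.
  obtain ⟨N, y, hy⟩ := L.unit_coker (P.cocomplex.X (i + 1)) z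
  have hdz : (L.functor.map (P.cocomplex.d (i + 1) (i + 2))).toLin z = 0 := hz.d_eq_zero (i + 2)
  have h1 : (L.unit.app (P.cocomplex.X (i + 2))).toLin
      ((P.cocomplex.d (i + 1) (i + 2)).toLin y) = 0 := by
    rw [← L.unit_naturality, hy, map_smul, hdz, smul_zero]
  obtain ⟨J, hJ⟩ := (L.unit_ker _ _).1 h1
  rw [← map_smul] at hJ
  obtain ⟨y', hy'⟩ := (Comod.exact_iff _).1 (P.exact_succ i) _ hJ
  have hy' : (P.cocomplex.d i (i + 1)).toLin y' = vGen p n ^ J • y := hy'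
  refine ⟨J + N, e.injective ?_⟩
  rw [map_zero, map_smul]
  refine ((hz.smul (vGen p n ^ (J + N))).eq_zero_iff (CochainComplex.prev_nat_succ i)).2
    ⟨(L.unit.app _).toLin y', ?_⟩
  have h2 : (L.unit.app (P.cocomplex.X (i + 1))).toLin (vGen p n ^ J • y) =
      vGen p n ^ (J + N) • z := by
    rw [pow_add, mul_smul, ← hy]
    exact map_smul (L.unit.app (P.cocomplex.X (i + 1))).toLin (vGen p n ^ J) y
  exact (L.unit_naturality _ _).trans ((congrArg _ hy').trans h2)

theorem idealI_fg (k : ℕ) : (idealI p k).FG := by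
  refine Submodule.fg_span ((Set.finite_lt_nat k).image (vGen p) |>.subset ?_)
  rintro _ ⟨j, hj, rfl⟩
  exact ⟨j, by exact_mod_cast hj, rfl⟩

/-- Each generator of `I_{n+1}` is nilpotent on `x`, and the ideal is finitely generated, so one
power of the ideal kills `x`. -/
theorem exists_idealI_pow_smul {M : Comod p} {x : M.carrier} (hx : ∃ K : ℕ, vGen p n ^ K • x = 0) :
    ∃ N : ℕ, ∀ a ∈ idealI p (n + 1) ^ N, a • x = 0 := by
  have h1 : idealI p (n + 1) ≤ (Ideal.torsionOf (BP p) M.carrier x).radical := by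
    refine Ideal.span_le.2 ?_
    rintro _ ⟨j, hj, rfl⟩
    exact vGen_mem_nilIdeal M x (mem_nilIdeal.2 hx) (Nat.lt_succ_iff.1 (by exact_mod_cast hj))
  have h2 : (idealI p ((n + 1 : ℕ) : ℕ∞)).FG := idealI_fg (n + 1)
  obtain ⟨N, hN⟩ := Ideal.exists_pow_le_of_le_radical_of_fg h1 (by exact_mod_cast h2)
  exact ⟨N, fun a ha => hN ha⟩

end DerivedFunctors

/-! ### When `L_n` is the inversion of `v_n` -/

section VGenLocalization

variable {p : ℕ} [hp : Fact p.Prime] {n : ℕ} (L : TorsionLocalization p n)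

/-- If `v_0, …, v_{n-1}` are nilpotent on `N`, then `v_n` acts isomorphically on the localization
of `N`. -/
theorem vGen_bijective_obj (N : Comod p) (hN : ∀ x : N.carrier, ∀ i < n, vGen p i ∈ nilIdeal x) :
    Function.Bijective fun y : (L.functor.obj N).carrier => vGen p n • y := by
  have hinj : ∀ (Z : Comod p) (y : (L.functor.obj Z).carrier), vGen p n • y = 0 → y = 0 :=
    fun Z y hy => L.torsionFree Z y 1 (by rwa [pow_one])
  refine ⟨fun y y' h => sub_eq_zero.1 (hinj N _ ((smul_sub _ _ _).trans (sub_eq_zero.2 h))),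
    fun y => ?_⟩
  let J := Injective.under N
  let f : N ⟶ J := Injective.ι N
  have hf := Comod.injective_of_mono f
  have hQ := isQDivisible_of_injective n J
  -- An injective comodule maps onto its localization, so the image of `y` lifts to `J`.
  obtain ⟨z, hz⟩ := (L.surjective_and_cechExact_of_isQDivisible hQ).1 ((L.functor.map f).toLin y)
  -- A power of `v_i` kills `y`, hence moves `z` into the `v_n`-torsion of `J`, which is also
  -- `v_i`-torsion.
  have hz' : ∀ i < n, vGen p i ∈ nilIdeal z := fun i hi => by
    obtain ⟨K, x, hx⟩ := L.unit_coker N y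
    obtain ⟨R, hR⟩ := mem_nilIdeal.1 (hN x i hi)
    have h1 : vGen p i ^ R • y = 0 := by
      refine L.torsionFree N _ K ?_
      rw [smul_comm, ← hx]
      refine (map_smul (L.unit.app N).toLin (vGen p i ^ R) x).symm.trans ?_
      rw [hR]
      exact map_zero _
    have h2 : (L.unit.app J).toLin (vGen p i ^ R • z) = 0 := by
      refine (map_smul (L.unit.app J).toLin (vGen p i ^ R) z).trans ?_
      rw [hz, ← map_smul, h1, map_zero]
    have h3 := vGen_mem_nilIdeal J _ (mem_nilIdeal.2 ((L.unit_ker J _).1 h2)) hi.le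
    obtain ⟨S, hS⟩ := mem_nilIdeal.1 h3
    exact mem_nilIdeal.2 ⟨S + R, by rw [pow_add, mul_smul, hS]⟩
  obtain ⟨z', -, rfl⟩ := hQ n le_rfl z hz'
  have h1 : vGen p n • (L.unit.app J).toLin z' = (L.functor.map f).toLin y :=
    (map_smul (L.unit.app J).toLin (vGen p n) z').symm.trans hz
  have hex : ∀ x, (Comod.cokerπ f).toLin x = 0 ↔ ∃ w, f.toLin w = x := fun x => by
    rw [← LinearMap.mem_ker, Comod.ker_cokerπ]; rfl
  -- The quotient of the image of `y` by `v_n` again comes from the localization of `N`: its image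
  -- in the localization of `J / N` is killed by `v_n`, which is injective there, and localization
  -- is left exact.
  have h2 : (L.functor.map (Comod.cokerπ f)).toLin ((L.unit.app J).toLin z') = 0 := by
    refine hinj _ _ ?_
    rw [← map_smul, h1]
    have h3 : f ≫ Comod.cokerπ f = 0 := Comod.hom_ext fun x => (hex _).2 ⟨x, rfl⟩
    have h4 := Comod.congr_toLin (L.functor.map_comp f (Comod.cokerπ f)) y
    rw [h3, L.functor.map_zero] at h4
    exact h4.symm
  obtain ⟨y', hy'⟩ := L.map_exact f (Comod.cokerπ f) hf hex _ h2
  refine ⟨y', L.map_injective f hf ?_⟩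
  change (L.functor.map f).toLin (vGen p n • y') = _
  rw [map_smul, hy', h1]

/-- A map to a module on which `v_j` is bijective, with `v_j`-torsion kernel and cokernel, is
the localization that inverts `v_j`. -/
theorem isLocalizedModule_vGen {j : ℕ} {M N : Type*} [AddCommGroup M] [Module (BP p) M]
    [AddCommGroup N] [Module (BP p) N] (f : M →ₗ[BP p] N)
    (hN : Function.Bijective fun y : N => vGen p j • y)
    (hk : ∀ x, f x = 0 → ∃ K : ℕ, vGen p j ^ K • x = 0)
    (hc : ∀ y, ∃ (K : ℕ) (x : M), f x = vGen p j ^ K • y) :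
    IsLocalizedModule (Submonoid.powers (vGen p j)) f where
  map_units := by
    rintro ⟨_, K, rfl⟩
    rw [Module.End.isUnit_iff]
    exact ⟨fun y y' h => sub_eq_zero.1 (vGen_pow_smul_injective hN.1 _ K
      ((smul_sub _ _ _).trans (sub_eq_zero.2 h))), fun y => vGen_pow_smul_surjective hN.2 K y⟩
  surj y := by
    obtain ⟨K, x, hx⟩ := hc y
    exact ⟨(x, ⟨_, K, rfl⟩), hx.symm⟩
  exists_of_eq {x y} h := by
    obtain ⟨K, hK⟩ := hk (x - y) (by rw [map_sub, h, sub_self])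
    exact ⟨⟨_, K, rfl⟩, sub_eq_zero.1 ((smul_sub _ _ _).symm.trans hK)⟩

theorem isLocalizedModule_unit (N : Comod p)
    (hN : ∀ x : N.carrier, ∀ i < n, vGen p i ∈ nilIdeal x) :
    IsLocalizedModule (Submonoid.powers (vGen p n)) (L.unit.app N).toLin :=
  isLocalizedModule_vGen _ (vGen_bijective_obj L N hN) (fun x => (L.unit_ker N x).1)
    (L.unit_coker N)

end VGenLocalization

/-! ### Invertible `v_j`, torsion quotients and rationalization -/

section SpecialComodules

variable {p : ℕ} [hp : Fact p.Prime] {n : ℕ} (L : TorsionLocalization p n)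

theorem isZero_derived_of_vGen_bijective {M : Comod p} {j : ℕ} (hj : j ≤ n)
    (hM : Function.Bijective fun x : M.carrier => vGen p j • x) {i : ℕ} (hi : 0 < i) :
    IsZero ((L.derived i).obj M) := by
  obtain ⟨i, rfl⟩ := Nat.exists_eq_succ_of_ne_zero hi.ne'
  exact isZero_derived_of_cech L (cechI_eq_zero_of_exact ((cechExact_of_vGen_bijective hj hM).exact_succ i))

theorem cechExact_obj (N : Comod p) (hN : ∀ x : N.carrier, ∀ i < n, vGen p i ∈ nilIdeal x) :
    CechExact (gens p n) (L.functor.obj N).carrier :=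
  cechExact_of_vGen_bijective le_rfl (vGen_bijective_obj L N hN)

theorem vGen_smul_BPmod {k : ℕ∞} {i : ℕ} (hi : (i : ℕ∞) < k) (x : (BPmod p k).carrier) :
    vGen p i • x = 0 := by
  obtain ⟨x, rfl⟩ := Submodule.Quotient.mk_surjective _ x
  have h : vGen p i * (show BP p from x) ∈ idealI p k :=
    Ideal.mul_mem_right (show BP p from x) _ (Ideal.subset_span ⟨i, hi, rfl⟩)
  exact (Submodule.Quotient.mk_eq_zero _).2 h

theorem vGen_mem_nilIdeal_BPmod {k : ℕ} (x : (BPmod p k).carrier) {i : ℕ} (hi : i < k) :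
    vGen p i ∈ nilIdeal x :=
  mem_nilIdeal.2 ⟨1, by rw [pow_one]; exact vGen_smul_BPmod (by exact_mod_cast hi) x⟩

theorem isVTorsion_BPmod {k : ℕ∞} (hk : n < k) : IsVTorsion p n (BPmod p k) := fun x =>
  ⟨1, by rw [pow_one]; exact vGen_smul_BPmod hk x⟩

/-- Integers prime to `p` are units in `ℤ_(p)`. Hence inverting `v_0 = p` in `BP_*` inverts all
non-zero integers and amounts to tensoring with `ℚ`. -/
theorem exists_intCast_eq (m : ℤ) (hm : m ≠ 0) :
    ∃ (K : ℕ) (u : (BP p)ˣ), ((m : ℤ) : BP p) = vGen p 0 ^ K * u := by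
  obtain ⟨c, hK, hc⟩ := (Int.finiteMultiplicity_iff (a := (p : ℤ)) (b := m)).2
    ⟨by simpa using hp.out.ne_one, hm⟩ |>.exists_eq_pow_mul_and_not_dvd
  have h1 : IsUnit (algebraMap ℤ (Localization.AtPrime (Ideal.span {(p : ℤ)})) c) :=
    IsLocalization.map_units (Localization.AtPrime (Ideal.span {(p : ℤ)}))
      (⟨c, fun h => hc (Ideal.mem_span_singleton.1 h)⟩ : (Ideal.span {(p : ℤ)}).primeCompl)
  rw [eq_intCast] at h1
  have h1 : IsUnit ((c : ℤ) : ZLoc p) := h1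
  have h2 : IsUnit ((c : ℤ) : BP p) := by
    have := h1.map (algebraMap (ZLoc p) (BP p))
    simpa using this
  exact ⟨_, h2.unit, by
    rw [vGen_zero, IsUnit.unit_spec, ← Int.cast_natCast, ← Int.cast_pow, ← Int.cast_mul, ← hK]⟩

theorem isLocalizedModule_rat : IsLocalizedModule (Submonoid.powers (vGen p 0))
    ((AlgebraTensorModule.mk ℤ (BP p) (BP p) ℚ).flip 1) := by
  have h0 : IsLocalizedModule (nonZeroDivisors ℤ) (TensorProduct.mk ℤ ℚ (BP p) 1) :=
    (isLocalizedModule_iff_isBaseChange (nonZeroDivisors ℤ) ℚ _).2 (TensorProduct.isBaseChange ℤ (BP p) ℚ)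
  have h1 : IsLocalizedModule (nonZeroDivisors ℤ)
    ((TensorProduct.comm ℤ ℚ (BP p)).toLinearMap ∘ₗ (TensorProduct.mk ℤ ℚ (BP p) 1)) :=
    IsLocalizedModule.of_linearEquiv _ _ _
  have hs : ∀ (m : ℤ) (y : BP p ⊗[ℤ] ℚ), m • y = (m : BP p) • y := fun m y =>
    (Int.cast_smul_eq_zsmul (BP p) m y).symm
  have hp0 : (p : ℤ) ∈ nonZeroDivisors ℤ := mem_nonZeroDivisors_of_ne_zero
    (by exact_mod_cast hp.out.ne_zero)
  refine isLocalizedModule_vGen _ ?_ (fun x hx => ?_) fun y => ?_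
  · have h2 := (Module.End.isUnit_iff _).1 (h1.map_units ⟨(p : ℤ), hp0⟩)
    have h3 : (fun y : BP p ⊗[ℤ] ℚ => vGen p 0 • y) = fun y => (p : ℤ) • y := by
      funext y
      rw [hs, vGen_zero, Int.cast_natCast]
    rw [h3]
    exact h2
  · obtain ⟨⟨m, hm⟩, h⟩ := h1.exists_of_eq (x₁ := x) (x₂ := 0) (by
      rw [map_zero]
      exact hx)
    obtain ⟨K, u, hu⟩ := exists_intCast_eq (p := p) m (nonZeroDivisors.ne_zero hm)
    refine ⟨K, ?_⟩
    have h : m • x = 0 := h.trans (smul_zero _)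
    rw [zsmul_eq_mul, hu, mul_assoc, mul_left_comm] at h
    exact (Units.mul_right_eq_zero u).1 h
  · obtain ⟨⟨x, ⟨m, hm⟩⟩, h⟩ := h1.surj y
    obtain ⟨K, u, hu⟩ := exists_intCast_eq (p := p) m (nonZeroDivisors.ne_zero hm)
    have h : m • y = x ⊗ₜ[ℤ] (1 : ℚ) := h
    rw [hs, hu, mul_comm, mul_smul] at h
    refine ⟨K, ((u⁻¹ : (BP p)ˣ) : BP p) • x, ?_⟩
    rw [map_smul]
    exact (congrArg _ h.symm).trans (inv_smul_smul u _)

theorem exists_linearEquiv_rat (L : TorsionLocalization p 0) :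
    ∃ e : (L.functor.obj (unitComod p)).carrier ≃ₗ[BP p] BP p ⊗[ℤ] ℚ,
      ∀ a : BP p, e ((L.unit.app (unitComod p)).toLin a) = a ⊗ₜ 1 := by
  let f : BP p →ₗ[BP p] (L.functor.obj (unitComod p)).carrier := (L.unit.app (unitComod p)).toLin
  have h1 : IsLocalizedModule (Submonoid.powers (vGen p 0)) f :=
    isLocalizedModule_unit L (unitComod p) fun x i hi => absurd hi (Nat.not_lt_zero i)
  have h2 := isLocalizedModule_rat (p := p)
  exact ⟨IsLocalizedModule.linearEquiv (Submonoid.powers (vGen p 0)) f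
    ((AlgebraTensorModule.mk ℤ (BP p) (BP p) ℚ).flip 1),
    fun a => IsLocalizedModule.linearEquiv_apply _ _ _ a⟩

end SpecialComodules

/-! ### Regular sequences modulo powers and cokernels of localizations -/

section Regularity

variable {p : ℕ} [hp : Fact p.Prime]

/-- The sequence `v_j, v_{j+1}, …` is regular on `M`, also after replacing the generators
by powers. -/
def IsVRegular (p : ℕ) [Fact p.Prime] (j : ℕ) (M : Type*) [AddCommGroup M] [Module (BP p) M] : Prop :=
  ∀ (κ : ℕ → ℕ) (l : ℕ), j ≤ l → ∀ x : M,
    vGen p l • x ∈ powIdeal p κ j l • (⊤ : Submodule (BP p) M) →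
      x ∈ powIdeal p κ j l • (⊤ : Submodule (BP p) M)

theorem powIdeal_self (κ : ℕ → ℕ) (j : ℕ) : powIdeal p κ j j = ⊥ := by
  rw [powIdeal, Ideal.span_eq_bot]
  rintro x ⟨i, hi, hi', _⟩
  omega

theorem powIdeal_update (κ : ℕ → ℕ) {j l : ℕ} (h : j < l) (R : ℕ) :
    powIdeal p (Function.update κ j R) j l = powIdeal p κ (j + 1) l ⊔ Ideal.span {vGen p j ^ R} := by
  rw [powIdeal, powIdeal, ← Ideal.span_union]
  congr 1
  ext x
  constructor
  · rintro ⟨i, h1, h2, rfl⟩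
    rcases h1.eq_or_lt with rfl | h1
    · rw [Function.update_self]
      exact Or.inr rfl
    · rw [Function.update_of_ne h1.ne']
      exact Or.inl ⟨i, h1, h2, rfl⟩
  · rintro (⟨i, h1, h2, rfl⟩ | rfl)
    · exact ⟨i, by omega, h2, by rw [Function.update_of_ne (by omega)]⟩
    · exact ⟨j, le_rfl, h, by rw [Function.update_self]⟩

theorem IsVRegular.eq_zero {j : ℕ} {M : Type*} [AddCommGroup M] [Module (BP p) M]
    (h : IsVRegular p j M) {x : M} (hx : vGen p j • x = 0) : x = 0 := by
  have := h (fun _ => 0) j le_rfl x (by rw [hx]; exact zero_mem _)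
  rwa [powIdeal_self, Submodule.bot_smul, Submodule.mem_bot] at this

/-- Regularity passes to the cokernel of the localization that inverts the first element. -/
theorem IsVRegular.cokernel {j : ℕ} {M E Q : Type*} [AddCommGroup M] [Module (BP p) M]
    [AddCommGroup E] [Module (BP p) E] [AddCommGroup Q] [Module (BP p) Q]
    (h : IsVRegular p j M) (f : M →ₗ[BP p] E) (g : E →ₗ[BP p] Q) (hf : Function.Injective f)
    (hE : Function.Bijective fun y : E => vGen p j • y)
    (hc : ∀ y : E, ∃ (K : ℕ) (x : M), f x = vGen p j ^ K • y)
    (hfg : Function.Exact f g) (hg : Function.Surjective g) : IsVRegular p (j + 1) Q := by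
  intro κ l hl x hx
  obtain ⟨e, rfl⟩ := hg x
  set J := powIdeal p κ (j + 1) l
  have hmap : (J • (⊤ : Submodule (BP p) E)).map g = J • ⊤ := by
    rw [Submodule.map_smul'', Submodule.map_top, LinearMap.range_eq_top.2 hg]
  rw [← hmap] at hx ⊢
  obtain ⟨w, hw, hwx⟩ := hx
  -- Denominators can be cleared within `J E`: up to a power of `v_j`, its elements come from `J M`.
  have hpow : ∀ w ∈ J • (⊤ : Submodule (BP p) E), ∃ (K : ℕ),
      ∃ y ∈ J • (⊤ : Submodule (BP p) M), f y = vGen p j ^ K • w := fun w hw => by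
    refine Submodule.smul_induction_on hw (fun a ha y _ => ?_) ?_
    · obtain ⟨K, x, hx⟩ := hc y
      exact ⟨K, a • x, Submodule.smul_mem_smul ha trivial, by rw [map_smul, hx, smul_comm]⟩
    · rintro y y' ⟨K, x, hx, hxy⟩ ⟨K', x', hx', hxy'⟩
      refine ⟨K + K', vGen p j ^ K' • x + vGen p j ^ K • x', add_mem (Submodule.smul_mem _ _ hx)
        (Submodule.smul_mem _ _ hx'), ?_⟩
      rw [map_add, map_smul, map_smul, hxy, hxy', smul_smul, smul_smul, smul_add, pow_add, mul_comm]
  obtain ⟨K, w', hw', hww'⟩ := hpow w hw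
  obtain ⟨y, hy⟩ := (hfg (vGen p l • e - w)).1 (by rw [map_sub, map_smul, hwx, sub_self])
  obtain ⟨S, x0, hx0⟩ := hc e
  -- Clearing denominators turns the relation in `Q` into one in `M` modulo `J` and `v_j ^ (K + S)`.
  -- This exponent depends on the element, which is why regularity is required for all exponents at
  -- once.
  have h1 : vGen p l • (vGen p j ^ K • x0) = vGen p j ^ S • w' + vGen p j ^ (K + S) • y := by
    apply hf
    rw [map_add, map_smul, map_smul, map_smul, map_smul, hx0, hww', hy, smul_sub, smul_smul,
      smul_smul, smul_smul, smul_smul]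
    rw [show vGen p l * vGen p j ^ K * vGen p j ^ S = vGen p j ^ (K + S) * vGen p l by ring,
      show vGen p j ^ S * vGen p j ^ K = vGen p j ^ (K + S) by ring]
    abel
  have hlt : j < l := hl
  have h2 := h (Function.update κ j (K + S)) l hlt.le (vGen p j ^ K • x0) (by
    rw [h1, powIdeal_update κ hlt, Submodule.sup_smul]
    exact Submodule.add_mem_sup (Submodule.smul_mem _ _ hw')
      (Submodule.smul_mem_smul (Ideal.mem_span_singleton_self _) trivial))
  rw [powIdeal_update κ hlt, Submodule.sup_smul, Submodule.ideal_span_singleton_smul,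
    Submodule.mem_sup] at h2
  obtain ⟨u, hu, _, ⟨z, -, rfl⟩, huz⟩ := h2
  have h3 : Function.Surjective (LinearMap.lsmul (BP p) E (vGen p j ^ (K + S))) :=
    vGen_pow_smul_surjective hE.2 (K + S)
  have h4 : ∃ u' ∈ J • (⊤ : Submodule (BP p) E), vGen p j ^ (K + S) • u' = f u := by
    have h5 : f u ∈ (J • (⊤ : Submodule (BP p) E)).map
        (LinearMap.lsmul (BP p) E (vGen p j ^ (K + S))) := by
      rw [Submodule.map_smul'', Submodule.map_top, LinearMap.range_eq_top.2 h3]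
      have : f u ∈ (J • (⊤ : Submodule (BP p) M)).map f := ⟨u, hu, rfl⟩
      rw [Submodule.map_smul''] at this
      exact Submodule.smul_mono le_rfl le_top this
    exact h5
  obtain ⟨u', hu', huu'⟩ := h4
  refine ⟨u', hu', ?_⟩
  -- Dividing by `v_j ^ (K + S)` in `E` shows that `e` lies in `J E` up to an element of `M`, and
  -- the latter disappears in `Q`.
  have h5 : e = u' + f z := by
    refine sub_eq_zero.1 (vGen_pow_smul_injective hE.1 _ (K + S) ?_)
    rw [smul_sub, smul_add, huu', sub_eq_zero, pow_add, mul_smul, ← hx0, ← map_smul, ← huz,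
      map_add]
    congr 1
    rw [← pow_add]
    exact map_smul f _ z
  rw [h5, map_add, (hfg (f z)).2 ⟨z, rfl⟩, add_zero]

theorem idealI_eq_powIdeal (κ : ℕ → ℕ) {k l : ℕ} (hl : k ≤ l) :
    idealI p k ⊔ powIdeal p κ k l = powIdeal p (fun i => if i < k then 1 else κ i) 0 l := by
  rw [idealI, powIdeal, powIdeal, ← Ideal.span_union]
  congr 1
  ext x
  constructor
  · rintro (⟨i, h1, rfl⟩ | ⟨i, h1, h2, rfl⟩)
    · have h1 : i < k := by exact_mod_cast h1
      exact ⟨i, Nat.zero_le _, by omega, by rw [if_pos h1, pow_one]⟩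
    · exact ⟨i, Nat.zero_le _, h2, by rw [if_neg (by omega)]⟩
  · rintro ⟨i, -, h2, rfl⟩
    by_cases h : i < k
    · exact Or.inl ⟨i, by exact_mod_cast h, by rw [if_pos h, pow_one]⟩
    · exact Or.inr ⟨i, by omega, h2, by rw [if_neg h]⟩

/-- Giving `v_0, …, v_{k-1}` the exponent `1` turns regularity on `BP_* / I_k` into the statement
`mem_powIdeal_of_vGen_mul` about `BP_*`. -/
theorem isVRegular_quotient (k : ℕ) : IsVRegular p k (BP p ⧸ idealI p k) := by
  intro κ l hl x hx
  obtain ⟨x, rfl⟩ := Submodule.Quotient.mk_surjective _ x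
  have key : ∀ y : BP p, (Submodule.Quotient.mk y : BP p ⧸ idealI p k) ∈
      powIdeal p κ k l • (⊤ : Submodule (BP p) (BP p ⧸ idealI p k)) ↔
      y ∈ powIdeal p (fun i => if i < k then 1 else κ i) 0 l := fun y => by
    rw [← idealI_eq_powIdeal κ hl, ← Submodule.range_mkQ (idealI p k), ← Submodule.map_top,
      ← Submodule.map_smul'', ← Ideal.one_eq_top, smul_eq_mul, mul_one]
    change (idealI p k).mkQ y ∈ _ ↔ _
    rw [← Submodule.mem_comap, Submodule.comap_map_mkQ]
  rw [← Submodule.Quotient.mk_smul, key] at hx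
  exact (key x).2 (mem_powIdeal_of_vGen_mul hx)

end Regularity

/-! ### Computing derived functors by other resolutions -/

section Comparison

variable {p : ℕ} [hp : Fact p.Prime] {n : ℕ} {L : TorsionLocalization p n} {M : Comod p}

namespace LocalResolution

/-- A resolution maps to any injective resolution. -/
theorem exists_hom_injective (R : LocalResolution L M) (P : InjectiveResolution M) :
    ∃ φ : R.C ⟶ P.cocomplex, R.ι ≫ φ.f 0 = P.ι.f 0 := by
  have := Comod.mono_of_injective R.ι R.ι_injective
  let ι' : M ⟶ P.cocomplex.X 0 := P.ι.f 0
  have h0 : R.ι ≫ R.C.d 0 1 = 0 := Comod.hom_ext fun x => (R.ι_exact _).2 ⟨x, rfl⟩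
  have hex0 : (ShortComplex.mk _ _ h0).Exact := (Comod.exact_iff _).2 fun x => (R.ι_exact x).1
  have hex : ∀ b, (ShortComplex.mk _ _ (R.C.d_comp_d b (b + 1) (b + 2))).Exact := fun b =>
    (Comod.exact_iff _).2 (R.d_exact b)
  let φ0 : R.C.X 0 ⟶ P.cocomplex.X 0 := Injective.factorThru ι' R.ι
  have hφ0 : R.ι ≫ φ0 = ι' := Injective.comp_factorThru _ _
  have h1 : R.ι ≫ φ0 ≫ P.cocomplex.d 0 1 = 0 := by
    rw [← Category.assoc, hφ0]
    exact P.ι_f_zero_comp_complex_d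
  exact ⟨CochainComplex.mkHom _ _ φ0 (hex0.descToInjective (φ0 ≫ P.cocomplex.d 0 1) h1)
    (hex0.comp_descToInjective _ _).symm fun b g =>
      ⟨(hex b).descToInjective (g.2.1 ≫ P.cocomplex.d (b + 1) (b + 2)) (by
        dsimp only
        rw [← Category.assoc, ← g.2.2, Category.assoc, P.cocomplex.d_comp_d, comp_zero]),
      ((hex b).comp_descToInjective _ _).symm⟩, hφ0⟩

/-- The derived functors are computed by resolutions whose localizations have an exact augmented
Čech complex. -/
theorem nonempty_iso_derived (R : LocalResolution L M) (i : ℕ) :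
    Nonempty (R.LC.homology i ≅ (L.derived i).obj M) := by
  let P := injectiveResolution M
  obtain ⟨φ, hφ⟩ := R.exists_hom_injective P
  let ψ := HomologicalComplex.homologyMap ((L.functor.mapHomologicalComplex _).map φ) i
  obtain ⟨e, he⟩ := R.exists_equiv i
  obtain ⟨e', he'⟩ := (injLocalResolution L P).exists_equiv i
  -- Both resolutions compute the Čech cohomology of `M`, compatibly with the comparison map, which
  -- is therefore bijective in cohomology.
  have h1 : ∀ x, e' (ψ.toLin x) = e x := fun x => by
    have h := ClassRel.map R (injLocalResolution L P) (𝟙 M) φ (hφ.trans (Category.id_comp _).symm)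
      ((he x _).2 rfl)
    rw [(cechI p n i).map_id] at h
    exact (he' _ _).1 h
  have h2 : Function.Bijective ψ.toLin := by
    have h3 : ⇑ψ.toLin = e'.symm ∘ e := funext fun x => e'.injective ((h1 x).trans
      (e'.apply_symm_apply _).symm)
    rw [h3]
    exact e'.symm.bijective.comp e.bijective
  have := Comod.isIso_of_bijective ψ h2
  exact ⟨asIso ψ ≪≫ (P.isoRightDerivedObj L.functor i).symm⟩

end LocalResolution

end Comparison

/-! ### The chromatic resolution of `BP_* / I_k` -/

section Chromatic

variable {p : ℕ} [hp : Fact p.Prime] (k : ℕ)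

variable (p) in
/-- The comodules `BP_* / (p, …, v_{k-1}, v_k^∞, …, v_{k+b-1}^∞)`. -/
def chromN : ℕ → Comod p
  | 0 => BPmod p k
  | b + 1 => Comod.coker ((someLocalization p (k + b)).unit.app (chromN b))

variable (p) in
/-- The localizations of `chromN` in which `v_{k+b}` is inverted. -/
def chromE (b : ℕ) : Comod p := (someLocalization p (k + b)).functor.obj (chromN p k b)

variable (p) in
/-- The inclusion of `chromN` in `chromE`. -/
def chromι (b : ℕ) : chromN p k b ⟶ chromE p k b :=
  (someLocalization p (k + b)).unit.app (chromN p k b)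

variable (p) in
/-- The projection of `chromE` to the next `chromN`. -/
def chromπ (b : ℕ) : chromE p k b ⟶ chromN p k (b + 1) := Comod.cokerπ (chromι p k b)

theorem chromπ_surjective (b : ℕ) : Function.Surjective (chromπ p k b).toLin :=
  Comod.cokerπ_surjective _

theorem chrom_exact (b : ℕ) : Function.Exact (chromι p k b).toLin (chromπ p k b).toLin :=
  fun x => SetLike.ext_iff.1 (Comod.ker_cokerπ (chromι p k b)) x

theorem exists_chromι (b : ℕ) (y : (chromE p k b).carrier) :
    ∃ (K : ℕ) (x : (chromN p k b).carrier), (chromι p k b).toLin x = vGen p (k + b) ^ K • y :=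
  (someLocalization p (k + b)).unit_coker _ y

/-- The cokernel of a localization map for `v_{k+b}` is `v_{k+b}`-torsion, and a comodule with this
property is torsion for all lower generators. By `vGen_bijective_obj` the localization at the next
stage is then plain inversion of the next generator. -/
theorem vGen_mem_nilIdeal_chromN (b : ℕ) (x : (chromN p k b).carrier) {i : ℕ} (hi : i < k + b) :
    vGen p i ∈ nilIdeal x := by
  cases b with
  | zero => exact vGen_mem_nilIdeal_BPmod x hi
  | succ b =>
    obtain ⟨e, rfl⟩ := chromπ_surjective k b x
    obtain ⟨K, x, hx⟩ := exists_chromι k b e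
    refine vGen_mem_nilIdeal (n := k + b) (chromN p k (b + 1)) _ (mem_nilIdeal.2 ⟨K, ?_⟩) (by omega)
    rw [← map_smul, ← hx]
    exact (chrom_exact k b _).2 ⟨x, rfl⟩

theorem vGen_bijective_chromE (b : ℕ) :
    Function.Bijective fun y : (chromE p k b).carrier => vGen p (k + b) • y :=
  vGen_bijective_obj _ _ fun x _ => vGen_mem_nilIdeal_chromN k b x

theorem isLocalizedModule_chromι (b : ℕ) :
    IsLocalizedModule (Submonoid.powers (vGen p (k + b))) (chromι p k b).toLin :=
  isLocalizedModule_unit _ _ fun x _ => vGen_mem_nilIdeal_chromN k b x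

/-- The two claims are proved together: regularity makes the localization map injective, and
injectivity is needed to carry regularity to the cokernel. -/
theorem isVRegular_chromN_and_injective (b : ℕ) : IsVRegular p (k + b) (chromN p k b).carrier ∧
    Function.Injective (chromι p k b).toLin := by
  have hinj : ∀ b, IsVRegular p (k + b) (chromN p k b).carrier →
      Function.Injective (chromι p k b).toLin := fun b hb =>
    (injective_iff_map_eq_zero _).2 fun x hx => by
      obtain ⟨K, hK⟩ := ((someLocalization p (k + b)).unit_ker _ x).1 hx
      refine vGen_pow_smul_injective (j := k + b) (fun y y' h => ?_) x K hK
      exact sub_eq_zero.1 (hb.eq_zero ((smul_sub _ _ _).trans (sub_eq_zero.2 h)))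
  induction b with
  | zero => exact ⟨isVRegular_quotient k, hinj 0 (isVRegular_quotient k)⟩
  | succ b ih =>
    have h : IsVRegular p (k + (b + 1)) (chromN p k (b + 1)).carrier :=
      ih.1.cokernel (chromι p k b).toLin (chromπ p k b).toLin ih.2 (vGen_bijective_chromE k b)
        (exists_chromι k b) (chrom_exact k b) (chromπ_surjective k b)
    exact ⟨h, hinj _ h⟩

theorem chromι_injective (b : ℕ) : Function.Injective (chromι p k b).toLin :=
  (isVRegular_chromN_and_injective k b).2

theorem isVTorsionFree_chromN (b : ℕ) : IsVTorsionFree p (k + b) (chromN p k b).carrier :=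
  vGen_pow_smul_injective fun _ _ h => sub_eq_zero.1
    ((isVRegular_chromN_and_injective k b).1.eq_zero ((smul_sub _ _ _).trans (sub_eq_zero.2 h)))

theorem isChromatic_chromN (b : ℕ) : IsChromatic k (k + b) (chromN p k b) := by
  induction b with
  | zero => exact .base _ (Iso.refl _)
  | succ b ih =>
    exact .step (k + b) _ _ _ (chromι p k b) (chromπ p k b) ih (chromι_injective k b)
      (isLocalizedModule_chromι k b) (chrom_exact k b) (chromπ_surjective k b)

variable {n : ℕ} (L : TorsionLocalization p n)

theorem isIso_unit_chromE {b : ℕ} (hb : k + b ≤ n) : IsIso (L.unit.app (chromE p k b)) :=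
  L.isIso_unit (isLocal_of_vGen_bijective hb (vGen_bijective_chromE k b))

/-- For `n < k + b` a numerator in `chromN` is `v_n`-torsion, and dividing by `v_{k+b}`, which acts
bijectively, preserves this; the whole comodule is torsion. -/
theorem isZero_obj_chromE {b : ℕ} (hb : n < k + b) : IsZero (L.functor.obj (chromE p k b)) :=
  L.isZero_obj fun y => by
    obtain ⟨K, x, hx⟩ := exists_chromι k b y
    obtain ⟨N, hN⟩ := mem_nilIdeal.1 (vGen_mem_nilIdeal_chromN k b x hb)
    refine ⟨N, vGen_pow_smul_injective (vGen_bijective_chromE k b).1 _ K ?_⟩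
    rw [smul_comm, ← hx, ← map_smul, hN, map_zero]

/-- `BP_* / I_k` is the kernel of a map from the local `chromE 0` to `chromN 1`. The latter has no
`v_{k+1}`-torsion, hence no `v_n`-torsion because `k + 1 ≤ n`. -/
theorem isIso_unit_BPmod (hk : k < n) : IsIso (L.unit.app (BPmod p k)) :=
  L.isIso_unit (isLocal_of_exact
    (isLocal_of_vGen_bijective (by omega : k + 0 ≤ n) (vGen_bijective_chromE k 0))
    ((isVTorsionFree_chromN k 1).of_le (by omega)) (chromι p k 0) (chromπ p k 0)
    (chromι_injective k 0) (chrom_exact k 0))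

variable (p) in
/-- The chromatic complex. -/
def chromComplex : CochainComplex (Comod p) ℕ :=
  CochainComplex.of (chromE p k) (fun b => chromπ p k b ≫ chromι p k (b + 1)) fun b =>
    Comod.hom_ext fun x => by
      change (chromι p k (b + 2)).toLin ((chromπ p k (b + 1)).toLin ((chromι p k (b + 1)).toLin
        ((chromπ p k b).toLin x))) = 0
      rw [(chrom_exact k (b + 1) _).2 ⟨_, rfl⟩, map_zero]

theorem chromComplex_d (b : ℕ) (x : (chromE p k b).carrier) :
    ((chromComplex p k).d b (b + 1)).toLin x =
      (chromι p k (b + 1)).toLin ((chromπ p k b).toLin x) := by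
  have h : (chromComplex p k).d b (b + 1) = chromπ p k b ≫ chromι p k (b + 1) :=
    CochainComplex.of_d (chromE p k) (fun b => chromπ p k b ≫ chromι p k (b + 1)) b
  exact Comod.congr_toLin h x

theorem chromComplex_d_eq_zero (b : ℕ) (x : (chromE p k b).carrier) :
    ((chromComplex p k).d b (b + 1)).toLin x = 0 ↔ ∃ y, (chromι p k b).toLin y = x := by
  rw [chromComplex_d]
  refine Iff.trans ⟨fun h => ?_, fun h => ?_⟩ (chrom_exact k b x)
  · exact chromι_injective k (b + 1) (h.trans (map_zero _).symm)
  · exact (congrArg _ h).trans (map_zero _)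

/-- The chromatic resolution of `BP_* / I_k`. -/
def chromResolution : LocalResolution L (BPmod p k) where
  C := chromComplex p k
  ι := chromι p k 0
  ι_injective := chromι_injective k 0
  ι_exact := chromComplex_d_eq_zero k 0
  d_exact b x hx := by
    obtain ⟨y, hy⟩ := (chromComplex_d_eq_zero k (b + 1) x).1 hx
    obtain ⟨e, rfl⟩ := chromπ_surjective k b y
    exact ⟨e, (chromComplex_d k b e).trans hy⟩
  cechExact b := by
    change CechExact (gens p n) (L.functor.obj (chromE p k b)).carrier
    -- If `k + b ≤ n`, the term is its own localization and `v_{k+b}` acts bijectively on it;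
    -- otherwise its localization is zero. Both have an exact augmented Čech complex.
    by_cases hb : k + b ≤ n
    · have := isIso_unit_chromE k L hb
      refine cechExact_of_vGen_bijective hb ?_
      let e := Comod.isoLinearEquiv (asIso (L.unit.app (chromE p k b)))
      have h : (fun y : (L.functor.obj (chromE p k b)).carrier => vGen p (k + b) • y) =
          e ∘ (fun y : (chromE p k b).carrier => vGen p (k + b) • y) ∘ e.symm := funext fun y => by
        change _ = e (_ • e.symm y)
        rw [map_smul, e.apply_symm_apply]
      rw [h]
      exact e.bijective.comp ((vGen_bijective_chromE k b).comp e.symm.bijective)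
    · have := (Comod.isZero_iff _).1 (isZero_obj_chromE k L (not_le.1 hb))
      have : Subsingleton (L.functor.obj (chromE p k b)).carrier :=
        ⟨fun x y => (this x).trans (this y).symm⟩
      exact CechExact.of_subsingleton _

end Chromatic

/-! ### The derived functors of `L_n` on `BP_* / I_k` -/

section ChromaticDerived

variable {p : ℕ} [hp : Fact p.Prime] {k n : ℕ} (L : TorsionLocalization p n)

theorem chromResolution_LC_d (b : ℕ) (x : (chromE p k b).carrier) :
    ((chromResolution k L).LC.d b (b + 1)).toLin ((L.unit.app (chromE p k b)).toLin x) =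
      (L.unit.app (chromE p k (b + 1))).toLin (((chromComplex p k).d b (b + 1)).toLin x) :=
  L.unit_naturality ((chromComplex p k).d b (b + 1)) x

/-- The localized chromatic resolution is exact in positive degrees `b` with `k + b ≠ n`. -/
theorem isZero_derived_BPmod {b : ℕ} (hb : k + (b + 1) ≠ n) :
    IsZero ((L.derived (b + 1)).obj (BPmod p k)) := by
  obtain ⟨e⟩ := (chromResolution k L).nonempty_iso_derived (b + 1)
  refine IsZero.of_iso ((Comod.isZero_iff _).2 fun h => ?_) e.symm
  obtain ⟨z, hz⟩ : ∃ z : (L.functor.obj (chromE p k (b + 1))).carrier,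
    IsComodClass (chromResolution k L).LC (b + 1) z h := exists_comodRep h
  refine (hz.eq_zero_iff (CochainComplex.prev_nat_succ b)).2 ?_
  -- Below the last non-zero degree, the three relevant terms of the complex agree with the
  -- unlocalized chromatic complex, which is exact there. Above it the term itself is zero.
  rcases hb.lt_or_gt with hb | hb
  · have h1 := isIso_unit_chromE k L hb.le
    have h2 := isIso_unit_chromE k L (b := b + 2) (by omega)
    obtain ⟨y, rfl⟩ := (Comod.bijective_of_isIso (L.unit.app (chromE p k (b + 1)))).2 z
    have hy := (chromResolution_LC_d L (b + 1) y).symm.trans (hz.d_eq_zero (b + 2))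
    have hy := (Comod.bijective_of_isIso (L.unit.app (chromE p k (b + 2)))).1
      (hy.trans (map_zero (L.unit.app (chromE p k (b + 2))).toLin).symm)
    obtain ⟨x, hx⟩ := (chromResolution k L).d_exact b y hy
    exact ⟨(L.unit.app (chromE p k b)).toLin x, (chromResolution_LC_d L b x).trans (congrArg _ hx)⟩
  · exact ⟨0, (map_zero _).trans ((Comod.isZero_iff _).1 (isZero_obj_chromE k L hb) z).symm⟩

/-- With `n = k + c + 1`, the localized complex ends with `chromE (c + 1)`. Its last cohomology is
the quotient of this by the image of `chromE c`, that is, by `chromN (c + 1)`; this is the cokernel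
in the definition of the next chromatic comodule. -/
theorem isChromatic_derived_BPmod {c : ℕ} (L : TorsionLocalization p (k + (c + 1))) :
    IsChromatic k (k + (c + 1) + 1) ((L.derived (c + 1)).obj (BPmod p k)) := by
  let R := chromResolution k L
  obtain ⟨e⟩ := R.nonempty_iso_derived (c + 1)
  have hu := isIso_unit_chromE k L (b := c + 1) le_rfl
  have hbu := Comod.bijective_of_isIso (L.unit.app (chromE p k (c + 1)))
  let u : chromE p k (c + 1) ⟶ R.LC.X (c + 1) := L.unit.app (chromE p k (c + 1))
  have hu0 : u ≫ R.LC.d (c + 1) (c + 2) = 0 :=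
    (isZero_obj_chromE k L (b := c + 2) (by omega)).eq_of_tgt _ _
  let l := R.LC.liftCycles u (c + 2) (by simp) hu0
  have hl : ∀ x, (R.LC.iCycles (c + 1)).toLin (l.toLin x) = u.toLin x :=
    Comod.congr_toLin (R.LC.liftCycles_i u (c + 2) (by simp) hu0)
  have hls : Function.Surjective l.toLin := fun w => by
    obtain ⟨x, hx⟩ := hbu.2 ((R.LC.iCycles (c + 1)).toLin w)
    exact ⟨x, Comod.injective_of_mono (R.LC.iCycles (c + 1)) ((hl x).trans hx)⟩
  have hcl : ∀ x, IsComodClass R.LC (c + 1) (u.toLin x)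
      ((R.LC.homologyπ (c + 1)).toLin (l.toLin x)) := fun x => ⟨l.toLin x, hl x, rfl⟩
  let E := Comod.isoLinearEquiv e
  refine .step (k + (c + 1)) (chromN p k (c + 1)) (chromE p k (c + 1)) _ (chromι p k (c + 1))
    (l ≫ R.LC.homologyπ (c + 1) ≫ e.hom) (isChromatic_chromN k (c + 1)) (chromι_injective k _)
    (isLocalizedModule_chromι k _) (fun x => ?_) ?_
  · change E ((R.LC.homologyπ (c + 1)).toLin (l.toLin x)) = 0 ↔ _
    rw [map_eq_zero_iff E E.injective, (hcl x).eq_zero_iff (CochainComplex.prev_nat_succ c)]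
    have h2 := isIso_unit_chromE k L (b := c) (by omega)
    have hb2 := Comod.bijective_of_isIso (L.unit.app (chromE p k c))
    constructor
    · rintro ⟨m, hm⟩
      obtain ⟨y, rfl⟩ := hb2.2 m
      have h3 := hbu.1 ((chromResolution_LC_d L c y).symm.trans hm)
      rw [chromComplex_d] at h3
      exact ⟨_, h3⟩
    · rintro ⟨y, rfl⟩
      obtain ⟨y, rfl⟩ := chromπ_surjective k c y
      refine ⟨(L.unit.app (chromE p k c)).toLin y, (chromResolution_LC_d L c y).trans ?_⟩
      exact congrArg _ (chromComplex_d k c y)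
  · exact E.surjective.comp ((Comod.surjective_of_epi (R.LC.homologyπ (c + 1))).comp hls)

theorem derived_BPmod_of_lt (hk : k < n) :
    (∀ i : ℕ, i ≠ 0 → i ≠ n - k → IsZero ((L.derived i).obj (BPmod p k))) ∧
      IsIso (L.unit.app (BPmod p k)) ∧
      IsChromatic k (n + 1) ((L.derived (n - k)).obj (BPmod p k)) := by
  refine ⟨fun i h0 hi => ?_, isIso_unit_BPmod k L hk, ?_⟩
  · obtain ⟨b, rfl⟩ := Nat.exists_eq_succ_of_ne_zero h0
    exact isZero_derived_BPmod L (by omega)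
  · obtain ⟨c, rfl⟩ : ∃ c, n = k + (c + 1) := ⟨n - k - 1, by omega⟩
    rw [Nat.add_sub_cancel_left]
    exact isChromatic_derived_BPmod L

end ChromaticDerived

/-! ### Kernels and cokernels of functors that preserve colimits -/

section ExactColimits

theorem exact_of_exact_evaluation {J : Type*} [Category* J] {A : Type*} [Category* A] [Abelian A]
    (S : ShortComplex (J ⥤ A)) (h : ∀ j, (S.map ((evaluation J A).obj j)).Exact) : S.Exact :=
  S.exact_iff_isZero_homology.2 ((Functor.isZero_iff _).2 fun j =>
    ((S.map _).exact_iff_isZero_homology.1 (h j)).of_iso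
      (S.mapHomologyIso ((evaluation J A).obj j)).symm)

variable {J : Type*} [Category* J] {D : Type*} [Category* D] {A : Type*} [Category* A] [Abelian A]
  {F G H : D ⥤ A} (α : F ⟶ G) (β : G ⟶ H) (w : ∀ X, α.app X ≫ β.app X = 0)
  (hex : ∀ X, (ShortComplex.mk (α.app X) (β.app X) (w X)).Exact)

include hex

/-- If colimits of shape `J` are exact, then a kernel of functors that preserve them preserves
them. -/
theorem preservesColimitsOfShape_kernel [HasColimitsOfShape J A] [HasExactColimitsOfShape J A]
    (hα : ∀ X, Mono (α.app X)) [PreservesColimitsOfShape J G] [PreservesColimitsOfShape J H] :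
    PreservesColimitsOfShape J F where
  preservesColimit {K} := ⟨fun {c} hc => by
    let t := colimit.isColimit (K ⋙ F)
    let φ : (colimit.cocone (K ⋙ F)).pt ⟶ F.obj c.pt := t.desc (F.mapCocone c)
    have hφ : ∀ j, (colimit.cocone (K ⋙ F)).ι.app j ≫ φ = F.map (c.ι.app j) := fun j =>
      t.fac (F.mapCocone c) j
    let S : ShortComplex (J ⥤ A) := ShortComplex.mk (Functor.whiskerLeft K α)
      (Functor.whiskerLeft K β) (by ext j; exact w _)
    have hS : S.Exact := exact_of_exact_evaluation _ fun j => hex (K.obj j)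
    have hmα : Mono (Functor.whiskerLeft K α) := by
      have : ∀ j, Mono ((Functor.whiskerLeft K α).app j) := fun j => hα (K.obj j)
      exact NatTrans.mono_of_mono_app _
    have hf : ∀ j, (colimit.cocone (K ⋙ F)).ι.app j ≫ φ ≫ α.app c.pt =
        S.f.app j ≫ (G.mapCocone c).ι.app j := fun j => by
      rw [← Category.assoc, hφ]
      exact α.naturality _
    have hg : ∀ j, (G.mapCocone c).ι.app j ≫ β.app c.pt =
        S.g.app j ≫ (H.mapCocone c).ι.app j := fun j => β.naturality _
    have hm : Mono (φ ≫ α.app c.pt) := colim.map_mono' (Functor.whiskerLeft K α) t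
      (isColimitOfPreserves G hc) (φ ≫ α.app c.pt) hf
    have he := colim.exact_mapShortComplex hS t (isColimitOfPreserves G hc)
      (isColimitOfPreserves H hc) (φ ≫ α.app c.pt) (β.app c.pt) hf hg
    have hm' : Mono (colim.mapShortComplex S t (G.mapCocone c) (H.mapCocone c)
      (φ ≫ α.app c.pt) (β.app c.pt) hf hg).f := hm
    -- Both the value of `F` at the colimit and the colimit of the values of `F` are kernels of the
    -- same map, because colimits of shape `J` are exact; this lift is the inverse of the comparison
    -- map.
    let s : F.obj c.pt ⟶ (colimit.cocone (K ⋙ F)).pt := he.lift (α.app c.pt) (w c.pt)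
    have hs : s ≫ φ ≫ α.app c.pt = α.app c.pt := he.lift_f (α.app c.pt) (w c.pt)
    have := hα c.pt
    have h1 : s ≫ φ = 𝟙 _ := by
      rw [← cancel_mono (α.app c.pt), Category.assoc, hs, Category.id_comp]
    have h2 : φ ≫ s = 𝟙 _ := by
      have := mono_of_mono φ (α.app c.pt)
      rw [← cancel_mono φ, Category.assoc, h1, Category.comp_id, Category.id_comp]
    have hi : IsIso (t.desc (F.mapCocone c)) := ⟨s, h2, h1⟩
    exact ⟨IsColimit.ofPointIso t⟩⟩

/-- A cokernel of functors that preserve colimits preserves colimits. -/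
theorem preservesColimitsOfShape_cokernel (hβ : ∀ X, Epi (β.app X))
    [PreservesColimitsOfShape J F] [PreservesColimitsOfShape J G] :
    PreservesColimitsOfShape J H where
  preservesColimit {K} := ⟨fun {c} hc => by
    have hF := isColimitOfPreserves F hc
    have hG := isColimitOfPreserves G hc
    have hβ' : ∀ X, Epi (ShortComplex.mk (α.app X) (β.app X) (w X)).g := hβ
    -- A cocone under `K ⋙ H` is a cocone under `K ⋙ G` that vanishes on `F`, and vanishing can be
    -- tested on the colimit cocone of `F`.
    have h0 : ∀ s : Cocone (K ⋙ H), α.app c.pt ≫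
        hG.desc ((Cocone.precompose (Functor.whiskerLeft K β)).obj s) = 0 := fun s =>
      hF.hom_ext fun j => by
        have h1 := hG.fac ((Cocone.precompose (Functor.whiskerLeft K β)).obj s) j
        have h2 : (F.mapCocone c).ι.app j ≫ α.app c.pt = α.app (K.obj j) ≫ (G.mapCocone c).ι.app j :=
          α.naturality _
        rw [← Category.assoc, h2, Category.assoc, h1, comp_zero]
        change α.app (K.obj j) ≫ β.app (K.obj j) ≫ s.ι.app j = 0
        rw [← Category.assoc, w, zero_comp]
    have hfac : ∀ s : Cocone (K ⋙ H), β.app c.pt ≫ (hex c.pt).desc _ (h0 s) =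
        hG.desc ((Cocone.precompose (Functor.whiskerLeft K β)).obj s) := fun s =>
      (hex c.pt).g_desc _ (h0 s)
    have hn : ∀ j, (G.mapCocone c).ι.app j ≫ β.app c.pt =
      β.app (K.obj j) ≫ (H.mapCocone c).ι.app j := fun j => β.naturality _
    refine ⟨{ desc := fun s => (hex c.pt).desc _ (h0 s), fac := fun s j => ?_, uniq := fun s m hm => ?_ }⟩
    · have := hβ (K.obj j)
      rw [← cancel_epi (β.app (K.obj j)), ← Category.assoc, ← hn, Category.assoc, hfac]
      exact hG.fac _ j
    · have := hβ c.pt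
      rw [← cancel_epi (β.app c.pt), hfac]
      refine hG.hom_ext fun j => ?_
      rw [hG.fac, ← Category.assoc, hn, Category.assoc, hm]
      rfl⟩

end ExactColimits

theorem map_toCycles {A : Type*} [Category* A] [Abelian A] {ι : Type*} (c : ComplexShape ι)
    {K K' : HomologicalComplex A c} (f : K ⟶ K') (i j : ι) :
    f.f i ≫ K'.toCycles i j = K.toCycles i j ≫ HomologicalComplex.cyclesMap f j := by
  rw [← cancel_mono (K'.iCycles j)]
  simp

/-! ### Homology preserves exact colimits -/

section Homology

variable {J : Type*} [Category* J] {A : Type*} [Category* A] [Abelian A] [HasColimitsOfShape J A]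
  [HasExactColimitsOfShape J A] {ι : Type*} (c : ComplexShape ι)

theorem preservesColimitsOfShape_cyclesFunctor (i : ι) :
    PreservesColimitsOfShape J (HomologicalComplex.cyclesFunctor A c i) :=
  preservesColimitsOfShape_kernel (F := HomologicalComplex.cyclesFunctor A c i)
    (G := HomologicalComplex.eval A c i) (H := HomologicalComplex.eval A c (c.next i))
    { app := fun K => K.iCycles i
      naturality := fun _ _ f => HomologicalComplex.cyclesMap_i f i }
    { app := fun K => K.d i (c.next i)
      naturality := fun _ _ f => f.comm _ _ }
    (fun K => K.iCycles_d i (c.next i))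
    (fun K => ShortComplex.exact_of_f_is_kernel _ (K.cyclesIsKernel i (c.next i) rfl))
    (fun K => inferInstanceAs (Mono (K.iCycles i)))

/-- Homology is a cokernel of a map to the cycles, and the cycles are a kernel of a differential;
colimits of complexes are formed degreewise. -/
theorem preservesColimitsOfShape_homologyFunctor (i : ι) :
    PreservesColimitsOfShape J (HomologicalComplex.homologyFunctor A c i) :=
  have := preservesColimitsOfShape_cyclesFunctor (J := J) (A := A) c i
  preservesColimitsOfShape_cokernel (F := HomologicalComplex.eval A c (c.prev i))
    (G := HomologicalComplex.cyclesFunctor A c i)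
    (H := HomologicalComplex.homologyFunctor A c i)
    { app := fun K => K.toCycles (c.prev i) i
      naturality := fun _ _ f => map_toCycles c f _ _ }
    (HomologicalComplex.natTransHomologyπ A c i)
    (fun K => K.toCycles_comp_homologyπ (c.prev i) i)
    (fun K => ShortComplex.exact_of_g_is_cokernel _ (K.homologyIsCokernel (c.prev i) i rfl))
    (fun K => inferInstanceAs (Epi (K.homologyπ i)))

end Homology

/-! ### Čech cohomology preserves exact colimits -/

section CechColimits

variable {A : Type} [CommRing A] {m : ℕ} (v : Fin m → A) {J : Type} [Category.{0} J]

theorem preservesColimitsOfShape_cechComplex : PreservesColimitsOfShape J (cechComplex v) :=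
  HomologicalComplex.preservesColimitsOfShape_of_eval _ fun k =>
    preservesColimitsOfShape_of_natIso (F := MonoidalCategory.tensorLeft
      (ModuleCat.of A (CechCochain v k))) (NatIso.ofComponents (fun _ => Iso.refl _) (fun f =>
        (Category.comp_id ((MonoidalCategory.tensorLeft (ModuleCat.of A (CechCochain v k))).map f)).trans
          (Category.id_comp ((MonoidalCategory.tensorLeft
            (ModuleCat.of A (CechCochain v k))).map f)).symm))

theorem preservesColimitsOfShape_cechCohomology [HasExactColimitsOfShape J (ModuleCat.{0} A)]
    (i : ℕ) : PreservesColimitsOfShape J (cechCohomology v i) :=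
  have := preservesColimitsOfShape_cechComplex v (J := J)
  have := preservesColimitsOfShape_homologyFunctor (J := J) (A := ModuleCat.{0} A)
    (ComplexShape.up ℕ) i
  inferInstanceAs (PreservesColimitsOfShape J (_ ⋙ _))

end CechColimits

/-! ### Colimits of comodules and the derived functors -/

section ComodColimits

variable {p : ℕ} [hp : Fact p.Prime] {J : Type*} [Category* J] {K : J ⥤ Comod p} {c : Cocone K}

/-- The linear map underlying a component of a cocone of comodules. -/
def coconeLin (c : Cocone K) (j : J) : (K.obj j).carrier →ₗ[BP p] c.pt.carrier := (c.ι.app j).toLin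

theorem coconeLin_gproj (c : Cocone K) (j : J) (d : ℤ) (x : (K.obj j).carrier) :
    coconeLin c j (gproj (K.obj j).isInternal d x) = gproj c.pt.isInternal d (coconeLin c j x) :=
  Comod.hom_gproj (c.ι.app j) d x

theorem coact_coconeLin (c : Cocone K) (j : J) (x : (K.obj j).carrier) :
    c.pt.coact (coconeLin c j x) = (coconeLin c j).lTensor (BPBP p) ((K.obj j).coact x) :=
  (c.ι.app j).map_coact x

/-- A colimit of modules is spanned by the images of the components of the cocone. -/
theorem iSup_range_eq_top (hc : IsColimit ((forgetMod p).mapCocone c)) :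
    ⨆ j, LinearMap.range (coconeLin c j) = ⊤ := by
  set S := ⨆ j, LinearMap.range (coconeLin c j) with hS
  let q : (forgetMod p).obj c.pt ⟶ ModuleCat.of (BP p) (c.pt.carrier ⧸ S) := ModuleCat.ofHom S.mkQ
  have h : q = 0 := hc.hom_ext fun j => by
    rw [comp_zero]
    ext x
    exact (Submodule.Quotient.mk_eq_zero S).2
      (Submodule.mem_iSup_of_mem j ⟨x, rfl⟩ : coconeLin c j x ∈ S)
  have h1 : S.mkQ = 0 := ModuleCat.hom_ext_iff.1 h
  rw [← Submodule.ker_mkQ S, h1, LinearMap.ker_zero]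

/-- Linear maps from a colimit of modules that restrict to homomorphisms of comodules are
homomorphisms of comodules. -/
def homOfColimit (hc : IsColimit ((forgetMod p).mapCocone c)) (s : Cocone K)
    (h : c.pt.carrier →ₗ[BP p] s.pt.carrier)
    (hh : ∀ j x, h (coconeLin c j x) = coconeLin s j x) : c.pt ⟶ s.pt where
  toLin := h
  map_deg {d m} hm := by
    have key : ∀ x, h (gproj c.pt.isInternal d x) = gproj s.pt.isInternal d (h x) := fun x => by
      have hx : x ∈ ⨆ j, LinearMap.range (coconeLin c j) := by
        rw [iSup_range_eq_top hc]; trivial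
      refine Submodule.iSup_induction _ (motive := fun x => h (gproj c.pt.isInternal d x) =
        gproj s.pt.isInternal d (h x)) hx ?_ (by simp) fun x y hx hy => by
          rw [map_add, map_add, hx, hy, map_add, map_add]
      rintro j _ ⟨x, rfl⟩
      rw [hh, ← coconeLin_gproj, ← coconeLin_gproj, hh]
    have h1 := key m
    rw [gproj_of_mem _ hm, if_pos rfl] at h1
    rw [h1]
    exact gproj_mem _ _ _
  map_coact m := by
    have hm : m ∈ ⨆ j, LinearMap.range (coconeLin c j) := by
      rw [iSup_range_eq_top hc]; trivial
    refine Submodule.iSup_induction _ (motive := fun m => s.pt.coact (h m) =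
      h.lTensor (BPBP p) (c.pt.coact m)) hm ?_ (by simp) fun x y hx hy => by
        rw [map_add, map_add, hx, hy, map_add, map_add]
    rintro j _ ⟨x, rfl⟩
    have h2 : h ∘ₗ coconeLin c j = coconeLin s j := LinearMap.ext (hh j)
    rw [hh, coact_coconeLin, coact_coconeLin, ← LinearMap.lTensor_comp_apply]
    exact congrArg (fun f => LinearMap.lTensor (BPBP p) f _) h2.symm

/-- The images of a colimit cocone span, so the linear map given by the universal property respects
degree and coaction as soon as its restrictions do. -/
instance : ReflectsColimitsOfShape J (forgetMod p) where
  reflectsColimit {K} := ⟨fun {c} hc => by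
    have hd : ∀ (s : Cocone K) j x, (hc.desc ((forgetMod p).mapCocone s)).hom
        (coconeLin c j x) = coconeLin s j x := fun s j x =>
      LinearMap.congr_fun (ModuleCat.hom_ext_iff.1 (hc.fac ((forgetMod p).mapCocone s) j)) x
    exact ⟨{ desc := fun s => homOfColimit hc s (hc.desc ((forgetMod p).mapCocone s)).hom (hd s)
             fac := fun s j => Comod.hom_ext fun x => hd s j x
             uniq := fun s m hm => by
              have h1 : (forgetMod p).map m = hc.desc ((forgetMod p).mapCocone s) :=
                hc.uniq ((forgetMod p).mapCocone s) _ fun j =>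
                  ((forgetMod p).map_comp (c.ι.app j) m).symm.trans (congrArg _ (hm j))
              exact Comod.Hom.ext (ModuleCat.hom_ext_iff.1 h1) }⟩⟩

variable {n : ℕ} (L : TorsionLocalization p n)

/-- Up to isomorphism, the underlying module of the derived functor is Čech cohomology after the
forgetful functor. The latter is a left adjoint, hence preserves colimits, and it reflects them. -/
theorem preservesColimitsOfShape_derived {J : Type} [Category.{0} J]
    [HasExactColimitsOfShape J (ModuleCat.{0} (BP p))] (i : ℕ) :
    PreservesColimitsOfShape J (L.derived i) := by
  obtain ⟨e, -⟩ := exists_cech_iso L i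
  have h1 := preservesColimitsOfShape_cechCohomology (J := J) (gens p n) i
  have h2 : PreservesColimitsOfShape J (forgetMod p) := inferInstance
  have h3 : PreservesColimitsOfShape J (cechI p n i) :=
    inferInstanceAs (PreservesColimitsOfShape J (_ ⋙ _))
  have h4 : PreservesColimitsOfShape J (L.derived i ⋙ forgetMod p) :=
    preservesColimitsOfShape_of_natIso e.symm
  exact preservesColimitsOfShape_of_reflects_of_preserves (L.derived i) (forgetMod p)

theorem preservesFilteredColimits_derived (i : ℕ) : PreservesFilteredColimits (L.derived i) :=
  ⟨fun _ _ _ => preservesColimitsOfShape_derived L i⟩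

theorem preservesCoproducts_derived (i : ℕ) (ι : Type) :
    PreservesColimitsOfShape (Discrete ι) (L.derived i) :=
  preservesColimitsOfShape_derived L i

end ComodColimits

end BPcomod

end

theorem theoremB (p : ℕ) [Fact p.Prime] (n : ℕ) :
    -- comodules have enough injectives, so that right derived functors exist; `L_n` exists;
    -- and every choice of `L_n` (they are all canonically isomorphic) has the stated properties
    ∃ _ : EnoughInjectives (Comod p), Nonempty (TorsionLocalization p n) ∧
      ∀ L : TorsionLocalization p n,
        -- the derived functors are Čech cohomology, naturally and as graded `BP_*`-modules
        (∀ i : ℕ, ∃ e : L.derived i ⋙ forgetMod p ≅ cechI p n i,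
          ∀ (M : Comod p) (d : ℤ) (x : ((L.derived i).obj M).carrier),
            x ∈ ((L.derived i).obj M).deg d ↔ (e.hom.app M).hom x ∈ cechDeg n M i d) ∧
        -- vanishing above degree `n`
        (∀ (M : Comod p) (i : ℕ), n < i → IsZero ((L.derived i).obj M)) ∧
        -- the higher derived functors are torsion with respect to `I_{n+1}`
        (∀ (M : Comod p) (i : ℕ), 0 < i → ∀ x : ((L.derived i).obj M).carrier,
          ∃ N : ℕ, ∀ a ∈ idealI p (n + 1) ^ N, a • x = 0) ∧
        -- comodules on which some `v_j` with `j ≤ n` acts invertibly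
        (∀ (M : Comod p) (j : ℕ), j ≤ n →
          Function.Bijective (fun x : M.carrier => vGen p j • x) →
          IsIso (L.unit.app M) ∧ ∀ i : ℕ, 0 < i → IsZero ((L.derived i).obj M)) ∧
        -- `BP_* / I_k` for `k < n`
        (∀ k : ℕ, k < n →
          (∀ i : ℕ, i ≠ 0 → i ≠ n - k → IsZero ((L.derived i).obj (BPmod p k))) ∧
          IsIso (L.unit.app (BPmod p k)) ∧
          IsChromatic k (n + 1) ((L.derived (n - k)).obj (BPmod p k))) ∧
        -- `BP_* / I_n`
        ((∀ i : ℕ, 0 < i → IsZero ((L.derived i).obj (BPmod p n))) ∧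
          (n = 0 → ∃ e : (L.functor.obj (unitComod p)).carrier ≃ₗ[BP p] BP p ⊗[ℤ] ℚ,
            ∀ a : BP p, e ((L.unit.app (unitComod p)).toLin a) = a ⊗ₜ 1) ∧
          (0 < n → IsLocalizedModule (Submonoid.powers (vGen p n))
            (L.unit.app (BPmod p n)).toLin)) ∧
        -- `BP_* / I_k` for `n < k ≤ ∞`
        (∀ k : ℕ∞, n < k → ∀ i : ℕ, IsZero ((L.derived i).obj (BPmod p k))) ∧
        -- filtered colimits, direct sums, and finite limits
        (∀ i : ℕ, PreservesFilteredColimits (L.derived i) ∧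
          ∀ ι : Type, PreservesColimitsOfShape (Discrete ι) (L.derived i)) ∧
        PreservesFiniteLimits L.functor := 
  ⟨inferInstance, nonempty_torsionLocalization p n, fun L =>
    ⟨fun i => (exists_cech_iso L i).imp fun _ h => h.2,
    fun M _ hi => isZero_derived_of_lt L M hi,
    fun M _ hi x => exists_idealI_pow_smul (isVTorsion_derived L M hi x),
    fun _ _ hj hM => ⟨L.isIso_unit (isLocal_of_vGen_bijective hj hM),
      fun _ hi => isZero_derived_of_vGen_bijective L hj hM hi⟩,
    fun _ hk => derived_BPmod_of_lt L hk,
    -- On `BP_* / I_n` the elements `v_0, …, v_{n-1}` act as zero, so `v_n` is bijective on the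
    -- localization. This yields both the vanishing and the description as the inversion of `v_n`.
    ⟨fun _ hi => isZero_derived_of_cechExact L
        (cechExact_obj L (BPmod p n) fun x _ h => vGen_mem_nilIdeal_BPmod x h) hi,
      fun h => by
        subst h
        exact exists_linearEquiv_rat L,
      fun _ => isLocalizedModule_unit L (BPmod p n) fun x _ h => vGen_mem_nilIdeal_BPmod x h⟩,
    fun _ hk i => isZero_derived_of_isVTorsion L (isVTorsion_BPmod hk) i,
    fun i => ⟨preservesFilteredColimits_derived L i, preservesCoproducts_derived L i⟩,
    inferInstance⟩⟩
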